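/- **Conventions.** Let $\Sigma_\varepsilon=\Sigma\cup\{\varepsilon\}$. A (length-preserving, binary) *transducer* over a finite alphabet $\Delta$ is a finite automaton whose edges are labelled by $\Delta^2\cup\{(\varepsilon,\varepsilon)\}$; it recognizes the relation $L(T)\subseteq\Delta^*\times\Delta^*$ of all pairs spelled by its accepting runs. A *succinct PDA* $\mathcal C$ over a finite input alphabet $\Sigma$ consists of a finite stack alphabet $\Gamma$, a finite alphabet $\Delta$, words $w_0,w_f\in\Delta^n$ for some $n\ge 0$, a transducer $T_{a,v}$ over $\Delta$ for each $a\in\Sigma_\varepsilon$ and each stack operation $v$ (push $\gamma$, pop $\gamma$, for $\gamma\in\Gamma$, or no change), and optionally an initial stack symbol. It represents the pushdown automaton with state set $\Delta^n$, initial state $w_0$, final state $w_f$, and a transition $q\to q'$ that reads $a$ and performs $v$ exactly if $(q,q')\in L(T_{a,v})$. Runs start with the stack containing just the initial stack symbol (with the empty stack if there is none), and acceptance is by final state, with arbitrary stack content. $L(\mathcal C)\subseteq\Sigma^*$ is the accepted language. A *doubly succinct NFA* $\mathcal B$ over $\Sigma$ consists of a finite alphabet $\Delta\supseteq\{0,1\}$,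 a number $M\in\mathbb N$ written in binary, a word $w_0\in\Delta^*$ with $|w_0|\le M$, and a transducer $T_a$ over $\Delta$ for each $a\in\Sigma_\varepsilon$. It represents the NFA with $\varepsilon$-transitions with state set $\Delta^M$, initial state $w_00^{M-|w_0|}$, unique final state $1^M$, and a transition $p\xrightarrow{a}q$ exactly if $(p,q)\in L(T_a)$. $L(\mathcal B)\subseteq\Sigma^*$ is the accepted language. For $\Theta\subseteq\Sigma$, let $\pi_\Theta(u)$ be obtained from $u\in\Sigma^*$ by deleting all letters outside $\Theta$, and let $|u|_\Theta=|\pi_\Theta(u)|$. For $L\subseteq\Sigma^*$ and $k\in\mathbb N$, the *$\Theta$-preserving downward closure* is $$\downarrow_{\Theta,k}L=\{u\in\Sigma^*\mid \exists v\in L:\ u\preccurlyeq v,\ \pi_\Theta(u)=\pi_\Theta(v),\ |v|_\Theta\le k\},$$ where $\preccurlyeq$ is the (scattered) subword order. **Theorem.** Given a succinct PDA $\mathcal C$ over an input alphabet $\Sigma$, a subset $\Theta\subseteq\Sigma$, and a number $K\in\mathbb N$ written in binary, one can construct in polynomial time a doubly succinct NFA $\mathcal B$ over $\Sigma$ with $L(\mathcal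 B)=\downarrow_{\Theta,K}L(\mathcal C)$. That is, there is a deterministic multi-tape Turing machine that, on the encoding of any triple $(\mathcal C,\Theta,K)$, outputs the encoding of such a $\mathcal B$ in time polynomial in the length of the input. In the encodings, alphabets and state sets of transducers are given by their sizes in unary, transducers by lists of their transitions, and $K$ and $M$ in binary. -/

import Mathlib

/-! ### Length-preserving transducers -/

/-- A length-preserving `2`-ary transducer over the alphabet `D`.  An edge `(q, some (x, y), q')`
reads the pair of letters `(x, y)`, an edge `(q, none, q')` reads `(ε, ε)`. The finite sets of
final states and of edges are presented by lists. -/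
structure Transducer (D : Type) where
  numStates : ℕ
  init : Fin numStates
  final : List (Fin numStates)
  edges : List (Fin numStates × Option (D × D) × Fin numStates)

/-- `T.Run q u v q'`: there is a sequence of edges of `T` from `q` to `q'` whose first
components spell `u` and whose second components spell `v`. -/
inductive Transducer.Run {D : Type} (T : Transducer D) :
    Fin T.numStates → List D → List D → Fin T.numStates → Prop
  | refl (q : Fin T.numStates) : T.Run q [] [] q
  | eps {q r s : Fin T.numStates} {u v : List D} :
      (q, none, r) ∈ T.edges → T.Run r u v s → T.Run q u v s
  | letter {q r s : Fin T.numStates} {x y : D} {u v : List D} :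
      (q, some (x, y), r) ∈ T.edges → T.Run r u v s → T.Run q (x :: u) (y :: v) s

/-- The binary relation on words recognized by a transducer. -/
def Transducer.Rel {D : Type} (T : Transducer D) (u v : List D) : Prop :=
  ∃ q ∈ T.final, T.Run T.init u v q

/-! ### Pushdown automata -/

/-- Stack operations: leave the stack unchanged, push a symbol, pop a symbol. -/
inductive StackOp (S : Type)
  | skip
  | push (x : S)
  | pop (x : S)

/-- `op.Apply w w'`: the operation `op` changes the stack content `w` into `w'`
(the head of the list is the top of the stack). -/
def StackOp.Apply {S : Type} : StackOp S → List S → List S → Prop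
  | .skip, w, w' => w' = w
  | .push x, w, w' => w' = x :: w
  | .pop x, w, w' => w = x :: w'

/-- Pushdown automata with states `Q`, input alphabet `A` and stack alphabet `S`.  The input label
`none` is the empty word. -/
structure PDA (Q A S : Type) where
  edges : Set (Q × Option A × StackOp S × Q)
  start : Q
  startStack : List S
  final : Set Q

/-- `P.Run q w u q' w'`: there is a run of `P` over the word `u` from the configuration `(q, w)` to
the configuration `(q', w')`. -/
inductive PDA.Run {Q A S : Type} (P : PDA Q A S) : Q → List S → List A → Q → List S → Prop
  | refl (q : Q) (w : List S) : P.Run q w [] q w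
  | step {q q' q'' : Q} {w w' w'' : List S} {a : Option A} {op : StackOp S} {u : List A} :
      (q, a, op, q') ∈ P.edges → op.Apply w w' → P.Run q' w' u q'' w'' →
        P.Run q w (a.toList ++ u) q'' w''

/-- Acceptance by final state, with arbitrary stack content at the end. -/
def PDA.language {Q A S : Type} (P : PDA Q A S) : Language A :=
  {u | ∃ q ∈ P.final, ∃ w, P.Run P.start P.startStack u q w}

/-! ### Succinct pushdown automata -/

/-- A succinct PDA over the input alphabet `A`: its stack alphabet is `Fin numStack`, its transducer
alphabet is `Fin numLetters`, and it has one transducer for each pair of an input label (a letter,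
or `none` for `ε`) and a stack operation.  The run starts with the stack holding the symbol
`bottom`, or with the empty stack if `bottom = none`. -/
structure SuccinctPDA (A : Type) where
  numStack : ℕ
  numLetters : ℕ
  n : ℕ
  start : List.Vector (Fin numLetters) n
  final : List.Vector (Fin numLetters) n
  bottom : Option (Fin numStack)
  transducer : Option A → StackOp (Fin numStack) → Transducer (Fin numLetters)

/-- The explicit PDA represented by a succinct PDA; its states are the words of length `n`. -/
def SuccinctPDA.explicit {A : Type} (C : SuccinctPDA A) :
    PDA (List.Vector (Fin C.numLetters) C.n) A (Fin C.numStack) where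
  edges := {e | (C.transducer e.2.1 e.2.2.1).Rel e.1.toList e.2.2.2.toList}
  start := C.start
  startStack := C.bottom.toList
  final := {C.final}

/-- The language of a succinct PDA. -/
def SuccinctPDA.language {A : Type} (C : SuccinctPDA A) : Language A :=
  C.explicit.language

/-! ### Doubly succinct finite automata -/

/-- A doubly succinct NFA over the input alphabet `A`.  Its transducer alphabet is
`Fin (extra + 2)`, which contains the two distinct letters `0` and `1`.  The words that serve as
states have length `M`, and `initPrefix` is a prefix of the initial state. -/
structure DSNFA (A : Type) where
  extra : ℕ
  M : ℕ
  initPrefix : List (Fin (extra + 2))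
  length_initPrefix : initPrefix.length ≤ M
  transducer : Option A → Transducer (Fin (extra + 2))

/-- The explicit NFA (with `ε`-transitions) represented by a doubly succinct NFA `B`: its states are
the words of length `B.M`, the initial state is `B.initPrefix` padded with `0`s, and the
final state is the word `1 ⋯ 1`. -/
def DSNFA.explicit {A : Type} (B : DSNFA A) : εNFA A (List.Vector (Fin (B.extra + 2)) B.M) where
  step p a := {q | (B.transducer a).Rel p.toList q.toList}
  start := {⟨B.initPrefix ++ List.replicate (B.M - B.initPrefix.length) 0, by
    simp [B.length_initPrefix]⟩}
  accept := {List.Vector.replicate B.M 1}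

/-- The language of a doubly succinct NFA. -/
def DSNFA.language {A : Type} (B : DSNFA A) : Language A :=
  B.explicit.accepts

/-! ### Alphabet-preserving downward closures -/

/-- The `Θ`-preserving downward closure of `L` with bound `k`: all subwords `u` of words `v ∈ L` such
that `u` and `v` have the same projection to `Θ` and `v` has at most `k` letters from `Θ`. -/
def preservingDownClosure {A : Type} [DecidableEq A] (Θ : Finset A) (k : ℕ) (L : Language A) :
    Language A :=
  {u | ∃ v ∈ L, u.Sublist v ∧ u.filter (· ∈ Θ) = v.filter (· ∈ Θ) ∧ (v.filter (· ∈ Θ)).length ≤ k}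

/-! ### Inputs, and the codes of inputs and outputs as words

Codes are words over the three-letter alphabet `Option Bool`, where `none` ends a number.
Alphabets and state sets are given by their sizes, in unary; the numbers `K` and `M` are in binary. -/

/-- An input: a succinct PDA over `Fin numInput`, a subalphabet `Θ` and a number `K`. -/
structure Instance where
  numInput : ℕ
  pda : SuccinctPDA (Fin numInput)
  Θ : Finset (Fin numInput)
  K : ℕ

namespace Code

def unary (n : ℕ) : List (Option Bool) := List.replicate n (some true) ++ [none]

/-- Binary code, least significant bit first. -/
def binary (n : ℕ) : List (Option Bool) := n.bits.map some ++ [none]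

def list {α : Type} (c : α → List (Option Bool)) (l : List α) : List (Option Bool) :=
  unary l.length ++ l.flatMap c

def letter {n : ℕ} (i : Fin n) : List (Option Bool) := unary i

/-- `none` has the code of `0`, and `some i` that of `i + 1`. -/
def optLetter {n : ℕ} : Option (Fin n) → List (Option Bool)
  | none => unary 0
  | some i => unary (i + 1)

def edge {n d : ℕ} : Fin n × Option (Fin d × Fin d) × Fin n → List (Option Bool)
  | (q, none, r) => letter q ++ (unary 0 ++ letter r)
  | (q, some (x, y), r) => letter q ++ (unary (x + 1) ++ (letter y ++ letter r))

def transducer {d : ℕ} (T : Transducer (Fin d)) : List (Option Bool) :=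
  unary T.numStates ++ (letter T.init ++ (list letter T.final ++ list edge T.edges))

/-- All input labels over `Fin s`: first `ε`, then the letters. -/
def labels (s : ℕ) : List (Option (Fin s)) := none :: (List.finRange s).map some

/-- All stack operations over `Fin g`. -/
def stackOps (g : ℕ) : List (StackOp (Fin g)) :=
  .skip :: ((List.finRange g).map .push ++ (List.finRange g).map .pop)

def succinctPDA {s : ℕ} (C : SuccinctPDA (Fin s)) : List (Option Bool) :=
  unary C.numStack ++ (unary C.numLetters ++ (unary C.n ++
    (C.start.toList.flatMap letter ++ (C.final.toList.flatMap letter ++ (optLetter C.bottom ++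
      (labels s).flatMap fun a => (stackOps C.numStack).flatMap fun op =>
        transducer (C.transducer a op))))))

/-- The subalphabet is coded by its characteristic bits. -/
def input (x : Instance) : List (Option Bool) :=
  unary x.numInput ++ (succinctPDA x.pda ++
    ((List.finRange x.numInput).map (fun a => some (decide (a ∈ x.Θ))) ++ binary x.K))

/-- The code of a doubly succinct NFA, together with its input alphabet `Fin s`. -/
def dsnfa (B : Σ s : ℕ, DSNFA (Fin s)) : List (Option Bool) :=
  unary B.1 ++ (unary B.2.extra ++ (binary B.2.M ++ (list letter B.2.initPrefix ++
    (labels B.1).flatMap fun a => transducer (B.2.transducer a))))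

/-! The codes of inputs and of outputs are injective. -/

/-- `c` is an injective code, and no code word is a proper prefix of another one. -/
def SelfDelimiting {α : Type} (c : α → List (Option Bool)) : Prop :=
  ∀ ⦃a b : α⦄ ⦃s t : List (Option Bool)⦄, c a ++ s = c b ++ t → a = b ∧ s = t

theorem selfDelimiting_map_some (u v : List Bool) (s t : List (Option Bool))
    (h : (u.map some ++ [none]) ++ s = (v.map some ++ [none]) ++ t) : u = v ∧ s = t := by
  induction u generalizing v with
  | nil => cases v <;> simp_all
  | cons x u ih =>
    cases v with
    | nil => simp at h
    | cons y v =>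
      simp only [List.map_cons, List.cons_append, List.cons.injEq, Option.some.injEq] at h
      obtain ⟨h1, h2⟩ := ih v h.2
      exact ⟨by rw [h.1, h1], h2⟩

theorem selfDelimiting_unary : SelfDelimiting unary := by
  intro a b s t h
  have := selfDelimiting_map_some (List.replicate a true) (List.replicate b true) s t
    (by simpa [unary] using h)
  exact ⟨by simpa using congrArg List.length this.1, this.2⟩

theorem bits_injective : Function.Injective Nat.bits := by
  intro a b h
  rw [← Nat.ofDigits_digits 2 a, ← Nat.ofDigits_digits 2 b, Nat.digits_two_eq_bits,
    Nat.digits_two_eq_bits, h]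

theorem selfDelimiting_binary : SelfDelimiting binary := by
  intro a b s t h
  have := selfDelimiting_map_some _ _ s t h
  exact ⟨bits_injective this.1, this.2⟩

theorem SelfDelimiting.flatMap {α : Type} {c : α → List (Option Bool)} (hc : SelfDelimiting c)
    {l m : List α} (hl : l.length = m.length) {s t : List (Option Bool)}
    (h : l.flatMap c ++ s = m.flatMap c ++ t) : l = m ∧ s = t := by
  induction l generalizing m with
  | nil => cases m <;> simp_all
  | cons x l ih =>
    cases m with
    | nil => simp at hl
    | cons y m =>
      simp only [List.flatMap_cons, List.append_assoc] at h
      obtain ⟨h1, h2⟩ := hc h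
      obtain ⟨h3, h4⟩ := ih (by simpa using hl) h2
      exact ⟨by rw [h1, h3], h4⟩

theorem SelfDelimiting.list {α : Type} {c : α → List (Option Bool)} (hc : SelfDelimiting c) :
    SelfDelimiting (list c) := by
  intro l m s t h
  simp only [Code.list, List.append_assoc] at h
  obtain ⟨h1, h2⟩ := selfDelimiting_unary h
  exact hc.flatMap h1 h2

theorem flatMap_family {ι α : Type} {c : α → List (Option Bool)} (hc : SelfDelimiting c)
    {F G : ι → α} (l : List ι) {s t : List (Option Bool)}
    (h : (l.flatMap fun i => c (F i)) ++ s = (l.flatMap fun i => c (G i)) ++ t) :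
    (∀ i ∈ l, F i = G i) ∧ s = t := by
  induction l with
  | nil => simpa using h
  | cons x l ih =>
    simp only [List.flatMap_cons, List.append_assoc] at h
    obtain ⟨h1, h2⟩ := hc h
    obtain ⟨h3, h4⟩ := ih h2
    exact ⟨by simpa using ⟨h1, h3⟩, h4⟩

theorem selfDelimiting_letter {n : ℕ} : SelfDelimiting (letter (n := n)) := by
  intro a b s t h
  obtain ⟨h1, h2⟩ := selfDelimiting_unary h
  exact ⟨Fin.ext h1, h2⟩

theorem selfDelimiting_optLetter {n : ℕ} : SelfDelimiting (optLetter (n := n)) := by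
  intro a b s t h
  cases a <;> cases b <;> obtain ⟨h1, h2⟩ := selfDelimiting_unary h
  · exact ⟨rfl, h2⟩
  · omega
  · omega
  · exact ⟨congrArg some (Fin.ext (by omega)), h2⟩

theorem selfDelimiting_edge {n d : ℕ} : SelfDelimiting (edge (n := n) (d := d)) := by
  rintro ⟨q, _ | ⟨x, y⟩, r⟩ ⟨q', _ | ⟨x', y'⟩, r'⟩ s t h <;>
    simp only [edge, List.append_assoc] at h <;>
    obtain ⟨h1, h⟩ := selfDelimiting_letter h <;>
    obtain ⟨h2, h⟩ := selfDelimiting_unary h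
  · obtain ⟨h3, h⟩ := selfDelimiting_letter h
    exact ⟨by rw [h1, h3], h⟩
  · omega
  · omega
  · obtain ⟨h3, h⟩ := selfDelimiting_letter h
    obtain ⟨h4, h⟩ := selfDelimiting_letter h
    have h5 : x = x' := Fin.ext (by omega)
    exact ⟨by rw [h1, h3, h4, h5], h⟩

theorem selfDelimiting_transducer {d : ℕ} : SelfDelimiting (transducer (d := d)) := by
  rintro ⟨n, i, f, e⟩ ⟨n', i', f', e'⟩ s t h
  simp only [transducer, List.append_assoc] at h
  obtain ⟨h1, h⟩ := selfDelimiting_unary h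
  subst h1
  obtain ⟨h2, h⟩ := selfDelimiting_letter h
  obtain ⟨h3, h⟩ := selfDelimiting_letter.list h
  obtain ⟨h4, h⟩ := selfDelimiting_edge.list h
  exact ⟨by rw [h2, h3, h4], h⟩

theorem mem_labels {s : ℕ} (a : Option (Fin s)) : a ∈ labels s := by
  cases a <;> simp [labels]

theorem mem_stackOps {g : ℕ} (op : StackOp (Fin g)) : op ∈ stackOps g := by
  cases op <;> simp [stackOps]

theorem selfDelimiting_succinctPDA {s : ℕ} : SelfDelimiting (succinctPDA (s := s)) := by
  rintro ⟨g, d, n, w, v, b, T⟩ ⟨g', d', n', w', v', b', T'⟩ x y h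
  simp only [succinctPDA, List.append_assoc] at h
  obtain ⟨h1, h⟩ := selfDelimiting_unary h
  subst h1
  obtain ⟨h2, h⟩ := selfDelimiting_unary h
  subst h2
  obtain ⟨h3, h⟩ := selfDelimiting_unary h
  subst h3
  obtain ⟨h4, h⟩ := selfDelimiting_letter.flatMap (by simp) h
  obtain ⟨h5, h⟩ := selfDelimiting_letter.flatMap (by simp) h
  obtain ⟨h6, h⟩ := selfDelimiting_optLetter h
  have hfam : SelfDelimiting fun f : StackOp (Fin g) → Transducer (Fin d) =>
      (stackOps g).flatMap fun op => transducer (f op) := by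
    intro f f' x y h
    obtain ⟨h7, h8⟩ := flatMap_family selfDelimiting_transducer _ h
    exact ⟨funext fun op => h7 op (mem_stackOps op), h8⟩
  obtain ⟨h7, h8⟩ := flatMap_family hfam _ h
  have h9 : T = T' := funext fun a => h7 a (mem_labels a)
  exact ⟨by rw [Subtype.ext h4, Subtype.ext h5, h6, h9], h8⟩

theorem input_injective : Function.Injective input := by
  rintro ⟨s, C, Θ, K⟩ ⟨s', C', Θ', K'⟩ h
  simp only [input] at h
  obtain ⟨h1, h⟩ := selfDelimiting_unary h
  subst h1
  obtain ⟨h2, h⟩ := selfDelimiting_succinctPDA h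
  obtain ⟨h3, h⟩ := List.append_inj h (by simp)
  have h4 : Θ = Θ' := by
    ext a
    simpa using List.map_inj_left.1 h3 a (List.mem_finRange a)
  obtain ⟨h5, -⟩ := selfDelimiting_binary (s := []) (t := []) (by simpa using h)
  rw [h2, h4, h5]

theorem dsnfa_injective : Function.Injective dsnfa := by
  rintro ⟨s, e, M, w, hw, T⟩ ⟨s', e', M', w', hw', T'⟩ h
  simp only [dsnfa] at h
  obtain ⟨h1, h⟩ := selfDelimiting_unary h
  subst h1
  obtain ⟨h2, h⟩ := selfDelimiting_unary h
  subst h2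
  obtain ⟨h3, hb⟩ := selfDelimiting_binary h
  clear h
  subst h3
  obtain ⟨h4, hc⟩ := selfDelimiting_letter.list hb
  clear hb
  subst h4
  obtain ⟨h5, -⟩ := flatMap_family (s := []) (t := []) selfDelimiting_transducer _
    (by simpa using hc)
  have h6 : T = T' := funext fun a => h5 a (mem_labels a)
  rw [h6]

end Code

/-!
The proof has three parts: the downward closure is recognized by a pushdown machine with a stack of
at most exponential height, such a machine can be simulated on words of exponential length, and the
automaton that does this can be written down in polynomial time.

**Pumping.** There is no bound for the stack that the PDA needs for a given word. Call the part of a run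
between a push and the matching pop, or between two points of such a part with the same stack, a
level run; it leads from a state `p` to a state `q`. If a level run from `p` to `q` contains a frame
that also leads from `p` to `q` and reads as many letters of `Θ`, then the context around this frame
reads letters outside `Θ` only, and it can be deleted or iterated. Hence any letters of its two
halves may be kept or deleted, in any number. The pumping machine (`PumpStep`) uses this: it may put
a bracket `(p, q)` on the stack, execute loops `p → p`, `q → q` of which one letter in one half is
kept (modes `A1`, `A2` and `B1`, `B2`), and continue with a level run that contains no further frame
of this kind. Each loop can be replaced by one of exponential height, since the possible loops form
the least fixed point of a monotone operator on subsets of a finite set (`map_iterate_card_subset`).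
The nesting of brackets is bounded by the rank `k * (N + 1) + (N - |V|)`, where `k` is the number of
letters of `Θ` to be read, `N` the number of pairs of states, and `V` the set of pairs in use since
`k` has changed (`LevelRun.path_of_rank`). Letters that are never popped need not be stored. Thus a
stack of height `pumpHeight` suffices (`exists_pumpPath_of_mem`). Conversely, the pumping machine
accepts nothing else: the loops executed at a bracket have pushed letters that can be popped by a
run from `q` to `q` on letters outside `Θ`, which is the content of the invariant (`Pump.Inv`,
`Pump.Sound.step`).

**Words.** A configuration of the pumping machine is a word: the mode, a pending letter, the bits of
a counter for the letters of `Θ`, the stack, and for each `i` a track that holds the `i`-th letters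
of the current state and of the states in the brackets (`Represents`, `encode`). The stack is padded
by blanks, and so are the tracks, so that their lengths never change. On such words, each step of
the pumping machine is a rational relation: the transducers of the PDA are applied to the first
letters of the tracks, and the operations on brackets change the topmost entries of each track
(`eps_sound`, `eps_complete`, `letter_sound`, `letter_complete`, `language_dsnfaOf`). The length of
the words is `2 ^ (10 * s ^ 2)` for an input of length `s`, which has polynomially many bits.

**Polynomial time.** The code of the automaton is a concatenation of lists over the ranges of
numbers and the transitions that are found in the code of the input. It is written by a program in a
small language `Gen` that reads the input once, in its order, and appends to several streams. Such
programs are compiled to programs over stacks (`Prog`), with polynomial bounds for their running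
time (`Gen.exec_run`), and these to machines of type `TM2` (`Prog.computableInPolyTime`). The
streams form the code of the automaton (`Gen.flatMap_proj_trace`).
-/

/-! ### A structured language of stack programs, and its compilation to `TM2` -/

/-- The symbols of codes, and of all stacks. -/
abbrev CSym : Type := Option Bool

/-- Structured programs over stacks of symbols, indexed by `K`. `case` pops a stack and branches on
the symbol found (`none` if the stack is empty); `loop k c f` pops the stack `k` and, as long as the
result satisfies `c`, runs `f` on it and starts again. -/
inductive Prog (K : Type)
  | skip : Prog K
  | push (k : K) (x : CSym) : Prog K
  | seq (p q : Prog K) : Prog K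
  | case (k : K) (f : Option CSym → Prog K) : Prog K
  | loop (k : K) (c : Option CSym → Bool) (f : Option CSym → Prog K) : Prog K

namespace Prog

variable {K : Type}

/-- The control points of a program. -/
def Label : Prog K → Type
  | skip => Unit
  | push _ _ => Unit
  | seq p q => p.Label ⊕ q.Label
  | case _ f => Option (Σ h, (f h).Label)
  | loop _ _ f => Option (Σ h, (f h).Label)

instance finite_label : (p : Prog K) → Finite p.Label
  | skip => inferInstanceAs (Finite Unit)
  | push _ _ => inferInstanceAs (Finite Unit)
  | seq p q =>
    have := p.finite_label
    have := q.finite_label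
    inferInstanceAs (Finite (p.Label ⊕ q.Label))
  | case _ f =>
    have := fun h => (f h).finite_label
    inferInstanceAs (Finite (Option (Σ h, (f h).Label)))
  | loop _ _ f =>
    have := fun h => (f h).finite_label
    inferInstanceAs (Finite (Option (Σ h, (f h).Label)))

/-- The control point at which a program starts. -/
def entry : (p : Prog K) → p.Label
  | skip => ()
  | push _ _ => ()
  | seq p _ => Sum.inl p.entry
  | case _ _ => (none : Option _)
  | loop _ _ _ => (none : Option _)

open Turing in
/-- The `TM2` statements of a program whose control points are embedded into the labels `L` by `e`,
and that continues at the label `exit`. The internal state holds the symbol popped last. -/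
def code {L : Type} : (p : Prog K) → (p.Label → L) → L → p.Label →
    TM2.Stmt (fun _ : K => CSym) L (Option CSym)
  | skip, _, exit, _ => .goto fun _ => exit
  | push k x, _, exit, _ => .push k (fun _ => x) (.goto fun _ => exit)
  | seq p q, e, exit, l => match l with
    | .inl l => p.code (fun l => e (.inl l)) (e (.inr q.entry)) l
    | .inr l => q.code (fun l => e (.inr l)) exit l
  | case k f, e, exit, l => match l with
    | none => .pop k (fun _ h => h) (.goto fun h => e (some ⟨h, (f h).entry⟩))
    | some ⟨h, l⟩ => (f h).code (fun l => e (some ⟨h, l⟩)) exit l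
  | loop k c f, e, exit, l => match l with
    | none => .pop k (fun _ h => h)
        (.goto fun h => if c h then e (some ⟨h, (f h).entry⟩) else exit)
    | some ⟨h, l⟩ => (f h).code (fun l => e (some ⟨h, l⟩)) (e (none : Option _)) l

variable [DecidableEq K]

/-- `p.Exec S S' t`: started on the stacks `S`, the program `p` terminates with the stacks `S'`, in
`t` steps. -/
inductive Exec : Prog K → (K → List CSym) → (K → List CSym) → ℕ → Prop
  | skip (S : K → List CSym) : Exec skip S S 1
  | push (k : K) (x : CSym) (S : K → List CSym) :
      Exec (push k x) S (Function.update S k (x :: S k)) 1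
  | seq {p q : Prog K} {S S' S'' : K → List CSym} {t t' : ℕ} :
      Exec p S S' t → Exec q S' S'' t' → Exec (seq p q) S S'' (t + t')
  | case {k : K} {f : Option CSym → Prog K} {S S' : K → List CSym} {t : ℕ} :
      Exec (f (S k).head?) (Function.update S k (S k).tail) S' t → Exec (case k f) S S' (t + 1)
  | loop_done {k : K} {c : Option CSym → Bool} {f : Option CSym → Prog K} {S : K → List CSym} :
      c (S k).head? = false → Exec (loop k c f) S (Function.update S k (S k).tail) 1
  | loop_step {k : K} {c : Option CSym → Bool} {f : Option CSym → Prog K} {S S' S'' : K → List CSym}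
      {t t' : ℕ} :
      c (S k).head? = true → Exec (f (S k).head?) (Function.update S k (S k).tail) S' t →
      Exec (loop k c f) S' S'' t' → Exec (loop k c f) S S'' (t + t' + 1)

open Turing in
/-- A program does what `Exec` says, in the given number of steps of a machine that contains its
code: `e` embeds the control points of the program into the labels of the machine, and control is
passed to `exit` at the end. -/
theorem Exec.iterate {L : Type} (m : L → TM2.Stmt (fun _ : K => CSym) L (Option CSym)) {p : Prog K}
    {S S' : K → List CSym} {t : ℕ} (h : p.Exec S S' t) (e : p.Label → L) (exit : L)
    (he : ∀ l, m (e l) = p.code e exit l) (v : Option CSym) :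
    ∃ v', (flip bind (TM2.step m))^[t] (some ⟨some (e p.entry), v, S⟩) =
      some ⟨some exit, v', S'⟩ := by
  have step1 : ∀ (l : L) (v : Option CSym) (S : K → List CSym),
      flip bind (TM2.step m) (some ⟨some l, v, S⟩) = some (TM2.stepAux (m l) v S) :=
    fun _ _ _ => rfl
  induction h generalizing exit v with
  | skip S => exact ⟨v, by rw [Function.iterate_one, step1, he]; rfl⟩
  | push k x S => exact ⟨v, by rw [Function.iterate_one, step1, he]; rfl⟩
  | seq h1 h2 ih1 ih2 =>
    obtain ⟨v1, h1⟩ := ih1 (fun l => e (.inl l)) (e (.inr _)) (fun l => he (.inl l)) v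
    obtain ⟨v2, h2⟩ := ih2 (fun l => e (.inr l)) exit (fun l => he (.inr l)) v1
    refine ⟨v2, ?_⟩
    rw [Nat.add_comm, Function.iterate_add_apply]
    exact (congrArg _ h1).trans h2
  | @case k f S S' t h ih =>
    obtain ⟨v1, h1⟩ := ih (fun l => e (some ⟨_, l⟩)) exit (fun l => he (some ⟨_, l⟩)) (S k).head?
    refine ⟨v1, ?_⟩
    rw [Function.iterate_add_apply, Function.iterate_one, step1, he, entry]
    simpa [code] using h1
  | @loop_done k c f S h =>
    refine ⟨(S k).head?, ?_⟩
    rw [Function.iterate_one, step1, he, entry]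
    simp [code, h]
  | @loop_step k c f S S' S'' t t' hc h1 h2 ih1 ih2 =>
    obtain ⟨v1, h1⟩ := ih1 (fun l => e (some ⟨_, l⟩)) (e (none : Option _))
      (fun l => he (some ⟨_, l⟩)) (S k).head?
    obtain ⟨v2, h2⟩ := ih2 e exit he v1
    refine ⟨v2, ?_⟩
    rw [Function.iterate_add_apply, Function.iterate_one, step1, he, entry, Nat.add_comm,
      Function.iterate_add_apply]
    simp only [code, TM2.stepAux, hc, if_true]
    exact (congrArg _ h1).trans h2

open Turing in
/-- The machine that runs the program `p`, with the input on the stack `k₀` and the output on the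
stack `k₁`. -/
noncomputable def machine [Fintype K] (p : Prog K) (k₀ k₁ : K) : FinTM2 where
  K := K
  k₀ := k₀
  k₁ := k₁
  Γ _ := CSym
  Λ := Option p.Label
  main := some p.entry
  ΛFin := Fintype.ofFinite _
  σ := Option CSym
  initialState := none
  m l := match l with
    | none => .load (fun _ => none) .halt
    | some l => p.code some none l

open Turing in
/-- A stack program that computes `f` in polynomial time yields a `TM2` machine that does. -/
theorem computableInPolyTime [Fintype K] {α β : Type} {ea : α → List CSym} {eb : β → List CSym}
    {f : α → β} (p : Prog K) (k₀ k₁ : K) (time : Polynomial ℕ)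
    (h : ∀ a, ∃ t ≤ time.eval (ea a).length,
      p.Exec (Function.update (fun _ => []) k₀ (ea a)) (Function.update (fun _ => []) k₁ (eb (f a)))
        t) :
    Nonempty (TM2ComputableInPolyTime ea eb f) := by
  have key : ∀ a, ∃ t ≤ (time + 1).eval (ea a).length,
      (flip bind (p.machine k₀ k₁).step)^[t] (some (initList (p.machine k₀ k₁) (ea a))) =
        some (haltList (p.machine k₀ k₁) (eb (f a))) := by
    intro a
    obtain ⟨t, ht, hp⟩ := h a
    obtain ⟨v', hv⟩ := hp.iterate (p.machine k₀ k₁).m some none (fun _ => rfl) none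
    refine ⟨1 + t, by simp; omega, ?_⟩
    rw [Function.iterate_add_apply]
    have h1 : initList (p.machine k₀ k₁) (ea a) =
        ⟨some (some p.entry), none, Function.update (fun _ => []) k₀ (ea a)⟩ := by
      unfold initList
      congr 1
      refine funext fun (k : K) => ?_
      by_cases hk : k = k₀
      · have hu : Function.update (fun _ : K => ([] : List CSym)) k₀ (ea a) k = (ea a) := by
          rw [hk, Function.update_self]
        exact (dif_pos hk).trans hu.symm
      · have hu : Function.update (fun _ : K => ([] : List CSym)) k₀ (ea a) k = [] :=
          Function.update_of_ne hk _ _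
        exact (dif_neg hk).trans hu.symm
    have h2 : haltList (p.machine k₀ k₁) (eb (f a)) =
        ⟨none, none, Function.update (fun _ => []) k₁ (eb (f a))⟩ := by
      unfold haltList
      congr 1
      refine funext fun (k : K) => ?_
      by_cases hk : k = k₁
      · have hu : Function.update (fun _ : K => ([] : List CSym)) k₁ (eb (f a)) k = (eb (f a)) := by
          rw [hk, Function.update_self]
        exact (dif_pos hk).trans hu.symm
      · have hu : Function.update (fun _ : K => ([] : List CSym)) k₁ (eb (f a)) k = [] :=
          Function.update_of_ne hk _ _
        exact (dif_neg hk).trans hu.symm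
    rw [h1, h2]
    refine (congrArg _ hv).trans ?_
    rfl
  choose t ht hs using key
  exact ⟨{
    tm := p.machine k₀ k₁
    inputAlphabet := Equiv.refl _
    outputAlphabet := Equiv.refl _
    time := time + 1
    outputsFun := fun a =>
      { steps := t a
        evals_in_steps := by
          have := hs a
          rw [← List.map_id (ea a), ← List.map_id (eb (f a))] at this
          exact this
        steps_le_m := ht a } }⟩

end Prog

/-! ### A language of generators -/

/-- The stacks used by a generator with registers `R` and output streams `O`: the input, the final
output, a scratch stack, the registers (holding unary numbers), for each register the number of
iterations left of the loop that it controls, and the streams. -/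
inductive Stk (R O : Type)
  | inp : Stk R O
  | out : Stk R O
  | tmp : Stk R O
  | reg (r : R) : Stk R O
  | aux (r : R) : Stk R O
  | str (o : O) : Stk R O
  deriving DecidableEq, Fintype

namespace Prog

variable {K : Type} [DecidableEq K]

theorem exec_push_eq {k : K} {x : CSym} {S S' : K → List CSym}
    (h : S' = Function.update S k (x :: S k)) : Exec (push k x) S S' 1 := h ▸ Exec.push k x S

/-- Pops the stack `k` until it is empty, running `p` after each pop. -/
def forEach (k : K) (p : Prog K) : Prog K := loop k Option.isSome fun _ => p

/-- Empties the stack `k`. -/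
def clear (k : K) : Prog K := forEach k skip

/-- A loop that empties the stack `k`: `S j` are the contents of the stacks when `j` iterations are
left, and each iteration takes at most `T` steps. -/
theorem exec_loop (k : K) (f : Option CSym → Prog K) (n T : ℕ) (S : ℕ → K → List CSym)
    (h0 : S 0 k = [])
    (hs : ∀ j < n, ∃ x l, S (j + 1) k = x :: l ∧ ∃ t ≤ T,
      Exec (f (some x)) (Function.update (S (j + 1)) k l) (S j) t) :
    ∃ t ≤ n * (T + 1) + 1, Exec (loop k Option.isSome f) (S n) (S 0) t := by
  induction n with
  | zero =>
    refine ⟨1, by simp, ?_⟩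
    have := Exec.loop_done (k := k) (c := Option.isSome) (f := f) (S := S 0) (by simp [h0])
    rwa [h0, List.tail_nil, ← h0, Function.update_eq_self] at this
  | succ n ih =>
    obtain ⟨t', ht', he'⟩ := ih fun j hj => hs j (by omega)
    obtain ⟨x, l, hx, t, ht, he⟩ := hs n (by omega)
    refine ⟨t + t' + 1, by rw [Nat.succ_mul]; omega, ?_⟩
    refine Exec.loop_step (by simp [hx]) ?_ he'
    simpa [hx] using he

theorem exec_forEach (k : K) (p : Prog K) (n T : ℕ) (S : ℕ → K → List CSym)
    (h0 : S 0 k = [])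
    (hs : ∀ j < n, ∃ x l, S (j + 1) k = x :: l ∧ ∃ t ≤ T,
      Exec p (Function.update (S (j + 1)) k l) (S j) t) :
    ∃ t ≤ n * (T + 1) + 1, Exec (forEach k p) (S n) (S 0) t :=
  exec_loop k _ n T S h0 hs

theorem exec_clear (k : K) (S : K → List CSym) :
    ∃ t ≤ (S k).length * 2 + 1, Exec (clear k) S (Function.update S k []) t := by
  have := exec_forEach k skip (S k).length 1
    (fun j => Function.update S k ((S k).drop ((S k).length - j))) (by simp) (by
      intro j hj
      have hlt : (S k).length - (j + 1) < (S k).length := by omega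
      refine ⟨(S k)[(S k).length - (j + 1)], (S k).drop ((S k).length - j), ?_, 1, le_rfl, ?_⟩
      · rw [Function.update_self, List.drop_eq_getElem_cons hlt]
        congr 2
        omega
      · simpa using Exec.skip _)
  simpa [clear] using this

end Prog

/-- Generators: programs that read the input from left to right and append symbols to the streams
`O`, with local variables `R` that hold numbers. `rd r g` reads a unary number and binds it to `r`
in `g`; `rep i r g` runs `g` for all values of `i` below the value of `r`; `ifz` tests a variable
for zero; `ifb` reads an input symbol and tests whether it is `some true`. -/
inductive Gen (R O : Type)
  | nop : Gen R O
  | emit (o : O) (x : CSym) : Gen R O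
  | seq (g h : Gen R O) : Gen R O
  | rd (r : R) (g : Gen R O) : Gen R O
  | rep (i r : R) (g : Gen R O) : Gen R O
  | ifz (r : R) (g h : Gen R O) : Gen R O
  | ifb (g h : Gen R O) : Gen R O

namespace Gen

variable {R O : Type}

/-- Reads a unary number, and returns it with the rest of the input. -/
def readUnary : List CSym → ℕ × List CSym
  | [] => (0, [])
  | some true :: l => ((readUnary l).1 + 1, (readUnary l).2)
  | _ :: l => (0, l)

/-- Runs `f t`, …, `f (t + n - 1)` on the input, collecting their outputs. -/
def repeatFrom (f : ℕ → List CSym → List CSym × List (O × CSym)) :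
    ℕ → ℕ → List CSym → List CSym × List (O × CSym)
  | _, 0, inp => (inp, [])
  | t, n + 1, inp =>
    let p := f t inp
    let q := repeatFrom f (t + 1) n p.1
    (q.1, p.2 ++ q.2)

variable [DecidableEq R]

/-- The rest of the input, and the symbols appended to the streams in the order of time. -/
def eval : Gen R O → (R → ℕ) → List CSym → List CSym × List (O × CSym)
  | nop, _, inp => (inp, [])
  | emit o x, _, inp => (inp, [(o, x)])
  | seq g h, ρ, inp =>
    let p := g.eval ρ inp
    let q := h.eval ρ p.1
    (q.1, p.2 ++ q.2)
  | rd r g, ρ, inp => g.eval (Function.update ρ r (readUnary inp).1) (readUnary inp).2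
  | rep i r g, ρ, inp => repeatFrom (fun t => g.eval (Function.update ρ i t)) 0 (ρ r) inp
  | ifz r g h, ρ, inp => if ρ r = 0 then g.eval ρ inp else h.eval ρ inp
  | ifb g h, ρ, inp => if inp.head? = some (some true) then g.eval ρ inp.tail else h.eval ρ inp.tail

/-- The variables bound in a generator. -/
def bound : Gen R O → List R
  | nop => []
  | emit _ _ => []
  | seq g h => g.bound ++ h.bound
  | rd r g => r :: g.bound
  | rep i _ g => i :: g.bound
  | ifz _ g h => g.bound ++ h.bound
  | ifb g h => g.bound ++ h.bound

/-- No variable is bound again in its scope. -/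
def Wf : Gen R O → Bool
  | nop => true
  | emit _ _ => true
  | seq g h => g.Wf && h.Wf
  | rd r g => !(g.bound.contains r) && g.Wf
  | rep i _ g => !(g.bound.contains i) && g.Wf
  | ifz _ g h => g.Wf && h.Wf
  | ifb g h => g.Wf && h.Wf

open Prog in
/-- The stack program of a generator. -/
def compile : Gen R O → Prog (Stk R O)
  | nop => .skip
  | emit o x => .push (.str o) x
  | seq g h => .seq g.compile h.compile
  | rd r g =>
    .seq (.loop .inp (fun h => h == some (some true)) fun _ => .push (.reg r) (some true))
      (.seq g.compile (clear (.reg r)))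
  | rep i r g =>
    .seq (.seq (forEach (.reg r) (.push .tmp (some true)))
        (forEach .tmp (.seq (.push (.reg r) (some true)) (.push (.aux i) (some true)))))
      (.seq (forEach (.aux i) (.seq g.compile (.push (.reg i) (some true)))) (clear (.reg i)))
  | ifz r g h =>
    .case (.reg r) fun x =>
      if x.isSome then .seq (.push (.reg r) (some true)) h.compile else g.compile
  | ifb g h => .case .inp fun x => if x = some (some true) then g.compile else h.compile

open Polynomial in
/-- A bound on the running time of the stack program of a generator, as a polynomial in a bound on
the variables and on the length of the input. -/
noncomputable def timeBound : Gen R O → ℕ[X]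
  | nop => 1
  | emit _ _ => 1
  | seq g h => g.timeBound + h.timeBound
  | rd _ g => g.timeBound + 4 * X + 2
  | rep _ _ g => X * g.timeBound + 9 * X + 4
  | ifz _ g h => g.timeBound + h.timeBound + 2
  | ifb g h => g.timeBound + h.timeBound + 1

theorem readUnary_length (l : List CSym) :
    (readUnary l).1 + (readUnary l).2.length ≤ l.length := by
  induction l with
  | nil => simp [readUnary]
  | cons x l ih =>
    rcases x with _ | _ | _ <;> simp [readUnary]
    omega

theorem repeatFrom_length (f : ℕ → List CSym → List CSym × List (O × CSym))
    (hf : ∀ t inp, (f t inp).1.length ≤ inp.length) (t n : ℕ) (inp : List CSym) :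
    (repeatFrom f t n inp).1.length ≤ inp.length := by
  induction n generalizing t inp with
  | zero => simp [repeatFrom]
  | succ n ih => exact (ih _ _).trans (hf _ _)

theorem eval_length (g : Gen R O) (ρ : R → ℕ) (inp : List CSym) :
    (g.eval ρ inp).1.length ≤ inp.length := by
  induction g generalizing ρ inp with
  | nop => simp [eval]
  | emit o x => simp [eval]
  | seq g h ihg ihh => exact (ihh _ _).trans (ihg _ _)
  | rd r g ih => exact (ih _ _).trans (by have := readUnary_length inp; omega)
  | rep i r g ih => exact repeatFrom_length _ (fun t => ih _) _ _ _
  | ifz r g h ihg ihh => rw [eval]; split <;> [exact ihg _ _; exact ihh _ _]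
  | ifb g h ihg ihh =>
    rw [eval]
    split
    · exact (ihg _ _).trans (by simp)
    · exact (ihh _ _).trans (by simp)

theorem repeatFrom_trace_length (f : ℕ → List CSym → List CSym × List (O × CSym)) (T L : ℕ)
    (hl : ∀ t inp, (f t inp).1.length ≤ inp.length) (t n : ℕ)
    (hf : ∀ t' < t + n, ∀ inp : List CSym, inp.length ≤ L → (f t' inp).2.length ≤ T)
    (inp : List CSym) (hi : inp.length ≤ L) :
    (repeatFrom f t n inp).2.length ≤ n * T := by
  induction n generalizing t inp with
  | zero => simp [repeatFrom]
  | succ n ih =>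
    have h1 := hf t (by omega) inp hi
    have h2 := ih (t + 1) (fun t' ht' => hf t' (by omega)) (f t inp).1 ((hl _ _).trans hi)
    simp only [repeatFrom, List.length_append, Nat.succ_mul]
    omega

theorem update_le {ρ : R → ℕ} {L : ℕ} (hρ : ∀ r, ρ r ≤ L) {i : R} {t : ℕ} (ht : t ≤ L) (r : R) :
    Function.update ρ i t r ≤ L := by
  by_cases h : r = i
  · subst h; simpa using ht
  · simpa [h] using hρ r

/-- A generator writes at most as many symbols as its time bound. -/
theorem trace_length (g : Gen R O) (L : ℕ) (ρ : R → ℕ) (hρ : ∀ r, ρ r ≤ L) (inp : List CSym)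
    (hi : inp.length ≤ L) : (g.eval ρ inp).2.length ≤ g.timeBound.eval L := by
  induction g generalizing ρ inp with
  | nop => simp [eval]
  | emit o x => simp [eval, timeBound]
  | seq g h ihg ihh =>
    have h1 := ihg ρ hρ inp hi
    have h2 := ihh ρ hρ (g.eval ρ inp).1 ((eval_length _ _ _).trans hi)
    simp only [eval, List.length_append, timeBound, Polynomial.eval_add]
    omega
  | rd r g ih =>
    have hl := readUnary_length inp
    have h1 := ih _ (update_le (i := r) hρ (t := (readUnary inp).1) (by omega))
      (readUnary inp).2 (by omega)
    simp only [eval, timeBound, Polynomial.eval_add]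
    omega
  | rep i r g ih =>
    have h1 := repeatFrom_trace_length (fun t => g.eval (Function.update ρ i t))
      (g.timeBound.eval L) L (fun t => eval_length _ _) 0 (ρ r)
      (fun t' ht' inp hi => ih _ (update_le hρ (by have := hρ r; omega)) inp hi) inp hi
    have h2 := Nat.mul_le_mul_right (g.timeBound.eval L) (hρ r)
    simp only [eval, timeBound, Polynomial.eval_add, Polynomial.eval_mul, Polynomial.eval_X]
    omega
  | ifz r g h ihg ihh =>
    have h1 := ihg ρ hρ inp hi
    have h2 := ihh ρ hρ inp hi
    simp only [eval, timeBound, Polynomial.eval_add]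
    split <;> omega
  | ifb g h ihg ihh =>
    have h1 := ihg ρ hρ inp.tail (by simp; omega)
    have h2 := ihh ρ hρ inp.tail (by simp; omega)
    simp only [eval, timeBound, Polynomial.eval_add]
    split <;> omega

/-- The symbols that a trace appends to the stream `o`. -/
def proj [DecidableEq O] (o : O) (w : List (O × CSym)) : List CSym :=
  (w.filter (fun p => p.1 = o)).map Prod.snd

variable [DecidableEq O]

/-- The stacks that represent the values `ρ` of the variables, the rest `inp` of the input, the
numbers `a` of iterations left, and the contents `st` of the streams. -/
def enc (ρ : R → ℕ) (inp : List CSym) (a : R → ℕ) (st : O → List CSym) : Stk R O → List CSym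
  | .inp => inp
  | .out => []
  | .tmp => []
  | .reg r => List.replicate (ρ r) (some true)
  | .aux r => List.replicate (a r) (some true)
  | .str o => st o

/-- Streams grow at the top of their stacks. -/
def push (st : O → List CSym) (w : List (O × CSym)) : O → List CSym :=
  fun o => (proj o w).reverse ++ st o

theorem push_nil (st : O → List CSym) : push st [] = st := by
  funext o; simp [push, proj]

theorem push_append (st : O → List CSym) (w w' : List (O × CSym)) :
    push st (w ++ w') = push (push st w) w' := by
  funext o; simp [push, proj]

theorem enc_update_reg (ρ : R → ℕ) (inp : List CSym) (a : R → ℕ) (st : O → List CSym) (r : R)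
    (n : ℕ) : Function.update (enc ρ inp a st) (.reg r) (List.replicate n (some true)) =
      enc (Function.update ρ r n) inp a st := by
  funext k
  cases k <;> simp [enc, Function.update_apply]
  split <;> rfl

theorem enc_update_aux (ρ : R → ℕ) (inp : List CSym) (a : R → ℕ) (st : O → List CSym) (r : R)
    (n : ℕ) : Function.update (enc ρ inp a st) (.aux r) (List.replicate n (some true)) =
      enc ρ inp (Function.update a r n) st := by
  funext k
  cases k <;> simp [enc, Function.update_apply]
  split <;> rfl

theorem enc_update_inp (ρ : R → ℕ) (inp inp' : List CSym) (a : R → ℕ) (st : O → List CSym) :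
    Function.update (enc ρ inp a st) .inp inp' = enc ρ inp' a st := by
  funext k
  cases k <;> simp [enc]

theorem enc_update_str (ρ : R → ℕ) (inp : List CSym) (a : R → ℕ) (st : O → List CSym) (o : O)
    (x : CSym) : Function.update (enc ρ inp a st) (.str o) (x :: enc ρ inp a st (.str o)) =
      enc ρ inp a (push st [(o, x)]) := by
  funext k
  cases k with
  | str o' =>
    by_cases h : o' = o
    · subst h; simp [enc, push, proj]
    · simp [enc, push, proj, h, Ne.symm h]
  | _ => simp [enc]

/-- Reading a number in unary into the register `r`. -/
theorem exec_read (ρ : R → ℕ) (inp : List CSym) (a : R → ℕ) (st : O → List CSym) (r : R) :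
    ∃ t ≤ 2 * inp.length + 1,
      Prog.Exec (.loop .inp (fun h => h == some (some true)) fun _ => .push (.reg r) (some true))
        (enc ρ inp a st)
        (enc (Function.update ρ r (ρ r + (readUnary inp).1)) (readUnary inp).2 a st) t := by
  induction inp generalizing ρ with
  | nil =>
    refine ⟨1, by simp, ?_⟩
    have := Prog.Exec.loop_done (k := .inp) (c := fun h => h == some (some true))
      (f := fun _ => .push (.reg r) (some true)) (S := enc ρ [] a st) (by simp [enc])
    rw [show (enc ρ [] a st .inp).tail = [] from rfl, enc_update_inp] at this
    simpa [readUnary] using this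
  | cons x l ih =>
    rcases eq_or_ne x (some true) with rfl | hx
    · obtain ⟨t, ht, he⟩ := ih (Function.update ρ r (ρ r + 1))
      refine ⟨1 + t + 1, by simp; omega, ?_⟩
      refine Prog.Exec.loop_step (by simp [enc]) ?_
        (S' := enc (Function.update ρ r (ρ r + 1)) l a st)
        ?_
      · rw [show (enc ρ (some true :: l) a st .inp).tail = l from rfl, enc_update_inp,
          ← enc_update_reg, List.replicate_succ]
        exact Prog.Exec.push _ _ _
      · simpa [readUnary, Nat.add_assoc, Nat.add_comm 1] using he
    · refine ⟨1, by simp, ?_⟩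
      have := Prog.Exec.loop_done (k := .inp) (c := fun h => h == some (some true))
        (f := fun _ => .push (.reg r) (some true)) (S := enc ρ (x :: l) a st) (by simp [enc, hx])
      rw [show (enc ρ (x :: l) a st .inp).tail = l from rfl, enc_update_inp] at this
      have hr : readUnary (x :: l) = (0, l) := by
        rcases x with _ | _ | _ <;> simp_all [readUnary]
      simpa [hr] using this

/-- Copying the register `r` to an auxiliary register; the detour through `tmp` restores `r`, which
is emptied on the way. -/
theorem exec_copy (ρ : R → ℕ) (inp : List CSym) (a : R → ℕ) (st : O → List CSym) (i r : R)
    (ha : a i = 0) :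
    ∃ t ≤ 5 * ρ r + 2, Prog.Exec (.seq (.forEach (.reg r) (.push .tmp (some true)))
      (.forEach .tmp (.seq (.push (.reg r) (some true)) (.push (.aux i) (some true)))))
        (enc ρ inp a st) (enc ρ inp (Function.update a i (ρ r)) st) t := by
  obtain ⟨t1, ht1, h1⟩ := Prog.exec_forEach (.reg r) (.push .tmp (some true)) (ρ r) 1
    (fun j => Function.update (enc (Function.update ρ r j) inp a st) .tmp
      (List.replicate (ρ r - j) (some true))) (by simp [enc]) (by
      intro j hj
      refine ⟨some true, List.replicate j (some true),
        by simp [enc, List.replicate_succ], 1, le_rfl,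
        ?_⟩
      refine Prog.exec_push_eq ?_
      rw [Function.update_comm (by simp), Function.update_idem, Function.update_comm (by simp),
        enc_update_reg, Function.update_idem, Function.update_of_ne (by simp), Function.update_self,
        show ρ r - j = ρ r - (j + 1) + 1 by omega, List.replicate_succ])
  obtain ⟨t2, ht2, h2⟩ := Prog.exec_forEach .tmp
    (.seq (.push (.reg r) (some true)) (.push (.aux i) (some true))) (ρ r) 2
    (fun j => Function.update (enc (Function.update ρ r (ρ r - j)) inp
      (Function.update a i (ρ r - j)) st) .tmp (List.replicate j (some true))) (by simp) (by
      intro j hj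
      refine ⟨some true, List.replicate j (some true), by simp [List.replicate_succ], 2, le_rfl, ?_⟩
      refine Prog.Exec.seq (t := 1) (t' := 1) (Prog.Exec.push _ _ _) ?_
      refine Prog.exec_push_eq ?_
      have h3 : ρ r - j = ρ r - (j + 1) + 1 := by omega
      funext k
      cases k with
      | reg r' =>
        rcases eq_or_ne r' r with h | h
        · subst h; simp [enc, h3, List.replicate_succ]
        · simp [enc, h]
      | aux i' =>
        rcases eq_or_ne i' i with h | h
        · subst h; simp [enc, h3, List.replicate_succ]
        · simp [enc, h]
      | _ => simp [enc])
  refine ⟨t1 + t2, by omega, Prog.Exec.seq (S' := Function.update (enc (Function.update ρ r 0) inp a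
    st) .tmp (List.replicate (ρ r) (some true))) ?_ ?_⟩
  · convert h1 using 1
    · funext k
      cases k <;> simp [enc]
    · simp
  · have ha' : Function.update a i 0 = a := by rw [← ha, Function.update_eq_self]
    convert h2 using 1
    · rw [Nat.sub_self, ha']
    · funext k
      cases k <;> simp [enc]

/-- The compiled repetition: the auxiliary register counts the remaining iterations, and the
register `i` those that are done. -/
theorem exec_repeat {g : Gen R O} {i : R} {L : ℕ} {ρ : R → ℕ} (hρ : ∀ r, ρ r ≤ L)
    (hi : i ∉ g.bound) (hb : ∀ j ∈ g.bound, ρ j = 0)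
    (ih : ∀ (ρ : R → ℕ) (inp : List CSym) (a : R → ℕ) (st : O → List CSym), (∀ r, ρ r ≤ L) →
      inp.length ≤ L → (∀ j ∈ g.bound, ρ j = 0 ∧ a j = 0) → ∃ t ≤ g.timeBound.eval L,
        g.compile.Exec (enc ρ inp a st) (enc ρ (g.eval ρ inp).1 a (push st (g.eval ρ inp).2)) t)
    (n t : ℕ) (hn : t + n ≤ L) (inp : List CSym) (hl : inp.length ≤ L) (a : R → ℕ)
    (ha : ∀ j ∈ g.bound, a j = 0) (st : O → List CSym) :
    ∃ T ≤ n * (g.timeBound.eval L + 2) + 1,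
      Prog.Exec (.forEach (.aux i) (.seq g.compile (.push (.reg i) (some true))))
        (enc (Function.update ρ i t) inp (Function.update a i n) st)
        (enc (Function.update ρ i (t + n))
          (repeatFrom (fun t => g.eval (Function.update ρ i t)) t n inp).1 (Function.update a i 0)
          (push st (repeatFrom (fun t => g.eval (Function.update ρ i t)) t n inp).2)) T := by
  induction n generalizing t inp st with
  | zero =>
    refine ⟨1, by simp, ?_⟩
    have := Prog.Exec.loop_done (k := .aux i) (c := Option.isSome)
      (f := fun _ => Prog.seq g.compile (.push (.reg i) (some true)))
      (S := enc (Function.update ρ i t) inp (Function.update a i 0) st) (by simp [enc])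
    rw [show (enc (Function.update ρ i t) inp (Function.update a i 0) st (.aux i)).tail =
      List.replicate 0 (some true) by simp [enc], enc_update_aux, Function.update_idem] at this
    simpa [repeatFrom, push_nil, Prog.forEach] using this
  | succ n ihn =>
    obtain ⟨T1, hT1, h1⟩ := ih (Function.update ρ i t) inp (Function.update a i n) st
      (update_le hρ (by omega)) hl (by
        intro j hj
        have : j ≠ i := fun h => hi (h ▸ hj)
        simp [this, hb j hj, ha j hj])
    obtain ⟨T2, hT2, h2⟩ := ihn (t + 1) (by omega) (g.eval (Function.update ρ i t) inp).1
      ((eval_length _ _ _).trans hl) (push st (g.eval (Function.update ρ i t) inp).2)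
    refine ⟨(T1 + 1) + T2 + 1, by rw [Nat.succ_mul]; omega, ?_⟩
    refine Prog.Exec.loop_step (S' := enc (Function.update ρ i (t + 1))
      (g.eval (Function.update ρ i t) inp).1 (Function.update a i n)
      (push st (g.eval (Function.update ρ i t) inp).2)) (by simp [enc, List.replicate_succ]) ?_ ?_
    · refine Prog.Exec.seq (S' := enc (Function.update ρ i t)
        (g.eval (Function.update ρ i t) inp).1 (Function.update a i n)
        (push st (g.eval (Function.update ρ i t) inp).2)) ?_ ?_
      · convert h1 using 1
        rw [show (enc (Function.update ρ i t) inp (Function.update a i (n + 1)) st (.aux i)).tail =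
          List.replicate n (some true) by simp [enc], enc_update_aux, Function.update_idem]
      · refine Prog.exec_push_eq ?_
        rw [show some true :: enc (Function.update ρ i t) (g.eval (Function.update ρ i t) inp).1
          (Function.update a i n) (push st (g.eval (Function.update ρ i t) inp).2) (.reg i) =
          List.replicate (t + 1) (some true) by simp [enc, List.replicate_succ], enc_update_reg,
          Function.update_idem]
    · rw [Prog.forEach] at h2
      convert h2 using 2
      · rw [Nat.add_assoc, Nat.add_comm 1]
      · rfl
      · exact push_append _ _ _

/-- The stack program of a generator computes its semantics, within the time bound. -/
theorem exec_compile (g : Gen R O) (hg : g.Wf = true) (L : ℕ) (ρ : R → ℕ) (inp : List CSym)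
    (a : R → ℕ) (st : O → List CSym) (hρ : ∀ r, ρ r ≤ L) (hi : inp.length ≤ L)
    (hb : ∀ j ∈ g.bound, ρ j = 0 ∧ a j = 0) :
    ∃ t ≤ g.timeBound.eval L,
      g.compile.Exec (enc ρ inp a st) (enc ρ (g.eval ρ inp).1 a (push st (g.eval ρ inp).2)) t := by
  induction g generalizing ρ inp a st with
  | nop => exact ⟨1, by simp [timeBound], by simpa [eval, push_nil, compile] using Prog.Exec.skip _⟩
  | emit o x =>
    refine ⟨1, by simp [timeBound], ?_⟩
    have := Prog.Exec.push (.str o) x (enc ρ inp a st)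
    rwa [enc_update_str] at this
  | seq g h ihg ihh =>
    simp only [Wf, Bool.and_eq_true] at hg
    simp only [bound, List.mem_append] at hb
    obtain ⟨t1, ht1, h1⟩ := ihg hg.1 ρ inp a st hρ hi fun j hj => hb j (.inl hj)
    obtain ⟨t2, ht2, h2⟩ := ihh hg.2 ρ _ a (push st (g.eval ρ inp).2) hρ
      ((eval_length g _ _).trans hi) fun j hj => hb j (.inr hj)
    refine ⟨t1 + t2, by simp only [timeBound, Polynomial.eval_add]; omega, ?_⟩
    simp only [eval, push_append]
    exact Prog.Exec.seq h1 h2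
  | rd r g ih =>
    simp only [Wf, Bool.and_eq_true, Bool.not_eq_true', List.contains_eq_mem,
      decide_eq_false_iff_not] at hg
    simp only [bound, List.mem_cons, forall_eq_or_imp] at hb
    have hlen := readUnary_length inp
    obtain ⟨t1, ht1, h1⟩ := exec_read ρ inp a st r
    rw [hb.1.1, Nat.zero_add] at h1
    obtain ⟨t2, ht2, h2⟩ := ih hg.2 (Function.update ρ r (readUnary inp).1) (readUnary inp).2 a st
      (update_le hρ (by omega)) (by omega) (by
        intro j hj
        have : j ≠ r := fun h => hg.1 (h ▸ hj)
        simpa [this] using hb.2 j hj)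
    obtain ⟨t3, ht3, h3⟩ := Prog.exec_clear (.reg r) (enc (Function.update ρ r (readUnary inp).1)
      (g.eval (Function.update ρ r (readUnary inp).1) (readUnary inp).2).1 a
      (push st (g.eval (Function.update ρ r (readUnary inp).1) (readUnary inp).2).2))
    have h4 : (enc (Function.update ρ r (readUnary inp).1)
      (g.eval (Function.update ρ r (readUnary inp).1) (readUnary inp).2).1 a
      (push st (g.eval (Function.update ρ r (readUnary inp).1) (readUnary inp).2).2)
        (.reg r)).length = (readUnary inp).1 := by simp [enc]
    rw [h4] at ht3
    rw [show ([] : List CSym) = List.replicate 0 (some true) from rfl, enc_update_reg,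
      Function.update_idem, ← hb.1.1, Function.update_eq_self] at h3
    refine ⟨t1 + (t2 + t3), ?_, Prog.Exec.seq h1 (Prog.Exec.seq h2 h3)⟩
    simp only [timeBound, Polynomial.eval_add, Polynomial.eval_mul, Polynomial.eval_X,
      Polynomial.eval_ofNat]
    omega
  | rep i r g ih =>
    simp only [Wf, Bool.and_eq_true, Bool.not_eq_true', List.contains_eq_mem,
      decide_eq_false_iff_not] at hg
    simp only [bound, List.mem_cons, forall_eq_or_imp] at hb
    obtain ⟨t1, ht1, h1⟩ := exec_copy ρ inp a st i r hb.1.2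
    obtain ⟨t2, ht2, h2⟩ := exec_repeat hρ hg.1 (fun j hj => (hb.2 j hj).1) (ih hg.2) (ρ r) 0
      (by simpa using hρ r) inp hi a (fun j hj => (hb.2 j hj).2) st
    rw [Nat.zero_add, ← hb.1.1, Function.update_eq_self, hb.1.1] at h2
    obtain ⟨t3, ht3, h3⟩ := Prog.exec_clear (.reg i) (enc (Function.update ρ i (ρ r))
          (repeatFrom (fun t => g.eval (Function.update ρ i t)) 0 (ρ r) inp).1
            (Function.update a i 0)
          (push st (repeatFrom (fun t => g.eval (Function.update ρ i t)) 0 (ρ r) inp).2))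
    have h4 : (enc (Function.update ρ i (ρ r))
          (repeatFrom (fun t => g.eval (Function.update ρ i t)) 0 (ρ r) inp).1
            (Function.update a i 0)
          (push st (repeatFrom (fun t => g.eval (Function.update ρ i t)) 0 (ρ r) inp).2)
        (.reg i)).length = ρ r := by simp [enc]
    rw [h4] at ht3
    have h5 : Function.update ρ i 0 = ρ := by rw [← hb.1.1, Function.update_eq_self]
    have h6 : Function.update a i 0 = a := by rw [← hb.1.2, Function.update_eq_self]
    rw [show ([] : List CSym) = List.replicate 0 (some true) from rfl, enc_update_reg,
      Function.update_idem, h5, h6] at h3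
    rw [h6] at h2
    refine ⟨t1 + (t2 + t3), ?_, Prog.Exec.seq h1 (Prog.Exec.seq h2 h3)⟩
    have h7 := hρ r
    have h8 := Nat.mul_le_mul_right (g.timeBound.eval L + 2) h7
    simp only [timeBound, Polynomial.eval_add, Polynomial.eval_mul, Polynomial.eval_X,
      Polynomial.eval_ofNat]
    rw [Nat.mul_add] at h8
    rw [Nat.mul_add] at ht2
    rw [Nat.mul_add] at h8
    omega
  | ifz r g h ihg ihh =>
    simp only [Wf, Bool.and_eq_true] at hg
    simp only [bound, List.mem_append] at hb
    simp only [timeBound, Polynomial.eval_add, Polynomial.eval_ofNat, eval]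
    rcases hr : ρ r with _ | k
    · obtain ⟨t1, ht1, h1⟩ := ihg hg.1 ρ inp a st hρ hi fun j hj => hb j (.inl hj)
      refine ⟨t1 + 1, by omega, Prog.Exec.case ?_⟩
      have h2 : enc ρ inp a st (.reg r) = [] := by simp [enc, hr]
      rw [h2]
      rw [List.tail_nil, ← h2, Function.update_eq_self, h2]
      simpa using h1
    · obtain ⟨t1, ht1, h1⟩ := ihh hg.2 ρ inp a st hρ hi fun j hj => hb j (.inr hj)
      refine ⟨1 + t1 + 1, by omega, Prog.Exec.case ?_⟩
      have h2 : enc ρ inp a st (.reg r) = some true :: List.replicate k (some true) := by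
        simp [enc, hr, List.replicate_succ]
      rw [h2]
      simp only [List.head?_cons, Option.isSome_some, if_true, List.tail_cons, Nat.add_eq_zero_iff,
        one_ne_zero, and_false, if_false]
      refine Prog.Exec.seq ?_ h1
      refine Prog.exec_push_eq ?_
      rw [Function.update_self, Function.update_idem, ← h2, Function.update_eq_self]
  | ifb g h ihg ihh =>
    simp only [Wf, Bool.and_eq_true] at hg
    simp only [bound, List.mem_append] at hb
    simp only [timeBound, Polynomial.eval_add, Polynomial.eval_one, eval]
    obtain ⟨t1, ht1, h1⟩ := ihg hg.1 ρ inp.tail a st hρ (by simp; omega) fun j hj => hb j (.inl hj)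
    obtain ⟨t2, ht2, h2⟩ := ihh hg.2 ρ inp.tail a st hρ (by simp; omega) fun j hj => hb j (.inr hj)
    by_cases hx : inp.head? = some (some true)
    · refine ⟨t1 + 1, by omega, Prog.Exec.case ?_⟩
      rw [show enc ρ inp a st .inp = inp from rfl, enc_update_inp, if_pos hx, if_pos hx]
      exact h1
    · refine ⟨t2 + 1, by omega, Prog.Exec.case ?_⟩
      rw [show enc ρ inp a st .inp = inp from rfl, enc_update_inp, if_neg hx, if_neg hx]
      exact h2

/-! ### Running a generator from the input to the output -/

/-- Measures the length of the input in the variable `r`. -/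
def measure (r : R) : Prog (Stk R O) :=
  .seq (.loop .inp Option.isSome fun h =>
      .seq (.push .tmp (h.getD none)) (.push (.reg r) (some true)))
    (.loop .tmp Option.isSome fun h => .push .inp (h.getD none))

/-- Appends the symbols `w` to the streams. -/
def pushAll : List (O × CSym) → Prog (Stk R O)
  | [] => .skip
  | p :: w => .seq (.push (.str p.1) p.2) (pushAll w)

/-- Reads the rest of the input, and writes `f x` for each symbol `x`. -/
def drain (f : CSym → List (O × CSym)) : Prog (Stk R O) :=
  .loop .inp Option.isSome fun h => pushAll (f (h.getD none))

/-- Writes the contents of the streams `os` to the output, the last one first. -/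
def collect : List O → Prog (Stk R O)
  | [] => .skip
  | o :: os => .seq (collect os) (.loop (.str o) Option.isSome fun h => .push .out (h.getD none))

/-- Measures the input, runs the generator `g`, translates the rest of the input by `f`, and outputs
the streams `os`. -/
def run (g : Gen R O) (r : R) (f : CSym → List (O × CSym)) (os : List O) : Prog (Stk R O) :=
  .seq (measure r) (.seq g.compile (.seq (drain f) (.seq (collect os) (.clear (.reg r)))))

/-- Measuring the input: it is moved to `tmp` and back, and counted in `r`. -/
theorem exec_measure (r : R) (ρ : R → ℕ) (hr : ρ r = 0) (inp : List CSym) (a : R → ℕ)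
    (st : O → List CSym) :
    ∃ t ≤ 5 * inp.length + 2, (measure r).Exec (enc ρ inp a st)
      (enc (Function.update ρ r inp.length) inp a st) t := by
  obtain ⟨t1, ht1, h1⟩ := Prog.exec_loop (.inp : Stk R O)
    (fun h => .seq (.push .tmp (h.getD none)) (.push (.reg r) (some true))) inp.length 2
    (fun j => Function.update (enc (Function.update ρ r (inp.length - j))
      (inp.drop (inp.length - j)) a st) .tmp (inp.take (inp.length - j)).reverse)
    (by simp [enc]) (by
      intro j hj
      have h3 : inp.length - j = inp.length - (j + 1) + 1 := by omega
      have hlt : inp.length - (j + 1) < inp.length := by omega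
      refine ⟨inp[inp.length - (j + 1)], inp.drop (inp.length - j), ?_, 2, le_rfl, ?_⟩
      · rw [Function.update_of_ne (by simp), enc, List.drop_eq_getElem_cons hlt, ← h3]
      · refine Prog.Exec.seq (t := 1) (t' := 1) (Prog.Exec.push _ _ _) ?_
        refine Prog.exec_push_eq ?_
        funext k
        cases k with
        | reg r' =>
          rcases eq_or_ne r' r with h | h
          · subst h; simp [enc, h3, List.replicate_succ]
          · simp [enc, h]
        | tmp => simp [h3]
        | _ => simp [enc])
  obtain ⟨t2, ht2, h2⟩ := Prog.exec_loop (.tmp : Stk R O)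
    (fun h => .push .inp (h.getD none)) inp.length 1
    (fun j => Function.update (enc (Function.update ρ r inp.length)
      (inp.drop j) a st) .tmp (inp.take j).reverse)
    (by simp) (by
      intro j hj
      refine ⟨inp[j], (inp.take j).reverse, by
        rw [Function.update_self, List.take_succ_eq_append_getElem hj, List.reverse_append,
          List.reverse_singleton, List.singleton_append], 1, le_rfl, ?_⟩
      refine Prog.exec_push_eq ?_
      funext k
      cases k with
      | inp => simp [enc]
      | _ => simp [enc])
  refine ⟨t1 + t2, by omega,
    Prog.Exec.seq (S' := Function.update (enc (Function.update ρ r inp.length)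
      [] a st) .tmp inp.reverse) ?_ ?_⟩
  · convert h1 using 1
    · simp only [Nat.sub_self, List.drop_zero, List.take_zero, List.reverse_nil]
      rw [← hr, Function.update_eq_self]
      funext k
      cases k <;> simp [enc]
    · simp
  · convert h2 using 1
    · simp
    · funext k
      cases k <;> simp [enc]

theorem exec_pushAll (w : List (O × CSym)) (ρ : R → ℕ) (inp : List CSym) (a : R → ℕ)
    (st : O → List CSym) :
    (pushAll w).Exec (enc ρ inp a st) (enc ρ inp a (push st w)) (w.length + 1) := by
  induction w generalizing st with
  | nil => simpa [push_nil, pushAll] using Prog.Exec.skip _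
  | cons p w ih =>
    rw [show p :: w = [p] ++ w from rfl, push_append, List.length_append, List.length_singleton,
      Nat.add_assoc]
    refine Prog.Exec.seq ?_ (ih _)
    rw [← enc_update_str]
    exact Prog.Exec.push _ _ _

/-- Reading the input to its end, writing what `f` prescribes for each symbol. -/
theorem exec_drain (f : CSym → List (O × CSym)) (T : ℕ) (hf : ∀ x, (f x).length ≤ T) (ρ : R → ℕ)
    (inp : List CSym) (a : R → ℕ) (st : O → List CSym) :
    ∃ t ≤ inp.length * (T + 2) + 1, (drain f).Exec (enc ρ inp a st)
      (enc ρ [] a (push st (inp.flatMap f))) t := by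
  obtain ⟨t, ht, h⟩ := Prog.exec_loop (.inp : Stk R O) (fun h => pushAll (f (h.getD none)))
    inp.length (T + 1) (fun j => enc ρ (inp.drop (inp.length - j)) a
      (push st ((inp.take (inp.length - j)).flatMap f))) (by simp [enc]) (by
      intro j hj
      have h3 : inp.length - j = inp.length - (j + 1) + 1 := by omega
      have hlt : inp.length - (j + 1) < inp.length := by omega
      refine ⟨inp[inp.length - (j + 1)], inp.drop (inp.length - j), ?_, _,
        Nat.succ_le_succ (hf inp[inp.length - (j + 1)]), ?_⟩
      · rw [enc, List.drop_eq_getElem_cons hlt, ← h3]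
      · rw [enc_update_inp]
        rw [h3, List.take_succ_eq_append_getElem hlt, List.flatMap_append, List.flatMap_singleton,
          push_append]
        exact exec_pushAll _ _ _ _ _)
  refine ⟨t, ht, ?_⟩
  simpa [push_nil, drain] using h

/-- Moving the streams to the output, one after the other, where each stream gets reversed. -/
theorem exec_collect (os : List O) (hos : os.Nodup) (ρ : R → ℕ) (a : R → ℕ)
    (st : O → List CSym) :
    ∃ t ≤ (os.map fun o => 2 * (st o).length + 2).sum + 1,
      (collect os).Exec (enc ρ [] a st)
        (Function.update (enc ρ [] a fun o => if o ∈ os then [] else st o) .out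
          (os.flatMap fun o => (st o).reverse)) t := by
  induction os with
  | nil =>
    refine ⟨1, by simp, ?_⟩
    have hst : Function.update (enc ρ [] a fun o => if o ∈ [] then [] else st o) .out
        (([] : List O).flatMap fun o => (st o).reverse) = enc ρ [] a st := by
      funext k
      cases k <;> simp [enc]
    rw [hst]
    exact Prog.Exec.skip _
  | cons o os ih =>
    obtain ⟨ho, hos⟩ := List.nodup_cons.1 hos
    obtain ⟨t1, ht1, h1⟩ := ih hos
    obtain ⟨t2, ht2, h2⟩ := Prog.exec_loop (.str o : Stk R O) (fun h => .push .out (h.getD none))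
      (st o).length 1 (fun j => Function.update (Function.update
        (enc ρ [] a fun o => if o ∈ os then [] else st o) .out
          (((st o).take ((st o).length - j)).reverse ++ os.flatMap fun o => (st o).reverse))
            (.str o)
          ((st o).drop ((st o).length - j))) (by simp) (by
      intro j hj
      have h3 : (st o).length - j = (st o).length - (j + 1) + 1 := by omega
      have hlt : (st o).length - (j + 1) < (st o).length := by omega
      have h4 : ((st o).take ((st o).length - j)).reverse = (st o)[(st o).length - (j + 1)] ::
          ((st o).take ((st o).length - (j + 1))).reverse := by
        rw [h3, List.take_succ_eq_append_getElem hlt, List.reverse_append, List.reverse_singleton,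
          List.singleton_append]
      refine ⟨(st o)[(st o).length - (j + 1)], (st o).drop ((st o).length - j), ?_, 1, le_rfl, ?_⟩
      · rw [Function.update_self, List.drop_eq_getElem_cons hlt, ← h3]
      · refine Prog.exec_push_eq ?_
        funext k
        cases k with
        | out => simp [h4]
        | str o' =>
          rcases eq_or_ne o' o with h | h
          · subst h; simp
          · simp [h]
        | _ => simp [enc])
    refine ⟨t1 + t2, by rw [List.map_cons, List.sum_cons]; omega, Prog.Exec.seq h1 ?_⟩
    convert h2 using 1
    · funext k
      cases k with
      | str o' =>
        rcases eq_or_ne o' o with h | h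
        · subst h; simp [enc, ho]
        · simp [h]
      | _ => simp [enc]
    · funext k
      cases k with
      | str o' =>
        rcases eq_or_ne o' o with h | h
        · subst h; simp [enc]
        · simp [h, enc]
      | _ => simp [enc]

/-- The trace of `Gen.run`, on the given input. -/
def runTrace (g : Gen R O) (r : R) (f : CSym → List (O × CSym)) (inp : List CSym) :
    List (O × CSym) :=
  let p := g.eval (Function.update (fun _ => 0) r inp.length) inp
  p.2 ++ p.1.flatMap f

theorem proj_length_le (o : O) (w : List (O × CSym)) : (proj o w).length ≤ w.length := by
  simpa [proj] using List.length_filter_le _ w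

theorem flatMap_length_le {α β : Type} (f : α → List β) (T : ℕ) (hf : ∀ x, (f x).length ≤ T)
    (l : List α) : (l.flatMap f).length ≤ l.length * T := by
  induction l with
  | nil => simp
  | cons x l ih =>
    have := hf x
    simp only [List.flatMap_cons, List.length_append, List.length_cons, Nat.succ_mul]
    omega

open Polynomial in
/-- `Gen.run` takes polynomial time. -/
theorem exec_run (g : Gen R O) (hg : g.Wf = true) (r : R) (hr : r ∉ g.bound)
    (f : CSym → List (O × CSym)) (os : List O) (hos : os.Nodup) (hmem : ∀ o, o ∈ os) :
    ∃ time : ℕ[X], ∀ inp : List CSym, ∃ t ≤ time.eval inp.length,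
      (run g r f os).Exec (Function.update (fun _ => []) .inp inp)
        (Function.update (fun _ => []) .out
          (os.flatMap fun o => proj o (runTrace g r f inp))) t := by
  obtain ⟨T, hT⟩ : ∃ T, ∀ x, (f x).length ≤ T :=
    ⟨(f none).length + (f (some true)).length + (f (some false)).length, by
      rintro (_ | _ | _) <;> omega⟩
  refine ⟨(5 * X + 2) + g.timeBound + (X * (C (T + 2)) + 1) +
    (C os.length * (2 * (g.timeBound + X * C T) + 2) + 1) + (X * 2 + 1), fun inp => ?_⟩
  have hinit : (Function.update (fun _ => []) .inp inp : Stk R O → List CSym) =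
      enc (fun _ => 0) inp (fun _ => 0) fun _ => [] := by
    funext k
    cases k <;> simp [enc]
  obtain ⟨t1, ht1, h1⟩ := exec_measure r (fun _ => 0) rfl inp (fun _ => 0) (fun _ : O => [])
  have hρ : ∀ r', Function.update (fun _ => 0) r inp.length r' ≤ inp.length :=
    update_le (fun _ => Nat.zero_le _) le_rfl
  obtain ⟨t2, ht2, h2⟩ := exec_compile g hg inp.length _ inp (fun _ => 0) (fun _ : O => []) hρ
    le_rfl
    (by
      intro j hj
      have : j ≠ r := fun h => hr (h ▸ hj)
      simp [this])
  have hlen := eval_length g (Function.update (fun _ => 0) r inp.length) inp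
  have htr := trace_length g inp.length _ hρ inp le_rfl
  obtain ⟨t3, ht3, h3⟩ := exec_drain f T hT (Function.update (fun _ => 0) r inp.length)
    (g.eval (Function.update (fun _ => 0) r inp.length) inp).1 (fun _ => 0)
    (push (fun _ => []) (g.eval (Function.update (fun _ => 0) r inp.length) inp).2)
  rw [← push_append] at h3
  obtain ⟨t4, ht4, h4⟩ := exec_collect os hos (Function.update (fun _ => 0) r inp.length)
    (fun _ => 0)
    (push (fun _ => []) (runTrace g r f inp))
  obtain ⟨t5, ht5, h5⟩ := Prog.exec_clear (.reg r : Stk R O)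
    (Function.update (enc (Function.update (fun _ => 0) r inp.length) [] (fun _ => 0) fun o =>
      if o ∈ os then [] else push (fun _ => []) (runTrace g r f inp) o) .out
          (os.flatMap fun o => (push (fun _ => []) (runTrace g r f inp) o).reverse))
  have htl : (runTrace g r f inp).length ≤ g.timeBound.eval inp.length + inp.length * T := by
    have := flatMap_length_le f T hT (g.eval (Function.update (fun _ => 0) r inp.length) inp).1
    have := Nat.mul_le_mul_right T hlen
    simp only [runTrace, List.length_append]
    omega
  have hsum : (os.map fun o => 2 * (push (fun _ => []) (runTrace g r f inp) o).length + 2).sum ≤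
      os.length * (2 * (g.timeBound.eval inp.length + inp.length * T) + 2) := by
    rw [← smul_eq_mul, ← List.length_map (as := os)
      (fun o => 2 * (push (fun _ => []) (runTrace g r f inp) o).length + 2)]
    refine List.sum_le_card_nsmul _ _ fun x hx => ?_
    obtain ⟨o, -, rfl⟩ := List.mem_map.1 hx
    have := proj_length_le o (runTrace g r f inp)
    simp only [push, List.append_nil, List.length_reverse]
    omega
  have hreg :
    (Function.update (enc (Function.update (fun _ => 0) r inp.length) [] (fun _ => 0) fun o =>
      if o ∈ os then [] else push (fun _ => []) (runTrace g r f inp) o) .out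
          (os.flatMap fun o => (push (fun _ => []) (runTrace g r f inp) o).reverse)
          (.reg r)).length = inp.length := by simp [enc]
  rw [hreg] at ht5
  refine ⟨t1 + (t2 + (t3 + (t4 + t5))), ?_, ?_⟩
  · have h3' := Nat.mul_le_mul_right (T + 2) hlen
    simp only [eval_add, eval_mul, eval_X, eval_ofNat, eval_C, eval_one]
    omega
  · rw [hinit]
    refine Prog.Exec.seq h1 (Prog.Exec.seq h2 (Prog.Exec.seq h3 (Prog.Exec.seq h4 ?_)))
    convert h5 using 1
    funext k
    cases k with
    | reg r' =>
      rcases eq_or_ne r' r with h | h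
      · subst h; simp
      · simp [h, enc]
    | _ => simp [enc, hmem, push]

end Gen

/-! ### Runs of pushdown automata, and words with the same projection -/

/-- `u` arises from `v` by deleting letters outside `Θ`. -/
def ThetaEmb {A : Type} [DecidableEq A] (Θ : Finset A) (u v : List A) : Prop :=
  u.Sublist v ∧ u.filter (· ∈ Θ) = v.filter (· ∈ Θ)

/-- The number of letters of `u` in `Θ`. -/
def thetaCount {A : Type} [DecidableEq A] (Θ : Finset A) (u : List A) : ℕ :=
  (u.filter (· ∈ Θ)).length

namespace ThetaEmb

variable {A : Type} [DecidableEq A] {Θ : Finset A}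

theorem refl (u : List A) : ThetaEmb Θ u u := ⟨List.Sublist.refl u, rfl⟩

theorem append {u u' v v' : List A} (h : ThetaEmb Θ u v) (h' : ThetaEmb Θ u' v') :
    ThetaEmb Θ (u ++ u') (v ++ v') :=
  ⟨h.1.append h'.1, by rw [List.filter_append, List.filter_append, h.2, h'.2]⟩

theorem of_free {u v : List A} (h : u.Sublist v) (hv : ∀ a ∈ v, a ∉ Θ) : ThetaEmb Θ u v :=
  ⟨h, by
    rw [List.filter_eq_nil_iff.2 (by simpa using fun a ha => hv a (h.subset ha)),
      List.filter_eq_nil_iff.2 (by simpa using hv)]⟩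

theorem nil_of_free {v : List A} (hv : ∀ a ∈ v, a ∉ Θ) : ThetaEmb Θ [] v :=
  of_free (List.nil_sublist v) hv

theorem count_eq {u v : List A} (h : ThetaEmb Θ u v) : thetaCount Θ u = thetaCount Θ v := by
  rw [thetaCount, thetaCount, h.2]

theorem split {u x y : List A} (h : ThetaEmb Θ u (x ++ y)) :
    ∃ u₁ u₂, u = u₁ ++ u₂ ∧ ThetaEmb Θ u₁ x ∧ ThetaEmb Θ u₂ y := by
  obtain ⟨u₁, u₂, rfl, h₁, h₂⟩ := List.sublist_append_iff.1 h.1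
  have h₃ := h₁.filter (· ∈ Θ)
  have h₄ := h₂.filter (· ∈ Θ)
  have h₅ := congrArg List.length h.2
  simp only [List.filter_append, List.length_append] at h₅
  have h₆ := h₃.length_le
  have h₇ := h₄.length_le
  exact ⟨u₁, u₂, rfl, ⟨h₁, h₃.eq_of_length (by omega)⟩, ⟨h₂, h₄.eq_of_length (by omega)⟩⟩

end ThetaEmb

theorem thetaCount_append {A : Type} [DecidableEq A] (Θ : Finset A) (u v : List A) :
    thetaCount Θ (u ++ v) = thetaCount Θ u + thetaCount Θ v := by
  simp [thetaCount]

theorem thetaCount_eq_zero {A : Type} [DecidableEq A] {Θ : Finset A} {u : List A} :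
    thetaCount Θ u = 0 ↔ ∀ a ∈ u, a ∉ Θ := by
  simp [thetaCount]

theorem StackOp.Apply.append {S : Type} {op : StackOp S} {w w' : List S} (h : op.Apply w w')
    (r : List S) : op.Apply (w ++ r) (w' ++ r) := by
  cases op <;> simp_all [StackOp.Apply]

namespace PDA

variable {Q A S : Type} {P : PDA Q A S}

theorem Run.trans {q q' q'' : Q} {w w' w'' : List S} {u v : List A} (h : P.Run q w u q' w')
    (h' : P.Run q' w' v q'' w'') : P.Run q w (u ++ v) q'' w'' := by
  induction h with
  | refl => exact h'
  | step he ho _ ih =>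
    rw [List.append_assoc]
    exact .step he ho (ih h')

theorem Run.lift {q q' : Q} {w w' : List S} {u : List A} (h : P.Run q w u q' w') (r : List S) :
    P.Run q (w ++ r) u q' (w' ++ r) := by
  induction h with
  | refl => exact .refl _ _
  | step he ho _ ih => exact .step he (ho.append r) ih

theorem Run.single {q q' : Q} {w w' : List S} {a : Option A} {op : StackOp S}
    (he : (q, a, op, q') ∈ P.edges) (ho : op.Apply w w') : P.Run q w a.toList q' w' := by
  simpa using Run.step he ho (Run.refl q' w')

end PDA

/-! ### The pumping machine -/

/-- The modes of the pumping machine. Outside of loops the mode is `N`. A loop at a bracket `(p, q)`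
first leads from `p` to `p` while pushing a word `w`, and then from `q` to `q` while popping `w`.
The first half keeps its letters in the modes `A1`, `A2`, the second half in the modes `B1`,
`B2`. -/
inductive Mode
  | N | A1 | A2 | B1 | B2

/-- In these modes, letters outside `Θ` may be read. -/
def Mode.reads : Mode → Bool
  | N => true
  | A1 => true
  | A2 => false
  | B1 => false
  | B2 => true

/-- An operation on the brackets of the pumping machine. It changes the mode from `src` to `dst`
and, if `(p, q)` is the bracket concerned, the current state from `p` or `q` (as `s` is `false` or
`true`) to `p` or `q` (by `t`). The bracket is present before and after the operation if `before`
and `after`, and it has to be on top of the stack if `atTop`. -/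
structure BracketOp where
  src : Mode
  dst : Mode
  atTop : Bool
  s : Bool
  t : Bool
  before : Bool
  after : Bool

/-- The bracket operations: open and close a bracket; start, turn around and end a loop that keeps
the letters of its first half; start, turn around and end a loop that keeps the letters of its
second half. -/
def bracketOp : Fin 8 → BracketOp := ![
  ⟨.N, .N, true, false, false, false, true⟩,
  ⟨.N, .N, true, true, true, true, false⟩,
  ⟨.N, .A1, true, false, false, true, true⟩,
  ⟨.A1, .A2, false, false, true, true, true⟩,
  ⟨.A2, .N, true, true, false, true, true⟩,
  ⟨.N, .B1, true, true, false, true, true⟩,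
  ⟨.B1, .B2, false, false, true, true, true⟩,
  ⟨.B2, .N, true, true, true, true, true⟩]

/-- The first or the second argument. -/
def pick {α : Type} (b : Bool) (p q : α) : α := if b then q else p

/-- A configuration of the pumping machine: the mode, a letter that has been chosen but not yet
consumed by the PDA, the number of letters of `Θ` that may still be read, the state of the PDA, the
stack with brackets (`none`), and the states `p, q` of the brackets from the top down. -/
@[ext]
structure Conf (Q A S : Type) where
  mode : Mode
  pend : Option A
  cnt : ℕ
  cur : Q
  ctrl : List (Option S)
  brs : List Q

/-- The operation on stacks with brackets. -/
def StackOp.lift {S : Type} : StackOp S → StackOp (Option S)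
  | .skip => .skip
  | .push x => .push (some x)
  | .pop x => .pop (some x)

variable {Q A S : Type}

/-- The steps of the pumping machine of the PDA `P`; the label is the letter read. -/
inductive PumpStep [DecidableEq A] (P : PDA Q A S) (Θ : Finset A) :
    Option A → Conf Q A S → Conf Q A S → Prop
  | readTheta {a : A} {k : ℕ} {q : Q} {c : List (Option S)} {b : List Q} (ha : a ∈ Θ) :
      PumpStep P Θ (some a) ⟨.N, none, k + 1, q, c, b⟩ ⟨.N, some a, k, q, c, b⟩
  | read {a : A} {m : Mode} {k : ℕ} {q : Q} {c : List (Option S)} {b : List Q} (ha : a ∉ Θ)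
      (hm : m.reads = true) : PumpStep P Θ (some a) ⟨m, none, k, q, c, b⟩ ⟨m, some a, k, q, c, b⟩
  | drop {a : A} {m : Mode} {k : ℕ} {q : Q} {c : List (Option S)} {b : List Q} (ha : a ∉ Θ) :
      PumpStep P Θ none ⟨m, none, k, q, c, b⟩ ⟨m, some a, k, q, c, b⟩
  | move {a : Option A} {op : StackOp S} {m : Mode} {k : ℕ} {q q' : Q} {c c' : List (Option S)}
      {b : List Q} (he : (q, a, op, q') ∈ P.edges) (ho : op.lift.Apply c c') :
      PumpStep P Θ none ⟨m, a, k, q, c, b⟩ ⟨m, none, k, q', c', b⟩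
  | forget {k : ℕ} {q : Q} {c : List (Option S)} {b : List Q} :
      PumpStep P Θ none ⟨.N, none, k, q, c, b⟩ ⟨.N, none, k, q, [], []⟩
  | bracket (r : Fin 8) (p q : Q) {k : ℕ} {c : List (Option S)} {b : List Q} :
      PumpStep P Θ none
        ⟨(bracketOp r).src, none, k, pick (bracketOp r).s p q,
          if (bracketOp r).atTop && (bracketOp r).before then none :: c else c,
          if (bracketOp r).before then p :: q :: b else b⟩
        ⟨(bracketOp r).dst, none, k, pick (bracketOp r).t p q,
          if (bracketOp r).atTop && (bracketOp r).after then none :: c else c,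
          if (bracketOp r).after then p :: q :: b else b⟩

/-! ### Soundness of the pumping machine -/

namespace Pump

variable [DecidableEq A] (P : PDA Q A S) (Θ : Finset A)

/-- The meaning of a configuration with stack `w` above the stack `c` with brackets `b`, in mode
`N`, after reading `u`: the PDA has a run on a word that embeds `u`. For a bracket `(p, p')`, the
loops executed at its beginning have pushed a word `w₁`, which can be popped by a run from `p'` to
`p'` on letters outside `Θ`. -/
def Inv : List (Option S) → List Q → List S → Q → List A → Prop
  | [], _, w, q, u => ∃ v r, P.Run P.start P.startStack v q (w ++ r) ∧ ThetaEmb Θ u v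
  | some x :: c, b, w, q, u => Inv c b (w ++ [x]) q u
  | none :: c, p :: p' :: b, w, q, u => ∃ u₁ u₂ z w₁ y, u = u₁ ++ u₂ ∧ Inv c b [] p u₁ ∧
      P.Run p [] z q (w ++ w₁) ∧ ThetaEmb Θ u₂ z ∧ P.Run p' w₁ y p' [] ∧ ∀ a ∈ y, a ∉ Θ
  | none :: _, _, _, _, _ => False

variable {P Θ}

/-- The invariant is kept by runs above the topmost bracket. -/
theorem Inv.extend {c : List (Option S)} {b : List Q} {w w' : List S} {q q' : Q} {u u' v : List A}
    (h : Inv P Θ c b w q u) (hr : P.Run q w v q' w') (he : ThetaEmb Θ u' v) :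
    Inv P Θ c b w' q' (u ++ u') := by
  induction c generalizing b w w' with
  | nil =>
    obtain ⟨v₀, r, h₁, h₂⟩ := h
    exact ⟨_, r, h₁.trans (hr.lift r), h₂.append he⟩
  | cons x c ih =>
    cases x with
    | some x => exact ih (b := b) (w := w ++ [x]) (w' := w' ++ [x]) h (hr.lift [x])
    | none =>
      match b, h with
      | p :: p' :: b, ⟨u₁, u₂, z, w₁, y, h₁, h₂, h₃, h₄, h₅⟩ =>
        exact ⟨u₁, u₂ ++ u', z ++ v, w₁, y, by rw [h₁, List.append_assoc], h₂,
          h₃.trans (hr.lift w₁), h₄.append he, h₅⟩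

/-- A configuration that satisfies the invariant belongs to a run of the PDA. As the PDA accepts
with arbitrary stack, the letters pushed by loops at open brackets may stay on the stack. -/
theorem Inv.exists_run {c : List (Option S)} {b : List Q} {w : List S} {q : Q} {u : List A}
    (h : Inv P Θ c b w q u) :
    ∃ v r, P.Run P.start P.startStack v q (w ++ r) ∧ ThetaEmb Θ u v := by
  induction c generalizing b w q u with
  | nil => exact h
  | cons x c ih =>
    cases x with
    | some x =>
      obtain ⟨v, r, h₁, h₂⟩ := ih (b := b) (w := w ++ [x]) h
      exact ⟨v, x :: r, by simpa using h₁, h₂⟩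
    | none =>
      match b, h with
      | p :: p' :: b, ⟨u₁, u₂, z, w₁, y, h₁, h₂, h₃, h₄, h₅⟩ =>
        obtain ⟨v, r, h₆, h₇⟩ := ih h₂
        refine ⟨v ++ z, w₁ ++ r, h₆.trans ?_, h₁ ▸ h₇.append h₄⟩
        simpa using h₃.lift r

theorem inv_map_some (l : List S) (c : List (Option S)) (b : List Q) (w : List S) (q : Q)
    (u : List A) : Inv P Θ (l.map some ++ c) b w q u ↔ Inv P Θ c b (w ++ l) q u := by
  induction l generalizing w with
  | nil => simp
  | cons x l ih => simpa [Inv] using ih (w ++ [x])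

variable (P Θ)

/-- The meaning of a configuration in the given mode, without a pending letter. Inside a loop, the
part of the stack above the top bracket is a word `w` without brackets, and the loop executed so far
is a run from `p` (and, after turning around, one from `p'`). -/
def ModeInv : Mode → List (Option S) → List Q → Q → List A → Prop
  | .N, c, b, q, u => Inv P Θ c b [] q u
  | .A1, c, b, q, u => ∃ w c' p p' b' u₀ u₁ v, c = w.map some ++ none :: c' ∧ b = p :: p' :: b' ∧
      u = u₀ ++ u₁ ∧ Inv P Θ (none :: c') b [] p u₀ ∧ P.Run p [] v q w ∧ ThetaEmb Θ u₁ v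
  | .A2, c, b, q, u => ∃ w c' p p' b' u₀ u₁ v w₁ v', c = w.map some ++ none :: c' ∧
      b = p :: p' :: b' ∧ u = u₀ ++ u₁ ∧ Inv P Θ (none :: c') b [] p u₀ ∧ P.Run p [] v p w₁ ∧
      ThetaEmb Θ u₁ v ∧ P.Run p' w₁ v' q w ∧ ∀ a ∈ v', a ∉ Θ
  | .B1, c, b, q, u => ∃ w c' p p' b' v, c = w.map some ++ none :: c' ∧ b = p :: p' :: b' ∧
      Inv P Θ (none :: c') b [] p' u ∧ P.Run p [] v q w ∧ ∀ a ∈ v, a ∉ Θ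
  | .B2, c, b, q, u => ∃ w c' p p' b' u₀ u₁ v w₁ v', c = w.map some ++ none :: c' ∧
      b = p :: p' :: b' ∧ u = u₀ ++ u₁ ∧ Inv P Θ (none :: c') b [] p' u₀ ∧ P.Run p [] v p w₁ ∧
      (∀ a ∈ v, a ∉ Θ) ∧ P.Run p' w₁ v' q w ∧ ThetaEmb Θ u₁ v'

variable {P Θ}

theorem apply_lift_append {op : StackOp S} {w : List S} {c d : List (Option S)}
    (h : op.lift.Apply (w.map some ++ none :: c) d) :
    ∃ w', d = w'.map some ++ none :: c ∧ op.Apply w w' := by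
  cases op with
  | skip => exact ⟨w, h, rfl⟩
  | push x => exact ⟨x :: w, h, rfl⟩
  | pop x =>
    cases w with
    | nil => simp [StackOp.lift, StackOp.Apply] at h
    | cons y w =>
      simp only [StackOp.lift, StackOp.Apply, List.map_cons, List.cons_append, List.cons.injEq,
        Option.some.injEq] at h
      exact ⟨w, h.2.symm, by rw [h.1]; rfl⟩

/-- The invariant is kept by an edge of the PDA, of whose letter `u'` is kept. -/
theorem ModeInv.move {m : Mode} {c c' : List (Option S)} {b : List Q} {q q' : Q} {u u' : List A}
    {a : Option A} {op : StackOp S} (h : ModeInv P Θ m c b q u) (he : (q, a, op, q') ∈ P.edges)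
    (ho : op.lift.Apply c c') (hu : ThetaEmb Θ u' a.toList)
    (hm : m = .N ∨ (∀ x ∈ a.toList, x ∉ Θ) ∧ (u' = [] ∨ m.reads = true)) :
    ModeInv P Θ m c' b q' (u ++ u') := by
  cases m with
  | N =>
    cases op with
    | skip =>
      obtain rfl : c' = c := ho
      exact Inv.extend h (.single he rfl) hu
    | push x =>
      obtain rfl : c' = some x :: c := ho
      exact Inv.extend (w := []) (w' := [x]) h (.single he rfl) hu
    | pop x =>
      obtain rfl : c = some x :: c' := ho
      exact Inv.extend (w := [x]) (w' := []) h (.single he rfl) hu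
  | A1 =>
    obtain ⟨w, c₁, p, p', b', u₀, u₁, v, rfl, h₂, h₃, h₄, h₅, h₆⟩ := h
    obtain ⟨w', rfl, hw⟩ := apply_lift_append ho
    exact ⟨w', c₁, p, p', b', u₀, u₁ ++ u', v ++ a.toList, rfl, h₂, by rw [h₃, List.append_assoc],
      h₄, h₅.trans (.single he hw), h₆.append hu⟩
  | A2 =>
    obtain ⟨w, c₁, p, p', b', u₀, u₁, v, w₁, v', rfl, h₂, h₃, h₄, h₅, h₆, h₇, h₈⟩ := h
    obtain ⟨w', rfl, hw⟩ := apply_lift_append ho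
    obtain ⟨ha, rfl⟩ : (∀ x ∈ a.toList, x ∉ Θ) ∧ u' = [] := by simpa [Mode.reads] using hm
    refine ⟨w', c₁, p, p', b', u₀, u₁, v, w₁, v' ++ a.toList, rfl,
      h₂, by simpa using h₃, h₄, h₅, h₆,
      h₇.trans (.single he hw), fun x hx => ?_⟩
    rcases List.mem_append.1 hx with hx | hx
    exacts [h₈ x hx, ha x hx]
  | B1 =>
    obtain ⟨w, c₁, p, p', b', v, rfl, h₂, h₃, h₄, h₅⟩ := h
    obtain ⟨w', rfl, hw⟩ := apply_lift_append ho
    obtain ⟨ha, rfl⟩ : (∀ x ∈ a.toList, x ∉ Θ) ∧ u' = [] := by simpa [Mode.reads] using hm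
    refine ⟨w', c₁, p, p', b', v ++ a.toList, rfl, h₂, by simpa using h₃,
      h₄.trans (.single he hw), fun x hx => ?_⟩
    rcases List.mem_append.1 hx with hx | hx
    exacts [h₅ x hx, ha x hx]
  | B2 =>
    obtain ⟨w, c₁, p, p', b', u₀, u₁, v, w₁, v', rfl, h₂, h₃, h₄, h₅, h₆, h₇, h₈⟩ := h
    obtain ⟨w', rfl, hw⟩ := apply_lift_append ho
    exact ⟨w', c₁, p, p', b', u₀, u₁ ++ u', v, w₁, v' ++ a.toList, rfl, h₂,
      by rw [h₃, List.append_assoc], h₄, h₅, h₆, h₇.trans (.single he hw), h₈.append hu⟩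

theorem eq_nil_of_map_some {w : List S} {c c' : List (Option S)}
    (h : none :: c = w.map some ++ none :: c') : w = [] ∧ c = c' := by
  cases w <;> simp_all

/-- The invariant is kept by the operations on brackets. Where a bracket is removed, the promised
run from `p'` to `p'` pops the letters pushed by the loops. After a loop at the beginning, its first
half joins the run above the bracket, and its second half joins the promised run. Before a loop at
the end, all pending second halves are executed, so that the whole loop joins the run above the
bracket, and nothing is left to be popped. -/
theorem ModeInv.bracket (r : Fin 8) {p q : Q} {c : List (Option S)} {b : List Q} {u : List A}
    (h : ModeInv P Θ (bracketOp r).src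
      (if (bracketOp r).atTop && (bracketOp r).before then none :: c else c)
      (if (bracketOp r).before then p :: q :: b else b) (pick (bracketOp r).s p q) u) :
    ModeInv P Θ (bracketOp r).dst
      (if (bracketOp r).atTop && (bracketOp r).after then none :: c else c)
      (if (bracketOp r).after then p :: q :: b else b) (pick (bracketOp r).t p q) u := by
  fin_cases r
  · exact ⟨u, [], [], [], [], by simp, h, .refl _ _, .refl _, .refl _ _, by simp⟩
  · obtain ⟨u₁, u₂, z, w₁, y, rfl, h₂, h₃, h₄, h₅, h₆⟩ := h
    exact Inv.extend h₂ (h₃.trans h₅) (by simpa using h₄.append (.nil_of_free h₆))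
  · exact ⟨[], c, p, q, b, u, [], [], rfl, rfl, by simp, h, .refl _ _, .refl _⟩
  · obtain ⟨w, c', p₁, p', b', u₀, u₁, v, h₁, h₂, h₃, h₄, h₅, h₆⟩ := h
    obtain ⟨rfl, rfl, rfl⟩ : p = p₁ ∧ q = p' ∧ b = b' := by simpa [bracketOp] using h₂
    exact ⟨w, c', p, q, b, u₀, u₁, v, w, [], h₁, rfl, h₃, h₄, h₅, h₆, .refl _ _, by simp⟩
  · obtain ⟨w, c', p₁, p', b', u₀, u₁, v, w₁, v', h₁, h₂, rfl, h₄, h₅, h₆, h₇, h₈⟩ := h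
    obtain ⟨rfl, rfl, rfl⟩ : p = p₁ ∧ q = p' ∧ b = b' := by simpa [bracketOp] using h₂
    obtain ⟨rfl, rfl⟩ := eq_nil_of_map_some h₁
    obtain ⟨u₂, u₃, z, w₂, y, rfl, k₂, k₃, k₄, k₅, k₆⟩ := h₄
    refine ⟨u₂, u₃ ++ u₁, z ++ v, w₁ ++ w₂, v' ++ y, by simp, k₂, k₃.trans (h₅.lift w₂),
      k₄.append h₆, (h₇.lift w₂).trans k₅, fun a ha => ?_⟩
    rcases List.mem_append.1 ha with ha | ha
    exacts [h₈ a ha, k₆ a ha]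
  · exact ⟨[], c, p, q, b, [], rfl, rfl, h, .refl _ _, by simp⟩
  · obtain ⟨w, c', p₁, p', b', v, h₁, h₂, h₃, h₄, h₅⟩ := h
    obtain ⟨rfl, rfl, rfl⟩ : p = p₁ ∧ q = p' ∧ b = b' := by simpa [bracketOp] using h₂
    exact ⟨w, c', p, q, b, u, [], v, w, [], h₁, rfl, by simp, h₃, h₄, h₅, .refl _ _, .refl _⟩
  · obtain ⟨w, c', p₁, p', b', u₀, u₁, v, w₁, v', h₁, h₂, rfl, h₄, h₅, h₆, h₇, h₈⟩ := h
    obtain ⟨rfl, rfl, rfl⟩ : p = p₁ ∧ q = p' ∧ b = b' := by simpa [bracketOp] using h₂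
    obtain ⟨rfl, rfl⟩ := eq_nil_of_map_some h₁
    obtain ⟨u₂, u₃, z, w₂, y, rfl, k₂, k₃, k₄, k₅, k₆⟩ := h₄
    refine ⟨u₂, u₃ ++ u₁, v ++ (z ++ (y ++ v')), [], [], by simp, k₂, ?_, ?_, .refl _ _, by simp⟩
    · exact h₅.trans ((k₃.lift w₁).trans ((k₅.lift w₁).trans h₇))
    · exact (ThetaEmb.nil_of_free h₆).append (k₄.append ((ThetaEmb.nil_of_free k₆).append h₈))

variable (P Θ)

/-- The invariant of the pumping machine started with the counter `K`, after reading `u`. A pending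
letter is the last letter of `u`, or it has been dropped and lies outside `Θ`. -/
def Sound (K : ℕ) (C : Conf Q A S) (u : List A) : Prop :=
  C.cnt + thetaCount Θ u = K ∧
    match C.pend with
    | none => ModeInv P Θ C.mode C.ctrl C.brs C.cur u
    | some a => (a ∉ Θ ∧ ModeInv P Θ C.mode C.ctrl C.brs C.cur u) ∨
        ∃ u₀, u = u₀ ++ [a] ∧ ModeInv P Θ C.mode C.ctrl C.brs C.cur u₀ ∧
          (C.mode = .N ∨ a ∉ Θ ∧ C.mode.reads = true)

variable {P Θ}

/-- The steps of the pumping machine keep the invariant. -/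
theorem Sound.step {K : ℕ} {C C' : Conf Q A S} {u : List A} {a : Option A} (h : Sound P Θ K C u)
    (hs : PumpStep P Θ a C C') : Sound P Θ K C' (u ++ a.toList) := by
  obtain ⟨h₁, h₂⟩ := h
  cases hs with
  | readTheta ha =>
    refine ⟨?_, .inr ⟨u, rfl, h₂, .inl rfl⟩⟩
    rw [thetaCount_append, ← h₁]
    simp [thetaCount, ha]
    omega
  | read ha hm =>
    refine ⟨?_, .inr ⟨u, rfl, h₂, .inr ⟨ha, hm⟩⟩⟩
    rw [thetaCount_append, ← h₁]
    simp [thetaCount, ha]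
  | drop ha => exact ⟨by simpa using h₁, .inl ⟨ha, by simpa using h₂⟩⟩
  | @move a op m k q q' c c' b he ho =>
    refine ⟨by simpa using h₁, ?_⟩
    simp only [Option.toList_none, List.append_nil]
    cases a with
    | none =>
      have := ModeInv.move (u' := []) h₂ he ho (.refl _) (.inr ⟨by simp, .inl rfl⟩)
      simpa using this
    | some a =>
      rcases h₂ with ⟨ha, h₂⟩ | ⟨u₀, rfl, h₂, h₃⟩
      · have := ModeInv.move (u' := []) h₂ he ho (.nil_of_free (by simpa using ha))
          (.inr ⟨by simpa using ha, .inl rfl⟩)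
        simpa using this
      · refine ModeInv.move (u' := [a]) h₂ he ho (.refl _) ?_
        rcases h₃ with h₃ | ⟨h₃, h₄⟩
        exacts [.inl h₃, .inr ⟨by simpa using h₃, .inr h₄⟩]
  | forget =>
    refine ⟨by simpa using h₁, ?_⟩
    obtain ⟨v, r, h₃, h₄⟩ := Inv.exists_run (w := []) h₂
    exact ⟨v, r, h₃, by simpa using h₄⟩
  | bracket r p q => exact ⟨by simpa using h₁, by simpa using ModeInv.bracket r h₂⟩

/-- The initial configuration satisfies the invariant. -/
theorem sound_start (K : ℕ) :
    Sound P Θ K ⟨.N, none, K, P.start, P.startStack.map some, []⟩ [] := by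
  refine ⟨by simp [thetaCount], ?_⟩
  have := (inv_map_some (P := P) (Θ := Θ) P.startStack [] [] [] P.start []).2
    ⟨[], [], by simpa using PDA.Run.refl _ _, .refl _⟩
  simpa [ModeInv] using this

/-- What the pumping machine accepts is in the downward closure. -/
theorem Sound.mem_downClosure {K k : ℕ} {q : Q} {c : List (Option S)} {b : List Q} {u : List A}
    (h : Sound P Θ K ⟨.N, none, k, q, c, b⟩ u) (hq : q ∈ P.final) :
    u ∈ preservingDownClosure Θ K P.language := by
  obtain ⟨h₁, h₂⟩ := h
  obtain ⟨v, r, h₃, h₄⟩ := Inv.exists_run (w := []) h₂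
  refine ⟨v, ⟨q, hq, _, h₃⟩, h₄.1, h₄.2, ?_⟩
  have := h₄.count_eq
  simp only [thetaCount] at *
  omega

/-- The invariant on the numbers of brackets. -/
def Balanced (C : Conf Q A S) : Prop :=
  C.brs.length = 2 * C.ctrl.countP Option.isNone ∧ (C.mode ≠ .N → C.brs ≠ [])

theorem countP_of_apply_lift {op : StackOp S} {c c' : List (Option S)} (h : op.lift.Apply c c') :
    c'.countP Option.isNone = c.countP Option.isNone := by
  cases op <;> simp [StackOp.lift, StackOp.Apply] at h <;> subst h <;> simp

theorem Balanced.step {P : PDA Q A S} {Θ : Finset A} {a : Option A} {C C' : Conf Q A S}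
    (h : Balanced C) (hs : PumpStep P Θ a C C') : Balanced C' := by
  obtain ⟨h₁, h₂⟩ := h
  cases hs with
  | readTheta => exact ⟨h₁, h₂⟩
  | read => exact ⟨h₁, h₂⟩
  | drop => exact ⟨h₁, h₂⟩
  | move he ho => exact ⟨by simpa [countP_of_apply_lift ho] using h₁, h₂⟩
  | forget => exact ⟨rfl, fun h => absurd rfl h⟩
  | bracket r p q =>
    fin_cases r <;> simp_all [bracketOp, Balanced] <;> omega

end Pump

/-! ### Fixed points on finite types -/

/-- The iterates of a monotone operator on the subsets of `T` are constant from the number of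
elements of `T` on. -/
theorem map_iterate_card_subset {T : Type} [Finite T] {F : Set T → Set T} (hF : Monotone F) :
    F (F^[Nat.card T] ∅) ⊆ F^[Nat.card T] ∅ := by
  have hmono : Monotone fun n => F^[n] (∅ : Set T) :=
    hF.monotone_iterate_of_le_map (Set.empty_subset _)
  have hsucc : ∀ n, F^[n + 1] (∅ : Set T) = F (F^[n] ∅) := fun n =>
    Function.iterate_succ_apply' F n ∅
  have hgrow : ∀ i, (∃ j < i, F (F^[j] (∅ : Set T)) = F^[j] ∅) ∨ i ≤ (F^[i] (∅ : Set T)).ncard := by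
    intro i
    induction i with
    | zero => exact .inr (Nat.zero_le _)
    | succ i ih =>
      rcases ih with ⟨j, hj, h⟩ | ih
      · exact .inl ⟨j, by omega, h⟩
      · rcases eq_or_ne (F (F^[i] (∅ : Set T))) (F^[i] ∅) with h | h
        · exact .inl ⟨i, by omega, h⟩
        · refine .inr (ih.trans_lt (Set.ncard_lt_ncard ?_ (Set.toFinite _)))
          exact (hmono (Nat.le_succ i)).lt_of_ne fun h' => h ((hsucc i).symm.trans h'.symm)
  obtain ⟨j, hj, h⟩ : ∃ j ≤ Nat.card T, F (F^[j] (∅ : Set T)) = F^[j] ∅ := by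
    rcases hgrow (Nat.card T + 1) with ⟨j, hj, h⟩ | h
    · exact ⟨j, by omega, h⟩
    · exact absurd (h.trans (Set.ncard_le_card _)) (by omega)
  have hconst : ∀ n, F^[j + n] (∅ : Set T) = F^[j] ∅ := by
    intro n
    induction n with
    | zero => rfl
    | succ n ih => rw [← Nat.add_assoc, hsucc, ih, h]
  obtain ⟨n, hn⟩ := Nat.exists_eq_add_of_le hj
  rw [hn, hconst, h]

/-! ### Paths of the pumping machine with a bounded stack -/

section
variable {Q A S : Type} [DecidableEq A]

/-- `PumpPath P Θ H C u C'`: the pumping machine leads from `C` to `C'` while reading `u`, and all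
stacks after the first configuration have at most `H` letters. -/
inductive PumpPath (P : PDA Q A S) (Θ : Finset A) (H : ℕ) :
    Conf Q A S → List A → Conf Q A S → Prop
  | refl (C : Conf Q A S) : PumpPath P Θ H C [] C
  | step {a : Option A} {C C' C'' : Conf Q A S} {u : List A} :
      PumpStep P Θ a C C' → C'.ctrl.length ≤ H → PumpPath P Θ H C' u C'' →
        PumpPath P Θ H C (a.toList ++ u) C''

namespace PumpPath

variable {P : PDA Q A S} {Θ : Finset A} {H : ℕ}

theorem trans {C C' C'' : Conf Q A S} {u v : List A} (h : PumpPath P Θ H C u C')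
    (h' : PumpPath P Θ H C' v C'') : PumpPath P Θ H C (u ++ v) C'' := by
  induction h with
  | refl => exact h'
  | step hs hl _ ih =>
    rw [List.append_assoc]
    exact .step hs hl (ih h')

/-- A silent step in front of a path. -/
theorem silent {C C' C'' : Conf Q A S} {u : List A} (hs : PumpStep P Θ none C C')
    (hl : C'.ctrl.length ≤ H) (h : PumpPath P Θ H C' u C'') : PumpPath P Θ H C u C'' :=
  step hs hl h

/-- The pumping machine can follow an edge of the PDA: the letter of the edge is read if it is kept,
or dropped if it is deleted, and then consumed by the PDA. -/
theorem edge {q q' : Q} {a : Option A} {op : StackOp S} {u : List A} {m : Mode} {k : ℕ}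
    {c c' : List (Option S)} {b : List Q} (he : (q, a, op, q') ∈ P.edges)
    (ho : op.lift.Apply c c') (hu : ThetaEmb Θ u a.toList)
    (hm : m = .N ∨ (∀ x ∈ a.toList, x ∉ Θ) ∧ (u = [] ∨ m.reads = true))
    (hc : c.length ≤ H) (hc' : c'.length ≤ H) :
    PumpPath P Θ H ⟨m, none, k + thetaCount Θ u, q, c, b⟩ u ⟨m, none, k, q', c', b⟩ := by
  have hlast : ∀ k, PumpPath P Θ H ⟨m, a, k, q, c, b⟩ [] ⟨m, none, k, q', c', b⟩ := fun k =>
    silent (.move he ho) hc' (.refl _)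
  cases a with
  | none =>
    obtain rfl : u = [] := List.sublist_nil.1 hu.1
    exact hlast k
  | some x =>
    by_cases hx : x ∈ Θ
    · obtain rfl : m = .N := by
        rcases hm with hm | hm
        exacts [hm, absurd hx (hm.1 x (by simp))]
      have h1 := hu.count_eq
      have h2 : thetaCount Θ (some x).toList = 1 := by simp [thetaCount, hx]
      have h3 : u = [x] := by
        refine hu.1.eq_of_length_le ?_
        have : thetaCount Θ u ≤ u.length := List.length_filter_le _ _
        simp only [Option.toList_some, List.length_singleton]
        omega
      rw [h1, h2, h3]
      exact step (a := some x) (.readTheta hx) hc (hlast k)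
    · have h0 : thetaCount Θ u = 0 := by
        rw [hu.count_eq]
        simp [thetaCount, hx]
      rw [h0]
      rcases List.sublist_singleton.1 hu.1 with rfl | rfl
      · exact silent (.drop hx) hc (hlast k)
      · have hr : m.reads = true := by
          rcases hm with rfl | hm
          · rfl
          · simpa using hm.2
        exact step (a := some x) (.read hx hr) hc (hlast k)

/-- Open a bracket, execute loops at its beginning, a path in between, and loops at its end. -/
theorem bracket {p q : Q} {k k' : ℕ} {c : List (Option S)} {b : List Q} {u : List A}
    (hc : c.length + 1 ≤ H)
    (h : PumpPath P Θ H ⟨.N, none, k, p, none :: c, p :: q :: b⟩ u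
      ⟨.N, none, k', q, none :: c, p :: q :: b⟩) :
    PumpPath P Θ H ⟨.N, none, k, p, c, b⟩ u ⟨.N, none, k', q, c, b⟩ := by
  refine silent (.bracket 0 p q) hc ?_
  rw [← List.append_nil u]
  exact h.trans (silent (.bracket 1 p q) (show c.length ≤ H by omega) (.refl _))

/-- A loop of which the first half keeps letters; the stack built up by the first half is `w`. -/
theorem loopA {p q : Q} {k : ℕ} {c : List (Option S)} {b : List Q} {u : List A} {w : List S}
    (hc : w.length + c.length + 1 ≤ H)
    (h₁ : PumpPath P Θ H ⟨.A1, none, k, p, none :: c, p :: q :: b⟩ u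
      ⟨.A1, none, k, p, w.map some ++ none :: c, p :: q :: b⟩)
    (h₂ : PumpPath P Θ H ⟨.A2, none, k, q, w.map some ++ none :: c, p :: q :: b⟩ []
      ⟨.A2, none, k, q, none :: c, p :: q :: b⟩) :
    PumpPath P Θ H ⟨.N, none, k, p, none :: c, p :: q :: b⟩ u
      ⟨.N, none, k, p, none :: c, p :: q :: b⟩ := by
  refine silent (.bracket 2 p q) (show c.length + 1 ≤ H by omega) ?_
  rw [← List.append_nil u, ← List.append_nil []]
  have hl : (w.map some ++ none :: c).length ≤ H := by simp; omega
  exact h₁.trans (silent (.bracket 3 p q) hl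
    (h₂.trans (silent (.bracket 4 p q) (show c.length + 1 ≤ H by omega) (.refl _))))

/-- A loop of which the second half keeps letters; the stack built up by the first half is `w`. -/
theorem loopB {p q : Q} {k : ℕ} {c : List (Option S)} {b : List Q} {u : List A} {w : List S}
    (hc : w.length + c.length + 1 ≤ H)
    (h₁ : PumpPath P Θ H ⟨.B1, none, k, p, none :: c, p :: q :: b⟩ []
      ⟨.B1, none, k, p, w.map some ++ none :: c, p :: q :: b⟩)
    (h₂ : PumpPath P Θ H ⟨.B2, none, k, q, w.map some ++ none :: c, p :: q :: b⟩ u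
      ⟨.B2, none, k, q, none :: c, p :: q :: b⟩) :
    PumpPath P Θ H ⟨.N, none, k, q, none :: c, p :: q :: b⟩ u
      ⟨.N, none, k, q, none :: c, p :: q :: b⟩ := by
  refine silent (.bracket 5 p q) (show c.length + 1 ≤ H by omega) ?_
  rw [← List.nil_append u, ← List.append_nil u]
  have hl : (w.map some ++ none :: c).length ≤ H := by simp; omega
  exact h₁.trans (silent (.bracket 6 p q) hl
    (h₂.trans (silent (.bracket 7 p q) (show c.length + 1 ≤ H by omega) (.refl _))))

end PumpPath

/-! ### Level runs and contexts -/

/-- Level runs: runs of `P` from the empty stack to the empty stack. A frame `(r, r')` is a level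
run from `r` to `r'` between a push and the matching pop; frames on words with exactly `k` letters
of `Θ` have to avoid the set `V`. -/
inductive LevelRun (P : PDA Q A S) (Θ : Finset A) (k : ℕ) (V : Set (Q × Q)) :
    Q → List A → Q → Prop
  | nil (p : Q) : LevelRun P Θ k V p [] p
  | skip {p p' q : Q} {a : Option A} {u : List A} (he : (p, a, .skip, p') ∈ P.edges)
      (h : LevelRun P Θ k V p' u q) : LevelRun P Θ k V p (a.toList ++ u) q
  | call {p r r' p' q : Q} {a a' : Option A} {x : S} {u v : List A}
      (he : (p, a, .push x, r) ∈ P.edges) (h : LevelRun P Θ k V r u r')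
      (hV : thetaCount Θ u = k → (r, r') ∉ V) (he' : (r', a', .pop x, p') ∈ P.edges)
      (h' : LevelRun P Θ k V p' v q) :
      LevelRun P Θ k V p (a.toList ++ (u ++ (a'.toList ++ v))) q

/-- Contexts: a run from `(p, [])` to `(r, w)` on `x`, together with a run from `(r', w)` to `(q,
[])` on `y`, where `w` is the stack built up by the first run. -/
inductive LevelContext (P : PDA Q A S) (Θ : Finset A) :
    Q → List A → Q → Q → List A → Q → Prop
  | hole {p r r' q : Q} {x y : List A} (h : LevelRun P Θ 0 ∅ p x r) (h' : LevelRun P Θ 0 ∅ r' y q) :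
      LevelContext P Θ p x r r' y q
  | down {p p₁ p₂ r r' q₂ q₁ q : Q} {a a' : Option A} {γ : S} {x₁ x₂ y₁ y₂ : List A}
      (h : LevelRun P Θ 0 ∅ p x₁ p₁) (he : (p₁, a, .push γ, p₂) ∈ P.edges)
      (hc : LevelContext P Θ p₂ x₂ r r' y₁ q₂) (he' : (q₂, a', .pop γ, q₁) ∈ P.edges)
      (h' : LevelRun P Θ 0 ∅ q₁ y₂ q) :
      LevelContext P Θ p (x₁ ++ (a.toList ++ x₂)) r r' (y₁ ++ (a'.toList ++ y₂)) q

variable {P : PDA Q A S} {Θ : Finset A}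

namespace LevelRun

variable {k : ℕ} {V : Set (Q × Q)}

theorem append {p q r : Q} {u v : List A} (h : LevelRun P Θ k V p u q)
    (h' : LevelRun P Θ k V q v r) : LevelRun P Θ k V p (u ++ v) r := by
  induction h with
  | nil => exact h'
  | skip he _ ih =>
    rw [List.append_assoc]
    exact .skip he (ih h')
  | call he h hV he' _ _ ih =>
    simp only [List.append_assoc]
    exact .call he h hV he' (ih h')

theorem weaken {p q : Q} {u : List A} (h : LevelRun P Θ k V p u q) (j : ℕ) :
    LevelRun P Θ j ∅ p u q := by
  induction h with
  | nil => exact .nil _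
  | skip he _ ih => exact .skip he ih
  | call he _ _ he' _ ih ih' => exact .call he ih (fun _ => id) he' ih'

end LevelRun

theorem LevelContext.prepend {p p' r r' q : Q} {x₀ x y : List A}
    (h : LevelContext P Θ p' x r r' y q) (h₀ : LevelRun P Θ 0 ∅ p x₀ p') :
    LevelContext P Θ p (x₀ ++ x) r r' y q := by
  cases h with
  | hole h h' => exact .hole (h₀.append h) h'
  | down h he hc he' h' =>
    rw [← List.append_assoc]
    exact .down (h₀.append h) he hc he' h'

/-- A level run avoids the frame `e` on words with `k` letters of `Θ`, or it contains such a frame;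
an innermost one contains no further frame of this kind. -/
theorem LevelRun.extract {k : ℕ} {V : Set (Q × Q)} {p q : Q} {u : List A}
    (h : LevelRun P Θ k V p u q) (e : Q × Q) :
    LevelRun P Θ k (insert e V) p u q ∨ ∃ x u' y, u = x ++ (u' ++ y) ∧ thetaCount Θ u' = k ∧
      LevelRun P Θ k (insert e V) e.1 u' e.2 ∧ LevelContext P Θ p x e.1 e.2 y q := by
  induction h with
  | nil => exact .inl (.nil _)
  | skip he _ ih =>
    rcases ih with ih | ⟨x, u', y, rfl, h₁, h₂, h₃⟩
    · exact .inl (.skip he ih)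
    · refine .inr ⟨_, u', y, (List.append_assoc _ x (u' ++ y)).symm, h₁, h₂, h₃.prepend ?_⟩
      simpa using LevelRun.skip he (.nil _)
  | @call p r r' p' q a a' γ u v he h hV he' h' ih ih' =>
    rcases ih with ih | ⟨x, u', y, rfl, h₁, h₂, h₃⟩
    · by_cases hk : thetaCount Θ u = k ∧ (r, r') = e
      · obtain ⟨hk, rfl⟩ := hk
        refine .inr ⟨a.toList ++ [], u, [] ++ (a'.toList ++ v), by simp, hk, ih, ?_⟩
        exact .down (.nil p) he (.hole (.nil _) (.nil _)) he' (h'.weaken 0)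
      · have hV' : thetaCount Θ u = k → (r, r') ∉ insert e V := by
          intro hu hmem
          rcases Set.mem_insert_iff.1 hmem with h | h
          exacts [hk ⟨hu, h⟩, hV hu h]
        rcases ih' with ih' | ⟨x, u', y, rfl, h₁, h₂, h₃⟩
        · exact .inl (.call he ih hV' he' ih')
        · refine .inr ⟨(a.toList ++ (u ++ (a'.toList ++ []))) ++ x, u', y, by simp, h₁, h₂,
            h₃.prepend ?_⟩
          exact .call he (h.weaken 0) (fun _ => id) he' (.nil _)
    · refine .inr ⟨[] ++ (a.toList ++ x), u', y ++ (a'.toList ++ v), by simp, h₁, h₂, ?_⟩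
      exact .down (.nil p) he h₃ he' (h'.weaken 0)

/-! ### Bounded heights for runs that keep at most one letter -/

/-- An edge on `ε` or a letter outside `Θ`, which is kept or deleted: `m` is what is kept. -/
def FreeEdge (P : PDA Q A S) (Θ : Finset A) (p : Q) (m : Option A) (op : StackOp S) (q : Q) :
    Prop :=
  ∃ a, (p, a, op, q) ∈ P.edges ∧ (∀ x ∈ a.toList, x ∉ Θ) ∧ m.toList.Sublist a.toList

/-- Level runs on letters outside `Θ`, of which at most one is kept, and whose frames are in `R`. -/
inductive LevelStep (P : PDA Q A S) (Θ : Finset A) (R : Set (Q × Option A × Q)) :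
    Q → Option A → Q → Prop
  | nil (p : Q) : LevelStep P Θ R p none p
  | skip {p p' q : Q} {m m₁ m₂ : Option A} (he : FreeEdge P Θ p m₁ .skip p')
      (h : LevelStep P Θ R p' m₂ q) (hm : m.toList = m₁.toList ++ m₂.toList) : LevelStep P Θ R p m q
  | call {p r r' p' q : Q} {m m₁ m₂ m₃ m₄ : Option A} {x : S}
      (he : FreeEdge P Θ p m₁ (.push x) r) (hR : (r, m₂, r') ∈ R)
      (he' : FreeEdge P Θ r' m₃ (.pop x) p') (h : LevelStep P Θ R p' m₄ q)
      (hm : m.toList = m₁.toList ++ (m₂.toList ++ (m₃.toList ++ m₄.toList))) :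
      LevelStep P Θ R p m q

/-- The level runs on letters outside `Θ` that keep at most one letter and have height less than
`h`. -/
def levelSet (P : PDA Q A S) (Θ : Finset A) (h : ℕ) : Set (Q × Option A × Q) :=
  (fun R => {t | LevelStep P Θ R t.1 t.2.1 t.2.2})^[h] ∅

/-- Contexts on letters outside `Θ`, of which each half keeps at most one. -/
def ContextStep (P : PDA Q A S) (Θ : Finset A) (L : Set (Q × Option A × Q))
    (R : Set (Q × Option A × Q × Q × Option A × Q)) :
    Set (Q × Option A × Q × Q × Option A × Q) :=
  {t | (t.1, t.2.1, t.2.2.1) ∈ L ∧ t.2.2.2 ∈ L} ∪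
  {t | ∃ p₁ p₂ q₂ q₁ m₁ m₂ m₃ m₁' m₂' m₃' γ, (t.1, m₁, p₁) ∈ L ∧ FreeEdge P Θ p₁ m₂ (.push γ) p₂ ∧
    (p₂, m₃, t.2.2.1, t.2.2.2.1, m₁', q₂) ∈ R ∧ FreeEdge P Θ q₂ m₂' (.pop γ) q₁ ∧
    (q₁, m₃', t.2.2.2.2.2) ∈ L ∧ t.2.1.toList = m₁.toList ++ (m₂.toList ++ m₃.toList) ∧
    t.2.2.2.2.1.toList = m₁'.toList ++ (m₂'.toList ++ m₃'.toList)}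

/-- The contexts of height less than `h` whose level runs have height less than `h₀`. -/
def contextSet (P : PDA Q A S) (Θ : Finset A) (h₀ h : ℕ) :
    Set (Q × Option A × Q × Q × Option A × Q) :=
  (ContextStep P Θ (levelSet P Θ h₀))^[h] ∅

omit [DecidableEq A] in
/-- A mark for a concatenation is a mark for one of the two parts. -/
theorem exists_mark_append {m : Option A} {u v : List A} (h : m.toList.Sublist (u ++ v)) :
    ∃ m₁ m₂ : Option A, m.toList = m₁.toList ++ m₂.toList ∧ m₁.toList.Sublist u ∧
      m₂.toList.Sublist v := by
  have hlist : ∀ l : List A, l.length ≤ 1 → ∃ m : Option A, m.toList = l := by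
    intro l hl
    match l, hl with
    | [], _ => exact ⟨none, rfl⟩
    | [x], _ => exact ⟨some x, rfl⟩
  obtain ⟨l₁, l₂, hl, h₁, h₂⟩ := List.sublist_append_iff.1 h
  have hlen : l₁.length + l₂.length ≤ 1 := by
    rw [← List.length_append, ← hl]
    cases m <;> simp
  obtain ⟨m₁, rfl⟩ := hlist l₁ (by omega)
  obtain ⟨m₂, rfl⟩ := hlist l₂ (by omega)
  exact ⟨m₁, m₂, hl, h₁, h₂⟩

omit [DecidableEq A] in
theorem LevelStep.mono {R R' : Set (Q × Option A × Q)} (hR : R ⊆ R') {p q : Q} {m : Option A}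
    (h : LevelStep P Θ R p m q) : LevelStep P Θ R' p m q := by
  induction h with
  | nil => exact .nil _
  | skip he _ hm ih => exact .skip he ih hm
  | call he hr he' _ hm ih => exact .call he (hR hr) he' ih hm

omit [DecidableEq A] in
theorem contextStep_mono (L : Set (Q × Option A × Q)) : Monotone (ContextStep P Θ L) := by
  rintro R R' hR t (h | ⟨p₁, p₂, q₂, q₁, m₁, m₂, m₃, m₁', m₂', m₃', γ, h₁, h₂, h₃, h₄⟩)
  · exact .inl h
  · exact .inr ⟨p₁, p₂, q₂, q₁, m₁, m₂, m₃, m₁', m₂', m₃', γ, h₁, h₂, hR h₃, h₄⟩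

omit [DecidableEq A] in
theorem LevelStep.mem_levelSet [Finite Q] [Finite A] {p q : Q} {m : Option A}
    (h : LevelStep P Θ (levelSet P Θ (Nat.card (Q × Option A × Q))) p m q) :
    (p, m, q) ∈ levelSet P Θ (Nat.card (Q × Option A × Q)) :=
  map_iterate_card_subset (T := Q × Option A × Q)
    (F := fun R => {t | LevelStep P Θ R t.1 t.2.1 t.2.2}) (fun _ _ hR _ ht => ht.mono hR) h

/-- A level run on letters outside `Θ` can be replaced by one of small height, if only one of its
letters has to be kept. -/
theorem LevelRun.mem_levelSet [Finite Q] [Finite A] {p q : Q} {u : List A}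
    (h : LevelRun P Θ 0 ∅ p u q) (hu : ∀ a ∈ u, a ∉ Θ) {m : Option A} (hm : m.toList.Sublist u) :
    (p, m, q) ∈ levelSet P Θ (Nat.card (Q × Option A × Q)) := by
  apply LevelStep.mem_levelSet
  induction h generalizing m with
  | nil p =>
    obtain rfl : m = none := by cases m <;> simp_all
    exact .nil p
  | skip he _ ih =>
    obtain ⟨m₁, m₂, hm, h₁, h₂⟩ := exists_mark_append hm
    simp only [List.mem_append, or_imp, forall_and] at hu
    exact .skip ⟨_, he, hu.1, h₁⟩ (ih hu.2 h₂) hm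
  | call he _ _ he' _ ih ih' =>
    obtain ⟨m₁, m₀, hm, h₁, h₀⟩ := exists_mark_append hm
    obtain ⟨m₂, m₀', hm', h₂, h₀'⟩ := exists_mark_append h₀
    obtain ⟨m₃, m₄, hm'', h₃, h₄⟩ := exists_mark_append h₀'
    simp only [List.mem_append, or_imp, forall_and] at hu
    exact .call ⟨_, he, hu.1, h₁⟩ (ih hu.2.1 h₂).mem_levelSet ⟨_, he', hu.2.2.1, h₃⟩
      (ih' hu.2.2.2 h₄) (by rw [hm, hm', hm''])

/-- A context on letters outside `Θ` can be replaced by one of small height, if only one letter of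
each half has to be kept. -/
theorem LevelContext.mem_contextSet [Finite Q] [Finite A] {p r r' q : Q} {x y : List A}
    (h : LevelContext P Θ p x r r' y q) (hx : ∀ a ∈ x, a ∉ Θ) (hy : ∀ a ∈ y, a ∉ Θ)
    {m m' : Option A} (hm : m.toList.Sublist x) (hm' : m'.toList.Sublist y) :
    (p, m, r, r', m', q) ∈ contextSet P Θ (Nat.card (Q × Option A × Q))
      (Nat.card (Q × Option A × Q × Q × Option A × Q)) := by
  apply map_iterate_card_subset (contextStep_mono _)
  induction h generalizing m m' with
  | hole h h' => exact .inl ⟨h.mem_levelSet hx hm, h'.mem_levelSet hy hm'⟩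
  | down h he hc he' h' ih =>
    obtain ⟨m₁, m₀, e₁, h₁, h₀⟩ := exists_mark_append hm
    obtain ⟨m₂, m₃, e₂, h₂, h₃⟩ := exists_mark_append h₀
    obtain ⟨n₁, n₀, f₁, k₁, k₀⟩ := exists_mark_append hm'
    obtain ⟨n₂, n₃, f₂, k₂, k₃⟩ := exists_mark_append k₀
    simp only [List.mem_append, or_imp, forall_and] at hx hy
    refine .inr ⟨_, _, _, _, m₁, m₂, m₃, n₁, n₂, n₃, _, h.mem_levelSet hx.1 h₁, ⟨_, he, hx.2.1, h₂⟩,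
      map_iterate_card_subset (contextStep_mono _) (ih hx.2.2 hy.1 h₃ k₁), ⟨_, he', hy.2.1, k₂⟩,
      h'.mem_levelSet hy.2.2 k₃, ?_, ?_⟩
    · rw [e₁, e₂]
    · rw [f₁, f₂]

/-- The pumping machine can follow a free edge in all modes in which it may read what is kept. -/
theorem FreeEdge.path {H : ℕ} {p q : Q} {op : StackOp S} {m : Option A} (h : FreeEdge P Θ p m op q)
    {μ : Mode} (hμ : m.toList = [] ∨ μ.reads = true) {k : ℕ} {c c' : List (Option S)} {b : List Q}
    (ho : op.lift.Apply c c') (hc : c.length ≤ H) (hc' : c'.length ≤ H) :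
    PumpPath P Θ H ⟨μ, none, k, p, c, b⟩ m.toList ⟨μ, none, k, q, c', b⟩ := by
  obtain ⟨a, he, ha, hm⟩ := h
  have hemb := ThetaEmb.of_free hm ha
  have := PumpPath.edge (k := k) (b := b) he ho hemb (.inr ⟨ha, hμ⟩) hc hc'
  rwa [thetaCount_eq_zero.2 fun x hx => ha x (hm.subset hx)] at this

/-- A level run of height less than `h` needs at most `h` additional letters on the stack. -/
theorem path_of_mem_levelSet {H h : ℕ} {p q : Q} {m : Option A} (hm : (p, m, q) ∈ levelSet P Θ h)
    {μ : Mode} (hμ : m.toList = [] ∨ μ.reads = true) {k : ℕ} {c : List (Option S)} {b : List Q}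
    (hc : c.length + h ≤ H) :
    PumpPath P Θ H ⟨μ, none, k, p, c, b⟩ m.toList ⟨μ, none, k, q, c, b⟩ := by
  induction h generalizing p q m c with
  | zero => exact absurd hm (Set.notMem_empty _)
  | succ h ih =>
    rw [levelSet, Function.iterate_succ_apply'] at hm
    change LevelStep P Θ (levelSet P Θ h) p m q at hm
    induction hm with
    | nil => exact .refl _
    | skip he _ hm ih' =>
      rw [hm, List.append_eq_nil_iff, and_or_right] at hμ
      rw [hm]
      exact (he.path hμ.1 rfl (by omega) (by omega)).trans (ih' hμ.2)
    | @call p r r' p' q m m₁ m₂ m₃ m₄ x he hR he' _ hm ih' =>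
      simp only [hm, List.append_eq_nil_iff, and_or_right] at hμ
      rw [hm]
      have hl : (some x :: c).length ≤ H := by simp; omega
      exact (he.path hμ.1 rfl (by omega) hl).trans
        ((ih hR hμ.2.1 (by simp; omega)).trans
        ((he'.path hμ.2.2.1 rfl hl (by omega)).trans (ih' hμ.2.2.2)))

/-- The two halves of a context of bounded height, which may be executed in different modes. -/
theorem path_of_mem_contextSet {H h₀ h : ℕ} {p r r' q : Q} {m m' : Option A}
    (hm : (p, m, r, r', m', q) ∈ contextSet P Θ h₀ h) :
    ∃ w : List S, w.length ≤ h ∧ ∀ (k : ℕ) (c : List (Option S)) (b : List Q),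
      c.length + h + h₀ ≤ H →
      (∀ μ : Mode, (m.toList = [] ∨ μ.reads = true) →
        PumpPath P Θ H ⟨μ, none, k, p, c, b⟩ m.toList ⟨μ, none, k, r, w.map some ++ c, b⟩) ∧
      (∀ μ : Mode, (m'.toList = [] ∨ μ.reads = true) →
        PumpPath P Θ H ⟨μ, none, k, r', w.map some ++ c, b⟩ m'.toList ⟨μ, none, k, q, c, b⟩) := by
  induction h generalizing p q m m' with
  | zero => exact absurd hm (Set.notMem_empty _)
  | succ h ih =>
    rw [contextSet, Function.iterate_succ_apply'] at hm
    rcases hm with hm | hm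
    · exact ⟨[], Nat.zero_le _, fun k c b hc =>
        ⟨fun μ hμ => path_of_mem_levelSet hm.1 hμ (by omega),
        fun μ hμ => path_of_mem_levelSet (c := c) hm.2 hμ (by omega)⟩⟩
    · obtain ⟨p₁, p₂, q₂, q₁, m₁, m₂, m₃, n₁, n₂, n₃, γ, h₁, h₂, h₃, h₄, h₅, h₆, h₇⟩ := hm
      dsimp only at h₁ h₃ h₅ h₆ h₇
      obtain ⟨w, hw, hpath⟩ := ih h₃
      refine ⟨w ++ [γ], by simp; omega, fun k c b hc => ?_⟩
      have hl : (some γ :: c).length ≤ H := by simp; omega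
      obtain ⟨hpath₁, hpath₂⟩ := hpath k (some γ :: c) b (by simp; omega)
      have hw' : (w ++ [γ]).map some ++ c = w.map some ++ some γ :: c := by simp
      rw [hw']
      refine ⟨fun μ hμ => ?_, fun μ hμ => ?_⟩
      · simp only [h₆, List.append_eq_nil_iff, and_or_right] at hμ
        rw [h₆]
        exact (path_of_mem_levelSet h₁ hμ.1 (by omega)).trans
          ((h₂.path hμ.2.1 rfl (by omega) hl).trans (hpath₁ μ hμ.2.2))
      · simp only [h₇, List.append_eq_nil_iff, and_or_right] at hμ
        rw [h₇]
        exact (hpath₂ μ hμ.1).trans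
          ((h₄.path hμ.2.1 rfl hl (by omega)).trans (path_of_mem_levelSet h₅ hμ.2.2 (by omega)))

/-! ### Completeness of the pumping machine -/

/-- A path for a level run, from paths for its frames. -/
theorem LevelRun.path {H k : ℕ} {V : Set (Q × Q)} {c : List (Option S)} {b : List Q}
    (hcall : ∀ r u r' u' κ x, LevelRun P Θ k V r u r' → thetaCount Θ u ≤ k →
      (thetaCount Θ u = k → (r, r') ∉ V) → ThetaEmb Θ u' u →
      PumpPath P Θ H ⟨.N, none, κ + thetaCount Θ u', r, some x :: c, b⟩ u'
        ⟨.N, none, κ, r', some x :: c, b⟩)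
    {p q : Q} {u : List A} (h : LevelRun P Θ k V p u q) (hu : thetaCount Θ u ≤ k)
    (hc : c.length + 1 ≤ H) {u' : List A} {κ : ℕ} (hemb : ThetaEmb Θ u' u) :
    PumpPath P Θ H ⟨.N, none, κ + thetaCount Θ u', p, c, b⟩ u' ⟨.N, none, κ, q, c, b⟩ := by
  induction h generalizing u' κ with
  | nil =>
    obtain rfl : u' = [] := List.sublist_nil.1 hemb.1
    exact .refl _
  | skip he _ ih =>
    obtain ⟨u₁, u₂, rfl, h₁, h₂⟩ := hemb.split
    rw [thetaCount_append] at hu ⊢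
    rw [Nat.add_comm (thetaCount Θ u₁), ← Nat.add_assoc]
    exact (PumpPath.edge he rfl h₁ (.inl rfl) (by omega) (by omega)).trans (ih (by omega) h₂)
  | @call p r r' p' q a a' x u v he h hV he' _ _ ih' =>
    obtain ⟨u₁, u₀, rfl, h₁, h₀⟩ := hemb.split
    obtain ⟨u₂, u₀', rfl, h₂, h₀'⟩ := h₀.split
    obtain ⟨u₃, u₄, rfl, h₃, h₄⟩ := h₀'.split
    simp only [thetaCount_append] at hu ⊢
    have hl : (some x :: c).length ≤ H := by simpa using hc
    have e : κ + (thetaCount Θ u₁ + (thetaCount Θ u₂ + (thetaCount Θ u₃ + thetaCount Θ u₄))) =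
      κ + thetaCount Θ u₄ + thetaCount Θ u₃ + thetaCount Θ u₂ + thetaCount Θ u₁ := by omega
    rw [e]
    exact (PumpPath.edge he rfl h₁ (.inl rfl) (by omega) hl).trans
      ((hcall _ _ _ _ _ x h (by omega) hV h₂).trans
      ((PumpPath.edge he' rfl h₃ (.inl rfl) hl (by omega)).trans (ih' (by omega) h₄)))

variable (Q A) in
/-- A bound for the heights of contexts and level runs that keep at most one letter, plus two. -/
noncomputable def loopHeight : ℕ :=
  Nat.card (Q × Option A × Q) + Nat.card (Q × Option A × Q × Q × Option A × Q) + 2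

section
variable [Finite Q] [Finite A]

/-- Letters of the first half of a context can be read in any number and order at a bracket, by one
loop for each of them. -/
theorem LevelContext.path_left {H k : ℕ} {p q : Q} {x y : List A} {c : List (Option S)} {b : List Q}
    (h : LevelContext P Θ p x p q y q) (hx : ∀ a ∈ x, a ∉ Θ) (hy : ∀ a ∈ y, a ∉ Θ)
    (hc : c.length + loopHeight Q A ≤ H) {u : List A} (hu : u ⊆ x) :
    PumpPath P Θ H ⟨.N, none, k, p, none :: c, p :: q :: b⟩ u
      ⟨.N, none, k, p, none :: c, p :: q :: b⟩ := by
  induction u with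
  | nil => exact .refl _
  | cons a u ih =>
    have ha := List.singleton_sublist.2 (hu (List.mem_cons_self (a := a)))
    obtain ⟨w, hw, hpath⟩ := path_of_mem_contextSet (H := H)
      (h.mem_contextSet hx hy (m := some a) (m' := none) ha (List.nil_sublist _))
    obtain ⟨h₁, h₂⟩ := hpath k (none :: c) (p :: q :: b)
      (by simp [loopHeight] at hc ⊢; omega)
    exact (PumpPath.loopA (u := [a]) (by simp [loopHeight] at hc hw ⊢; omega) (h₁ .A1 (.inr rfl))
      (h₂ .A2 (.inl rfl))).trans (ih fun z hz => hu (List.mem_cons_of_mem a hz))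

/-- Letters of the second half of a context can be read in any number and order at a bracket, by one
loop for each of them. -/
theorem LevelContext.path_right {H k : ℕ} {p q : Q} {x y : List A} {c : List (Option S)}
    {b : List Q} (h : LevelContext P Θ p x p q y q) (hx : ∀ a ∈ x, a ∉ Θ) (hy : ∀ a ∈ y, a ∉ Θ)
    (hc : c.length + loopHeight Q A ≤ H) {u : List A} (hu : u ⊆ y) :
    PumpPath P Θ H ⟨.N, none, k, q, none :: c, p :: q :: b⟩ u
      ⟨.N, none, k, q, none :: c, p :: q :: b⟩ := by
  induction u with
  | nil => exact .refl _
  | cons a u ih =>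
    have ha := List.singleton_sublist.2 (hu (List.mem_cons_self (a := a)))
    obtain ⟨w, hw, hpath⟩ := path_of_mem_contextSet (H := H)
      (h.mem_contextSet hx hy (m := none) (m' := some a) (List.nil_sublist _) ha)
    obtain ⟨h₁, h₂⟩ := hpath k (none :: c) (p :: q :: b)
      (by simp [loopHeight] at hc ⊢; omega)
    exact (PumpPath.loopB (u := [a]) (by simp [loopHeight] at hc hw ⊢; omega) (h₁ .B1 (.inl rfl))
      (h₂ .B2 (.inr rfl))).trans (ih fun z hz => hu (List.mem_cons_of_mem a hz))

/-- Level runs are simulated with bounded height. The rank `ρ` decreases from a level run to its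
frames: a frame that keeps all `k` letters of `Θ` cannot be the frame `(p, q)` again, as the
innermost occurrence of the latter has been chosen. The levels of the run outside of it are replaced
by loops at the bracket `(p, q)`, one for each letter to be kept. -/
theorem LevelRun.path_of_rank (ρ : ℕ) {k : ℕ} {V : Set (Q × Q)}
    (hρ : k * (Nat.card (Q × Q) + 1) + (Nat.card (Q × Q) - V.ncard) = ρ) {p q : Q} {u u' : List A}
    (h : LevelRun P Θ k V p u q) (hu : thetaCount Θ u = k) (hpq : (p, q) ∉ V)
    (hemb : ThetaEmb Θ u' u) {H κ : ℕ} {c : List (Option S)} {b : List Q}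
    (hc : c.length + loopHeight Q A + 2 * ρ ≤ H) :
    PumpPath P Θ H ⟨.N, none, κ + thetaCount Θ u', p, c, b⟩ u' ⟨.N, none, κ, q, c, b⟩ := by
  induction ρ using Nat.strong_induction_on generalizing k V p q u u' κ c b with
  | _ ρ ih =>
  set N := Nat.card (Q × Q) with hN
  have hVN : (insert (p, q) V).ncard ≤ N := Set.ncard_le_card _
  rw [Set.ncard_insert_of_notMem hpq] at hVN
  have hcore : ∀ u u' κ, LevelRun P Θ k (insert (p, q) V) p u q → thetaCount Θ u ≤ k →
      ThetaEmb Θ u' u → PumpPath P Θ H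
        ⟨.N, none, κ + thetaCount Θ u', p, none :: c, p :: q :: b⟩ u'
        ⟨.N, none, κ, q, none :: c, p :: q :: b⟩ := by
    intro u u' κ h hu hemb
    refine h.path (fun r v r' v' κ x hv hvk hV hemb => ?_) hu
      (by simp [loopHeight] at hc ⊢; omega) hemb
    -- Frames with fewer letters of `Θ` have smaller rank even for the empty set of forbidden pairs;
    -- frames with as many letters have smaller rank because `(p, q)` is forbidden now.
    rcases hvk.lt_or_eq with hlt | heq
    · have hrank : thetaCount Θ v * (N + 1) + (N - (∅ : Set (Q × Q)).ncard) < ρ := by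
        have := Nat.mul_le_mul_right (N + 1) (Nat.succ_le_of_lt hlt)
        rw [Nat.succ_mul] at this
        simp only [Set.ncard_empty, Nat.sub_zero]
        omega
      refine ih _ hrank rfl (hv.weaken _) rfl (Set.notMem_empty _) hemb ?_
      simp only [List.length_cons]
      omega
    · have hrank : k * (N + 1) + (N - (insert (p, q) V).ncard) < ρ := by
        rw [Set.ncard_insert_of_notMem hpq]
        omega
      refine ih _ hrank rfl hv heq (hV heq) hemb ?_
      simp only [List.length_cons]
      omega
  refine PumpPath.bracket (by simp [loopHeight] at hc; omega) ?_
  -- The context around an innermost frame `(p, q)` is replaced by loops; it has no letter of `Θ`,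
  -- as this frame has them all.
  rcases h.extract (p, q) with h' | ⟨x, v, y, rfl, hv, h', hctx⟩
  · exact hcore u u' κ h' hu.le hemb
  · simp only [thetaCount_append] at hu
    have hx := thetaCount_eq_zero.1 (show thetaCount Θ x = 0 by omega)
    have hy := thetaCount_eq_zero.1 (show thetaCount Θ y = 0 by omega)
    obtain ⟨u₁, u₀, rfl, h₁, h₀⟩ := hemb.split
    obtain ⟨u₂, u₃, rfl, h₂, h₃⟩ := h₀.split
    have e₁ := h₁.count_eq
    have e₃ := h₃.count_eq
    have e : thetaCount Θ (u₁ ++ (u₂ ++ u₃)) = thetaCount Θ u₂ := by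
      simp only [thetaCount_append]
      omega
    rw [e]
    exact (hctx.path_left hx hy (by omega) h₁.1.subset).trans
      ((hcore v u₂ κ h' hv.le h₂).trans (hctx.path_right hx hy (by omega) h₃.1.subset))

end

/-- Runs of `P` from a stack `w`, as sequences of level runs, edges that pop letters of `w`, and
edges that push a letter which is never popped; after such an edge, the stack below is forgotten. -/
inductive TopRun (P : PDA Q A S) (Θ : Finset A) : Q → List S → List A → Q → Prop
  | done (p : Q) (w : List S) : TopRun P Θ p w [] p
  | level {p r f : Q} {w : List S} {u v : List A} (h : LevelRun P Θ 0 ∅ p u r)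
      (h' : TopRun P Θ r w v f) : TopRun P Θ p w (u ++ v) f
  | pop {p r f : Q} {w : List S} {a : Option A} {x : S} {v : List A}
      (he : (p, a, .pop x, r) ∈ P.edges) (h' : TopRun P Θ r w v f) :
      TopRun P Θ p (x :: w) (a.toList ++ v) f
  | push {p r f : Q} {w : List S} {a : Option A} {x : S} {v : List A}
      (he : (p, a, .push x, r) ∈ P.edges) (h' : TopRun P Θ r [] v f) :
      TopRun P Θ p w (a.toList ++ v) f

/-- A letter `x` on the stack is popped at some point, or it stays below everything that follows. -/
theorem TopRun.popped_or_kept {p f : Q} {x : S} {w : List S} {v : List A}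
    (h : TopRun P Θ p (x :: w) v f) :
    (∃ v₁ r a r' v₂, v = v₁ ++ (a.toList ++ v₂) ∧ LevelRun P Θ 0 ∅ p v₁ r ∧
      (r, a, .pop x, r') ∈ P.edges ∧ TopRun P Θ r' w v₂ f) ∨ TopRun P Θ p [] v f := by
  generalize hw : x :: w = w' at h
  induction h with
  | done => exact .inr (.done _ _)
  | level h _ ih =>
    rcases ih hw with ⟨v₁, r, a, r', v₂, rfl, h₁, h₂⟩ | h'
    · exact .inl ⟨_, r, a, r', v₂, (List.append_assoc _ _ _).symm, h.append h₁, h₂⟩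
    · exact .inr (.level h h')
  | pop he h' =>
    obtain ⟨rfl, rfl⟩ := List.cons.inj hw
    exact .inl ⟨[], _, _, _, _, rfl, .nil _, he, h'⟩
  | push he h' => exact .inr (.push he h')

/-- Every run can be decomposed at the letters that are pushed and never popped. -/
theorem PDA.Run.topRun {p f : Q} {w w' : List S} {u : List A} (h : P.Run p w u f w') :
    TopRun P Θ p w u f := by
  induction h with
  | refl => exact .done _ _
  | @step q q' q'' w w' w'' a op u he ho _ ih =>
    cases op with
    | skip =>
      obtain rfl : w' = w := ho
      have : LevelRun P Θ 0 ∅ q (a.toList ++ []) q' := .skip he (.nil _)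
      rw [List.append_nil] at this
      exact .level this ih
    | pop x =>
      obtain rfl : w = x :: w' := ho
      exact .pop he ih
    | push x =>
      obtain rfl : w' = x :: w := ho
      rcases ih.popped_or_kept with ⟨v₁, r, a', r', v₂, rfl, h₁, h₂, h₃⟩ | h'
      · have : LevelRun P Θ 0 ∅ q (a.toList ++ (v₁ ++ (a'.toList ++ []))) r' :=
          .call he h₁ (fun _ => id) h₂ (.nil _)
        have := TopRun.level this h₃
        simpa only [List.append_assoc, List.append_nil, List.nil_append] using this
      · exact .push he h'

/-- A bound for the stack of the pumping machine. -/
noncomputable def pumpHeight (P : PDA Q A S) (K : ℕ) : ℕ :=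
  P.startStack.length + loopHeight Q A +
    2 * (K * (Nat.card (Q × Q) + 1) + Nat.card (Q × Q)) + 1

variable [Finite Q] [Finite A]

/-- The pumping machine can read what is kept of the word of a run. It forgets the stack whenever
the run pushes a letter that is never popped. -/
theorem TopRun.path {K : ℕ} {p f : Q} {w : List S} {u u' : List A} (h : TopRun P Θ p w u f)
    (hw : w.length ≤ P.startStack.length) (hemb : ThetaEmb Θ u' u) {κ : ℕ}
    (hK : thetaCount Θ u ≤ K) :
    ∃ c, PumpPath P Θ (pumpHeight P K) ⟨.N, none, κ + thetaCount Θ u', p, w.map some, []⟩ u'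
      ⟨.N, none, κ, f, c, []⟩ := by
  have hH : P.startStack.length + 1 ≤ pumpHeight P K := by simp [pumpHeight]; omega
  induction h generalizing u' κ with
  | done p w =>
    obtain rfl : u' = [] := List.sublist_nil.1 hemb.1
    exact ⟨_, .refl _⟩
  | @level p r f w u v h _ ih =>
    obtain ⟨u₁, u₂, rfl, h₁, h₂⟩ := hemb.split
    rw [thetaCount_append] at hK ⊢
    obtain ⟨c, hc⟩ := ih hw h₂ (κ := κ) (by omega)
    refine ⟨c, ?_⟩
    rw [Nat.add_comm (thetaCount Θ u₁), ← Nat.add_assoc]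
    refine PumpPath.trans ?_ hc
    refine (h.weaken (thetaCount Θ u)).path_of_rank _ rfl rfl (Set.notMem_empty _) h₁ ?_
    have := Nat.mul_le_mul_right (Nat.card (Q × Q) + 1) (show thetaCount Θ u ≤ K by omega)
    simp only [List.length_map, Set.ncard_empty, Nat.sub_zero, pumpHeight]
    omega
  | @pop p r f w a x v he _ ih =>
    obtain ⟨u₁, u₂, rfl, h₁, h₂⟩ := hemb.split
    rw [thetaCount_append] at hK ⊢
    simp only [List.length_cons] at hw
    obtain ⟨c, hc⟩ := ih (by omega) h₂ (κ := κ) (by omega)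
    refine ⟨c, ?_⟩
    rw [Nat.add_comm (thetaCount Θ u₁), ← Nat.add_assoc]
    exact (PumpPath.edge he rfl h₁ (.inl rfl) (by simp; omega) (by simp; omega)).trans hc
  | @push p r f w a x v he _ ih =>
    obtain ⟨u₁, u₂, rfl, h₁, h₂⟩ := hemb.split
    rw [thetaCount_append] at hK ⊢
    obtain ⟨c, hc⟩ := ih (Nat.zero_le _) h₂ (κ := κ) (by omega)
    refine ⟨c, ?_⟩
    rw [Nat.add_comm (thetaCount Θ u₁), ← Nat.add_assoc]
    exact (PumpPath.edge (c' := some x :: w.map some) he rfl h₁ (.inl rfl) (by simp; omega)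
      (by simp; omega)).trans (.silent .forget (Nat.zero_le _) hc)

/-- Every word of the downward closure is read by the pumping machine with a bounded stack. -/
theorem exists_pumpPath_of_mem {K : ℕ} {u : List A}
    (h : u ∈ preservingDownClosure Θ K P.language) :
    ∃ k, ∃ f ∈ P.final, ∃ c, PumpPath P Θ (pumpHeight P K)
      ⟨.N, none, K, P.start, P.startStack.map some, []⟩ u ⟨.N, none, k, f, c, []⟩ := by
  obtain ⟨v, ⟨f, hf, w, hr⟩, h₁, h₂, h₃⟩ := h
  have hemb : ThetaEmb Θ u v := ⟨h₁, h₂⟩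
  obtain ⟨c, hc⟩ := (hr.topRun (Θ := Θ)).path le_rfl hemb (κ := K - thetaCount Θ u) h₃
  have : thetaCount Θ u ≤ K := by rw [hemb.count_eq]; exact h₃
  rw [Nat.sub_add_cancel this] at hc
  exact ⟨_, f, hf, c, hc⟩

end

/-! ### Transducers over coded letters and states -/

/-- The letters of the doubly succinct automaton. `hash` and `zero` are the letters `0` and `1` that
occur in the initial and the final state. -/
inductive Ltr
  | hash | zero | bracket | one | blank
  | data (i : ℕ)
  deriving DecidableEq

/-- The numbers of the letters. -/
def Ltr.num : Ltr → ℕ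
  | hash => 0
  | zero => 1
  | bracket => 2
  | one => 3
  | blank => 4
  | data i => 5 + i

theorem Ltr.num_injective : Function.Injective Ltr.num := by
  rintro (_ | _ | _ | _ | _ | i) (_ | _ | _ | _ | _ | j) h <;> simp [Ltr.num] at h <;>
    first | rfl | omega | skip
  rw [h]

/-- Edges of a transducer with states in `X`. -/
abbrev LEdge (X : Type) := X × Option (Ltr × Ltr) × X

/-- Runs along the edges in `E`. -/
inductive LRun {X : Type} (E : Set (LEdge X)) : X → List Ltr → List Ltr → X → Prop
  | nil (q : X) : LRun E q [] [] q
  | eps {q r s : X} {u v : List Ltr} (he : (q, none, r) ∈ E) (h : LRun E r u v s) : LRun E q u v s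
  | letter {q r s : X} {a b : Ltr} {u v : List Ltr} (he : (q, some (a, b), r) ∈ E)
      (h : LRun E r u v s) : LRun E q (a :: u) (b :: v) s

namespace LRun

variable {X : Type} {E : Set (LEdge X)}

theorem append {q r s : X} {u v u' v' : List Ltr} (h : LRun E q u v r) (h' : LRun E r u' v' s) :
    LRun E q (u ++ u') (v ++ v') s := by
  induction h with
  | nil => exact h'
  | eps he _ ih => exact .eps he (ih h')
  | letter he _ ih => exact .letter he (ih h')

theorem split {q s : X} {u u' v : List Ltr} (h : LRun E q (u ++ u') v s) :
    ∃ r v₁ v₂, v = v₁ ++ v₂ ∧ LRun E q u v₁ r ∧ LRun E r u' v₂ s := by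
  generalize hw : u ++ u' = w at h
  induction h generalizing u with
  | nil q =>
    obtain ⟨rfl, rfl⟩ := List.append_eq_nil_iff.1 hw
    exact ⟨q, [], [], rfl, .nil q, .nil q⟩
  | eps he _ ih =>
    obtain ⟨r, v₁, v₂, rfl, h₁, h₂⟩ := ih hw
    exact ⟨r, v₁, v₂, rfl, .eps he h₁, h₂⟩
  | @letter q r s a b w v he h ih =>
    cases u with
    | nil =>
      obtain rfl : u' = a :: w := hw
      exact ⟨q, [], _, rfl, .nil q, .letter he h⟩
    | cons c u =>
      obtain ⟨rfl, hw'⟩ := List.cons.inj hw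
      obtain ⟨r', v₁, v₂, rfl, h₁, h₂⟩ := ih hw'
      exact ⟨r', b :: v₁, v₂, rfl, .letter he h₁, h₂⟩

/-- Inversion for a state without `ε`-edges. -/
theorem cons_inv {q s : X} {a : Ltr} {u v : List Ltr} (h : LRun E q (a :: u) v s)
    (hq : ∀ r, (q, none, r) ∉ E) :
    ∃ b r v', v = b :: v' ∧ (q, some (a, b), r) ∈ E ∧ LRun E r u v' s := by
  cases h with
  | eps he _ => exact absurd he (hq _)
  | letter he h => exact ⟨_, _, _, rfl, he, h⟩

theorem nil_inv {q s : X} {v : List Ltr} (h : LRun E q [] v s) (hq : ∀ r, (q, none, r) ∉ E) :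
    v = [] ∧ s = q := by
  cases h with
  | nil => exact ⟨rfl, rfl⟩
  | eps he _ => exact absurd he (hq _)

/-- Inversion for a state with a loop, whose labels are in `ρ`, and with further edges. -/
theorem loop_inv {q s : X} {u v : List Ltr} (h : LRun E q u v s) {ρ : Ltr → Ltr → Prop}
    (hq : ∀ r, (q, none, r) ∉ E) (hρ : ∀ a b, (q, some (a, b), q) ∈ E → ρ a b) :
    (List.Forall₂ ρ u v ∧ s = q) ∨ ∃ u₁ v₁ a b r u₂ v₂, u = u₁ ++ a :: u₂ ∧ v = v₁ ++ b :: v₂ ∧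
      List.Forall₂ ρ u₁ v₁ ∧ (q, some (a, b), r) ∈ E ∧ r ≠ q ∧ LRun E r u₂ v₂ s := by
  induction u generalizing v with
  | nil =>
    obtain ⟨rfl, rfl⟩ := h.nil_inv hq
    exact .inl ⟨.nil, rfl⟩
  | cons a u ih =>
    obtain ⟨b, r, v', rfl, he, h'⟩ := h.cons_inv hq
    clear h
    rcases eq_or_ne r q with rfl | hr
    · rcases ih h' with ⟨h₁, h₂⟩ | ⟨u₁, v₁, a', b', r', u₂, v₂, rfl, rfl, h₁, h₂⟩
      · exact .inl ⟨.cons (hρ _ _ he) h₁, h₂⟩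
      · exact .inr ⟨a :: u₁, b :: v₁, a', b', r', u₂, v₂, rfl, rfl, .cons (hρ _ _ he) h₁, h₂⟩
    · exact .inr ⟨[], [], a, b, r, u, v', rfl, rfl, .nil, he, hr, h'⟩

/-- Inversion for a state that is not left by edges reading the letters of `u`. -/
theorem stay_inv {q s : X} {u v : List Ltr} (h : LRun E q u v s) {ρ : Ltr → Ltr → Prop}
    (hq : ∀ r, (q, none, r) ∉ E)
    (hρ : ∀ a ∈ u, ∀ b r, (q, some (a, b), r) ∈ E → r = q ∧ ρ a b) :
    List.Forall₂ ρ u v ∧ s = q := by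
  induction u generalizing v with
  | nil =>
    obtain ⟨rfl, rfl⟩ := h.nil_inv hq
    exact ⟨.nil, rfl⟩
  | cons a u ih =>
    obtain ⟨b, r, v', rfl, he, h'⟩ := h.cons_inv hq
    clear h
    obtain ⟨rfl, hab⟩ := hρ a List.mem_cons_self b r he
    obtain ⟨h₁, h₂⟩ := ih h' fun a ha => hρ a (List.mem_cons_of_mem _ ha)
    exact ⟨.cons hab h₁, h₂⟩

/-- The run along a loop. -/
theorem loop {q : X} {u : List Ltr} (f : Ltr → Ltr) (h : ∀ a ∈ u, (q, some (a, f a), q) ∈ E) :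
    LRun E q u (u.map f) q := by
  induction u with
  | nil => exact .nil q
  | cons a u ih =>
    exact .letter (h a List.mem_cons_self) (ih fun a ha => h a (List.mem_cons_of_mem _ ha))

theorem copy {q : X} {u : List Ltr} (h : ∀ a ∈ u, (q, some (a, a), q) ∈ E) : LRun E q u u q := by
  simpa using loop (f := id) h

end LRun

/-- The transducer over `Fin (N + 1)` with `k + 1` states for the given states and edges. -/
def mkTransducer {X : Type} (num : X → ℕ) (N k : ℕ) (i : X) (F : List X) (E : List (LEdge X)) :
    Transducer (Fin (N + 1)) where
  numStates := k + 1
  init := Fin.ofNat (k + 1) (num i)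
  final := F.map fun q => Fin.ofNat (k + 1) (num q)
  edges := E.map fun e => (Fin.ofNat (k + 1) (num e.1),
    e.2.1.map fun l => (Fin.ofNat (N + 1) l.1.num, Fin.ofNat (N + 1) l.2.num),
    Fin.ofNat (k + 1) (num e.2.2))

/-- All letters of the word have numbers up to `N`. -/
def IsWord (N : ℕ) (u : List Ltr) : Prop := ∀ a ∈ u, a.num ≤ N

/-- The letters as elements of `Fin (N + 1)`. -/
def toFin (N : ℕ) (a : Ltr) : Fin (N + 1) := Fin.ofNat (N + 1) a.num

theorem toFin_injOn {N : ℕ} {a b : Ltr} (ha : a.num ≤ N) (hb : b.num ≤ N)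
    (h : toFin N a = toFin N b) : a = b := by
  apply Ltr.num_injective
  have := congrArg Fin.val h
  simpa [toFin, Nat.mod_eq_of_lt (Nat.lt_succ_of_le ha), Nat.mod_eq_of_lt (Nat.lt_succ_of_le hb)]
    using this

/-- An edge between states in `G` whose letters have numbers up to `N`. -/
def GoodEdge {X : Type} (G : Set X) (N : ℕ) (e : LEdge X) : Prop :=
  e.1 ∈ G ∧ e.2.2 ∈ G ∧ ∀ l ∈ e.2.1, l.1.num ≤ N ∧ l.2.num ≤ N

section
variable {X : Type} {num : X → ℕ} {N k : ℕ} {i : X} {F : List X} {E : List (LEdge X)} {G : Set X}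

theorem mkTransducer_run_of_lRun {q r : X} {u v : List Ltr} (h : LRun {e | e ∈ E} q u v r) :
    (mkTransducer num N k i F E).Run (Fin.ofNat (k + 1) (num q)) (u.map (toFin N))
      (v.map (toFin N)) (Fin.ofNat (k + 1) (num r)) := by
  induction h with
  | nil => exact .refl _
  | eps he _ ih => exact .eps (List.mem_map.2 ⟨_, he, rfl⟩) ih
  | letter he _ ih => exact .letter (List.mem_map.2 ⟨_, he, rfl⟩) ih

/-- A run of `mkTransducer` comes from a run along the edges in `E`, as `num` is injective on the
good states. -/
theorem lRun_of_mkTransducer_run (hinj : Set.InjOn num G) (hk : ∀ q ∈ G, num q ≤ k)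
    (hE : ∀ e ∈ E, GoodEdge G N e) {q : X} (hq : q ∈ G) {u : List Ltr} (hu : IsWord N u)
    {v : List (Fin (N + 1))} {r : Fin (k + 1)}
    (h : (mkTransducer num N k i F E).Run (Fin.ofNat (k + 1) (num q)) (u.map (toFin N)) v r) :
    ∃ w r', r' ∈ G ∧ r = Fin.ofNat (k + 1) (num r') ∧ v = w.map (toFin N) ∧ IsWord N w ∧
      LRun {e | e ∈ E} q u w r' := by
  have hstate : ∀ {q q'}, q ∈ G → q' ∈ G →
      Fin.ofNat (k + 1) (num q) = Fin.ofNat (k + 1) (num q') → q = q' := by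
    intro q q' hq hq' h
    refine hinj hq hq' ?_
    have := congrArg Fin.val h
    simpa [Nat.mod_eq_of_lt (Nat.lt_succ_of_le (hk q hq)),
      Nat.mod_eq_of_lt (Nat.lt_succ_of_le (hk q' hq'))] using this
  have key : ∀ (q₀ r₀ : Fin (mkTransducer num N k i F E).numStates) (u₀ v : List (Fin (N + 1))),
      (mkTransducer num N k i F E).Run q₀ u₀ v r₀ → ∀ q ∈ G, ∀ u, IsWord N u →
        Fin.ofNat (k + 1) (num q) = q₀ → u.map (toFin N) = u₀ →
        ∃ w r', r' ∈ G ∧ r₀ = Fin.ofNat (k + 1) (num r') ∧ v = w.map (toFin N) ∧ IsWord N w ∧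
          LRun {e | e ∈ E} q u w r' := by
    intro q₀ r₀ u₀ v h
    induction h with
    | refl =>
      intro q hq u hu hq₀ hu₀
      obtain rfl := List.map_eq_nil_iff.1 hu₀
      exact ⟨[], q, hq, hq₀.symm, rfl, by simp [IsWord], .nil q⟩
    | eps he _ ih =>
      intro q hq u hu hq₀ hu₀
      obtain ⟨⟨q', l, r'⟩, he', heq⟩ := List.mem_map.1 he
      have h₁ : Fin.ofNat (k + 1) (num q') = _ := congrArg (fun e => e.1) heq
      have h₂ : l.map _ = none := congrArg (fun e => e.2.1) heq
      have h₃ : Fin.ofNat (k + 1) (num r') = _ := congrArg (fun e => e.2.2) heq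
      obtain rfl := Option.map_eq_none_iff.1 h₂
      obtain ⟨g₁, g₂, -⟩ := hE _ he'
      obtain rfl := hstate g₁ hq (h₁.trans hq₀.symm)
      obtain ⟨w, r'', h₄, h₅, h₆, h₇, h₈⟩ := ih _ g₂ u hu h₃ hu₀
      exact ⟨w, r'', h₄, h₅, h₆, h₇, .eps he' h₈⟩
    | letter he _ ih =>
      intro q hq u hu hq₀ hu₀
      obtain ⟨⟨q', l, r'⟩, he', heq⟩ := List.mem_map.1 he
      have h₁ : Fin.ofNat (k + 1) (num q') = _ := congrArg (fun e => e.1) heq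
      have h₂ : l.map _ = some _ := congrArg (fun e => e.2.1) heq
      have h₃ : Fin.ofNat (k + 1) (num r') = _ := congrArg (fun e => e.2.2) heq
      obtain ⟨⟨a, b⟩, rfl, hab⟩ := Option.map_eq_some_iff.1 h₂
      obtain ⟨ha, rfl⟩ := Prod.mk.inj hab
      obtain ⟨g₁, g₂, g₃⟩ := hE _ he'
      obtain rfl := hstate g₁ hq (h₁.trans hq₀.symm)
      cases u with
      | nil => simp at hu₀
      | cons c u =>
        obtain ⟨hc, hu₀⟩ := List.cons.inj hu₀
        obtain ⟨w, r'', h₄, h₅, h₆, h₇, h₈⟩ :=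
          ih _ g₂ u (fun a ha => hu a (List.mem_cons_of_mem _ ha)) h₃ hu₀
        have g₄ := g₃ _ rfl
        obtain rfl := toFin_injOn (hu c List.mem_cons_self) g₄.1 (hc.trans ha.symm)
        refine ⟨b :: w, r'', h₄, h₅, by rw [h₆]; rfl, ?_, .letter he' h₈⟩
        intro z hz
        rcases List.mem_cons.1 hz with rfl | hz
        exacts [g₄.2, h₇ z hz]
  exact key _ _ _ _ h q hq u hu rfl rfl

/-- The relation recognized by `mkTransducer` on words of letters. -/
theorem mkTransducer_rel_iff (hinj : Set.InjOn num G) (hk : ∀ q ∈ G, num q ≤ k)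
    (hE : ∀ e ∈ E, GoodEdge G N e) (hi : i ∈ G) (hF : ∀ q ∈ F, q ∈ G) {u : List Ltr}
    (hu : IsWord N u) {v : List (Fin (N + 1))} :
    (mkTransducer num N k i F E).Rel (u.map (toFin N)) v ↔
      ∃ w, v = w.map (toFin N) ∧ IsWord N w ∧ ∃ q ∈ F, LRun {e | e ∈ E} i u w q := by
  constructor
  · rintro ⟨q, hq, h⟩
    obtain ⟨w, r, h₁, h₂, h₃, h₄, h₅⟩ := lRun_of_mkTransducer_run hinj hk hE hi hu h
    obtain ⟨q', hq', rfl⟩ := List.mem_map.1 hq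
    refine ⟨w, h₃, h₄, q', hq', ?_⟩
    have := congrArg Fin.val h₂
    simp [Nat.mod_eq_of_lt (Nat.lt_succ_of_le (hk r h₁)),
      Nat.mod_eq_of_lt (Nat.lt_succ_of_le (hk q' (hF q' hq')))] at this
    rwa [hinj (hF q' hq') h₁ this]
  · rintro ⟨w, rfl, -, q, hq, h⟩
    exact ⟨_, List.mem_map.2 ⟨q, hq, rfl⟩, mkTransducer_run_of_lRun h⟩

end

/-! ### The transducers of the doubly succinct automaton -/

/-- The letter for a mode. -/
def Mode.ltr : Mode → Ltr
  | N => .data 0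
  | A1 => .data 1
  | A2 => .data 2
  | B1 => .data 3
  | B2 => .data 4

/-- The first letter of the initial state. -/
def startLtr : Ltr := .data 5

/-- The letter for an optional number. -/
def optLtr {k : ℕ} : Option (Fin k) → Ltr
  | none => .blank
  | some i => .data i

/-- The states of the transducers for `ε`. In this order: the initial state; the gadgets for the
bracket operations, which handle the first letters, the stack with brackets, and the tracks of
the letters of the current state; for the edges of the PDA; for deleted letters; for forgetting the
stack; for the first step and for the last step. -/
inductive EpsState (x : Instance)
  | init
  | rowHead (r : Fin 8)
  | rowStack (r : Fin 8)
  | row (r : Fin 8)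
  | rowTrack (r : Fin 8)
  | rowFst (r : Fin 8) (p q : Fin x.pda.numLetters)
  | rowSnd (r : Fin 8) (q : Fin x.pda.numLetters)
  | pdaHead (a : Option (Fin x.numInput)) (op : StackOp (Fin x.pda.numStack))
  | pdaStack (a : Option (Fin x.numInput)) (op : StackOp (Fin x.pda.numStack))
  | pda (a : Option (Fin x.numInput)) (op : StackOp (Fin x.pda.numStack))
      (q : Fin (x.pda.transducer a op).numStates)
  | pdaTrack (a : Option (Fin x.numInput)) (op : StackOp (Fin x.pda.numStack))
      (q : Fin (x.pda.transducer a op).numStates)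
  | dropHead
  | drop
  | clearHead
  | clear
  | clearTrack
  | startHead
  | startCount
  | start (i : ℕ)
  | startTrack (i : ℕ)
  | finishHead
  | finish (i : ℕ)
  | finishTrack (i : ℕ)

/-- The length of the code of an input. -/
def Instance.size (x : Instance) : ℕ := (Code.input x).length

/-- The letters other than `hash`. -/
def plainLtrs (x : Instance) : List Ltr :=
  [.zero, .bracket, .one, .blank] ++ (List.range x.size).map .data

/-- The letters below the stack with brackets. -/
def baseLtrs : List Ltr := [.zero, .one, .blank]

/-- The edges of the transducer for `ε`. -/
inductive EpsEdge (x : Instance) : EpsState x → Option (Ltr × Ltr) → EpsState x → Prop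
  | row_head (r : Fin 8) :
      EpsEdge x .init (some ((bracketOp r).src.ltr, (bracketOp r).dst.ltr)) (.rowHead r)
  | row_stack (r : Fin 8) (h : (bracketOp r).atTop = true) :
      EpsEdge x (.rowHead r) (some (.blank, .blank)) (.rowStack r)
  | row_skip (r : Fin 8) (h : (bracketOp r).atTop = false) :
      EpsEdge x (.rowHead r) (some (.blank, .blank)) (.row r)
  | row_base (r : Fin 8) (h : (bracketOp r).atTop = true) {l : Ltr} (hl : l ∈ baseLtrs) :
      EpsEdge x (.rowStack r) (some (l, l)) (.rowStack r)
  | row_top (r : Fin 8) (h : (bracketOp r).atTop = true) :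
      EpsEdge x (.rowStack r) (some (if (bracketOp r).before then .bracket else .blank,
        if (bracketOp r).after then .bracket else .blank)) (.row r)
  | row_copy (r : Fin 8) {l : Ltr} (hl : l ∈ plainLtrs x) : EpsEdge x (.row r) (some (l, l))
    (.row r)
  | row_hash (r : Fin 8) : EpsEdge x (.row r) (some (.hash, .hash)) (.rowTrack r)
  | row_cur (r : Fin 8) (p q : Fin x.pda.numLetters) :
      EpsEdge x (.rowTrack r) (some (.data (pick (bracketOp r).s p q),
        .data (pick (bracketOp r).t p q))) (.rowFst r p q)
  | row_blank (r : Fin 8) (p q : Fin x.pda.numLetters) :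
      EpsEdge x (.rowFst r p q) (some (.blank, .blank)) (.rowFst r p q)
  | row_fst (r : Fin 8) (p q : Fin x.pda.numLetters) :
      EpsEdge x (.rowFst r p q) (some (if (bracketOp r).before then .data p else .blank,
        if (bracketOp r).after then .data p else .blank)) (.rowSnd r q)
  | row_blank' (r : Fin 8) (q : Fin x.pda.numLetters) :
      EpsEdge x (.rowSnd r q) (some (.blank, .blank)) (.rowSnd r q)
  | row_snd (r : Fin 8) (q : Fin x.pda.numLetters) :
      EpsEdge x (.rowSnd r q) (some (if (bracketOp r).before then .data q else .blank,
        if (bracketOp r).after then .data q else .blank)) (.row r)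
  | pda_head (m : Mode) (a : Option (Fin x.numInput)) (op : StackOp (Fin x.pda.numStack)) :
      EpsEdge x .init (some (m.ltr, m.ltr)) (.pdaHead a op)
  | pda_skip (a : Option (Fin x.numInput)) :
      EpsEdge x (.pdaHead a .skip) (some (optLtr a, .blank))
        (.pda a .skip (x.pda.transducer a _).init)
  | pda_stack (a : Option (Fin x.numInput)) {op : StackOp (Fin x.pda.numStack)} (h : op ≠ .skip) :
      EpsEdge x (.pdaHead a op) (some (optLtr a, .blank)) (.pdaStack a op)
  | pda_base (a : Option (Fin x.numInput)) {op : StackOp (Fin x.pda.numStack)} (h : op ≠ .skip)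
      {l : Ltr} (hl : l ∈ baseLtrs) : EpsEdge x (.pdaStack a op) (some (l, l)) (.pdaStack a op)
  | pda_push (a : Option (Fin x.numInput)) (γ : Fin x.pda.numStack) :
      EpsEdge x (.pdaStack a (.push γ)) (some (.blank, .data γ))
        (.pda a (.push γ) (x.pda.transducer a _).init)
  | pda_pop (a : Option (Fin x.numInput)) (γ : Fin x.pda.numStack) :
      EpsEdge x (.pdaStack a (.pop γ)) (some (.data γ, .blank))
        (.pda a (.pop γ) (x.pda.transducer a _).init)
  | pda_copy (a : Option (Fin x.numInput)) (op : StackOp (Fin x.pda.numStack))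
      (q : Fin (x.pda.transducer a op).numStates) {l : Ltr} (hl : l ∈ plainLtrs x) :
      EpsEdge x (.pda a op q) (some (l, l)) (.pda a op q)
  | pda_hash (a : Option (Fin x.numInput)) (op : StackOp (Fin x.pda.numStack))
      (q : Fin (x.pda.transducer a op).numStates) :
      EpsEdge x (.pda a op q) (some (.hash, .hash)) (.pdaTrack a op q)
  | pda_eps (a : Option (Fin x.numInput)) (op : StackOp (Fin x.pda.numStack))
      {q q' : Fin (x.pda.transducer a op).numStates}
      (h : (q, none, q') ∈ (x.pda.transducer a op).edges) :
      EpsEdge x (.pda a op q) none (.pda a op q')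
  | pda_letter (a : Option (Fin x.numInput)) (op : StackOp (Fin x.pda.numStack))
      {q q' : Fin (x.pda.transducer a op).numStates} {y z : Fin x.pda.numLetters}
      (h : (q, some (y, z), q') ∈ (x.pda.transducer a op).edges) :
      EpsEdge x (.pdaTrack a op q) (some (.data y, .data z)) (.pda a op q')
  | drop_head (m : Mode) : EpsEdge x .init (some (m.ltr, m.ltr)) .dropHead
  | drop_letter {a : Fin x.numInput} (ha : a ∉ x.Θ) :
      EpsEdge x .dropHead (some (.blank, .data a)) .drop
  | drop_copy {l : Ltr} (hl : l ∈ plainLtrs x) : EpsEdge x .drop (some (l, l)) .drop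
  | drop_hash : EpsEdge x .drop (some (.hash, .hash)) .drop
  | clear_head : EpsEdge x .init (some (Mode.N.ltr, Mode.N.ltr)) .clearHead
  | clear_pend : EpsEdge x .clearHead (some (.blank, .blank)) .clear
  | clear_base {l : Ltr} (hl : l ∈ baseLtrs) : EpsEdge x .clear (some (l, l)) .clear
  | clear_bracket : EpsEdge x .clear (some (.bracket, .blank)) .clear
  | clear_data {i : ℕ} (hi : i < x.size) : EpsEdge x .clear (some (.data i, .blank)) .clear
  | clear_hash : EpsEdge x .clear (some (.hash, .hash)) .clearTrack
  | clear_cur {i : ℕ} (hi : i < x.size) : EpsEdge x .clearTrack (some (.data i, .data i)) .clear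
  | start_head : EpsEdge x .init (some (startLtr, Mode.N.ltr)) .startHead
  | start_pend : EpsEdge x .startHead (some (.blank, .blank)) .startCount
  | start_base {l : Ltr} (hl : l ∈ baseLtrs) : EpsEdge x .startCount (some (l, l)) .startCount
  | start_blank : EpsEdge x .startCount (some (.hash, .blank)) .startCount
  | start_bottom : EpsEdge x .startCount (some (.hash, optLtr x.pda.bottom)) (.start 0)
  | start_pad {i : ℕ} (hi : i ≤ x.pda.n) : EpsEdge x (.start i) (some (.hash, .blank)) (.start i)
  | start_hash {i : ℕ} (hi : i < x.pda.n) :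
      EpsEdge x (.start i) (some (.hash, .hash)) (.startTrack i)
  | start_cur (i : Fin x.pda.n) :
      EpsEdge x (.startTrack i) (some (.hash, .data (x.pda.start.get i))) (.start (i + 1))
  | finish_head : EpsEdge x .init (some (Mode.N.ltr, .zero)) .finishHead
  | finish_pend : EpsEdge x .finishHead (some (.blank, .zero)) (.finish 0)
  | finish_copy {i : ℕ} (hi : i ≤ x.pda.n) {l : Ltr} (hl : l ∈ plainLtrs x) :
      EpsEdge x (.finish i) (some (l, .zero)) (.finish i)
  | finish_hash {i : ℕ} (hi : i < x.pda.n) : EpsEdge x (.finish i) (some (.hash, .zero))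
    (.finishTrack i)
  | finish_cur (i : Fin x.pda.n) :
      EpsEdge x (.finishTrack i) (some (.data (x.pda.final.get i), .zero)) (.finish (i + 1))

/-- The final states of the transducer for `ε`. -/
inductive EpsFinal (x : Instance) : EpsState x → Prop
  | row (r : Fin 8) : EpsFinal x (.row r)
  | pda (a : Option (Fin x.numInput)) (op : StackOp (Fin x.pda.numStack))
      {q : Fin (x.pda.transducer a op).numStates} (h : q ∈ (x.pda.transducer a op).final) :
      EpsFinal x (.pda a op q)
  | drop : EpsFinal x .drop
  | clear : EpsFinal x .clear
  | start : EpsFinal x (.start x.pda.n)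
  | finish : EpsFinal x (.finish x.pda.n)

/-- The edges of the transducer for `ε` as a set. -/
def epsEdgeSet (x : Instance) : Set (LEdge (EpsState x)) := {e | EpsEdge x e.1 e.2.1 e.2.2}

/-- The states of the transducers for letters. -/
inductive LetterState
  | init | head | count | copy

/-- The edges of the transducer for the letter `a`. The pending letter becomes `a`; if `a ∈ Θ`,
the counter, with the least significant bit first, is decremented. -/
inductive LetterEdge (x : Instance) (a : Fin x.numInput) :
    LetterState → Option (Ltr × Ltr) → LetterState → Prop
  | theta_head (h : a ∈ x.Θ) : LetterEdge x a .init (some (Mode.N.ltr, Mode.N.ltr)) .head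
  | theta_pend (h : a ∈ x.Θ) : LetterEdge x a .head (some (.blank, .data a)) .count
  | borrow (h : a ∈ x.Θ) : LetterEdge x a .count (some (.zero, .one)) .count
  | decrement (h : a ∈ x.Θ) : LetterEdge x a .count (some (.one, .zero)) .copy
  | free_head (h : a ∉ x.Θ) {m : Mode} (hm : m.reads = true) :
      LetterEdge x a .init (some (m.ltr, m.ltr)) .head
  | free_pend (h : a ∉ x.Θ) : LetterEdge x a .head (some (.blank, .data a)) .copy
  | copy {l : Ltr} (hl : l ∈ plainLtrs x) : LetterEdge x a .copy (some (l, l)) .copy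
  | hash : LetterEdge x a .copy (some (.hash, .hash)) .copy

/-- The edges of the transducer for a letter as a set. -/
def letterEdgeSet (x : Instance) (a : Fin x.numInput) : Set (LEdge LetterState) :=
  {e | LetterEdge x a e.1 e.2.1 e.2.2}

/-! ### Words that represent configurations -/

/-- The track of a letter of the current state: this letter, and the corresponding letters of the
states of the brackets. -/
abbrev Track := Ltr × List Ltr

/-- A track as a word. -/
def Track.word (G : Track) : List Ltr := .hash :: G.1 :: G.2

/-- The word with the given first two letters, counter and stack, and tracks. -/
def confWord (m a : Ltr) (u : List Ltr) (G : List Track) : List Ltr :=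
  m :: a :: (u ++ G.flatMap Track.word)

/-- The bits in a word. -/
def bitsOf : List Ltr → List Bool :=
  List.filterMap fun | .zero => some false | .one => some true | _ => none

/-- The stack with brackets in a word. -/
def stackOf : List Ltr → List (Option ℕ) :=
  List.filterMap fun | .bracket => some none | .data i => some (some i) | _ => none

/-- The numbers in a word. -/
def dataOf : List Ltr → List ℕ :=
  List.filterMap fun | .data i => some i | _ => none

/-- The value of a binary number, least significant bit first. -/
def bitsVal : List Bool → ℕ := List.foldr Nat.bit 0

/-- The states of the explicit PDA. -/
abbrev PState (x : Instance) := List.Vector (Fin x.pda.numLetters) x.pda.n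

/-- The configurations of the pumping machine of the explicit PDA. -/
abbrev PConf (x : Instance) := Conf (PState x) (Fin x.numInput) (Fin x.pda.numStack)

/-- The word `W` represents the configuration `C`. The counter, the stack and the letters of the
states of the brackets can be padded with blanks at any place. -/
def Represents (x : Instance) (W : List Ltr) (C : PConf x) : Prop :=
  ∃ (u : List Ltr) (G : Fin x.pda.n → Track), W = confWord C.mode.ltr (optLtr C.pend) u
    (List.ofFn G) ∧
    Ltr.hash ∉ u ∧ bitsVal (bitsOf u) = C.cnt ∧ stackOf u = C.ctrl.map (Option.map Fin.val) ∧
    ∀ i, (G i).1 = .data (C.cur.get i) ∧ Ltr.hash ∉ (G i).2 ∧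
      dataOf (G i).2 = C.brs.map fun q => (q.get i).val

theorem exists_ofFn_of_forall₂ {α β : Type} {n : ℕ} {ρ : α → β → Prop} {f : Fin n → α} {l : List β}
    (h : List.Forall₂ ρ (List.ofFn f) l) : ∃ g : Fin n → β, l = List.ofFn g ∧
      ∀ i, ρ (f i) (g i) := by
  obtain ⟨hl, h⟩ := List.forall₂_iff_get.1 h
  rw [List.length_ofFn] at hl
  subst hl
  refine ⟨l.get, (List.ofFn_get l).symm, fun i => ?_⟩
  have := h i.1 (by simp) i.2
  simpa using this

theorem Mode.ltr_injective : Function.Injective Mode.ltr := by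
  intro a b h
  cases a <;> cases b <;> simp_all [Mode.ltr]

theorem optLtr_injective {k : ℕ} : Function.Injective (optLtr (k := k)) := by
  rintro (_ | a) (_ | b) h <;> simp_all [optLtr, Fin.ext_iff]

theorem optLtr_eq_blank {k : ℕ} {a : Option (Fin k)} (h : optLtr a = .blank) : a = none := by
  cases a <;> simp_all [optLtr]

/-- A state in which a run can be continued at the beginning of a track, or end. -/
def Exits {X : Type} (E : Set (LEdge X)) (F : X → Prop) (q : X) : Prop :=
  F q ∨ ∃ l r, (q, l, r) ∈ E ∧ ∀ p ∈ l, p.1 = .hash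

theorem LRun.exits {X : Type} {E : Set (LEdge X)} {F : X → Prop} {q f : X} {G : List Track}
    {v : List Ltr} (h : LRun E q (G.flatMap Track.word) v f) (hf : F f) : Exits E F q := by
  generalize hu : G.flatMap Track.word = u at h
  cases h with
  | nil => exact .inl hf
  | eps he _ => exact .inr ⟨_, _, he, by simp⟩
  | letter he _ =>
    cases G with
    | nil => simp at hu
    | cons G₀ G =>
      simp only [List.flatMap_cons, Track.word, List.cons_append, List.cons.injEq] at hu
      exact .inr ⟨_, _, he, by simp [hu.1]⟩

/-- Runs over tracks that return to the same state after each track. -/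
theorem LRun.tracks_inv {X : Type} {E : Set (LEdge X)} {F : X → Prop} {q f : X} {G : List Track}
    {v : List Ltr} {ρ : Track → Track → Prop} (h : LRun E q (G.flatMap Track.word) v f) (hf : F f)
    (hG : ∀ g ∈ G, Ltr.hash ∉ g.2) (hq : ∀ r, (q, none, r) ∉ E)
    (hρ : ∀ g v r, Ltr.hash ∉ g.2 → LRun E q (Track.word g) v r → Exits E F r →
      r = q ∧ ∃ g', v = Track.word g' ∧ ρ g g') :
    f = q ∧ ∃ G', v = G'.flatMap Track.word ∧ List.Forall₂ ρ G G' := by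
  induction G generalizing v with
  | nil =>
    obtain ⟨rfl, rfl⟩ := h.nil_inv hq
    exact ⟨rfl, [], rfl, .nil⟩
  | cons g G ih =>
    rw [List.flatMap_cons] at h
    obtain ⟨r, v₁, v₂, rfl, h₁, h₂⟩ := h.split
    obtain ⟨rfl, g', rfl, h₃⟩ := hρ g v₁ r (hG g List.mem_cons_self) h₁ (h₂.exits hf)
    obtain ⟨h₄, G', rfl, h₅⟩ := ih h₂ fun g hg => hG g (List.mem_cons_of_mem _ hg)
    exact ⟨h₄, g' :: G', rfl, .cons h₃ h₅⟩

theorem hash_notMem_plainLtrs (x : Instance) : Ltr.hash ∉ plainLtrs x := by simp [plainLtrs]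

theorem bitsOf_append (u v : List Ltr) : bitsOf (u ++ v) = bitsOf u ++ bitsOf v :=
  List.filterMap_append

theorem stackOf_append (u v : List Ltr) : stackOf (u ++ v) = stackOf u ++ stackOf v :=
  List.filterMap_append

theorem dataOf_append (u v : List Ltr) : dataOf (u ++ v) = dataOf u ++ dataOf v :=
  List.filterMap_append

theorem stackOf_eq_nil {u : List Ltr} (h : ∀ a ∈ u, a ∈ baseLtrs) : stackOf u = [] := by
  rw [stackOf, List.filterMap_eq_nil_iff]
  intro a ha
  have := h a ha
  simp only [baseLtrs, List.mem_cons, List.not_mem_nil, or_false] at this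
  rcases this with rfl | rfl | rfl <;> rfl

theorem dataOf_eq_nil {u : List Ltr} (h : ∀ a ∈ u, a = Ltr.blank) : dataOf u = [] := by
  rw [dataOf, List.filterMap_eq_nil_iff]
  intro a ha
  rw [h a ha]

/-! ### Soundness of the transducers -/

section
variable {x : Instance}

theorem eps_cons_inv {q s : EpsState x} {a : Ltr} {u v : List Ltr}
    (h : LRun (epsEdgeSet x) q (a :: u) v s) (hq : ∀ a op r, q ≠ .pda a op r) :
    ∃ b r v' l, v = b :: v' ∧ l = some (a, b) ∧ EpsEdge x q l r ∧ LRun (epsEdgeSet x) r u v' s := by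
  have hq' : ∀ r, (q, none, r) ∉ epsEdgeSet x := by
    intro r hr
    cases (show EpsEdge x q none r from hr)
    exact hq _ _ _ rfl
  obtain ⟨b, r, v', rfl, he, h⟩ := h.cons_inv hq'
  exact ⟨b, r, v', _, rfl, rfl, he, h⟩

theorem eps_nil_inv {q s : EpsState x} {v : List Ltr}
    (h : LRun (epsEdgeSet x) q [] v s) (hq : ∀ a op r, q ≠ .pda a op r) : v = [] ∧ s = q := by
  refine h.nil_inv fun r hr => ?_
  cases (show EpsEdge x q none r from hr)
  exact hq _ _ _ rfl

theorem eps_stay_inv {q s : EpsState x} {u v : List Ltr} (h : LRun (epsEdgeSet x) q u v s)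
    {ρ : Ltr → Ltr → Prop} (hq : ∀ a op r, q ≠ .pda a op r)
    (hρ : ∀ a b l r, a ∈ u → l = some (a, b) → EpsEdge x q l r → r = q ∧ ρ a b) :
    List.Forall₂ ρ u v ∧ s = q := by
  refine h.stay_inv (fun r hr => ?_) fun a ha b r he => hρ a b _ r ha rfl he
  cases (show EpsEdge x q none r from hr)
  exact hq _ _ _ rfl

theorem eps_loop_inv {q s : EpsState x} {u v : List Ltr} (h : LRun (epsEdgeSet x) q u v s)
    (ρ : Ltr → Ltr → Prop) (hq : ∀ a op r, q ≠ .pda a op r)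
    (hρ : ∀ a b l, l = some (a, b) → EpsEdge x q l q → ρ a b) :
    (List.Forall₂ ρ u v ∧ s = q) ∨ ∃ u₁ v₁ a b r u₂ v₂ l, u = u₁ ++ a :: u₂ ∧ v = v₁ ++ b :: v₂ ∧
      List.Forall₂ ρ u₁ v₁ ∧ l = some (a, b) ∧ EpsEdge x q l r ∧ r ≠ q ∧
      LRun (epsEdgeSet x) r u₂ v₂ s := by
  have hq' : ∀ r, (q, none, r) ∉ epsEdgeSet x := by
    intro r hr
    cases (show EpsEdge x q none r from hr)
    exact hq _ _ _ rfl
  rcases h.loop_inv (ρ := ρ) hq' fun a b he => hρ a b _ rfl he with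
    h | ⟨u₁, v₁, a, b, r, u₂, v₂, h₁, h₂, h₃, h₄, h₅, h₆⟩
  exacts [.inl h, .inr ⟨u₁, v₁, a, b, r, u₂, v₂, _, h₁, h₂, h₃, rfl, h₄, h₅, h₆⟩]

theorem eps_exits_inv {q : EpsState x} (h : Exits (epsEdgeSet x) (EpsFinal x) q) :
    EpsFinal x q ∨ ∃ l r, EpsEdge x q l r ∧ (l = none ∨ ∃ b, l = some (.hash, b)) := by
  rcases h with h | ⟨_ | ⟨a, b⟩, r, he, hl⟩
  · exact .inl h
  · exact .inr ⟨_, r, he, .inl rfl⟩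
  · exact .inr ⟨_, r, he, .inr ⟨b, by rw [← hl _ rfl]⟩⟩

theorem forall₂_eq {α : Type} {u v : List α} (h : List.Forall₂ (fun a b => b = a) u v) : v = u := by
  induction h with
  | nil => rfl
  | cons h _ ih => rw [h, ih]

theorem dataOf_cons_ite (c : Prop) [Decidable c] (i : ℕ) (u : List Ltr) :
    dataOf ((if c then .data i else .blank) :: u) = if c then i :: dataOf u else dataOf u := by
  split <;> rfl

/-- Two words that agree up to their letters in `baseLtrs`. -/
theorem forall₂_base {u v : List Ltr} (h : List.Forall₂ (fun a b => b = a ∧ a ∈ baseLtrs) u v) :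
    v = u ∧ stackOf u = [] ∧ Ltr.hash ∉ u := by
  have hb : ∀ a ∈ u, a ∈ baseLtrs := by
    induction h with
    | nil => simp
    | cons h _ ih => simpa using ⟨h.2, ih⟩
  exact ⟨forall₂_eq (h.imp fun _ _ h => h.1), stackOf_eq_nil hb,
    fun h => absurd (hb _ h) (by simp [baseLtrs])⟩

theorem row_copy_inv {r : Fin 8} {s : EpsState x} {u v : List Ltr}
    (h : LRun (epsEdgeSet x) (.row r) u v s) (hu : Ltr.hash ∉ u) : v = u ∧ s = .row r := by
  obtain ⟨h₁, h₂⟩ := eps_stay_inv (ρ := fun a b => b = a) h nofun fun a b l r ha hl he => by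
    cases he <;> grind
  exact ⟨forall₂_eq h₁, h₂⟩

/-- What the gadget for a bracket operation does to the counter and the stack. -/
theorem row_stack_inv {r : Fin 8} {s : EpsState x} {u v : List Ltr} {G : List Track}
    (h : LRun (epsEdgeSet x) (if (bracketOp r).atTop then .rowStack r else .row r)
      (u ++ G.flatMap Track.word) v s) (hs : EpsFinal x s) (hu : Ltr.hash ∉ u) :
    ∃ u' v' c, v = u' ++ v' ∧ Ltr.hash ∉ u' ∧ bitsOf u' = bitsOf u ∧
      LRun (epsEdgeSet x) (.row r) (G.flatMap Track.word) v' s ∧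
      stackOf u = (if (bracketOp r).atTop && (bracketOp r).before then none :: c else c) ∧
      stackOf u' = (if (bracketOp r).atTop && (bracketOp r).after then none :: c else c) := by
  obtain ⟨t, v₁, v₂, rfl, h₁, h₂⟩ := h.split
  by_cases htop : (bracketOp r).atTop = true
  · rw [if_pos htop] at h₁
    rcases eps_loop_inv h₁ (fun a b => b = a ∧ a ∈ baseLtrs) nofun (fun a b l hl he => by
      cases he; grind) with ⟨-, rfl⟩ | ⟨u₁, w₁, a, b, t', u₂, w₂, l, rfl, rfl, h₃, hl, he, ht, h₄⟩
    · rcases eps_exits_inv (h₂.exits hs) with hf | ⟨l, t, he, hl⟩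
      · cases hf
      · cases he <;> grind [baseLtrs]
    · obtain ⟨rfl, h₅, h₆⟩ := forall₂_base h₃
      cases he with
      | row_base => exact absurd rfl ht
      | row_top =>
        simp only [Option.some.injEq, Prod.mk.injEq] at hl
        have hu₂ : Ltr.hash ∉ u₂ := fun h => hu (by simp [h])
        obtain ⟨rfl, rfl⟩ := row_copy_inv h₄ hu₂
        refine ⟨_, v₂, stackOf w₂, rfl, ?_, ?_, h₂, ?_, ?_⟩
        · rw [← hl.2]
          simp only [List.mem_append, List.mem_cons, not_or]
          refine ⟨h₆, ?_, hu₂⟩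
          split <;> simp
        · rw [← hl.1, ← hl.2, bitsOf_append, bitsOf_append]
          congr 1
          cases (bracketOp r).before <;> cases (bracketOp r).after <;> rfl
        · rw [← hl.1, stackOf_append, h₅, htop]
          cases (bracketOp r).before <;> rfl
        · rw [← hl.2, stackOf_append, h₅, htop]
          cases (bracketOp r).after <;> rfl
  · rw [if_neg htop] at h₁
    obtain ⟨rfl, rfl⟩ := row_copy_inv h₁ hu
    exact ⟨v₁, v₂, stackOf v₁, rfl, hu, rfl, h₂, by simp [htop], by simp [htop]⟩

/-- What the gadget for a bracket operation does to a track. -/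
theorem row_track_inv {r : Fin 8} {s : EpsState x} {v : List Ltr} {g : Track}
    (h : LRun (epsEdgeSet x) (.row r) (Track.word g) v s)
    (hs : Exits (epsEdgeSet x) (EpsFinal x) s) (hg : Ltr.hash ∉ g.2) :
    s = .row r ∧ ∃ g' : Track, v = Track.word g' ∧ ∃ (p q : Fin x.pda.numLetters) (b : List ℕ),
      g.1 = .data (pick (bracketOp r).s p q) ∧ g'.1 = .data (pick (bracketOp r).t p q) ∧
      Ltr.hash ∉ g'.2 ∧ dataOf g.2 = (if (bracketOp r).before then p.1 :: q.1 :: b else b) ∧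
      dataOf g'.2 = (if (bracketOp r).after then p.1 :: q.1 :: b else b) := by
  have hblank : ∀ {u w : List Ltr}, List.Forall₂ (fun a b => a = .blank ∧ b = .blank) u w →
      dataOf u = [] ∧ dataOf w = [] ∧ Ltr.hash ∉ w := by
    intro u w h
    induction h with
    | nil => exact ⟨rfl, rfl, by simp⟩
    | cons h _ ih =>
      obtain ⟨rfl, rfl⟩ := h
      exact ⟨ih.1, ih.2.1, by simpa using ih.2.2⟩
  obtain ⟨b, t, v, l, rfl, hl, he, h'⟩ := eps_cons_inv h nofun
  clear h
  cases he with
  | row_copy r hl' =>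
    simp only [Option.some.injEq, Prod.mk.injEq] at hl
    exact absurd (hl.1 ▸ hl') (hash_notMem_plainLtrs x)
  | row_hash =>
  simp only [Option.some.injEq, Prod.mk.injEq, true_and] at hl
  subst hl
  obtain ⟨b, t, v, l, rfl, hl, he, h⟩ := eps_cons_inv h' nofun
  clear h'
  cases he with
  | row_cur r p q =>
  simp only [Option.some.injEq, Prod.mk.injEq] at hl
  obtain ⟨hl₁, rfl⟩ := hl
  rcases eps_loop_inv h (fun a b => a = .blank ∧ b = .blank) nofun (fun a b l hl he => by
    cases he; grind) with
    ⟨-, rfl⟩ | ⟨u₁, w₁, a, b, t', u₂, w₂, l, hg₂, rfl, h₃, hl, he, ht, h₄⟩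
  · rcases eps_exits_inv hs with hf | ⟨l, t, he, hl⟩
    · cases hf
    · cases he <;> grind
  cases he with
  | row_blank => exact absurd rfl ht
  | row_fst =>
  simp only [Option.some.injEq, Prod.mk.injEq] at hl
  obtain ⟨rfl, rfl⟩ := hl
  obtain ⟨k₁, k₂, k₃⟩ := hblank h₃
  rcases eps_loop_inv h₄ (fun a b => a = .blank ∧ b = .blank) nofun (fun a b l hl he => by
    cases he; grind) with
    ⟨-, rfl⟩ | ⟨u₃, w₃, a, b, t', u₄, w₄, l, rfl, rfl, h₅, hl, he, ht, h₆⟩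
  · rcases eps_exits_inv hs with hf | ⟨l, t, he, hl⟩
    · cases hf
    · cases he <;> grind
  cases he with
  | row_blank' => exact absurd rfl ht
  | row_snd =>
  simp only [Option.some.injEq, Prod.mk.injEq] at hl
  obtain ⟨rfl, rfl⟩ := hl
  obtain ⟨k₄, k₅, k₆⟩ := hblank h₅
  rw [hg₂] at hg
  have hu₄ : Ltr.hash ∉ u₄ := fun h => hg (by simp [h])
  obtain ⟨rfl, rfl⟩ := row_copy_inv h₆ hu₄
  refine ⟨rfl, ⟨_, _⟩, rfl, p, q, dataOf w₄, hl₁.symm, rfl, ?_, ?_, ?_⟩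
  · simp only [List.mem_append, List.mem_cons, not_or]
    refine ⟨k₃, ?_, k₆, ?_, hu₄⟩ <;> split <;> simp
  · rw [hg₂, dataOf_append, k₁, List.nil_append, dataOf_cons_ite, dataOf_append, k₄,
      List.nil_append, dataOf_cons_ite]
    split <;> rfl
  · rw [dataOf_append, k₂, List.nil_append, dataOf_cons_ite, dataOf_append, k₅,
      List.nil_append, dataOf_cons_ite]
    split <;> rfl

/-- The gadget for a bracket operation performs this operation. -/
theorem row_sound {r : Fin 8} {s : EpsState x} {v : List Ltr} {C : PConf x}
    (hC : Pump.Balanced C) (hm : C.mode = (bracketOp r).src) {u : List Ltr}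
    {G : Fin x.pda.n → Track} (hu : Ltr.hash ∉ u) (hcnt : bitsVal (bitsOf u) = C.cnt)
    (hstack : stackOf u = C.ctrl.map (Option.map Fin.val))
    (hG : ∀ i, (G i).1 = .data (C.cur.get i) ∧ Ltr.hash ∉ (G i).2 ∧
      dataOf (G i).2 = C.brs.map fun q => (q.get i).val)
    (h : LRun (epsEdgeSet x) (.rowHead r)
      (optLtr C.pend :: (u ++ (List.ofFn G).flatMap Track.word)) v s) (hs : EpsFinal x s) :
    ∃ C', Represents x ((bracketOp r).dst.ltr :: v) C' ∧
      PumpStep x.pda.explicit x.Θ none C C' := by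
  obtain ⟨b, t, v, l, rfl, hl, he, h'⟩ := eps_cons_inv h nofun
  clear h
  obtain ⟨hpend, rfl, rfl⟩ : C.pend = none ∧ b = .blank ∧
      t = (if (bracketOp r).atTop then .rowStack r else .row r) := by
    cases he <;> simp only [Option.some.injEq, Prod.mk.injEq] at hl <;>
      exact ⟨optLtr_eq_blank hl.1.symm, hl.2.symm, by simp_all⟩
  obtain ⟨u', v', c, rfl, hu', hbits, h₁, hc, hc'⟩ := row_stack_inv h' hs hu
  obtain ⟨rfl, G₁, rfl, hG₁⟩ := h₁.tracks_inv (F := EpsFinal x) hs (by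
    intro g hg
    obtain ⟨i, rfl⟩ := (List.mem_ofFn' _ _).1 hg
    exact (hG i).2.1) (fun t ht => by cases (show EpsEdge x _ none t from ht))
    fun g v t hg h hs => row_track_inv h hs hg
  obtain ⟨G', rfl, hG'⟩ := exists_ofFn_of_forall₂ hG₁
  choose p q b h₁ h₂ h₃ h₄ h₅ using hG'
  have hbrs : ∃ P Q B, C.brs = (if (bracketOp r).before then P :: Q :: B else B) ∧
      ∀ i, P.get i = p i ∧ Q.get i = q i ∧ b i = B.map fun q => (q.get i).val := by
    by_cases hb : (bracketOp r).before = true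
    · have : 2 ≤ C.brs.length := by
        have h₁ := hC.1
        by_cases htop : (bracketOp r).atTop = true
        · rw [hstack, htop, hb] at hc
          match hctrl : C.ctrl, hc with
          | none :: d, _ =>
            rw [hctrl] at h₁
            simp at h₁
            omega
        · have : C.mode ≠ .N := by
            rw [hm]
            fin_cases r <;> simp_all [bracketOp]
          have := List.length_pos_iff.2 (hC.2 this)
          omega
      match hbrs : C.brs, this with
      | P :: Q :: B, _ =>
      refine ⟨P, Q, B, by simp [hb], fun i => ?_⟩
      have := h₄ i
      rw [(hG i).2.2, hbrs] at this
      simp [hb] at this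
      exact ⟨Fin.ext this.1, Fin.ext this.2.1, this.2.2.symm⟩
    · refine ⟨List.Vector.ofFn p, List.Vector.ofFn q, C.brs, by simp [hb], fun i => ?_⟩
      have := h₄ i
      rw [(hG i).2.2] at this
      simp [hb] at this
      simp [this]
  obtain ⟨P, Q, B, hB, hPQ⟩ := hbrs
  obtain ⟨d, hd, rfl⟩ : ∃ d : List (Option (Fin x.pda.numStack)),
      C.ctrl = (if (bracketOp r).atTop && (bracketOp r).before then none :: d else d) ∧
        c = d.map (Option.map Fin.val) := by
    rw [hstack] at hc
    split at hc
    · match hctrl : C.ctrl, hc with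
      | none :: d, hc => exact ⟨d, by simp_all, by simpa using hc.symm⟩
      | some _ :: d, hc => simp at hc
    · exact ⟨C.ctrl, by simp_all, hc.symm⟩
  have hpick : ∀ (b : Bool) i, ((pick b P Q).get i).val = pick b (p i).val (q i).val := by
    intro b i
    cases b
    exacts [congrArg Fin.val (hPQ i).1, congrArg Fin.val (hPQ i).2.1]
  refine ⟨⟨(bracketOp r).dst, none, C.cnt, pick (bracketOp r).t P Q,
    if (bracketOp r).atTop && (bracketOp r).after then none :: d else d,
    if (bracketOp r).after then P :: Q :: B else B⟩,
    ⟨u', G', rfl, hu', hbits ▸ hcnt, ?_, fun i => ?_⟩,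
    ?_⟩
  · rw [hc']
    split <;> rfl
  · refine ⟨?_, h₃ i, ?_⟩
    · rw [h₂]
      exact congrArg Ltr.data (hpick _ i).symm
    · rw [h₅, (hPQ i).2.2]
      split
      · simp [(hPQ i).1, (hPQ i).2.1]
      · rfl
  · have hcur : C.cur = pick (bracketOp r).s P Q := by
      refine List.Vector.ext fun i => Fin.ext ?_
      have := (hG i).1.symm.trans (h₁ i)
      rw [hpick]
      exact Ltr.data.inj this
    have hCeq : C = ⟨(bracketOp r).src, none, C.cnt, pick (bracketOp r).s P Q,
        if (bracketOp r).atTop && (bracketOp r).before then none :: d else d,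
        if (bracketOp r).before then P :: Q :: B else B⟩ :=
      Conf.ext hm hpend rfl hcur hd hB
    rw [hCeq]
    exact .bracket r P Q

end

section
variable {x : Instance}

theorem Transducer.Run.trans {D : Type} {T : Transducer D} {q r s : Fin T.numStates}
    {u v u' v' : List D} (h : T.Run q u v r) (h' : T.Run r u' v' s) :
    T.Run q (u ++ u') (v ++ v') s := by
  induction h with
  | refl => exact h'
  | eps he _ ih => exact .eps he (ih h')
  | letter he _ ih => exact .letter he (ih h')

/-- Up to the next track, the gadget for edges of the PDA copies its input; meanwhile the transducer
of the PDA can only take steps on `ε`. -/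
theorem pda_copy_inv {a : Option (Fin x.numInput)} {op : StackOp (Fin x.pda.numStack)}
    {q : Fin (x.pda.transducer a op).numStates} {u v : List Ltr} {s : EpsState x}
    (h : LRun (epsEdgeSet x) (.pda a op q) u v s) (hu : Ltr.hash ∉ u) :
    v = u ∧ ∃ r, s = .pda a op r ∧ (x.pda.transducer a op).Run q [] [] r := by
  generalize hq : EpsState.pda a op q = q' at h
  induction h generalizing q with
  | nil => exact ⟨rfl, q, hq.symm, .refl q⟩
  | @eps _ t s u v he _ ih =>
    subst hq
    generalize hl : none = l at he
    cases (show EpsEdge x _ l t from he) with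
    | pda_eps _ _ h =>
      obtain ⟨h₁, r, h₂, h₃⟩ := ih hu rfl
      exact ⟨h₁, r, h₂, .eps h h₃⟩
    | pda_copy => simp at hl
    | pda_hash => simp at hl
  | @letter _ t s b c u v he _ ih =>
    subst hq
    simp only [List.mem_cons, not_or] at hu
    generalize hl : some (b, c) = l at he
    cases (show EpsEdge x _ l t from he) with
    | pda_eps => simp at hl
    | pda_copy =>
      obtain ⟨rfl, r, h₂, h₃⟩ := ih hu.2 rfl
      simp only [Option.some.injEq, Prod.mk.injEq] at hl
      exact ⟨by rw [hl.1, hl.2], r, h₂, h₃⟩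
    | pda_hash => exact absurd (by simp at hl; exact hl.1.symm) hu.1

theorem pda_hash_inv {a : Option (Fin x.numInput)} {op : StackOp (Fin x.pda.numStack)}
    {q : Fin (x.pda.transducer a op).numStates} {u v : List Ltr} {s : EpsState x}
    (h : LRun (epsEdgeSet x) (.pda a op q) (.hash :: u) v s) :
    ∃ r v', v = .hash :: v' ∧ (x.pda.transducer a op).Run q [] [] r ∧
      LRun (epsEdgeSet x) (.pdaTrack a op r) u v' s := by
  generalize hq : EpsState.pda a op q = q' at h
  generalize hw : Ltr.hash :: u = w at h
  induction h generalizing q with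
  | nil => simp at hw
  | @eps _ t s u v he _ ih =>
    subst hq
    generalize hl : none = l at he
    cases (show EpsEdge x _ l t from he) with
    | pda_eps _ _ h =>
      obtain ⟨r, v', h₁, h₂, h₃⟩ := ih rfl hw
      exact ⟨r, v', h₁, .eps h h₂, h₃⟩
    | pda_copy => simp at hl
    | pda_hash => simp at hl
  | @letter _ t s b c u v he h ih =>
    subst hq
    obtain ⟨rfl, rfl⟩ := List.cons.inj hw
    generalize hl : some (Ltr.hash, c) = l at he
    cases (show EpsEdge x _ l t from he) with
    | pda_eps => simp at hl
    | pda_copy _ _ _ hl' =>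
      simp only [Option.some.injEq, Prod.mk.injEq] at hl
      exact absurd (hl.1 ▸ hl') (hash_notMem_plainLtrs x)
    | pda_hash =>
      simp only [Option.some.injEq, Prod.mk.injEq, true_and] at hl
      exact ⟨q, v, by rw [hl], .refl q, h⟩

/-- On the tracks, the gadget for edges of the PDA applies the transducer of the PDA to the current
state. -/
theorem pda_tracks_inv {a : Option (Fin x.numInput)} {op : StackOp (Fin x.pda.numStack)}
    {q : Fin (x.pda.transducer a op).numStates} {G : List Track} {v : List Ltr} {s : EpsState x}
    (h : LRun (epsEdgeSet x) (.pda a op q) (G.flatMap Track.word) v s) (hs : EpsFinal x s)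
    (hG : ∀ g ∈ G, Ltr.hash ∉ g.2) {y : List (Fin x.pda.numLetters)}
    (hy : G.map Prod.fst = y.map fun i => .data i.1) :
    ∃ (z : List (Fin x.pda.numLetters)) (r : _), s = .pda a op r ∧
      (x.pda.transducer a op).Run q y z r ∧
      v = (List.zipWith (fun i g => (Ltr.data i.1, g.2)) z G).flatMap Track.word ∧
      z.length = y.length := by
  induction G generalizing q v y with
  | nil =>
    obtain ⟨rfl, r, h₁, h₂⟩ := pda_copy_inv h (by simp)
    obtain rfl := List.map_eq_nil_iff.1 hy.symm
    exact ⟨[], r, h₁, h₂, rfl, rfl⟩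
  | cons g G ih =>
    cases y with
    | nil => simp at hy
    | cons i y =>
    obtain ⟨hi, hy'⟩ := List.cons.inj hy
    obtain ⟨r₁, v₁, rfl, h₁, h₂⟩ := pda_hash_inv h
    have h₂' : LRun _ _ (g.1 :: (g.2 ++ G.flatMap Track.word)) v₁ s := h₂
    clear h h₂
    obtain ⟨b, t, v₂, l, rfl, hl, he, h₃⟩ := eps_cons_inv h₂' nofun
    cases he with
    | @pda_letter _ _ _ r₂ y' z he =>
    simp only [Option.some.injEq, Prod.mk.injEq] at hl
    obtain rfl : y' = i := Fin.ext (Ltr.data.inj (hl.1.trans hi))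
    obtain ⟨t, v₃, v₄, rfl, h₄, h₅⟩ := h₃.split
    obtain ⟨rfl, r₃, rfl, h₆⟩ := pda_copy_inv h₄ (hG g List.mem_cons_self)
    obtain ⟨z', r₄, rfl, h₇, rfl, h₈⟩ := ih h₅ (fun g hg => hG g (List.mem_cons_of_mem _ hg)) hy'
    refine ⟨z :: z', r₄, rfl, ?_, ?_, congrArg Nat.succ h₈⟩
    · exact h₁.trans (.letter he (h₆.trans h₇))
    · simp [Track.word, ← hl.2]

/-- The effect of a stack operation on the represented stack. -/
theorem pda_stack_inv {a : Option (Fin x.numInput)} {op : StackOp (Fin x.pda.numStack)}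
    (hop : op ≠ .skip) {s : EpsState x} {u v : List Ltr} {G : List Track}
    (h : LRun (epsEdgeSet x) (.pdaStack a op) (u ++ G.flatMap Track.word) v s) (hs : EpsFinal x s)
    (hu : Ltr.hash ∉ u) {c : List (Option (Fin x.pda.numStack))}
    (hc : stackOf u = c.map (Option.map Fin.val)) :
    ∃ u' v' c' r, v = u' ++ v' ∧ Ltr.hash ∉ u' ∧ bitsOf u' = bitsOf u ∧
      stackOf u' = c'.map (Option.map Fin.val) ∧ op.lift.Apply c c' ∧
      (x.pda.transducer a op).Run (x.pda.transducer a op).init [] [] r ∧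
      LRun (epsEdgeSet x) (.pda a op r) (G.flatMap Track.word) v' s := by
  obtain ⟨t, v₁, v₂, rfl, h₁, h₂⟩ := h.split
  rcases eps_loop_inv h₁ (fun a b => b = a ∧ a ∈ baseLtrs) nofun (fun a b l hl he => by
      cases he; grind) with ⟨-, rfl⟩ | ⟨u₁, w₁, b, b', t', u₂, w₂, l, rfl, rfl, h₃, hl, he, ht, h₄⟩
  · rcases eps_exits_inv (h₂.exits hs) with hf | ⟨l, t, he, hl⟩
    · cases hf
    · cases he <;> grind [baseLtrs]
  obtain ⟨rfl, h₅, h₆⟩ := forall₂_base h₃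
  have hu₂ : Ltr.hash ∉ u₂ := fun h => hu (by simp [h])
  rw [stackOf_append, h₅, List.nil_append] at hc
  cases he with
  | pda_base => exact absurd rfl ht
  | pda_push _ γ =>
    simp only [Option.some.injEq, Prod.mk.injEq] at hl
    obtain ⟨rfl, rfl⟩ := hl
    obtain ⟨rfl, r, rfl, h₇⟩ := pda_copy_inv h₄ hu₂
    refine ⟨_, v₂, some γ :: c, r, rfl, ?_, ?_, ?_, rfl, h₇, h₂⟩
    · simp [h₆, hu₂]
    · simp only [bitsOf_append]
      rfl
    · rw [stackOf_append, h₅, List.map_cons, ← hc]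
      rfl
  | pda_pop _ γ =>
    simp only [Option.some.injEq, Prod.mk.injEq] at hl
    obtain ⟨rfl, rfl⟩ := hl
    obtain ⟨rfl, r, rfl, h₇⟩ := pda_copy_inv h₄ hu₂
    change some γ.1 :: stackOf w₂ = _ at hc
    cases c with
    | nil => simp at hc
    | cons γ' c =>
    obtain ⟨hγ, hc'⟩ := List.cons.inj hc
    obtain rfl : γ' = some γ := by
      cases γ' with
      | none => simp at hγ
      | some γ' => simpa [Fin.ext_iff] using hγ.symm
    refine ⟨_, v₂, c, r, rfl, ?_, ?_, ?_, rfl, h₇, h₂⟩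
    · simp [h₆, hu₂]
    · simp only [bitsOf_append]
      rfl
    · rw [stackOf_append, h₅]
      exact hc'

theorem zipWith_toList_ofFn (q : PState x) (G : Fin x.pda.n → Track) :
    List.zipWith (fun i (g : Track) => (Ltr.data i.1, g.2)) q.toList (List.ofFn G) =
      List.ofFn fun i => (Ltr.data (q.get i).1, (G i).2) := by
  refine List.ext_get (by simp) fun i h₁ h₂ => ?_
  simp only [List.get_eq_getElem, List.getElem_zipWith, List.getElem_ofFn]
  rfl

/-- The gadget for edges of the PDA performs such an edge. -/
theorem pda_sound {a : Option (Fin x.numInput)} {op : StackOp (Fin x.pda.numStack)}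
    {s : EpsState x} {v : List Ltr} {C : PConf x} {u : List Ltr} {G : Fin x.pda.n → Track}
    (hu : Ltr.hash ∉ u) (hcnt : bitsVal (bitsOf u) = C.cnt)
    (hstack : stackOf u = C.ctrl.map (Option.map Fin.val))
    (hG : ∀ i, (G i).1 = .data (C.cur.get i) ∧ Ltr.hash ∉ (G i).2 ∧
      dataOf (G i).2 = C.brs.map fun q => (q.get i).val)
    (h : LRun (epsEdgeSet x) (.pdaHead a op)
      (optLtr C.pend :: (u ++ (List.ofFn G).flatMap Track.word)) v s) (hs : EpsFinal x s) :
    ∃ C', Represents x (C.mode.ltr :: v) C' ∧ PumpStep x.pda.explicit x.Θ none C C' := by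
  have hmain : C.pend = a ∧ ∃ u' v' c' r, v = .blank :: (u' ++ v') ∧ Ltr.hash ∉ u' ∧
      bitsOf u' = bitsOf u ∧ stackOf u' = c'.map (Option.map Fin.val) ∧ op.lift.Apply C.ctrl c' ∧
      (x.pda.transducer a op).Run (x.pda.transducer a op).init [] [] r ∧
      LRun (epsEdgeSet x) (.pda a op r) ((List.ofFn G).flatMap Track.word) v' s := by
    obtain ⟨b, t, v, l, rfl, hl, he, h'⟩ := eps_cons_inv h nofun
    clear h
    cases he with
    | pda_skip =>
      simp only [Option.some.injEq, Prod.mk.injEq] at hl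
      obtain ⟨t, v₁, v₂, rfl, h₁, h₂⟩ := h'.split
      obtain ⟨rfl, r, rfl, h₃⟩ := pda_copy_inv h₁ hu
      exact ⟨(optLtr_injective hl.1).symm, v₁, v₂, C.ctrl, r,
        by rw [hl.2], hu, rfl, hstack, rfl, h₃,
        h₂⟩
    | pda_stack _ hop =>
      simp only [Option.some.injEq, Prod.mk.injEq] at hl
      obtain ⟨u', v', c', r, rfl, h₁⟩ := pda_stack_inv hop h' hs hu hstack
      exact ⟨(optLtr_injective hl.1).symm, u', v', c', r, by rw [hl.2], h₁⟩
  obtain ⟨rfl, u', v', c', r, rfl, h₁, h₂, h₃, h₄, h₅, h₆⟩ := hmain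
  have hcur : (List.ofFn G).map Prod.fst = C.cur.toList.map fun i => .data i.1 := by
    refine List.ext_get (by simp) fun i h₁ h₂ => ?_
    simp only [List.length_map, List.length_ofFn] at h₁
    have := (hG ⟨i, h₁⟩).1
    simp only [List.get_eq_getElem, List.getElem_map, List.getElem_ofFn, this]
    rfl
  obtain ⟨z, r', rfl, h₇, rfl, h₈⟩ := pda_tracks_inv h₆ hs (by
    intro g hg
    obtain ⟨i, rfl⟩ := (List.mem_ofFn' _ _).1 hg
    exact (hG i).2.1) hcur
  rw [List.Vector.toList_length] at h₈
  rw [show List.zipWith _ z (List.ofFn G) = _ from zipWith_toList_ofFn (x := x) ⟨z, h₈⟩ G]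
  refine ⟨⟨C.mode, none, C.cnt, ⟨z, h₈⟩, c', C.brs⟩, ⟨u', _, rfl, h₁, h₂ ▸ hcnt, h₃, fun i => ?_⟩,
    ?_⟩
  · exact ⟨rfl, (hG i).2⟩
  · refine PumpStep.move (op := op) ?_ h₄
    cases hs with
    | pda _ _ hr =>
    exact ⟨r', hr, by simpa using h₅.trans h₇⟩

end

section
variable {x : Instance}

/-- The gadget for deleted letters makes a letter outside `Θ` the pending one. -/
theorem drop_sound {s : EpsState x} {v u : List Ltr} {C : PConf x}
    (h : LRun (epsEdgeSet x) .dropHead (optLtr C.pend :: u) v s) :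
    C.pend = none ∧ ∃ a, a ∉ x.Θ ∧ v = optLtr (some a) :: u := by
  obtain ⟨b, t, v, l, rfl, hl, he, h'⟩ := eps_cons_inv h nofun
  clear h
  cases he with
  | @drop_letter a ha =>
  simp only [Option.some.injEq, Prod.mk.injEq] at hl
  obtain ⟨h₁, -⟩ := eps_stay_inv (ρ := fun a b => b = a) h' nofun fun a b l r ha hl he => by
    cases he <;> grind
  exact ⟨optLtr_eq_blank hl.1.symm, a, ha, by rw [forall₂_eq h₁, ← hl.2]; rfl⟩

theorem clear_inv {s : EpsState x} {u v : List Ltr} (h : LRun (epsEdgeSet x) .clear u v s)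
    (hu : Ltr.hash ∉ u) :
    s = .clear ∧ Ltr.hash ∉ v ∧ bitsOf v = bitsOf u ∧ stackOf v = [] ∧ dataOf v = [] := by
  induction u generalizing v with
  | nil =>
    obtain ⟨rfl, rfl⟩ := eps_nil_inv h nofun
    exact ⟨rfl, by simp, rfl, rfl, rfl⟩
  | cons a u ih =>
    simp only [List.mem_cons, not_or] at hu
    obtain ⟨b, t, v, l, rfl, hl, he, h'⟩ := eps_cons_inv h nofun
    clear h
    cases he with
    | clear_hash => grind
    | clear_base hl' =>
      obtain ⟨rfl, rfl⟩ : _ = a ∧ _ = b := by simpa using hl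
      obtain ⟨h₁, h₂, h₃, h₄, h₅⟩ := ih h' hu.2
      simp only [baseLtrs, List.mem_cons, List.not_mem_nil, or_false] at hl'
      rcases hl' with rfl | rfl | rfl <;> simp_all [bitsOf, stackOf, dataOf]
    | clear_bracket =>
      obtain ⟨rfl, rfl⟩ : _ = a ∧ _ = b := by simpa using hl
      obtain ⟨h₁, h₂, h₃, h₄, h₅⟩ := ih h' hu.2
      simp_all [bitsOf, stackOf, dataOf]
    | clear_data =>
      obtain ⟨rfl, rfl⟩ : _ = a ∧ _ = b := by simpa using hl
      obtain ⟨h₁, h₂, h₃, h₄, h₅⟩ := ih h' hu.2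
      simp_all [bitsOf, stackOf, dataOf]

/-- The gadget for forgetting the stack removes the stack and the brackets. -/
theorem clear_sound {s : EpsState x} {v : List Ltr} {C : PConf x} {u : List Ltr}
    {G : Fin x.pda.n → Track} (hm : C.mode = .N) (hu : Ltr.hash ∉ u)
    (hcnt : bitsVal (bitsOf u) = C.cnt)
    (hG : ∀ i, (G i).1 = .data (C.cur.get i) ∧ Ltr.hash ∉ (G i).2 ∧
      dataOf (G i).2 = C.brs.map fun q => (q.get i).val)
    (h : LRun (epsEdgeSet x) .clearHead
      (optLtr C.pend :: (u ++ (List.ofFn G).flatMap Track.word)) v s) (hs : EpsFinal x s) :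
    ∃ C', Represents x (Mode.N.ltr :: v) C' ∧ PumpStep x.pda.explicit x.Θ none C C' := by
  obtain ⟨b, t, v, l, rfl, hl, he, h'⟩ := eps_cons_inv h nofun
  clear h
  cases he with
  | clear_pend =>
  simp only [Option.some.injEq, Prod.mk.injEq] at hl
  obtain ⟨t, v₁, v₂, rfl, h₁, h₂⟩ := h'.split
  obtain ⟨rfl, h₃, h₄, h₅, -⟩ := clear_inv h₁ hu
  obtain ⟨rfl, G₁, rfl, hG₁⟩ := h₂.tracks_inv (F := EpsFinal x)
    (ρ := fun g g' => g'.1 = g.1 ∧ Ltr.hash ∉ g'.2 ∧ dataOf g'.2 = []) hs (by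
    intro g hg
    obtain ⟨i, rfl⟩ := (List.mem_ofFn' _ _).1 hg
    exact (hG i).2.1) (fun t ht => by cases (show EpsEdge x _ none t from ht)) (by
    intro g v r hg h hr
    obtain ⟨b, t, v, l, rfl, hl, he, h'⟩ := eps_cons_inv h nofun
    clear h
    cases he with
    | clear_base hl' => simp [baseLtrs] at hl'; grind
    | clear_bracket => grind
    | clear_data => grind
    | clear_hash =>
    obtain ⟨b', t', v, l', rfl, hl', he', h''⟩ := eps_cons_inv h' nofun
    clear h'
    cases he' with
    | clear_cur =>
    obtain ⟨h₁, h₂, -, -, h₃⟩ := clear_inv h'' hg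
    simp only [Option.some.injEq, Prod.mk.injEq] at hl hl'
    exact ⟨h₁, (b', v), by rw [← hl.2]; rfl, by rw [← hl'.1, ← hl'.2], h₂, h₃⟩)
  obtain ⟨G', rfl, hG'⟩ := exists_ofFn_of_forall₂ hG₁
  refine ⟨⟨.N, none, C.cnt, C.cur, [], []⟩, ⟨v₁, G', by rw [← hl.2]; rfl, h₃, h₄ ▸ hcnt, h₅,
    fun i => ⟨(hG' i).1.trans (hG i).1, (hG' i).2⟩⟩, ?_⟩
  have hCeq : C = ⟨.N, none, C.cnt, C.cur, C.ctrl, C.brs⟩ :=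
    Conf.ext hm (optLtr_eq_blank hl.1.symm) rfl rfl rfl rfl
  rw [hCeq]
  exact .forget

theorem start_inv {m i : ℕ} {v : List Ltr} {s : EpsState x}
    (h : LRun (epsEdgeSet x) (.start i) (List.replicate m .hash) v s) (hs : EpsFinal x s) :
    ∃ (t : List Ltr) (G : List Track), v = t ++ G.flatMap Track.word ∧ (∀ a ∈ t, a = .blank) ∧
      G.map Prod.fst = (x.pda.start.toList.drop i).map (fun j => .data j.1) ∧
      ∀ g ∈ G, ∀ a ∈ g.2, a = Ltr.blank := by
  induction m using Nat.strong_induction_on generalizing i v with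
  | _ m ih =>
  cases m with
  | zero =>
    obtain ⟨rfl, rfl⟩ := eps_nil_inv h nofun
    cases hs
    exact ⟨[], [], rfl, by simp, by simp, by simp⟩
  | succ m =>
    obtain ⟨b, t, v, l, rfl, hl, he, h'⟩ := eps_cons_inv h nofun
    clear h
    cases he with
    | start_pad =>
      obtain ⟨t, G, rfl, h₁, h₂⟩ := ih m (by omega) h'
      exact ⟨.blank :: t, G, by grind, by simpa using h₁, h₂⟩
    | start_hash =>
      cases m with
      | zero =>
        obtain ⟨rfl, rfl⟩ := eps_nil_inv h' nofun
        cases hs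
      | succ m =>
        obtain ⟨b', t', v, l', rfl, hl', he', h''⟩ := eps_cons_inv h' nofun
        clear h'
        cases he' with
        | start_cur i =>
        obtain ⟨t, G, rfl, h₁, h₂, h₃⟩ := ih m (by omega) h''
        refine ⟨[], (b', t) :: G, ?_, by simp, ?_, ?_⟩
        · simp only [Option.some.injEq, Prod.mk.injEq] at hl
          simp [Track.word, ← hl.2]
        · simp only [Option.some.injEq, Prod.mk.injEq] at hl'
          rw [List.map_cons, h₂, ← hl'.2, List.drop_eq_getElem_cons (i := i.1)
            (l := x.pda.start.toList) (by simp)]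
          rfl
        · exact List.forall_mem_cons.2 ⟨h₁, h₃⟩

theorem exists_eq_ofFn {α : Type} {n : ℕ} {l : List α} (h : l.length = n) :
    ∃ f : Fin n → α, l = List.ofFn f := by
  subst h
  exact ⟨l.get, (List.ofFn_get l).symm⟩

/-- The bits of a number as letters. -/
def bitLtr (b : Bool) : Ltr := if b then .one else .zero

theorem bitsOf_map_bitLtr (u : List Bool) : bitsOf (u.map bitLtr) = u := by
  induction u with
  | nil => rfl
  | cons b u ih => cases b <;> simpa [bitsOf, bitLtr] using ih

theorem bitLtr_mem_baseLtrs {u : List Bool} {a : Ltr} (h : a ∈ u.map bitLtr) : a ∈ baseLtrs := by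
  obtain ⟨b, -, rfl⟩ := List.mem_map.1 h
  cases b <;> simp [bitLtr, baseLtrs]

theorem bitsVal_bits (n : ℕ) : bitsVal n.bits = n := by
  induction n using Nat.binaryRec' with
  | zero => simp [bitsVal]
  | bit b n h ih =>
    rw [Nat.bits_append_bit n b h, bitsVal, List.foldr_cons]
    exact congrArg _ ih

theorem bitsOf_blank {u : List Ltr} (h : ∀ a ∈ u, a = Ltr.blank) : bitsOf u = [] := by
  rw [bitsOf, List.filterMap_eq_nil_iff]
  intro a ha
  rw [h a ha]

/-- The first configuration of the pumping machine. -/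
def startConf (x : Instance) : PConf x :=
  ⟨.N, none, x.K, x.pda.start, x.pda.bottom.toList.map some, []⟩

/-- The gadget for the first step produces a word that represents the initial configuration. -/
theorem start_sound {m : ℕ} {v : List Ltr} {s : EpsState x}
    (h : LRun (epsEdgeSet x) .startHead (.blank :: (x.K.bits.map bitLtr ++ List.replicate m .hash))
      v s) (hs : EpsFinal x s) : Represents x (Mode.N.ltr :: v) (startConf x) := by
  obtain ⟨b, t, v, l, rfl, hl, he, h'⟩ := eps_cons_inv h nofun
  clear h
  cases he with
  | start_pend =>
  simp only [Option.some.injEq, Prod.mk.injEq] at hl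
  obtain ⟨t, v₁, v₂, rfl, h₁, h₂⟩ := h'.split
  obtain ⟨h₃, rfl⟩ := eps_stay_inv (ρ := fun a b => b = a) h₁ nofun fun a b l r ha hl he => by
    have ha' := bitLtr_mem_baseLtrs ha
    cases he <;> grind [baseLtrs]
  obtain rfl := forall₂_eq h₃
  rcases eps_loop_inv h₂ (fun a b => a = .hash → b = .blank) nofun (fun a b l hl he => by
    cases he <;> grind [baseLtrs]) with ⟨-, rfl⟩ |
      ⟨u₁, w₁, a, b', t', u₂, w₂, l', hu, rfl, h₄, hl', he', ht, h₅⟩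
  · cases hs
  have hall : ∀ c ∈ u₁ ++ a :: u₂, c = Ltr.hash := fun c hc => List.eq_of_mem_replicate (hu ▸ hc)
  have hu₂ : u₂ = List.replicate u₂.length .hash :=
    List.eq_replicate_of_mem fun c hc => hall c (by simp [hc])
  have hw₁ : ∀ c ∈ w₁, c = Ltr.blank := by
    have : ∀ c ∈ u₁, c = Ltr.hash := fun c hc => hall c (by simp [hc])
    clear hu h₂ h' hall
    induction h₄ with
    | nil => simp
    | cons h _ ih =>
      simp only [List.mem_cons, forall_eq_or_imp] at this ⊢
      exact ⟨h this.1, ih this.2⟩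
  have ha : a = Ltr.hash := hall a (by simp)
  subst ha
  cases he' with
  | start_base => exact absurd rfl ht
  | start_blank => exact absurd rfl ht
  | start_bottom =>
  simp only [Option.some.injEq, Prod.mk.injEq, true_and] at hl'
  rw [hu₂] at h₅
  obtain ⟨t, G, rfl, h₆, h₇, h₈⟩ := start_inv h₅ hs
  obtain ⟨G, rfl⟩ := exists_eq_ofFn (n := x.pda.n) (l := G) (by
    simpa using congrArg List.length h₇)
  have hkb : Ltr.hash ∉ x.K.bits.map bitLtr := fun h => by
    simpa [baseLtrs] using bitLtr_mem_baseLtrs h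
  refine ⟨x.K.bits.map bitLtr ++ (w₁ ++ (b' :: t)), G,
    by simp [confWord, ← hl.2, startConf, optLtr],
    ?_, ?_, ?_, fun i => ⟨?_, ?_, ?_⟩⟩
  · simp only [List.mem_append, List.mem_cons, not_or]
    refine ⟨hkb, fun h => by simpa using hw₁ _ h, ?_, fun h => by simpa using h₆ _ h⟩
    rw [← hl']
    cases x.pda.bottom <;> simp [optLtr]
  · rw [bitsOf_append, bitsOf_map_bitLtr, bitsOf_append, bitsOf_blank hw₁, List.nil_append,
      show bitsOf (b' :: t) = bitsOf [b'] ++ bitsOf t from bitsOf_append [b'] t, bitsOf_blank h₆,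
      ← hl']
    cases x.pda.bottom <;> simp [optLtr, bitsOf, bitsVal_bits, startConf]
  · rw [stackOf_append, stackOf_eq_nil fun a ha => bitLtr_mem_baseLtrs ha, stackOf_append,
      stackOf_eq_nil fun a ha => by rw [hw₁ a ha]; simp [baseLtrs],
      show stackOf (b' :: t) = stackOf [b'] ++ stackOf t from stackOf_append [b'] t,
      stackOf_eq_nil (u := t) fun a ha => by rw [h₆ a ha]; simp [baseLtrs], ← hl']
    cases h : x.pda.bottom <;> simp [optLtr, stackOf, startConf, h]
  · have := congrArg (fun l => l[i.1]?) h₇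
    simp at this
    rw [this]
    rfl
  · exact fun h => by simpa using h₈ (G i) ((List.mem_ofFn' _ _).2 ⟨i, rfl⟩) _ h
  · exact dataOf_eq_nil (h₈ (G i) ((List.mem_ofFn' _ _).2 ⟨i, rfl⟩))

theorem finish_inv {i : ℕ} {u v : List Ltr} {s : EpsState x}
    (h : LRun (epsEdgeSet x) (.finish i) u v s) (hu : Ltr.hash ∉ u) :
    s = .finish i ∧ v = List.replicate u.length .zero := by
  obtain ⟨h₁, h₂⟩ := eps_stay_inv (ρ := fun _ b => b = .zero) h nofun fun a b l r ha hl he => by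
    cases he <;> grind
  refine ⟨h₂, ?_⟩
  clear h hu
  induction h₁ with
  | nil => rfl
  | cons h _ ih => rw [h, ih, List.length_cons, List.replicate_succ]

theorem finish_tracks_inv {i : ℕ} {G : List Track} {v : List Ltr} {s : EpsState x}
    (h : LRun (epsEdgeSet x) (.finish i) (G.flatMap Track.word) v s) (hs : EpsFinal x s)
    (hG : ∀ g ∈ G, Ltr.hash ∉ g.2) : v = List.replicate (G.flatMap Track.word).length .zero ∧
      G.map Prod.fst = (x.pda.final.toList.drop i).map fun j => .data j.1 := by
  induction G generalizing i v with
  | nil =>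
    obtain ⟨rfl, rfl⟩ := eps_nil_inv h nofun
    cases hs
    exact ⟨rfl, by simp⟩
  | cons g G ih =>
    obtain ⟨b, t, v, l, rfl, hl, he, h'⟩ := eps_cons_inv h nofun
    clear h
    cases he with
    | finish_copy _ hl' =>
      simp only [Option.some.injEq, Prod.mk.injEq] at hl
      exact absurd (hl.1 ▸ hl') (hash_notMem_plainLtrs x)
    | finish_hash =>
    have h₁ : LRun _ _ (g.1 :: (g.2 ++ G.flatMap Track.word)) v s := h'
    clear h'
    obtain ⟨b', t', v, l', rfl, hl', he', h₂⟩ := eps_cons_inv h₁ nofun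
    cases he' with
    | finish_cur i =>
    simp only [Option.some.injEq, Prod.mk.injEq] at hl hl'
    obtain ⟨t, v₁, v₂, rfl, h₃, h₄⟩ := h₂.split
    obtain ⟨rfl, rfl⟩ := finish_inv h₃ (hG g List.mem_cons_self)
    obtain ⟨rfl, h₅⟩ := ih h₄ fun g hg => hG g (List.mem_cons_of_mem _ hg)
    constructor
    · simp only [← hl.2, ← hl'.2, List.flatMap_cons, Track.word, List.length_append,
        List.length_cons, List.replicate_append_replicate, ← List.replicate_succ]
      congr 1
      omega
    · rw [List.map_cons, h₅, ← hl'.1, List.drop_eq_getElem_cons (i := i.1)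
        (l := x.pda.final.toList) (by simp)]
      rfl

/-- The gadget for the last step checks that the current state is final and that no letter is
pending. -/
theorem finish_sound {s : EpsState x} {v : List Ltr} {C : PConf x} {u : List Ltr}
    {G : Fin x.pda.n → Track} (hu : Ltr.hash ∉ u)
    (hG : ∀ i, (G i).1 = .data (C.cur.get i) ∧ Ltr.hash ∉ (G i).2 ∧
      dataOf (G i).2 = C.brs.map fun q => (q.get i).val)
    (h : LRun (epsEdgeSet x) .finishHead
      (optLtr C.pend :: (u ++ (List.ofFn G).flatMap Track.word)) v s) (hs : EpsFinal x s) :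
    C.pend = none ∧ C.cur = x.pda.final ∧ ∃ m, v = List.replicate m .zero := by
  obtain ⟨b, t, v, l, rfl, hl, he, h'⟩ := eps_cons_inv h nofun
  clear h
  cases he with
  | finish_pend =>
  simp only [Option.some.injEq, Prod.mk.injEq] at hl
  obtain ⟨t, v₁, v₂, rfl, h₁, h₂⟩ := h'.split
  obtain ⟨rfl, rfl⟩ := finish_inv h₁ hu
  obtain ⟨rfl, h₃⟩ := finish_tracks_inv h₂ hs (by
    intro g hg
    obtain ⟨i, rfl⟩ := (List.mem_ofFn' _ _).1 hg
    exact (hG i).2.1)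
  refine ⟨optLtr_eq_blank hl.1.symm, ?_, _, by
    rw [← hl.2, List.replicate_append_replicate, ← List.replicate_succ]⟩
  refine List.Vector.ext fun i => Fin.ext ?_
  have := congrArg (fun l => l[i.1]?) h₃
  simp [(hG i).1] at this
  exact this

/-- An `ε`-step between words is a step of the pumping machine, or the last step. -/
theorem eps_sound {s : EpsState x} {W V : List Ltr} {C : PConf x} (hW : Represents x W C)
    (hC : Pump.Balanced C) (h : LRun (epsEdgeSet x) .init W V s) (hs : EpsFinal x s) :
    (∃ C', Represents x V C' ∧ PumpStep x.pda.explicit x.Θ none C C') ∨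
      (C.mode = .N ∧ C.pend = none ∧ C.cur = x.pda.final ∧ ∃ m, V = List.replicate m .zero) := by
  obtain ⟨u, G, rfl, hu, hcnt, hstack, hG⟩ := hW
  obtain ⟨b, t, v, l, rfl, hl, he, h'⟩ := eps_cons_inv h nofun
  clear h
  cases he with
  | row_head r =>
    simp only [Option.some.injEq, Prod.mk.injEq] at hl
    rw [← hl.2]
    exact .inl (row_sound hC (Mode.ltr_injective hl.1.symm) hu hcnt hstack hG h' hs)
  | pda_head m a op =>
    simp only [Option.some.injEq, Prod.mk.injEq] at hl
    rw [← hl.2, hl.1]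
    exact .inl (pda_sound hu hcnt hstack hG h' hs)
  | drop_head m =>
    simp only [Option.some.injEq, Prod.mk.injEq] at hl
    obtain ⟨h₁, a, ha, rfl⟩ := drop_sound h'
    refine .inl
      ⟨⟨C.mode, some a, C.cnt, C.cur, C.ctrl, C.brs⟩, ⟨u, G, ?_, hu, hcnt, hstack, hG⟩, ?_⟩
    · rw [← hl.2, hl.1]
      rfl
    · have hCeq : C = ⟨C.mode, none, C.cnt, C.cur, C.ctrl, C.brs⟩ :=
        Conf.ext rfl h₁ rfl rfl rfl rfl
      rw [hCeq]
      exact .drop ha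
  | clear_head =>
    simp only [Option.some.injEq, Prod.mk.injEq] at hl
    rw [← hl.2]
    exact .inl (clear_sound (Mode.ltr_injective hl.1.symm) hu hcnt hG h' hs)
  | start_head =>
    simp only [Option.some.injEq, Prod.mk.injEq] at hl
    cases hm : C.mode <;> simp [hm, startLtr, Mode.ltr] at hl
  | finish_head =>
    simp only [Option.some.injEq, Prod.mk.injEq] at hl
    obtain ⟨h₁, h₂, m, rfl⟩ := finish_sound hu hG h' hs
    exact .inr ⟨Mode.ltr_injective hl.1.symm, h₁, h₂, m + 1, by rw [← hl.2, List.replicate_succ]⟩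

theorem letter_cons_inv {a : Fin x.numInput} {q s : LetterState} {b : Ltr} {u v : List Ltr}
    (h : LRun (letterEdgeSet x a) q (b :: u) v s) :
    ∃ c r v' l, v = c :: v' ∧ l = some (b, c) ∧ LetterEdge x a q l r ∧
      LRun (letterEdgeSet x a) r u v' s := by
  obtain ⟨c, r, v', rfl, he, h⟩ := h.cons_inv fun r hr => by
    cases (show LetterEdge x a q none r from hr)
  exact ⟨c, r, v', _, rfl, rfl, he, h⟩

theorem letter_copy_inv {a : Fin x.numInput} {s : LetterState} {u v : List Ltr}
    (h : LRun (letterEdgeSet x a) .copy u v s) : v = u ∧ s = .copy := by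
  obtain ⟨h₁, h₂⟩ := h.stay_inv (ρ := fun a b => b = a) (fun r hr => by
    cases (show LetterEdge x a _ none r from hr)) fun b _ c r he => by
      generalize hl : some (b, c) = l at he
      cases (show LetterEdge x a _ l r from he) <;> grind
  exact ⟨forall₂_eq h₁, h₂⟩

/-- The transducer for a letter performs a step of the pumping machine that reads this letter. -/
theorem letter_sound {a : Fin x.numInput} {W V : List Ltr} {C : PConf x}
    (hW : Represents x W C) (h : LRun (letterEdgeSet x a) .init W V .copy) :
    ∃ C', Represents x V C' ∧ PumpStep x.pda.explicit x.Θ (some a) C C' := by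
  obtain ⟨u, G, rfl, hu, hcnt, hstack, hG⟩ := hW
  obtain ⟨b, t, v, l, rfl, hl, he, h'⟩ := letter_cons_inv h
  clear h
  cases he with
  | theta_head ha =>
    obtain ⟨b', t, v, l', rfl, hl', he', h⟩ := letter_cons_inv h'
    clear h'
    simp only [Option.some.injEq, Prod.mk.injEq] at hl hl'
    cases he' with
    | free_pend ha' => exact absurd ha ha'
    | theta_pend =>
    simp only [Option.some.injEq, Prod.mk.injEq] at hl'
    obtain ⟨t, v₁, v₂, rfl, h₁, h₂⟩ := h.split
    rcases h₁.loop_inv (ρ := fun b c => b = .zero ∧ c = .one) (fun r hr => by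
        cases (show LetterEdge x a _ none r from hr)) (fun b c he => by
        generalize hl : some (b, c) = l at he
        cases (show LetterEdge x a _ l _ from he)
        grind) with
      ⟨-, rfl⟩ | ⟨u₁, w₁, b₁, c, t', u₂, w₂, rfl, rfl, h₃, he, ht, h₄⟩
    · rcases h₂.exits (F := fun q => q = .copy) rfl with h | ⟨l, r, he, hl⟩
      · cases h
      · cases (show LetterEdge x a _ l r from he) <;> simp at hl
    generalize hl'' : some (b₁, c) = l'' at he
    cases (show LetterEdge x a _ l'' _ from he) with
    | borrow => exact absurd rfl ht
    | decrement =>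
    simp only [Option.some.injEq, Prod.mk.injEq] at hl''
    obtain ⟨rfl, rfl⟩ := hl''
    obtain ⟨rfl, rfl⟩ := letter_copy_inv h₄
    obtain ⟨rfl, -⟩ := letter_copy_inv h₂
    have hval : bitsVal (bitsOf (u₁ ++ .one :: w₂)) = bitsVal (bitsOf (w₁ ++ .zero :: w₂)) + 1 ∧
        stackOf w₁ = stackOf u₁ ∧ Ltr.hash ∉ w₁ := by
      clear h₁ h hcnt hstack hu
      induction h₃ with
      | nil => exact ⟨by simp [bitsOf, bitsVal, Nat.bit], rfl, by simp⟩
      | cons h _ ih =>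
        obtain ⟨rfl, rfl⟩ := h
        obtain ⟨h₁, h₂, h₃⟩ := ih
        refine ⟨?_, h₂, by simpa using h₃⟩
        simp only [bitsOf, bitsVal, List.cons_append, List.filterMap_cons, List.foldr_cons] at h₁ ⊢
        rw [h₁]
        simp only [Nat.bit, cond_true, cond_false]
        omega
    rw [hval.1] at hcnt
    have hnone : Ltr.hash ∉ w₂ := fun h => hu (by simp [h])
    refine ⟨⟨.N, some a, bitsVal (bitsOf (w₁ ++ .zero :: w₂)), C.cur, C.ctrl, C.brs⟩,
      ⟨w₁ ++ .zero :: w₂, G, ?_, ?_, rfl, ?_, hG⟩, ?_⟩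
    · rw [← hl.2, ← hl'.2]
      rfl
    · simp [hval.2.2, hnone]
    · rw [← hstack, stackOf_append, stackOf_append, hval.2.1]
      rfl
    · have hCeq : C = ⟨.N, none, bitsVal (bitsOf (w₁ ++ .zero :: w₂)) + 1, C.cur, C.ctrl, C.brs⟩ :=
        Conf.ext (Mode.ltr_injective hl.1.symm) (optLtr_eq_blank hl'.1.symm) hcnt.symm rfl rfl rfl
      rw [hCeq]
      exact .readTheta ha
  | free_head ha hm =>
    obtain ⟨b', t, v, l', rfl, hl', he', h⟩ := letter_cons_inv h'
    clear h'
    simp only [Option.some.injEq, Prod.mk.injEq] at hl hl'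
    cases he' with
    | theta_pend ha' => exact absurd ha' ha
    | free_pend =>
    simp only [Option.some.injEq, Prod.mk.injEq] at hl'
    obtain ⟨rfl, -⟩ := letter_copy_inv h
    refine ⟨⟨C.mode, some a, C.cnt, C.cur, C.ctrl, C.brs⟩, ⟨u, G, ?_, hu, hcnt, hstack, hG⟩, ?_⟩
    · rw [← hl.2, hl.1, ← hl'.2]
      rfl
    · have hCeq : C = ⟨C.mode, none, C.cnt, C.cur, C.ctrl, C.brs⟩ :=
        Conf.ext rfl (optLtr_eq_blank hl'.1.symm) rfl rfl rfl rfl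
      rw [hCeq]
      exact .read ha (Mode.ltr_injective hl.1 ▸ hm)

end

/-! ### Completeness of the transducers -/

section
variable {x : Instance}

/-- The sizes of the PDA and the number of bits of `K` are bounded by the length of the input. -/
theorem length_code_le_size (x : Instance) :
    x.numInput + x.pda.numStack + x.pda.numLetters + x.pda.n + x.K.bits.length + 7 ≤ x.size := by
  simp only [Instance.size, Code.input, Code.succinctPDA, Code.unary, Code.binary, Code.labels,
    Code.stackOps, List.length_append, List.length_replicate, List.length_cons, List.length_nil,
    List.length_map, List.flatMap_cons, Code.transducer]
  have : 1 ≤ (Code.optLetter x.pda.bottom).length := by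
    cases x.pda.bottom <;> simp [Code.optLetter, Code.unary]
  omega

theorem data_mem_plainLtrs {i : ℕ} (h : i < x.size) : Ltr.data i ∈ plainLtrs x := by
  simp [plainLtrs, h]

theorem blank_mem_plainLtrs : Ltr.blank ∈ plainLtrs x := by simp [plainLtrs]

theorem baseLtrs_subset : baseLtrs ⊆ plainLtrs x := by simp [baseLtrs, plainLtrs]

theorem stackSym_lt_size (γ : Fin x.pda.numStack) : γ.1 < x.size := by
  have := length_code_le_size x
  omega

theorem letter_lt_size (i : Fin x.pda.numLetters) : i.1 < x.size := by
  have := length_code_le_size x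
  omega

/-- The letter for a stack symbol or a bracket. -/
def stackLtr {g : ℕ} : Option (Fin g) → Ltr
  | none => .bracket
  | some γ => .data γ

/-- The word `l`, padded with blanks to length `J`. -/
def padWord (J : ℕ) (l : List Ltr) : List Ltr := List.replicate (J - l.length) .blank ++ l

/-- The track of the `i`-th letters in a configuration. -/
def confTrack (J : ℕ) (C : PConf x) (i : Fin x.pda.n) : Track :=
  (.data (C.cur.get i), padWord J (C.brs.map fun q => .data (q.get i)))

/-- A word that represents the configuration `C`, where `k` are the bits of the counter, and the
stack and the tracks are padded to the lengths `J` and `J'`. -/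
def encode (J J' : ℕ) (k : List Bool) (C : PConf x) : List Ltr :=
  confWord C.mode.ltr (optLtr C.pend) (k.map bitLtr ++ padWord J (C.ctrl.map stackLtr))
    (List.ofFn (confTrack J' C))

theorem padWord_cons {J : ℕ} {l : List Ltr} (h : l.length + 1 ≤ J) :
    ∃ j, padWord J l = List.replicate j .blank ++ .blank :: l ∧
      ∀ a, padWord J (a :: l) = List.replicate j .blank ++ a :: l := by
  refine ⟨J - (l.length + 1), ?_, fun a => rfl⟩
  have : J - l.length = J - (l.length + 1) + 1 := by omega
  rw [padWord, this, List.replicate_succ', List.append_assoc]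
  rfl

theorem padWord_cons_cons {J : ℕ} {l : List Ltr} (h : l.length + 2 ≤ J) :
    ∃ j, padWord J l = List.replicate j .blank ++ .blank :: .blank :: l ∧
      ∀ a b, padWord J (a :: b :: l) = List.replicate j .blank ++ a :: b :: l := by
  refine ⟨J - (l.length + 2), ?_, fun a b => rfl⟩
  have : J - l.length = J - (l.length + 2) + 1 + 1 := by omega
  rw [padWord, this, List.replicate_succ', List.replicate_succ', List.append_assoc,
    List.append_assoc]
  rfl

theorem mem_padWord {J : ℕ} {l : List Ltr} (hl : ∀ a ∈ l, a ∈ plainLtrs x) :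
    ∀ a ∈ padWord J l, a ∈ plainLtrs x := by
  intro a ha
  rcases List.mem_append.1 ha with ha | ha
  · rw [List.eq_of_mem_replicate ha]
    exact blank_mem_plainLtrs
  · exact hl a ha

theorem stackLtr_mem_plainLtrs {c : List (Option (Fin x.pda.numStack))} :
    ∀ a ∈ c.map stackLtr, a ∈ plainLtrs x := by
  intro a ha
  obtain ⟨b, -, rfl⟩ := List.mem_map.1 ha
  cases b
  · simp [stackLtr, plainLtrs]
  · exact data_mem_plainLtrs (stackSym_lt_size _)

theorem confTrack_mem_plainLtrs {J : ℕ} {C : PConf x} {i : Fin x.pda.n} :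
    ∀ a ∈ (confTrack J C i).2, a ∈ plainLtrs x := by
  refine mem_padWord fun a ha => ?_
  obtain ⟨q, -, rfl⟩ := List.mem_map.1 ha
  exact data_mem_plainLtrs (letter_lt_size _)

theorem confStack_mem_plainLtrs {J : ℕ} {k : List Bool} {c : List (Option (Fin x.pda.numStack))} :
    ∀ a ∈ k.map bitLtr ++ padWord J (c.map stackLtr), a ∈ plainLtrs x := by
  intro a ha
  rcases List.mem_append.1 ha with ha | ha
  · exact baseLtrs_subset (bitLtr_mem_baseLtrs ha)
  · exact mem_padWord stackLtr_mem_plainLtrs a ha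

theorem LRun.tracks {X : Type} {E : Set (LEdge X)} {q : X} {n : ℕ} {f g : Fin n → Track}
    (h : ∀ i, LRun E q (Track.word (f i)) (Track.word (g i)) q) :
    LRun E q ((List.ofFn f).flatMap Track.word) ((List.ofFn g).flatMap Track.word) q := by
  rw [List.ofFn_eq_map, List.ofFn_eq_map]
  induction List.finRange n with
  | nil => exact .nil q
  | cons i l ih => exact (h i).append ih

theorem bracketOp_before_or_after (r : Fin 8) :
    (bracketOp r).before = true ∨ (bracketOp r).after = true := by
  fin_cases r <;> simp [bracketOp]

/-- The gadget for a bracket operation can perform it, if the encodings are long enough. -/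
theorem row_complete {J J' : ℕ} {k : List Bool} {r : Fin 8} {p q : PState x}
    {c : List (Option (Fin x.pda.numStack))} {b : List (PState x)} {κ : ℕ}
    {C C' : PConf x}
    (hC : C = ⟨(bracketOp r).src, none, κ, pick (bracketOp r).s p q,
      if (bracketOp r).atTop && (bracketOp r).before then none :: c else c,
      if (bracketOp r).before then p :: q :: b else b⟩)
    (hC' : C' = ⟨(bracketOp r).dst, none, κ, pick (bracketOp r).t p q,
      if (bracketOp r).atTop && (bracketOp r).after then none :: c else c,
      if (bracketOp r).after then p :: q :: b else b⟩)
    (h₁ : C.ctrl.length ≤ J) (h₂ : C.brs.length ≤ J') (h₃ : C'.ctrl.length ≤ J)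
    (h₄ : C'.brs.length ≤ J') :
    LRun (epsEdgeSet x) .init (encode J J' k C) (encode J J' k C') (.row r) := by
  subst hC hC'
  dsimp only at h₁ h₂ h₃ h₄
  have hba := bracketOp_before_or_after r
  have hb : (b.length + 2 ≤ J') := by
    rcases hba with h | h
    · simpa only [h, if_true, List.length_cons] using h₂
    · simpa only [h, if_true, List.length_cons] using h₄
  refine .letter (EpsEdge.row_head r) (LRun.append (r := EpsState.row r)
    (u := .blank :: (k.map bitLtr ++ padWord J _)) (v := .blank :: (k.map bitLtr ++ padWord J _))
    ?_ (.tracks fun i => ?_))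
  · by_cases htop : (bracketOp r).atTop = true
    · have hc : (c.map stackLtr).length + 1 ≤ J := by
        rcases hba with h | h
        · simpa [h, htop] using h₁
        · simpa [h, htop] using h₃
      obtain ⟨j, hj, hj'⟩ := padWord_cons hc
      have key : ∀ β : Bool, padWord J ((if (bracketOp r).atTop && β then none :: c else c).map
          stackLtr) = List.replicate j .blank ++ (if β then Ltr.bracket else Ltr.blank) ::
            c.map stackLtr := by
        intro β
        cases β
        · simpa using hj
        · simp only [htop, Bool.and_self, if_true]
          exact hj' _
      rw [key, key]
      refine .letter (EpsEdge.row_stack r htop) ?_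
      refine LRun.append (r := EpsState.rowStack r) (.copy fun a ha => EpsEdge.row_base r htop
        (bitLtr_mem_baseLtrs ha)) (LRun.append (r := EpsState.rowStack r) (.copy fun a ha =>
        EpsEdge.row_base r htop ?_) (.letter (EpsEdge.row_top r htop) (.copy fun a ha =>
        EpsEdge.row_copy r (stackLtr_mem_plainLtrs a ha))))
      rw [List.eq_of_mem_replicate ha]
      simp [baseLtrs]
    · simp only [htop, Bool.false_and]
      exact .letter (EpsEdge.row_skip r (by simpa using htop)) (.copy fun a ha =>
        EpsEdge.row_copy r (confStack_mem_plainLtrs a ha))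
  · obtain ⟨j, hj, hj'⟩ := padWord_cons_cons (J := J') (l := b.map fun q => .data (q.get i).1)
      (by simpa using hb)
    have key : ∀ β : Bool, padWord J' ((if β then p :: q :: b else b).map
        fun q => Ltr.data (q.get i).1) = List.replicate j .blank ++
          (if β then .data (p.get i) else .blank) :: (if β then .data (q.get i) else .blank) ::
            b.map fun q => .data (q.get i).1 := by
      intro β
      cases β
      · simpa using hj
      · simpa using hj' _ _
    have hpick : ∀ β : Bool, ((pick β p q).get i).1 = pick β (p.get i).1 (q.get i).1 := by
      intro β
      cases β <;> rfl
    simp only [Track.word, confTrack, key, hpick]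
    refine .letter (EpsEdge.row_hash r) (.letter (EpsEdge.row_cur r _ _) (LRun.append
      (r := EpsState.rowFst r (p.get i) (q.get i)) (.copy fun a ha => ?_)
      (.letter (EpsEdge.row_fst r _ _) (.letter (EpsEdge.row_snd r _) (.copy fun a ha => ?_)))))
    · rw [List.eq_of_mem_replicate ha]
      exact EpsEdge.row_blank r _ _
    · obtain ⟨q, -, rfl⟩ := List.mem_map.1 ha
      exact EpsEdge.row_copy r (data_mem_plainLtrs (letter_lt_size _))

theorem pda_tracks_complete {a : Option (Fin x.numInput)} {op : StackOp (Fin x.pda.numStack)}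
    {q r : Fin (x.pda.transducer a op).numStates} {y z : List (Fin x.pda.numLetters)}
    (h : (x.pda.transducer a op).Run q y z r) {G : List Track} (hG : G.length = y.length)
    (hp : ∀ g ∈ G, ∀ a ∈ g.2, a ∈ plainLtrs x) :
    LRun (epsEdgeSet x) (.pda a op q)
      ((List.zipWith (fun i (g : Track) => (Ltr.data i.1, g.2)) y G).flatMap Track.word)
      ((List.zipWith (fun i (g : Track) => (Ltr.data i.1, g.2)) z G).flatMap Track.word)
      (.pda a op r) := by
  induction h generalizing G with
  | refl => exact .nil _
  | eps he _ ih => exact .eps (EpsEdge.pda_eps a op he) (ih hG hp)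
  | letter he _ ih =>
    cases G with
    | nil => simp at hG
    | cons g G =>
      refine .letter (EpsEdge.pda_hash a op _) (.letter (EpsEdge.pda_letter a op he)
        (LRun.append (.copy fun l hl => ?_) (ih (by simpa using hG) fun g hg =>
          hp g (List.mem_cons_of_mem _ hg))))
      exact EpsEdge.pda_copy a op _ (hp g List.mem_cons_self l hl)

/-- The gadget for edges of the PDA can perform an edge, if the encodings are long enough. -/
theorem pda_complete {J J' : ℕ} {k : List Bool} {a : Option (Fin x.numInput)}
    {op : StackOp (Fin x.pda.numStack)} {m : Mode} {κ : ℕ} {q q' : PState x}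
    {c c' : List (Option (Fin x.pda.numStack))} {b : List (PState x)}
    (he : (q, a, op, q') ∈ x.pda.explicit.edges) (ho : op.lift.Apply c c')
    (hc : c.length ≤ J) (hc' : c'.length ≤ J) :
    ∃ s, EpsFinal x s ∧ LRun (epsEdgeSet x) .init (encode J J' k (⟨m, a, κ, q, c, b⟩ : PConf x))
      (encode J J' k (⟨m, none, κ, q', c', b⟩ : PConf x)) s := by
  obtain ⟨r, hr, hrun⟩ := he
  refine ⟨_, .pda a op hr, .letter (EpsEdge.pda_head m a op) (LRun.append
    (r := EpsState.pda a op (x.pda.transducer a op).init)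
    (u := optLtr a :: (k.map bitLtr ++ padWord J _)) (v := .blank :: (k.map bitLtr ++ padWord J _))
    ?_ ?_)⟩
  · have hbase : ∀ (j : ℕ) (hop : op ≠ .skip), LRun (epsEdgeSet x) (.pdaStack a op)
        (k.map bitLtr ++ List.replicate j .blank) (k.map bitLtr ++ List.replicate j .blank)
        (.pdaStack a op) := by
      refine fun j hop => .copy fun l hl => EpsEdge.pda_base a hop ?_
      rcases List.mem_append.1 hl with hl | hl
      · exact bitLtr_mem_baseLtrs hl
      · rw [List.eq_of_mem_replicate hl]
        simp [baseLtrs]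
    cases op with
    | skip =>
      obtain rfl : c' = c := ho
      exact .letter (EpsEdge.pda_skip a) (.copy fun l hl =>
        EpsEdge.pda_copy a _ _ (confStack_mem_plainLtrs l hl))
    | push γ =>
      obtain rfl : c' = some γ :: c := ho
      obtain ⟨j, hj, hj'⟩ := padWord_cons (J := J) (l := c.map stackLtr) (by simpa using hc')
      rw [hj, List.map_cons, hj', ← List.append_assoc, ← List.append_assoc]
      exact .letter (EpsEdge.pda_stack a nofun) ((hbase j nofun).append
        (.letter (EpsEdge.pda_push a γ) (.copy fun l hl =>
          EpsEdge.pda_copy a _ _ (stackLtr_mem_plainLtrs l hl))))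
    | pop γ =>
      obtain rfl : c = some γ :: c' := ho
      obtain ⟨j, hj, hj'⟩ := padWord_cons (J := J) (l := c'.map stackLtr) (by simpa using hc)
      rw [hj, List.map_cons, hj', ← List.append_assoc, ← List.append_assoc]
      exact .letter (EpsEdge.pda_stack a nofun) ((hbase j nofun).append
        (.letter (EpsEdge.pda_pop a γ) (.copy fun l hl =>
          EpsEdge.pda_copy a _ _ (stackLtr_mem_plainLtrs l hl))))
  · have := pda_tracks_complete hrun
      (G := List.ofFn (confTrack J' (⟨m, a, κ, q, c, b⟩ : PConf x))) (by simp) (by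
        intro g hg
        obtain ⟨i, rfl⟩ := (List.mem_ofFn' _ _).1 hg
        exact confTrack_mem_plainLtrs)
    rw [zipWith_toList_ofFn, zipWith_toList_ofFn] at this
    exact this

theorem drop_complete {u : List Ltr} {m : Mode} {a : Fin x.numInput} (ha : a ∉ x.Θ)
    (hu : ∀ l ∈ u, l ∈ plainLtrs x) {G : List Track}
    (hG : ∀ g ∈ G, ∀ l ∈ g.1 :: g.2, l ∈ plainLtrs x) :
    LRun (epsEdgeSet x) .init (confWord m.ltr .blank u G) (confWord m.ltr (.data a) u G) .drop := by
  refine .letter (EpsEdge.drop_head m) (.letter (EpsEdge.drop_letter ha) (.copy fun l hl => ?_))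
  rcases List.mem_append.1 hl with hl | hl
  · exact EpsEdge.drop_copy (hu l hl)
  · obtain ⟨g, hg, hl⟩ := List.mem_flatMap.1 hl
    rcases List.mem_cons.1 hl with rfl | hl
    · exact EpsEdge.drop_hash
    · exact EpsEdge.drop_copy (hG g hg l hl)

theorem confTracks_mem_plainLtrs {J : ℕ} {C : PConf x} :
    ∀ g ∈ List.ofFn (confTrack J C), ∀ l ∈ g.1 :: g.2, l ∈ plainLtrs x := by
  intro g hg l hl
  obtain ⟨i, rfl⟩ := (List.mem_ofFn' _ _).1 hg
  rcases List.mem_cons.1 hl with rfl | hl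
  · exact data_mem_plainLtrs (letter_lt_size _)
  · exact confTrack_mem_plainLtrs l hl

theorem length_padWord {J : ℕ} {l : List Ltr} (h : l.length ≤ J) : (padWord J l).length = J := by
  simp [padWord, h]

theorem padWord_nil (J : ℕ) : padWord J [] = List.replicate J .blank := by simp [padWord]

/-- Letters that are replaced by blanks when the stack is forgotten. -/
theorem clear_loop {J : ℕ} {u : List Ltr}
    (hu : ∀ a ∈ u, a = .bracket ∨ ∃ i < x.size, a = .data i) (hJ : u.length ≤ J) :
    LRun (epsEdgeSet x) .clear (padWord J u) (padWord J []) .clear := by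
  rw [padWord_nil]
  conv => arg 4; rw [← length_padWord hJ]
  rw [← List.map_const']
  refine .loop _ fun a ha => ?_
  rcases List.mem_append.1 ha with ha | ha
  · rw [List.eq_of_mem_replicate ha]
    exact EpsEdge.clear_base (by simp [baseLtrs])
  · rcases hu a ha with rfl | ⟨i, hi, rfl⟩
    exacts [EpsEdge.clear_bracket, EpsEdge.clear_data hi]

theorem clear_complete {J J' : ℕ} {k : List Bool} {κ : ℕ} {q : PState x}
    {c : List (Option (Fin x.pda.numStack))} {b : List (PState x)} (hc : c.length ≤ J)
    (hb : b.length ≤ J') :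
    LRun (epsEdgeSet x) .init (encode J J' k (⟨.N, none, κ, q, c, b⟩ : PConf x))
      (encode J J' k (⟨.N, none, κ, q, [], []⟩ : PConf x)) .clear := by
  refine .letter EpsEdge.clear_head (.letter EpsEdge.clear_pend (LRun.append (r := EpsState.clear)
    (LRun.append (r := EpsState.clear)
      (.copy fun a ha => EpsEdge.clear_base (bitLtr_mem_baseLtrs ha))
    (clear_loop (fun a ha => ?_) (by simpa using hc))) (.tracks fun i => ?_)))
  · obtain ⟨γ, -, rfl⟩ := List.mem_map.1 ha
    cases γ with
    | none => exact .inl rfl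
    | some γ => exact .inr ⟨γ, stackSym_lt_size γ, rfl⟩
  · refine .letter EpsEdge.clear_hash (.letter (EpsEdge.clear_cur (letter_lt_size _))
      (clear_loop (fun a ha => ?_) (by simpa using hb)))
    obtain ⟨q, -, rfl⟩ := List.mem_map.1 ha
    exact .inr ⟨_, letter_lt_size _, rfl⟩

theorem start_tracks_complete {J' i : ℕ} {l : List (Fin x.pda.numLetters)}
    (hl : x.pda.start.toList.drop i = l) (hi : i + l.length = x.pda.n) :
    LRun (epsEdgeSet x) (.start i) (List.replicate (l.length * (2 + J')) .hash)
      ((l.map fun a : Fin _ => ((.data a.1, padWord J' []) : Track)).flatMap Track.word)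
        (.start x.pda.n) := by
  induction l generalizing i with
  | nil =>
    obtain rfl : i = x.pda.n := hi
    simpa using LRun.nil _
  | cons a l ih =>
    simp only [List.length_cons] at hi
    have hi' : i < x.pda.start.toList.length := by
      rw [List.Vector.toList_length]
      omega
    rw [List.drop_eq_getElem_cons hi'] at hl
    obtain ⟨h₁, h₂⟩ := List.cons.inj hl
    have e : (a :: l).length * (2 + J') = (J' + l.length * (2 + J')) + 1 + 1 := by
      rw [List.length_cons, Nat.succ_mul]
      omega
    rw [e, List.replicate_succ, List.replicate_succ, List.replicate_add]
    have hcur := EpsEdge.start_cur (x := x) ⟨i, by omega⟩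
    rw [show x.pda.start.get ⟨i, by omega⟩ = a from h₁] at hcur
    refine .letter (EpsEdge.start_hash (by omega)) (.letter hcur (LRun.append
      (r := EpsState.start (i + 1)) ?_ (ih h₂ (by omega))))
    rw [padWord_nil]
    have := LRun.loop (E := epsEdgeSet x) (q := .start (i + 1)) (u := List.replicate J' Ltr.hash)
      (fun _ => .blank) fun a ha => by
        rw [List.eq_of_mem_replicate ha]
        exact EpsEdge.start_pad (by omega)
    simpa using this

/-- The first step leads to the encoding of the initial configuration; the lengths `J` and `J'` of
its parts are guessed. -/
theorem start_complete {J J' : ℕ} (hJ : 1 ≤ J) :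
    LRun (epsEdgeSet x) .init (startLtr :: .blank :: (x.K.bits.map bitLtr ++
      List.replicate (J + x.pda.n * (2 + J')) .hash)) (encode J J' x.K.bits (startConf x))
      (.start x.pda.n) := by
  have h₁ : padWord J ((startConf x).ctrl.map stackLtr) =
      List.replicate (J - 1) .blank ++ [optLtr x.pda.bottom] := by
    obtain ⟨j, rfl⟩ := Nat.exists_eq_add_of_le' hJ
    rw [startConf]
    cases x.pda.bottom with
    | none => simp [padWord, optLtr, List.replicate_succ']
    | some γ => simp [padWord, optLtr, stackLtr]
  have h₂ : List.ofFn (confTrack J' (startConf x)) =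
      x.pda.start.toList.map fun a : Fin _ => ((.data a.1, padWord J' []) : Track) := by
    refine List.ext_get (by simp) fun i h₁ h₂ => ?_
    simp only [List.get_eq_getElem, List.getElem_ofFn, List.getElem_map]
    rfl
  rw [encode, confWord, h₁, h₂]
  obtain ⟨j, rfl⟩ := Nat.exists_eq_add_of_le' hJ
  rw [List.append_assoc, List.append_assoc, List.replicate_add, List.replicate_succ',
    List.append_assoc, Nat.add_sub_cancel]
  refine .letter EpsEdge.start_head (.letter EpsEdge.start_pend (LRun.append
    (r := EpsState.startCount) (.copy fun a ha => EpsEdge.start_base (bitLtr_mem_baseLtrs ha))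
    (LRun.append (r := EpsState.startCount) ?_ (.letter EpsEdge.start_bottom ?_))))
  · have := LRun.loop (E := epsEdgeSet x) (q := .startCount) (u := List.replicate j Ltr.hash)
      (fun _ => .blank) fun a ha => by
        rw [List.eq_of_mem_replicate ha]
        exact EpsEdge.start_blank
    simpa using this
  · have := start_tracks_complete (x := x) (J' := J') (i := 0) rfl (by simp)
    simpa using this

theorem finish_copy_complete {i : ℕ} (hi : i ≤ x.pda.n) {u : List Ltr}
    (hu : ∀ a ∈ u, a ∈ plainLtrs x) :
    LRun (epsEdgeSet x) (.finish i) u (List.replicate u.length .zero) (.finish i) := by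
  rw [← List.map_const']
  exact .loop _ fun a ha => EpsEdge.finish_copy hi (hu a ha)

theorem finish_tracks_complete {i : ℕ} {G : List Track}
    (hG : G.map Prod.fst = (x.pda.final.toList.drop i).map fun j => .data j.1)
    (hi : i + G.length = x.pda.n) (hp : ∀ g ∈ G, ∀ a ∈ g.2, a ∈ plainLtrs x) :
    LRun (epsEdgeSet x) (.finish i) (G.flatMap Track.word)
      (List.replicate (G.flatMap Track.word).length .zero) (.finish x.pda.n) := by
  induction G generalizing i with
  | nil =>
    obtain rfl : i = x.pda.n := hi
    exact .nil _
  | cons g G ih =>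
    simp only [List.length_cons] at hi
    have hi' : i < x.pda.final.toList.length := by
      rw [List.Vector.toList_length]
      omega
    rw [List.drop_eq_getElem_cons hi', List.map_cons] at hG
    obtain ⟨h₁, h₂⟩ := List.cons.inj hG
    have hcur := EpsEdge.finish_cur (x := x) ⟨i, by omega⟩
    rw [show Ltr.data (x.pda.final.get ⟨i, by omega⟩).1 = g.1 from h₁.symm] at hcur
    have e : (List.flatMap Track.word (g :: G)).length =
        g.2.length + (G.flatMap Track.word).length + 1 + 1 := by
      simp [Track.word]
    rw [e, List.replicate_succ, List.replicate_succ, List.replicate_add]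
    exact .letter (EpsEdge.finish_hash (by omega)) (.letter hcur (LRun.append
      (r := EpsState.finish (i + 1)) (finish_copy_complete (by omega) (hp g List.mem_cons_self))
      (ih h₂ (by omega) fun g hg => hp g (List.mem_cons_of_mem _ hg))))

/-- The last step replaces all letters of a final configuration by the letter `1` of the automaton.
-/
theorem finish_complete {J J' : ℕ} {k : List Bool} {κ : ℕ}
    {c : List (Option (Fin x.pda.numStack))} {b : List (PState x)} {W : List Ltr}
    (hW : W = encode J J' k (⟨.N, none, κ, x.pda.final, c, b⟩ : PConf x)) :
    LRun (epsEdgeSet x) .init W (List.replicate W.length .zero) (.finish x.pda.n) := by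
  subst hW
  have e : (encode J J' k (⟨.N, none, κ, x.pda.final, c, b⟩ : PConf x)).length =
      (k.map bitLtr ++ padWord J (c.map stackLtr)).length +
        ((List.ofFn (confTrack J' (⟨.N, none, κ, x.pda.final, c, b⟩ : PConf x))).flatMap
          Track.word).length + 1 + 1 := by
    simp [encode, confWord]
    omega
  rw [e, List.replicate_succ, List.replicate_succ, List.replicate_add]
  refine .letter EpsEdge.finish_head
    (.letter EpsEdge.finish_pend (LRun.append (r := EpsState.finish 0)
    (finish_copy_complete (Nat.zero_le _) confStack_mem_plainLtrs)
    (finish_tracks_complete ?_ (by simp) ?_)))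
  · refine List.ext_get (by simp) fun i h₁ h₂ => ?_
    simp only [List.get_eq_getElem, List.getElem_map, List.getElem_ofFn, List.drop_zero]
    rfl
  · exact fun g hg a ha => confTracks_mem_plainLtrs g hg a (List.mem_cons_of_mem _ ha)

/-- An `ε`-step of the pumping machine is an `ε`-step between words. -/
theorem eps_complete {J J' : ℕ} {k : List Bool} {C C' : PConf x}
    (h : PumpStep x.pda.explicit x.Θ none C C') (h₁ : C.ctrl.length ≤ J) (h₂ : C.brs.length ≤ J')
    (h₃ : C'.ctrl.length ≤ J) (h₄ : C'.brs.length ≤ J') :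
    C'.cnt = C.cnt ∧ ∃ s, EpsFinal x s ∧
      LRun (epsEdgeSet x) .init (encode J J' k C) (encode J J' k C') s := by
  generalize hC : C = D at h
  generalize hC' : C' = D' at h
  cases h with
  | drop ha =>
    subst hC hC'
    exact ⟨rfl, _, .drop, drop_complete ha confStack_mem_plainLtrs confTracks_mem_plainLtrs⟩
  | move he ho =>
    subst hC hC'
    exact ⟨rfl, pda_complete he ho h₁ h₃⟩
  | forget =>
    subst hC hC'
    exact ⟨rfl, _, .clear, clear_complete h₁ h₂⟩
  | bracket r p q =>
    subst hC hC'
    exact ⟨rfl, _, .row r, row_complete rfl rfl h₁ h₂ h₃ h₄⟩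

/-- Decrementing a counter, with the least significant bit first. -/
theorem exists_decrement {k : List Bool} {n : ℕ} (hk : bitsVal k = n + 1) :
    ∃ (j : ℕ) (l : List Bool), k = List.replicate j false ++ true :: l ∧
      bitsVal (List.replicate j true ++ false :: l) = n := by
  induction k generalizing n with
  | nil => simp [bitsVal] at hk
  | cons b k ih =>
    rw [bitsVal, List.foldr_cons] at hk
    change Nat.bit b (bitsVal k) = n + 1 at hk
    cases b with
    | true =>
      refine ⟨0, k, rfl, ?_⟩
      change Nat.bit false (bitsVal k) = n
      simp [Nat.bit] at hk ⊢
      omega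
    | false =>
      obtain ⟨m, hm⟩ : ∃ m, bitsVal k = m + 1 := by
        refine ⟨bitsVal k - 1, ?_⟩
        simp [Nat.bit] at hk
        omega
      obtain ⟨j, l, rfl, hl⟩ := ih hm
      refine ⟨j + 1, l, rfl, ?_⟩
      change Nat.bit true (bitsVal (List.replicate j true ++ false :: l)) = n
      rw [hl]
      rw [hm] at hk
      simp [Nat.bit] at hk ⊢
      omega

/-- A step of the pumping machine that reads a letter is such a step between words. -/
theorem letter_complete {J J' : ℕ} {k : List Bool} {C C' : PConf x} {a : Fin x.numInput}
    (h : PumpStep x.pda.explicit x.Θ (some a) C C') (hk : bitsVal k = C.cnt) :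
    ∃ k', k'.length = k.length ∧ bitsVal k' = C'.cnt ∧
      LRun (letterEdgeSet x a) .init (encode J J' k C) (encode J J' k' C') .copy := by
  have hcopy : ∀ (u : List Ltr) (G : List Track), (∀ l ∈ u, l ∈ plainLtrs x) →
      (∀ g ∈ G, ∀ l ∈ g.1 :: g.2, l ∈ plainLtrs x) → LRun (letterEdgeSet x a) .copy
        (u ++ G.flatMap Track.word) (u ++ G.flatMap Track.word) .copy := by
    refine fun u G hu hG => .copy fun l hl => ?_
    rcases List.mem_append.1 hl with hl | hl
    · exact LetterEdge.copy (hu l hl)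
    · obtain ⟨g, hg, hl⟩ := List.mem_flatMap.1 hl
      rcases List.mem_cons.1 hl with rfl | hl
      · exact LetterEdge.hash
      · exact LetterEdge.copy (hG g hg l hl)
  cases h with
  | read ha hm =>
    exact ⟨k, rfl, hk, .letter (LetterEdge.free_head ha hm) (.letter (LetterEdge.free_pend ha)
      (hcopy _ _ confStack_mem_plainLtrs confTracks_mem_plainLtrs))⟩
  | @readTheta _ κ q c b ha =>
    obtain ⟨j, l, rfl, hl⟩ := exists_decrement hk
    refine ⟨_, by simp, hl,
      .letter (LetterEdge.theta_head ha) (.letter (LetterEdge.theta_pend ha) ?_)⟩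
    simp only [List.map_append, List.map_cons, List.map_replicate, List.append_assoc,
      List.cons_append]
    refine LRun.append (r := LetterState.count) ?_ (.letter (LetterEdge.decrement ha) ?_)
    · have := LRun.loop (E := letterEdgeSet x a) (q := .count) (u := List.replicate j Ltr.zero)
        (fun _ => .one) fun b hb => by
          rw [List.eq_of_mem_replicate hb]
          exact LetterEdge.borrow ha
      simpa [bitLtr] using this
    · have := hcopy _ _ (confStack_mem_plainLtrs (J := J) (k := l) (c := c))
        (confTracks_mem_plainLtrs (J := J') (C := ⟨.N, none, κ + 1, q, c, b⟩))
      rw [List.append_assoc] at this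
      exact this

end

/-! ### Lists of the edges and of the final states -/

/-- An edge or a final state of a transducer with states in `X`. -/
inductive Item (X : Type)
  | edge (q : X) (l : Option (Ltr × Ltr)) (r : X)
  | final (q : X)

namespace Item

variable {X : Type}

/-- The edges in a list of items. -/
def edges (l : List (Item X)) : List (LEdge X) :=
  l.filterMap fun | edge q l r => some (q, l, r) | final _ => none

/-- The final states in a list of items. -/
def finals (l : List (Item X)) : List X :=
  l.filterMap fun | edge _ _ _ => none | final q => some q

theorem mem_edges {l : List (Item X)} {e : LEdge X} : e ∈ edges l ↔ edge e.1 e.2.1 e.2.2 ∈ l := by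
  rw [edges, List.mem_filterMap]
  constructor
  · rintro ⟨_ | _, h, h'⟩ <;> simp at h'
    subst h'
    exact h
  · exact fun h => ⟨_, h, rfl⟩

theorem mem_finals {l : List (Item X)} {q : X} : q ∈ finals l ↔ final q ∈ l := by
  rw [finals, List.mem_filterMap]
  constructor
  · rintro ⟨_ | _, h, h'⟩ <;> simp at h'
    subst h'
    exact h
  · exact fun h => ⟨_, h, rfl⟩

/-- Loops at `q` for the letters in `l`, which copy these letters. -/
def loops (q : X) (l : List Ltr) : List (Item X) := l.map fun a => edge q (some (a, a)) q

end Item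

/-- All modes. -/
def modes : List Mode := [.N, .A1, .A2, .B1, .B2]

theorem mem_modes (m : Mode) : m ∈ modes := by cases m <;> simp [modes]

open Item

section
variable (x : Instance)

/-- The edges and final states of the gadget for a bracket operation. -/
def rowItems (r : Fin 8) : List (Item (EpsState x)) := List.flatten [
  [edge .init (some ((bracketOp r).src.ltr, (bracketOp r).dst.ltr)) (.rowHead r)],
  if (bracketOp r).atTop then List.flatten [
      [edge (.rowHead r) (some (.blank, .blank)) (.rowStack r)],
      loops (.rowStack r) baseLtrs,
      [edge (.rowStack r) (some (if (bracketOp r).before then .bracket else .blank,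
        if (bracketOp r).after then .bracket else .blank)) (.row r)]]
    else [edge (.rowHead r) (some (.blank, .blank)) (.row r)],
  loops (.row r) (plainLtrs x),
  [edge (.row r) (some (.hash, .hash)) (.rowTrack r), final (.row r)],
  (List.finRange x.pda.numLetters).flatMap fun p : Fin x.pda.numLetters =>
    (List.finRange x.pda.numLetters).flatMap fun q : Fin x.pda.numLetters =>
      [edge (.rowTrack r) (some (.data (pick (bracketOp r).s p q),
        .data (pick (bracketOp r).t p q))) (.rowFst r p q),
        edge (.rowFst r p q) (some (.blank, .blank)) (.rowFst r p q),
        edge (.rowFst r p q) (some (if (bracketOp r).before then .data p else .blank,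
          if (bracketOp r).after then .data p else .blank)) (.rowSnd r q)],
  (List.finRange x.pda.numLetters).flatMap fun q : Fin x.pda.numLetters =>
    [edge (.rowSnd r q) (some (.blank, .blank)) (.rowSnd r q),
      edge (.rowSnd r q) (some (if (bracketOp r).before then .data q else .blank,
        if (bracketOp r).after then .data q else .blank)) (.row r)]]

/-- The edges and final states that depend only on the sizes in the input. -/
def baseItems : List (Item (EpsState x)) := List.flatten [
  (List.finRange 8).flatMap (rowItems x),
  modes.map fun m => edge .init (some (m.ltr, m.ltr)) .dropHead,
  loops .drop (plainLtrs x),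
  [edge .drop (some (.hash, .hash)) .drop, final .drop,
    edge .init (some (Mode.N.ltr, Mode.N.ltr)) .clearHead,
    edge .clearHead (some (.blank, .blank)) .clear],
  loops .clear baseLtrs,
  [edge .clear (some (.bracket, .blank)) .clear, edge .clear (some (.hash, .hash)) .clearTrack,
    final .clear],
  (List.range x.size).flatMap fun i => [edge .clear (some (.data i, .blank)) .clear,
    edge .clearTrack (some (.data i, .data i)) .clear],
  [edge .init (some (startLtr, Mode.N.ltr)) .startHead,
    edge .startHead (some (.blank, .blank)) .startCount],
  loops .startCount baseLtrs,
  [edge .startCount (some (.hash, .blank)) .startCount, final (.start x.pda.n),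
    edge (.start x.pda.n) (some (.hash, .blank)) (.start x.pda.n),
    edge .init (some (Mode.N.ltr, .zero)) .finishHead,
    edge .finishHead (some (.blank, .zero)) (.finish 0), final (.finish x.pda.n)],
  (plainLtrs x).map fun l => edge (.finish x.pda.n) (some (l, .zero)) (.finish x.pda.n)]

/-- The edges that compare with the initial state of the PDA. -/
def startItems : List (Item (EpsState x)) :=
  (List.finRange x.pda.n).flatMap fun i : Fin x.pda.n =>
    [edge (.start i) (some (.hash, .blank)) (.start i),
      edge (.start i) (some (.hash, .hash)) (.startTrack i),
      edge (.startTrack i) (some (.hash, .data (x.pda.start.get i))) (.start (i + 1))]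

/-- The edges that compare with the final state of the PDA. -/
def finishItems : List (Item (EpsState x)) :=
  (List.finRange x.pda.n).flatMap fun i : Fin x.pda.n =>
    ((plainLtrs x).map fun l => edge (.finish i) (some (l, .zero)) (.finish i)) ++
    [edge (.finish i) (some (.hash, .zero)) (.finishTrack i),
      edge (.finishTrack i) (some (.data (x.pda.final.get i), .zero)) (.finish (i + 1))]

/-- The edges that write the initial stack symbol. -/
def bottomItems : List (Item (EpsState x)) :=
  [edge .startCount (some (.hash, optLtr x.pda.bottom)) (.start 0)]

/-- The edges that handle the stack, in the gadget for a transducer of the PDA. -/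
def stackItems (a : Option (Fin x.numInput)) (op : StackOp (Fin x.pda.numStack)) :
    List (Item (EpsState x)) :=
  match op with
  | .skip => [edge (.pdaHead a .skip) (some (optLtr a, .blank))
    (.pda a .skip (x.pda.transducer a _).init)]
  | .push γ => edge (.pdaHead a (.push γ)) (some (optLtr a, .blank)) (.pdaStack a (.push γ)) ::
      (loops (.pdaStack a (.push γ)) baseLtrs ++
      [edge (.pdaStack a (.push γ)) (some (.blank, .data γ))
        (.pda a (.push γ) (x.pda.transducer a _).init)])
  | .pop γ => edge (.pdaHead a (.pop γ)) (some (optLtr a, .blank)) (.pdaStack a (.pop γ)) ::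
      (loops (.pdaStack a (.pop γ)) baseLtrs ++
      [edge (.pdaStack a (.pop γ)) (some (.data γ, .blank))
        (.pda a (.pop γ) (x.pda.transducer a _).init)])

/-- The item for an edge of a transducer of the PDA. -/
def pdaItem (a : Option (Fin x.numInput)) (op : StackOp (Fin x.pda.numStack)) :
    Fin (x.pda.transducer a op).numStates × Option (Fin x.pda.numLetters × Fin x.pda.numLetters) ×
      Fin (x.pda.transducer a op).numStates → Item (EpsState x)
  | (q, none, r) => edge (.pda a op q) none (.pda a op r)
  | (q, some (y, z), r) => edge (.pdaTrack a op q) (some (.data y, .data z)) (.pda a op r)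

/-- The edges and final states of the gadget for a transducer of the PDA. -/
def pdaItems (a : Option (Fin x.numInput)) (op : StackOp (Fin x.pda.numStack)) :
    List (Item (EpsState x)) := List.flatten [
  modes.map fun m => edge .init (some (m.ltr, m.ltr)) (.pdaHead a op),
  (List.finRange (x.pda.transducer a op).numStates).flatMap fun q =>
    [edge (.pda a op q) (some (.hash, .hash)) (.pdaTrack a op q)] ++
      loops (.pda a op q) (plainLtrs x),
  stackItems x a op,
  (x.pda.transducer a op).final.map fun q => final (.pda a op q),
  (x.pda.transducer a op).edges.map (pdaItem x a op)]

/-- The edges that delete letters. -/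
def dropItems : List (Item (EpsState x)) :=
  (List.finRange x.numInput).flatMap fun a =>
    if a ∈ x.Θ then [] else [edge .dropHead (some (.blank, .data a)) .drop]

/-- The edges and final states of the transducer for `ε`. -/
def epsItems : List (Item (EpsState x)) := List.flatten [
  baseItems x, startItems x, finishItems x, bottomItems x,
  (Code.labels x.numInput).flatMap fun a => (Code.stackOps x.pda.numStack).flatMap fun op =>
    pdaItems x a op,
  dropItems x]

/-- The edges of the transducer for the letter `a`. -/
def letterItems (a : Fin x.numInput) : List (LEdge LetterState) :=
  (if a ∈ x.Θ then
    [(.init, some (Mode.N.ltr, Mode.N.ltr), .head), (.head, some (.blank, .data a), .count),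
      (.count, some (.zero, .one), .count), (.count, some (.one, .zero), .copy)]
  else
    (modes.filter Mode.reads).map (fun m => (.init, some (m.ltr, m.ltr), .head)) ++
      [(.head, some (.blank, .data a), .copy)]) ++
  ((.copy, some (.hash, .hash), .copy) :: (plainLtrs x).map fun l => (.copy, some (l, l), .copy))

end

variable {x : Instance}

theorem mem_loops {X : Type} {q : X} {l : List Ltr} {e : Item X} :
    e ∈ loops q l ↔ ∃ a ∈ l, edge q (some (a, a)) q = e := by simp [loops]

theorem mem_letterItems {a : Fin x.numInput} {e : LEdge LetterState} :
    e ∈ letterItems x a ↔ LetterEdge x a e.1 e.2.1 e.2.2 := by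
  constructor
  · intro h
    rw [letterItems] at h
    split at h
    · simp only [List.mem_append, List.mem_cons, List.mem_map, List.not_mem_nil, or_false] at h
      rcases h with (rfl | rfl | rfl | rfl) | rfl | ⟨l, hl, rfl⟩
      exacts [.theta_head (by assumption), .theta_pend (by assumption), .borrow (by assumption),
        .decrement (by assumption), .hash, .copy hl]
    · simp only [List.mem_append, List.mem_cons, List.mem_map, List.not_mem_nil, or_false,
        List.mem_filter] at h
      rcases h with (⟨m, hm, rfl⟩ | rfl) | rfl | ⟨l, hl, rfl⟩
      · exact .free_head (by assumption) hm.2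
      · exact .free_pend (by assumption)
      · exact .hash
      · exact .copy hl
  · obtain ⟨q, l, r⟩ := e
    intro h
    cases h with
    | @free_head h m hm =>
      simp only [letterItems, h, if_false, List.mem_append, List.mem_map, List.mem_filter]
      exact .inl (.inl ⟨m, ⟨mem_modes m, hm⟩, rfl⟩)
    | copy hl => simp [letterItems, hl]
    | hash => simp [letterItems]
    | _ => simp_all [letterItems]

/-- The items are sound: each stands for an edge or a final state. -/
def Item.Valid (x : Instance) : Item (EpsState x) → Prop
  | edge q l r => EpsEdge x q l r
  | final q => EpsFinal x q

theorem rowItems_valid {r : Fin 8} {e : Item (EpsState x)} (h : e ∈ rowItems x r) : e.Valid x := by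
  simp only [rowItems, List.flatten_cons, List.flatten_nil, List.append_nil, List.mem_cons,
    List.mem_append, mem_loops, List.mem_flatMap,
    List.not_mem_nil, or_false] at h
  rcases h with rfl | h | ⟨l, hl, rfl⟩ | (rfl | rfl) | ⟨p, -, q, -, rfl | rfl | rfl⟩ |
    ⟨q, -, rfl | rfl⟩
  · exact .row_head r
  · split at h
    · rename_i hr
      simp only [List.mem_cons, List.mem_append, mem_loops, List.not_mem_nil, or_false] at h
      rcases h with rfl | ⟨l, hl, rfl⟩ | rfl
      exacts [.row_stack r hr, .row_base r hr hl, .row_top r hr]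
    · rename_i hr
      rw [List.mem_singleton] at h
      subst h
      exact .row_skip r (by simpa using hr)
  · exact .row_copy r hl
  · exact .row_hash r
  · exact .row r
  · exact .row_cur r p q
  · exact .row_blank r p q
  · exact .row_fst r p q
  · exact .row_blank' r q
  · exact .row_snd r q

theorem baseItems_valid {e : Item (EpsState x)} (h : e ∈ baseItems x) : e.Valid x := by
  simp only [baseItems, List.flatten_cons, List.flatten_nil, List.append_nil, List.mem_cons,
    List.mem_append, mem_loops, List.mem_flatMap, List.mem_map,
    List.not_mem_nil, or_false, List.mem_range] at h
  rcases h with ⟨r, -, h⟩ | ⟨m, -, rfl⟩ | ⟨l, hl, rfl⟩ | (rfl | rfl | rfl | rfl) | ⟨l, hl, rfl⟩ |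
    (rfl | rfl | rfl) | ⟨i, hi, rfl | rfl⟩ | (rfl | rfl) | ⟨l, hl, rfl⟩ |
    (rfl | rfl | rfl | rfl | rfl | rfl) | ⟨l, hl, rfl⟩
  · exact rowItems_valid h
  · exact .drop_head m
  · exact .drop_copy hl
  · exact .drop_hash
  · exact .drop
  · exact .clear_head
  · exact .clear_pend
  · exact .clear_base hl
  · exact .clear_bracket
  · exact .clear_hash
  · exact .clear
  · exact .clear_data hi
  · exact .clear_cur hi
  · exact .start_head
  · exact .start_pend
  · exact .start_base hl
  · exact .start_blank
  · exact .start
  · exact .start_pad le_rfl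
  · exact .finish_head
  · exact .finish_pend
  · exact .finish
  · exact .finish_copy le_rfl hl

theorem startItems_valid {e : Item (EpsState x)} (h : e ∈ startItems x) : e.Valid x := by
  simp only [startItems, List.mem_cons, List.mem_flatMap, List.not_mem_nil, or_false] at h
  rcases h with ⟨i, -, rfl | rfl | rfl⟩
  exacts [.start_pad i.2.le, .start_hash i.2, .start_cur i]

theorem finishItems_valid {e : Item (EpsState x)} (h : e ∈ finishItems x) : e.Valid x := by
  simp only [finishItems, List.mem_cons, List.mem_append, List.mem_map, List.mem_flatMap,
    List.not_mem_nil, or_false] at h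
  rcases h with ⟨i, -, ⟨l, hl, rfl⟩ | rfl | rfl⟩
  exacts [.finish_copy i.2.le hl, .finish_hash i.2, .finish_cur i]

theorem pdaItems_valid {a : Option (Fin x.numInput)} {op : StackOp (Fin x.pda.numStack)}
    {e : Item (EpsState x)} (h : e ∈ pdaItems x a op) : e.Valid x := by
  simp only [pdaItems, List.flatten_cons, List.flatten_nil, List.append_nil, List.mem_cons,
    List.mem_append, mem_loops, List.mem_flatMap,
    List.mem_map, List.not_mem_nil, or_false] at h
  rcases h with ⟨m, -, rfl⟩ | ⟨q, -, rfl | ⟨l, hl, rfl⟩⟩ | h | ⟨q, hq, rfl⟩ | ⟨⟨q, l, r⟩, he, rfl⟩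
  · exact .pda_head m a op
  · exact .pda_hash a op q
  · exact .pda_copy a op q hl
  · cases op <;> simp only [stackItems, List.mem_cons, List.mem_append, mem_loops,
      List.not_mem_nil, or_false] at h
    · subst h
      exact .pda_skip a
    · rcases h with rfl | ⟨l, hl, rfl⟩ | rfl
      exacts [.pda_stack a (by simp), .pda_base (op := .push _) a (by simp) hl, .pda_push a _]
    · rcases h with rfl | ⟨l, hl, rfl⟩ | rfl
      exacts [.pda_stack a (by simp), .pda_base (op := .pop _) a (by simp) hl, .pda_pop a _]
  · exact .pda a op hq
  · rcases l with _ | ⟨y, z⟩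
    exacts [.pda_eps a op he, .pda_letter a op he]

theorem epsItems_valid {e : Item (EpsState x)} (h : e ∈ epsItems x) : e.Valid x := by
  simp only [epsItems, List.flatten_cons, List.flatten_nil, List.append_nil, List.mem_append,
    List.mem_flatMap] at h
  rcases h with h | h | h | h | ⟨a, -, op, -, h⟩ | h
  · exact baseItems_valid h
  · exact startItems_valid h
  · exact finishItems_valid h
  · rw [bottomItems, List.mem_singleton] at h
    subst h
    exact .start_bottom
  · exact pdaItems_valid h
  · rw [dropItems, List.mem_flatMap] at h
    obtain ⟨a, -, h⟩ := h
    split at h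
    · simp at h
    · rw [List.mem_singleton] at h
      subst h
      exact .drop_letter (by assumption)

theorem mem_epsItems_of_row {r : Fin 8} {e : Item (EpsState x)} (h : e ∈ rowItems x r) :
    e ∈ epsItems x := by
  simp only [epsItems, baseItems, List.flatten_cons, List.flatten_nil, List.append_nil,
    List.mem_append, List.mem_flatMap]
  exact .inl (.inl ⟨r, List.mem_finRange r, h⟩)

theorem mem_epsItems_of_base {e : Item (EpsState x)} (h : e ∈ baseItems x) : e ∈ epsItems x :=
  List.mem_flatten_of_mem (by simp) h

theorem mem_epsItems_of_pda {a : Option (Fin x.numInput)} {op : StackOp (Fin x.pda.numStack)}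
    {e : Item (EpsState x)} (h : e ∈ pdaItems x a op) : e ∈ epsItems x := by
  simp only [epsItems, List.flatten_cons, List.flatten_nil, List.append_nil, List.mem_append,
    List.mem_flatMap]
  exact .inr (.inr (.inr (.inr (.inl ⟨a, Code.mem_labels a, op, Code.mem_stackOps op, h⟩))))

theorem mem_epsItems_of_start {e : Item (EpsState x)} (h : e ∈ startItems x) : e ∈ epsItems x :=
  List.mem_flatten_of_mem (by simp) h

theorem mem_epsItems_of_finish {e : Item (EpsState x)} (h : e ∈ finishItems x) : e ∈ epsItems x :=
  List.mem_flatten_of_mem (by simp) h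

theorem edge_mem_epsItems {q r : EpsState x} {l : Option (Ltr × Ltr)} (h : EpsEdge x q l r) :
    edge q l r ∈ epsItems x := by
  cases h with
  | row_head r => exact mem_epsItems_of_row (r := r) (by simp [rowItems])
  | row_stack r hr => exact mem_epsItems_of_row (r := r) (by simp [rowItems, hr])
  | row_skip r hr => exact mem_epsItems_of_row (r := r) (by simp [rowItems, hr])
  | row_base r hr hl => exact mem_epsItems_of_row (r := r) (by simp [rowItems, hr, mem_loops, hl])
  | row_top r hr => exact mem_epsItems_of_row (r := r) (by simp [rowItems, hr])
  | row_copy r hl => exact mem_epsItems_of_row (r := r) (by simp [rowItems, mem_loops, hl])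
  | row_hash r => exact mem_epsItems_of_row (r := r) (by simp [rowItems])
  | row_cur r p q =>
    refine mem_epsItems_of_row (r := r) ?_
    simp only [rowItems, List.flatten_cons, List.flatten_nil, List.append_nil, List.mem_append,
      List.mem_flatMap]
    exact .inr (.inr (.inr (.inr (.inl ⟨p, List.mem_finRange p, q, List.mem_finRange q, by simp⟩))))
  | row_blank r p q =>
    refine mem_epsItems_of_row (r := r) ?_
    simp only [rowItems, List.flatten_cons, List.flatten_nil, List.append_nil, List.mem_append,
      List.mem_flatMap]
    exact .inr (.inr (.inr (.inr (.inl ⟨p, List.mem_finRange p, q, List.mem_finRange q, by simp⟩))))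
  | row_fst r p q =>
    refine mem_epsItems_of_row (r := r) ?_
    simp only [rowItems, List.flatten_cons, List.flatten_nil, List.append_nil, List.mem_append,
      List.mem_flatMap]
    exact .inr (.inr (.inr (.inr (.inl ⟨p, List.mem_finRange p, q, List.mem_finRange q, by simp⟩))))
  | row_blank' r q =>
    refine mem_epsItems_of_row (r := r) ?_
    simp only [rowItems, List.flatten_cons, List.flatten_nil, List.append_nil, List.mem_append,
      List.mem_flatMap]
    exact .inr (.inr (.inr (.inr (.inr ⟨q, List.mem_finRange q, by simp⟩))))
  | row_snd r q =>
    refine mem_epsItems_of_row (r := r) ?_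
    simp only [rowItems, List.flatten_cons, List.flatten_nil, List.append_nil, List.mem_append,
      List.mem_flatMap]
    exact .inr (.inr (.inr (.inr (.inr ⟨q, List.mem_finRange q, by simp⟩))))
  | pda_head m a op => exact mem_epsItems_of_pda (a := a) (op := op) (by simp [pdaItems, mem_modes])
  | pda_skip a => exact mem_epsItems_of_pda (a := a) (op := .skip) (by simp [pdaItems, stackItems])
  | @pda_stack a op h =>
    refine mem_epsItems_of_pda (a := a) (op := op) ?_
    cases op <;> simp_all [pdaItems, stackItems]
  | @pda_base a op h l hl =>
    refine mem_epsItems_of_pda (a := a) (op := op) ?_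
    cases op <;> simp_all [pdaItems, stackItems, mem_loops]
  | pda_push a γ => exact
      mem_epsItems_of_pda (a := a) (op := .push γ) (by simp [pdaItems, stackItems])
  | pda_pop a γ => exact
      mem_epsItems_of_pda (a := a) (op := .pop γ) (by simp [pdaItems, stackItems])
  | pda_copy a op q hl =>
    exact mem_epsItems_of_pda (a := a) (op := op) (by simp [pdaItems, mem_loops, hl])
  | pda_hash a op q => exact mem_epsItems_of_pda (a := a) (op := op) (by simp [pdaItems])
  | pda_eps a op h =>
    refine mem_epsItems_of_pda (a := a) (op := op) ?_
    simp only [pdaItems, List.flatten_cons, List.flatten_nil, List.append_nil, List.mem_append,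
      List.mem_map]
    exact .inr (.inr (.inr (.inr ⟨_, h, rfl⟩)))
  | pda_letter a op h =>
    refine mem_epsItems_of_pda (a := a) (op := op) ?_
    simp only [pdaItems, List.flatten_cons, List.flatten_nil, List.append_nil, List.mem_append,
      List.mem_map]
    exact .inr (.inr (.inr (.inr ⟨_, h, rfl⟩)))
  | drop_head m => exact mem_epsItems_of_base (by simp [baseItems, mem_modes])
  | @drop_letter a ha =>
    simp only [epsItems, List.flatten_cons, List.flatten_nil, List.append_nil, List.mem_append,
      dropItems, List.mem_flatMap]
    exact .inr (.inr (.inr (.inr (.inr ⟨a, List.mem_finRange a, by simp [ha]⟩))))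
  | drop_copy hl => exact mem_epsItems_of_base (by simp [baseItems, mem_loops, hl])
  | drop_hash => exact mem_epsItems_of_base (by simp [baseItems])
  | clear_head => exact mem_epsItems_of_base (by simp [baseItems])
  | clear_pend => exact mem_epsItems_of_base (by simp [baseItems])
  | clear_base hl => exact mem_epsItems_of_base (by simp [baseItems, mem_loops, hl])
  | clear_bracket => exact mem_epsItems_of_base (by simp [baseItems])
  | clear_data hi => exact mem_epsItems_of_base (by simp [baseItems, hi])
  | clear_hash => exact mem_epsItems_of_base (by simp [baseItems])
  | clear_cur hi => exact mem_epsItems_of_base (by simp [baseItems, hi])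
  | start_head => exact mem_epsItems_of_base (by simp [baseItems])
  | start_pend => exact mem_epsItems_of_base (by simp [baseItems])
  | start_base hl => exact mem_epsItems_of_base (by simp [baseItems, mem_loops, hl])
  | start_blank => exact mem_epsItems_of_base (by simp [baseItems])
  | start_bottom => simp [epsItems, bottomItems]
  | @start_pad i hi =>
    rcases hi.lt_or_eq with hi | rfl
    · exact mem_epsItems_of_start (List.mem_flatMap.2 ⟨⟨i, hi⟩, List.mem_finRange _, by simp⟩)
    · exact mem_epsItems_of_base (by simp [baseItems])
  | @start_hash i hi =>
    exact mem_epsItems_of_start (List.mem_flatMap.2 ⟨⟨i, hi⟩, List.mem_finRange _, by simp⟩)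
  | start_cur i =>
    exact mem_epsItems_of_start (List.mem_flatMap.2 ⟨i, List.mem_finRange _, by simp⟩)
  | finish_head => exact mem_epsItems_of_base (by simp [baseItems])
  | finish_pend => exact mem_epsItems_of_base (by simp [baseItems])
  | @finish_copy i hi l hl =>
    rcases hi.lt_or_eq with hi | rfl
    · exact mem_epsItems_of_finish (List.mem_flatMap.2 ⟨⟨i, hi⟩, List.mem_finRange _, by simp [hl]⟩)
    · exact mem_epsItems_of_base (by simp [baseItems, hl])
  | @finish_hash i hi =>
    exact mem_epsItems_of_finish (List.mem_flatMap.2 ⟨⟨i, hi⟩, List.mem_finRange _, by simp⟩)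
  | finish_cur i =>
    exact mem_epsItems_of_finish (List.mem_flatMap.2 ⟨i, List.mem_finRange _, by simp⟩)

theorem final_mem_epsItems {q : EpsState x} (h : EpsFinal x q) : final q ∈ epsItems x := by
  cases h with
  | row r => exact mem_epsItems_of_row (r := r) (by simp [rowItems])
  | pda a op h =>
    refine mem_epsItems_of_pda (a := a) (op := op) ?_
    simp only [pdaItems, List.flatten_cons, List.flatten_nil, List.append_nil, List.mem_append,
      List.mem_map]
    exact .inr (.inr (.inr (.inl ⟨_, h, rfl⟩)))
  | drop => exact mem_epsItems_of_base (by simp [baseItems])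
  | clear => exact mem_epsItems_of_base (by simp [baseItems])
  | start => exact mem_epsItems_of_base (by simp [baseItems])
  | finish => exact mem_epsItems_of_base (by simp [baseItems])

/-- The list of edges is complete and contains edges of the transducer only. -/
theorem mem_edges_epsItems {e : LEdge (EpsState x)} :
    e ∈ edges (epsItems x) ↔ e ∈ epsEdgeSet x :=
  mem_edges.trans ⟨fun h => epsItems_valid h, edge_mem_epsItems⟩

theorem mem_finals_epsItems {q : EpsState x} : q ∈ finals (epsItems x) ↔ EpsFinal x q :=
  mem_finals.trans ⟨fun h => epsItems_valid h, final_mem_epsItems⟩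

/-! ### The doubly succinct automaton -/

theorem length_le_length_flatMap {α β : Type} (f : α → List β) {l : List α} {a : α} (h : a ∈ l) :
    (f a).length ≤ (l.flatMap f).length := by
  obtain ⟨u, v, rfl⟩ := List.append_of_mem h
  simp only [List.flatMap_append, List.flatMap_cons, List.length_append]
  omega

theorem length_mul_le_length_flatMap {α β : Type} (f : α → List β) (l : List α) (c : ℕ)
    (h : ∀ a ∈ l, c ≤ (f a).length) : l.length * c ≤ (l.flatMap f).length := by
  induction l with
  | nil => simp
  | cons a l ih =>
    have h₁ := h a List.mem_cons_self
    have h₂ := ih fun b hb => h b (List.mem_cons_of_mem _ hb)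
    simp only [List.flatMap_cons, List.length_append, List.length_cons, Nat.add_mul]
    omega

theorem numStates_le_length_code {d : ℕ} (T : Transducer (Fin d)) :
    T.numStates + 4 ≤ (Code.transducer T).length := by
  simp only [Code.transducer, Code.unary, Code.letter, Code.list, List.length_append,
    List.length_replicate, List.length_singleton]
  omega

section
variable (x : Instance)

theorem length_codes_add_le_size :
    ((Code.labels x.numInput).flatMap fun a => (Code.stackOps x.pda.numStack).flatMap fun op =>
      Code.transducer (x.pda.transducer a op)).length + 5 ≤ x.size := by
  have : 1 ≤ (Code.optLetter x.pda.bottom).length := by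
    cases x.pda.bottom <;> simp [Code.optLetter, Code.unary]
  simp only [Instance.size, Code.input, Code.succinctPDA, List.length_append, Code.unary,
    List.length_replicate, List.length_singleton]
  omega

theorem numStates_lt_size (a : Option (Fin x.numInput)) (op : StackOp (Fin x.pda.numStack)) :
    (x.pda.transducer a op).numStates < x.size := by
  have h₁ := numStates_le_length_code (x.pda.transducer a op)
  have h₂ := length_le_length_flatMap (fun op => Code.transducer (x.pda.transducer a op))
    (Code.mem_stackOps op)
  have h₃ := length_le_length_flatMap (fun a => (Code.stackOps x.pda.numStack).flatMap fun op =>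
      Code.transducer (x.pda.transducer a op)) (Code.mem_labels a)
  have h₄ := length_codes_add_le_size x
  omega

theorem numStack_lt_size : 2 * x.pda.numStack + 8 ≤ x.size := by
  have h₁ := length_mul_le_length_flatMap
    (fun op => Code.transducer (x.pda.transducer none op)) (Code.stackOps x.pda.numStack) 5
    fun op _ => (Nat.add_le_add_right (x.pda.transducer none op).init.pos 4).trans
      (numStates_le_length_code _)
  have h₃ := length_le_length_flatMap (fun a => (Code.stackOps x.pda.numStack).flatMap fun op =>
      Code.transducer (x.pda.transducer a op)) (Code.mem_labels none)
  have h₄ := length_codes_add_le_size x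
  simp only [Code.stackOps, List.length_cons, List.length_append, List.length_map,
    List.length_finRange] at h₁ h₃ h₄
  omega

end

/-- The number of an input label. -/
def labCode {s : ℕ} : Option (Fin s) → ℕ
  | none => 0
  | some a => a + 1

/-- The number of a stack operation. -/
def opCode {g : ℕ} : StackOp (Fin g) → ℕ
  | .skip => 0
  | .push γ => 1 + γ
  | .pop γ => 1 + g + γ

theorem labCode_injective {s : ℕ} : Function.Injective (labCode (s := s)) := by
  rintro (_ | a) (_ | b) h <;> simp_all [labCode, Fin.ext_iff]

theorem opCode_injective {g : ℕ} : Function.Injective (opCode (g := g)) := by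
  rintro (_ | a | a) (_ | b | b) h <;> simp only [opCode] at h <;>
    first | rfl | omega | (congr; omega)

theorem num_optLtr {s : ℕ} (a : Option (Fin s)) : (optLtr a).num = 4 + labCode a := by
  cases a <;> simp [optLtr, Ltr.num, labCode]
  omega

/-- The kind of a state, and its parameters. -/
def EpsState.code {x : Instance} : EpsState x → ℕ × ℕ × ℕ × ℕ
  | init => (0, 0, 0, 0)
  | rowHead r => (1, r, 0, 0)
  | rowStack r => (2, r, 0, 0)
  | row r => (3, r, 0, 0)
  | rowTrack r => (4, r, 0, 0)
  | rowFst r p q => (5, r, p, q)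
  | rowSnd r q => (6, r, q, 0)
  | pdaHead a op => (7, 0, labCode a, opCode op)
  | pdaStack a op => (8, 0, labCode a, opCode op)
  | pda a op q => (9, q, labCode a, opCode op)
  | pdaTrack a op q => (10, q, labCode a, opCode op)
  | dropHead => (11, 0, 0, 0)
  | drop => (12, 0, 0, 0)
  | clearHead => (13, 0, 0, 0)
  | clear => (14, 0, 0, 0)
  | clearTrack => (15, 0, 0, 0)
  | startHead => (16, 0, 0, 0)
  | startCount => (17, 0, 0, 0)
  | start i => (18, i, 0, 0)
  | startTrack i => (19, i, 0, 0)
  | finishHead => (20, 0, 0, 0)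
  | finish i => (21, i, 0, 0)
  | finishTrack i => (22, i, 0, 0)

theorem EpsState.code_injective {x : Instance} : Function.Injective (EpsState.code (x := x)) := by
  intro s t h
  have h₁ := congrArg Prod.fst h
  cases s <;> cases t <;> first
    | rfl
    | (simp [code] at h₁; done)
    | (simp only [code, Prod.mk.injEq, Fin.val_inj, true_and, and_true, labCode_injective.eq_iff,
        opCode_injective.eq_iff] at h
       first
         | (subst h; rfl)
         | (obtain ⟨rfl, rfl⟩ := h; rfl)
         | (obtain ⟨rfl, rfl, rfl⟩ := h; rfl)
         | (obtain ⟨h, rfl, rfl⟩ := h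
            obtain rfl := Fin.val_injective h
            rfl))

/-- The number with four digits in base `ℓ`. -/
def fourDigits (ℓ : ℕ) (c : ℕ × ℕ × ℕ × ℕ) : ℕ := c.2.1 + ℓ * (c.2.2.1 + ℓ * (c.2.2.2 + ℓ * c.1))

theorem add_mul_inj {ℓ a b A B : ℕ} (ha : a < ℓ) (hb : b < ℓ) (h : a + ℓ * A = b + ℓ * B) :
    a = b ∧ A = B := by
  have h₁ : a = b := by
    have := congrArg (· % ℓ) h
    simpa [Nat.mod_eq_of_lt ha, Nat.mod_eq_of_lt hb] using this
  subst h₁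
  exact ⟨rfl, Nat.eq_of_mul_eq_mul_left (by omega) (Nat.add_left_cancel h)⟩

/-- The number of a state. -/
def EpsState.num {x : Instance} (s : EpsState x) : ℕ := fourDigits x.size s.code

/-- The states all of whose parameters are smaller than the size of the input. -/
def EpsState.Good {x : Instance} : Set (EpsState x) :=
  {s | s.code.1 < 23 ∧ s.code.2.1 < x.size ∧ s.code.2.2.1 < x.size ∧ s.code.2.2.2 < x.size}

theorem EpsState.num_injOn {x : Instance} : Set.InjOn EpsState.num (EpsState.Good (x := x)) := by
  rintro s ⟨-, h₁, h₂, h₃⟩ t ⟨-, k₁, k₂, k₃⟩ h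
  obtain ⟨e₁, h⟩ := add_mul_inj h₁ k₁ h
  obtain ⟨e₂, h⟩ := add_mul_inj h₂ k₂ h
  obtain ⟨e₃, h⟩ := add_mul_inj h₃ k₃ h
  exact EpsState.code_injective (Prod.ext h (Prod.ext e₁ (Prod.ext e₂ e₃)))

theorem add_mul_lt {ℓ a A B : ℕ} (ha : a < ℓ) (h : A < B) : a + ℓ * A < ℓ * B :=
  calc a + ℓ * A < ℓ + ℓ * A := by omega
    _ = ℓ * (A + 1) := by ring
    _ ≤ ℓ * B := Nat.mul_le_mul_left _ h

theorem EpsState.num_le {x : Instance} {s : EpsState x} (h : s ∈ EpsState.Good) :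
    s.num ≤ 23 * x.size ^ 3 := by
  obtain ⟨h₀, h₁, h₂, h₃⟩ := h
  refine (add_mul_lt h₁ (add_mul_lt h₂ (add_mul_lt h₃ h₀))).le.trans_eq ?_
  ring

theorem labCode_lt_size {x : Instance} (a : Option (Fin x.numInput)) : labCode a < x.size := by
  have := length_code_le_size x
  cases a <;> simp only [labCode] <;> omega

theorem opCode_lt_size {x : Instance} (op : StackOp (Fin x.pda.numStack)) : opCode op < x.size := by
  have := numStack_lt_size x
  cases op <;> simp only [opCode] <;> omega

/-- The states and letters of an edge have numbers that are small enough. -/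
theorem EpsEdge.good {x : Instance} {e : LEdge (EpsState x)} (h : e ∈ epsEdgeSet x) :
    GoodEdge EpsState.Good (x.size + 4) e := by
  have hs := length_code_le_size x
  have hs' := numStack_lt_size x
  have hr : ∀ r : Fin 8, r.1 < x.size := fun r => by omega
  have hd : ∀ i : Fin x.pda.numLetters, i.1 < x.size := letter_lt_size
  have hγ : ∀ i : Fin x.pda.numStack, i.1 < x.size := stackSym_lt_size
  have hi : ∀ i : Fin x.numInput, i.1 < x.size := fun i => by omega
  have hn : x.pda.n < x.size := by omega
  have hn' : ∀ i : Fin x.pda.n, i.1 < x.size := fun i => by omega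
  have hn'' : ∀ i : Fin x.pda.n, i.1 + 1 < x.size := fun i => by omega
  have h0 : 0 < x.size := by omega
  have hq : ∀ {a op} (q : Fin (x.pda.transducer a op).numStates), q.1 < x.size :=
    fun q => q.2.trans (numStates_lt_size x _ _)
  have hm : ∀ m : Mode, m.ltr.num ≤ x.size + 4 := fun m => by
    cases m <;> simp only [Mode.ltr, Ltr.num] <;> omega
  have hl : ∀ {l}, l ∈ plainLtrs x → l.num ≤ x.size + 4 := by
    intro l hl
    simp only [plainLtrs, List.mem_append, List.mem_cons, List.not_mem_nil, or_false,
      List.mem_map, List.mem_range] at hl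
    rcases hl with (rfl | rfl | rfl | rfl) | ⟨i, hi, rfl⟩ <;> simp only [Ltr.num] <;> omega
  have hb : ∀ {l}, l ∈ baseLtrs → l.num ≤ x.size + 4 := fun h => hl (baseLtrs_subset h)
  have ho : ∀ {k} (i : Option (Fin k)), k ≤ x.size → (optLtr i).num ≤ x.size + 4 := by
    intro k i hk
    cases i <;> simp only [optLtr, Ltr.num] <;> omega
  have hdata : ∀ {i}, i < x.size → (Ltr.data i).num ≤ x.size + 4 := fun h => by
    simp only [Ltr.num]
    omega
  have hc : ∀ l ∈ [Ltr.hash, .zero, .bracket, .one, .blank, startLtr], l.num ≤ x.size + 4 := by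
    simp only [List.mem_cons, List.not_mem_nil, or_false, startLtr]
    rintro l (rfl | rfl | rfl | rfl | rfl | rfl) <;> simp only [Ltr.num] <;> omega
  have hp : ∀ (b : Bool) (p q : Fin x.pda.numLetters), pick b p.1 q.1 < x.size := by
    intro b p q
    cases b
    exacts [hd p, hd q]
  obtain ⟨q, l, r⟩ := e
  simp only [List.forall_mem_cons, List.not_mem_nil, false_imp_iff, implies_true, and_true] at hc
  obtain ⟨c₀, c₁, c₂, c₃, c₄, c₅⟩ := hc
  have hi' : ∀ (b : Bool) (u v : Ltr), u.num ≤ x.size + 4 → v.num ≤ x.size + 4 →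
      (if b then u else v).num ≤ x.size + 4 := by
    intro b u v hu hv
    split <;> assumption
  have hgood : ∀ s : EpsState x, s.code.2.1 < x.size → s.code.2.2.1 < x.size →
      s.code.2.2.2 < x.size → s ∈ EpsState.Good := by
    refine fun s h₁ h₂ h₃ => ⟨?_, h₁, h₂, h₃⟩
    cases s <;> simp [EpsState.code]
  have hlab := labCode_lt_size (x := x)
  have hop := opCode_lt_size (x := x)
  have h : EpsEdge x q l r := h
  have hs1 : x.pda.numStack ≤ x.size := by omega
  have hs2 : x.numInput ≤ x.size := by omega
  cases h <;> refine ⟨hgood _ ?_ ?_ ?_, hgood _ ?_ ?_ ?_, ?_⟩ <;>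
    (try simp only [EpsState.code, Option.mem_def, reduceCtorEq, false_imp_iff, implies_true,
      Option.some.injEq, forall_eq']) <;>
    first
    | assumption
    | (solve_by_elim)
    | omega
    | (constructor <;> solve_by_elim)

theorem LetterEdge.good {x : Instance} {a : Fin x.numInput} {e : LEdge LetterState}
    (h : e ∈ letterEdgeSet x a) : GoodEdge Set.univ (x.size + 4) e := by
  have hs := length_code_le_size x
  have hm : ∀ m : Mode, m.ltr.num ≤ x.size + 4 := fun m => by
    cases m <;> simp only [Mode.ltr, Ltr.num] <;> omega
  refine ⟨Set.mem_univ _, Set.mem_univ _, ?_⟩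
  obtain ⟨q, l, r⟩ := e
  have h : LetterEdge x a q l r := h
  cases h with
  | copy hl =>
    simp only [plainLtrs, List.mem_append, List.mem_cons, List.not_mem_nil, or_false,
      List.mem_map, List.mem_range] at hl
    rcases hl with (rfl | rfl | rfl | rfl) | ⟨i, hi, rfl⟩ <;> simp [Ltr.num]; omega
  | theta_head | free_head => simpa using hm _
  | _ => simp [Ltr.num]; try omega

/-- The number of a state. -/
def LetterState.num : LetterState → ℕ
  | init => 0
  | head => 1
  | count => 2
  | copy => 3

theorem LetterState.num_injective : Function.Injective LetterState.num := by
  intro s t h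
  cases s <;> cases t <;> simp_all [num]

/-- The length of the states of the doubly succinct automaton, for inputs of size `ℓ`. -/
def stateLength (ℓ : ℕ) : ℕ := 2 ^ (10 * ℓ ^ 2)

theorem le_stateLength (ℓ : ℕ) : ℓ ≤ stateLength ℓ := by
  refine Nat.lt_two_pow_self.le.trans (Nat.pow_le_pow_right two_pos ?_)
  nlinarith [Nat.le_self_pow two_ne_zero ℓ]

/-- The word at the beginning of the initial state. -/
def initWord (x : Instance) : List Ltr :=
  startLtr :: .blank :: (x.K.bits.map bitLtr ++ [.hash])

theorem length_initWord_le (x : Instance) : (initWord x).length ≤ stateLength x.size := by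
  have := length_code_le_size x
  have := le_stateLength x.size
  simp only [initWord, List.length_map, List.length_cons, List.length_append, List.length_nil]
  omega

/-- The doubly succinct automaton for an input. -/
def dsnfaOf (x : Instance) : DSNFA (Fin x.numInput) where
  extra := x.size + 3
  M := stateLength x.size
  initPrefix := (initWord x).map (toFin (x.size + 4))
  length_initPrefix := by
    rw [List.length_map]
    exact length_initWord_le x
  transducer
    | none => mkTransducer EpsState.num (x.size + 4) (23 * x.size ^ 3) .init
        (Item.finals (epsItems x)) (Item.edges (epsItems x))
    | some a => mkTransducer LetterState.num (x.size + 4) 3 .init [.copy] (letterItems x a)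

/-- The transitions of the doubly succinct automaton, on words of letters. -/
def WordStep (x : Instance) : Option (Fin x.numInput) → List Ltr → List Ltr → Prop
  | none, W, V => ∃ s, EpsFinal x s ∧ LRun (epsEdgeSet x) .init W V s
  | some a, W, V => LRun (letterEdgeSet x a) .init W V .copy

theorem LRun.length_eq {X : Type} {E : Set (LEdge X)} {q r : X} {u v : List Ltr}
    (h : LRun E q u v r) : v.length = u.length := by
  induction h with
  | nil => rfl
  | eps _ _ ih => exact ih
  | letter _ _ ih => simp [ih]

variable {x : Instance}

theorem WordStep.length_eq {a : Option (Fin x.numInput)} {W V : List Ltr} (h : WordStep x a W V) :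
    V.length = W.length := by
  cases a with
  | none => exact h.choose_spec.2.length_eq
  | some a => exact LRun.length_eq h

theorem EpsFinal.good {s : EpsState x} (h : EpsFinal x s) : s ∈ EpsState.Good := by
  have hs := length_code_le_size x
  have hs' := numStack_lt_size x
  cases h with
  | row r => exact ⟨by simp [EpsState.code], by simp [EpsState.code]; omega,
      by simp [EpsState.code]; omega, by simp [EpsState.code]; omega⟩
  | @pda a op q _ => exact ⟨by simp [EpsState.code], q.2.trans (numStates_lt_size x _ _),
      labCode_lt_size a, opCode_lt_size op⟩
  | _ => exact ⟨by simp [EpsState.code], by simp [EpsState.code]; omega,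
      by simp [EpsState.code]; omega, by simp [EpsState.code]; omega⟩

/-- The transducers of the automaton, in terms of the steps between words of letters. -/
theorem dsnfaOf_rel_iff {a : Option (Fin x.numInput)} {W : List Ltr} (hW : IsWord (x.size + 4) W)
    {v : List (Fin (x.size + 3 + 2))} :
    ((dsnfaOf x).transducer a).Rel (W.map (toFin (x.size + 4))) v ↔
      ∃ V, v = V.map (toFin (x.size + 4)) ∧ IsWord (x.size + 4) V ∧ WordStep x a W V := by
  cases a with
  | none =>
    refine (mkTransducer_rel_iff EpsState.num_injOn (fun _ => EpsState.num_le)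
      (fun e he => EpsEdge.good (mem_edges_epsItems.1 he)) ?_
      (fun q hq => (mem_finals_epsItems.1 hq).good) hW).trans ?_
    · have := numStack_lt_size x
      refine ⟨?_, ?_, ?_, ?_⟩ <;> simp only [EpsState.code] <;> omega
    · simp_rw [mem_edges_epsItems, mem_finals_epsItems, Set.ofPred_mem_eq]
      rfl
  | some a =>
    refine (mkTransducer_rel_iff (G := Set.univ) LetterState.num_injective.injOn
      (fun q _ => by cases q <;> simp [LetterState.num])
      (fun e he => LetterEdge.good (mem_letterItems.1 he)) trivial
      (fun _ _ => trivial) hW).trans ?_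
    simp_rw [mem_letterItems]
    simp only [List.mem_singleton, exists_eq_left]
    rfl

/-! ### The language of the doubly succinct automaton -/

/-- What is known about a state of the doubly succinct automaton that is reached by `u`. -/
inductive Reached (x : Instance) : List Ltr → List (Fin x.numInput) → Prop
  | start (m : ℕ) : Reached x (initWord x ++ List.replicate m .hash) []
  | conf {W : List Ltr} {C : PConf x} {u : List (Fin x.numInput)} (hW : Represents x W C)
      (hs : Pump.Sound x.pda.explicit x.Θ x.K C u) (hb : Pump.Balanced C) : Reached x W u
  | finish (m : ℕ) {u : List (Fin x.numInput)}
      (h : u ∈ preservingDownClosure x.Θ x.K x.pda.language) : Reached x (List.replicate m .zero) u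

theorem Mode.ltr_ne_zero (m : Mode) : m.ltr ≠ .zero := by cases m <;> simp [ltr]

theorem Mode.ltr_ne_startLtr (m : Mode) : m.ltr ≠ startLtr := by cases m <;> simp [ltr, startLtr]

theorem balanced_startConf : Pump.Balanced (startConf x) := by
  constructor
  · simp [startConf]
  · simp [startConf]

/-- The final state of the automaton cannot be left. -/
theorem not_wordStep_replicate_zero {a : Option (Fin x.numInput)} {m : ℕ} {V : List Ltr} :
    ¬ WordStep x a (List.replicate m .zero) V := by
  intro h
  cases a with
  | none =>
    obtain ⟨s, hs, h⟩ := h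
    cases m with
    | zero =>
      obtain ⟨-, rfl⟩ := h.nil_inv (fun r hr => by cases (show EpsEdge x _ none r from hr))
      cases hs
    | succ m =>
      obtain ⟨b, t, v, l, rfl, hl, he, -⟩ := eps_cons_inv h nofun
      cases he <;> simp_all [Mode.ltr_ne_zero, startLtr]
  | some a =>
    cases m with
    | zero =>
      obtain ⟨-, h⟩ := LRun.nil_inv h (fun r hr => by cases (show LetterEdge x a _ none r from hr))
      cases h
    | succ m =>
      obtain ⟨b, t, v, l, rfl, hl, he, -⟩ := letter_cons_inv h
      cases he <;> simp_all [Mode.ltr_ne_zero]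

/-- The invariant `Reached` is kept by the steps of the automaton. -/
theorem Reached.step {a : Option (Fin x.numInput)} {W V : List Ltr} {u : List (Fin x.numInput)}
    (h : Reached x W u) (hs : WordStep x a W V) : Reached x V (u ++ a.toList) := by
  cases h with
  | start m =>
    cases a with
    | none =>
      obtain ⟨s, hs, h⟩ := hs
      obtain ⟨b, t, v, l, rfl, hl, he, h'⟩ := eps_cons_inv h nofun
      clear h
      cases he with
      | start_head =>
        obtain rfl : Mode.N.ltr = b := by simpa using hl
        rw [Option.toList_none, List.append_nil]
        refine .conf (start_sound (m := m + 1) ?_ hs) (Pump.sound_start _) balanced_startConf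
        simpa [List.replicate_succ] using h'
      | _ => simp [Mode.ltr_ne_startLtr] at hl
    | some a =>
      obtain ⟨b, t, v, l, rfl, hl, he, -⟩ := letter_cons_inv hs
      cases he <;> simp [Mode.ltr_ne_startLtr] at hl
  | @conf _ C _ hW hsound hb =>
    cases a with
    | none =>
      obtain ⟨s, hs, h⟩ := hs
      rcases eps_sound hW hb h hs with ⟨C', hC', hstep⟩ | ⟨hm, hp, hc, m, rfl⟩
      · exact .conf hC' (hsound.step hstep) (hb.step hstep)
      · obtain ⟨mode, pend, cnt, cur, ctrl, brs⟩ := C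
        obtain rfl : mode = .N := hm
        obtain rfl : pend = none := hp
        refine .finish m ?_
        rw [Option.toList_none, List.append_nil]
        exact hsound.mem_downClosure hc
    | some a =>
      obtain ⟨C', hC', hstep⟩ := letter_sound hW hs
      exact .conf hC' (hsound.step hstep) (hb.step hstep)
  | finish m h => exact absurd hs not_wordStep_replicate_zero

/-- The paths of the doubly succinct automaton, on words of letters. -/
inductive WordPath (x : Instance) : List Ltr → List (Option (Fin x.numInput)) → List Ltr → Prop
  | nil (W : List Ltr) : WordPath x W [] W
  | cons {W V U : List Ltr} {a : Option (Fin x.numInput)} {l : List (Option (Fin x.numInput))}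
      (h : WordStep x a W V) (h' : WordPath x V l U) : WordPath x W (a :: l) U

theorem WordPath.length_eq {W V : List Ltr} {l : List (Option (Fin x.numInput))}
    (h : WordPath x W l V) : V.length = W.length := by
  induction h with
  | nil => rfl
  | cons h _ ih => rw [ih, h.length_eq]

theorem WordPath.append {W V U : List Ltr} {l l' : List (Option (Fin x.numInput))}
    (h : WordPath x W l V) (h' : WordPath x V l' U) : WordPath x W (l ++ l') U := by
  induction h with
  | nil => exact h'
  | cons h _ ih => exact .cons h (ih h')

theorem Reached.path {W V : List Ltr} {l : List (Option (Fin x.numInput))}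
    {u : List (Fin x.numInput)} (h : Reached x W u) (hp : WordPath x W l V) :
    Reached x V (u ++ l.reduceOption) := by
  induction hp generalizing u with
  | nil => simpa using h
  | @cons _ _ _ a l hs _ ih =>
    have := ih (h.step hs)
    cases a <;> simpa using this

theorem exists_wordPath_of_isPath {p q : List.Vector (Fin (x.size + 3 + 2)) (stateLength x.size)}
    {l : List (Option (Fin x.numInput))} (h : (dsnfaOf x).explicit.IsPath p q l) {W : List Ltr}
    (hW : IsWord (x.size + 4) W) (hp : p.toList = W.map (toFin (x.size + 4))) :
    ∃ V, IsWord (x.size + 4) V ∧ q.toList = V.map (toFin (x.size + 4)) ∧ WordPath x W l V := by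
  induction l generalizing p W with
  | nil =>
    obtain rfl := (εNFA.isPath_nil _).1 h
    exact ⟨W, hW, hp, .nil W⟩
  | cons a l ih =>
    cases h with
    | cons t _ _ _ _ hs h =>
      have hs : ((dsnfaOf x).transducer a).Rel p.toList t.toList := hs
      rw [hp] at hs
      obtain ⟨V, ht, hV, hs⟩ := (dsnfaOf_rel_iff hW).1 hs
      obtain ⟨U, hU, hq, hp⟩ := ih h hV ht
      exact ⟨U, hU, hq, .cons hs hp⟩

theorem LRun.isWord {X : Type} {E : Set (LEdge X)} {G : Set X} {N : ℕ}
    (hE : ∀ e ∈ E, GoodEdge G N e) {q r : X} {u v : List Ltr} (h : LRun E q u v r) :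
    IsWord N v := by
  induction h with
  | nil => simp [IsWord]
  | eps _ _ ih => exact ih
  | letter he _ ih => exact List.forall_mem_cons.2 ⟨((hE _ he).2.2 _ rfl).2, ih⟩

theorem WordStep.isWord {a : Option (Fin x.numInput)} {W V : List Ltr} (h : WordStep x a W V) :
    IsWord (x.size + 4) V := by
  cases a with
  | none => exact h.choose_spec.2.isWord fun _ => EpsEdge.good
  | some a => exact LRun.isWord (fun _ => LetterEdge.good) h

theorem exists_isPath_of_wordPath {W V : List Ltr} {l : List (Option (Fin x.numInput))}
    (h : WordPath x W l V) (hW : IsWord (x.size + 4) W)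
    {p : List.Vector (Fin (x.size + 3 + 2)) (stateLength x.size)}
    (hp : p.toList = W.map (toFin (x.size + 4))) :
    ∃ q : List.Vector (Fin (x.size + 3 + 2)) (stateLength x.size),
      q.toList = V.map (toFin (x.size + 4)) ∧ (dsnfaOf x).explicit.IsPath p q l := by
  induction h generalizing p with
  | nil => exact ⟨p, hp, .nil p⟩
  | @cons W V U a l hs _ ih =>
    have hl : (V.map (toFin (x.size + 4))).length = stateLength x.size := by
      rw [List.length_map, hs.length_eq, ← p.toList_length, hp, List.length_map]
    obtain ⟨q, hq, h⟩ := ih hs.isWord (p := ⟨_, hl⟩) rfl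
    refine ⟨q, hq, .cons _ _ _ _ _ ?_ h⟩
    show ((dsnfaOf x).transducer a).Rel p.toList (V.map (toFin (x.size + 4)))
    rw [hp]
    exact (dsnfaOf_rel_iff hW).2 ⟨V, rfl, hs.isWord, hs⟩

/-- The initial state as a word of letters. -/
def startWord (x : Instance) : List Ltr :=
  initWord x ++ List.replicate (stateLength x.size - (initWord x).length) .hash

theorem length_startWord : (startWord x).length = stateLength x.size := by
  have := length_initWord_le x
  rw [startWord, List.length_append, List.length_replicate]
  omega

theorem map_startWord : (startWord x).map (toFin (x.size + 4)) = (dsnfaOf x).initPrefix ++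
    List.replicate ((dsnfaOf x).M - (dsnfaOf x).initPrefix.length) 0 := by
  rw [startWord, List.map_append, List.map_replicate]
  simp only [dsnfaOf, List.length_map]
  rfl

theorem isWord_startWord : IsWord (x.size + 4) (startWord x) := by
  have := length_code_le_size x
  intro a ha
  simp only [startWord, initWord, List.cons_append, List.mem_cons, List.mem_append, List.mem_map,
    List.mem_replicate, List.not_mem_nil, or_false] at ha
  rcases ha with rfl | rfl | (⟨b, -, rfl⟩ | rfl) | ⟨-, rfl⟩
  · simp only [startLtr, Ltr.num]; omega
  · simp only [Ltr.num]; omega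
  · cases b <;> simp [bitLtr, Ltr.num]
  · simp only [Ltr.num]; omega
  · simp only [Ltr.num]; omega

theorem isWord_replicate_zero (m : ℕ) : IsWord (x.size + 4) (List.replicate m .zero) := by
  intro a ha
  rw [List.eq_of_mem_replicate ha]
  simp only [Ltr.num]
  omega

theorem map_toFin_injOn {N : ℕ} {u v : List Ltr} (hu : IsWord N u) (hv : IsWord N v)
    (h : u.map (toFin N) = v.map (toFin N)) : u = v := by
  induction u generalizing v with
  | nil => simpa using h.symm
  | cons a u ih =>
    cases v with
    | nil => simp at h
    | cons b v =>
      rw [IsWord, List.forall_mem_cons] at hu hv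
      simp only [List.map_cons, List.cons.injEq] at h
      rw [toFin_injOn hu.1 hv.1 h.1, ih hu.2 hv.2 h.2]

/-- The language of the automaton, in terms of paths between words of letters. -/
theorem mem_dsnfaOf_language {u : List (Fin x.numInput)} :
    u ∈ (dsnfaOf x).language ↔ ∃ l, l.reduceOption = u ∧
      WordPath x (startWord x) l (List.replicate (stateLength x.size) .zero) := by
  have hfinal : (List.Vector.replicate (stateLength x.size) (1 : Fin (x.size + 3 + 2))).toList =
      (List.replicate (stateLength x.size) Ltr.zero).map (toFin (x.size + 4)) := by
    rw [List.map_replicate]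
    rfl
  refine (εNFA.mem_accepts_iff_exists_path _).trans ⟨?_, ?_⟩
  · rintro ⟨p, q, l, rfl, rfl, rfl, h⟩
    obtain ⟨V, hV, hq, h⟩ := exists_wordPath_of_isPath h isWord_startWord
      map_startWord.symm
    refine ⟨l, rfl, ?_⟩
    rwa [← map_toFin_injOn hV (isWord_replicate_zero _) (hq.symm.trans hfinal)]
  · rintro ⟨l, rfl, h⟩
    obtain ⟨q, hq, h⟩ := exists_isPath_of_wordPath h isWord_startWord
      (p := ⟨_, (List.length_map _).trans length_startWord⟩) rfl
    refine ⟨_, _, l, ?_, ?_, rfl, h⟩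
    · exact List.Vector.eq _ _ map_startWord
    · exact List.Vector.eq _ _ (hq.trans hfinal.symm)

/-- Every accepted word comes from a run of the pumping machine. -/
theorem language_dsnfaOf_le :
    (dsnfaOf x).language ≤ preservingDownClosure x.Θ x.K x.pda.language := by
  intro u hu
  obtain ⟨l, rfl, h⟩ := mem_dsnfaOf_language.1 hu
  have := (Reached.start _).path h
  rw [List.nil_append] at this
  generalize l.reduceOption = u at this
  obtain ⟨m, hm⟩ : ∃ m, stateLength x.size = m + 1 :=
    Nat.exists_eq_add_one_of_ne_zero (pow_ne_zero _ two_ne_zero)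
  generalize hV : List.replicate (stateLength x.size) Ltr.zero = V at this
  rw [hm, List.replicate_succ] at hV
  cases this with
  | start m => simp [initWord, startLtr] at hV
  | @conf _ C _ hW _ _ =>
    obtain ⟨u, G, rfl, -⟩ := hW
    simp only [confWord, List.cons.injEq] at hV
    exact absurd hV.1.symm C.mode.ltr_ne_zero
  | finish m h => exact h

/-- A path of the pumping machine with stacks of at most `H` letters is simulated on words in which
the stack has the length `J` and each track leaves room for the states of `H` brackets. -/
theorem wordPath_of_pumpPath {H J : ℕ} (hJ : H ≤ J) {C C' : PConf x} {u : List (Fin x.numInput)}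
    (h : PumpPath x.pda.explicit x.Θ H C u C') (hC : C.ctrl.length ≤ H) (hb : Pump.Balanced C)
    {k : List Bool} (hk : bitsVal k = C.cnt) :
    ∃ k' l, k'.length = k.length ∧ l.reduceOption = u ∧
      WordPath x (encode J (2 * H) k C) l (encode J (2 * H) k' C') := by
  have hbrs : ∀ {C : PConf x}, Pump.Balanced C → C.ctrl.length ≤ H → C.brs.length ≤ 2 * H := by
    intro C hb hC
    rw [hb.1]
    exact Nat.mul_le_mul_left _ (List.countP_le_length.trans hC)
  induction h generalizing k with
  | refl C => exact ⟨k, [], rfl, rfl, .nil _⟩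
  | @step a C C₁ C₂ u hs hC₁ _ ih =>
    have hb₁ := hb.step hs
    rcases a with _ | a
    · obtain ⟨hcnt, s, hs', hr⟩ := eps_complete (k := k) hs (hC.trans hJ) (hbrs hb hC)
        (hC₁.trans hJ) (hbrs hb₁ hC₁)
      obtain ⟨k', l, h₁, h₂, h₃⟩ := ih hC₁ hb₁ (hk.trans hcnt.symm)
      exact ⟨k', none :: l, h₁, by simpa using h₂, .cons ⟨s, hs', hr⟩ h₃⟩
    · obtain ⟨k₁, hk₁, hk₁', hr⟩ := letter_complete (J := J) (J' := 2 * H) hs hk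
      obtain ⟨k', l, h₁, h₂, h₃⟩ := ih hC₁ hb₁ hk₁'
      exact ⟨k', some a :: l, h₁.trans hk₁, by simpa using h₂, .cons hr h₃⟩

/-- With `y = 2 ^ (size ^ 2)`, the numbers of states and of letters of the PDA, and `K`, are at most
`y`, hence the bound for the stack is a polynomial in `y`. -/
theorem pumpHeight_le (x : Instance) :
    pumpHeight x.pda.explicit x.K ≤ (2 ^ x.size ^ 2) ^ 7 := by
  have hs := length_code_le_size x
  have hn := numStack_lt_size x
  set y := 2 ^ x.size ^ 2 with hy
  have hpow : ∀ m ≤ x.size, 2 ^ m ≤ y := fun m hm =>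
    Nat.pow_le_pow_right two_pos (hm.trans (Nat.le_self_pow two_ne_zero _))
  have hD : Nat.card (PState x) ≤ y := by
    rw [Nat.card_eq_fintype_card, card_vector, Fintype.card_fin]
    calc x.pda.numLetters ^ x.pda.n ≤ (2 ^ x.size) ^ x.pda.n :=
          Nat.pow_le_pow_left (le_trans (by omega) Nat.lt_two_pow_self.le) _
      _ = 2 ^ (x.size * x.pda.n) := (pow_mul _ _ _).symm
      _ ≤ y := Nat.pow_le_pow_right two_pos (by
          rw [sq]
          exact Nat.mul_le_mul_left _ (by omega))
  have hA : Nat.card (Option (Fin x.numInput)) ≤ y := by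
    rw [Nat.card_eq_fintype_card, Fintype.card_option, Fintype.card_fin]
    exact Nat.lt_two_pow_self.le.trans (hpow _ (by omega))
  have hK : x.K ≤ y := by
    refine (Nat.lt_size_self x.K).le.trans (hpow _ ?_)
    have : x.K.bits.length = x.K.size := Nat.size_eq_bits_len _
    omega
  have hy1 : 12 ≤ y := le_trans (by norm_num) (hpow 8 (by omega))
  have hst : x.pda.explicit.startStack.length ≤ 1 := by
    simp only [SuccinctPDA.explicit]
    cases x.pda.bottom <;> simp
  rw [pumpHeight, loopHeight]
  simp only [Nat.card_prod]
  calc _ ≤ 1 + (y * (y * y) + y * (y * (y * (y * (y * y)))) + 2) + 2 * (y * (y * y + 1) + y * y) +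
           1 := by
        gcongr
    _ = y ^ 6 + 3 * y ^ 3 + 2 * y ^ 2 + 2 * y ^ 1 + 4 * y ^ 0 := by ring
    _ ≤ y ^ 6 + 3 * y ^ 6 + 2 * y ^ 6 + 2 * y ^ 6 + 4 * y ^ 6 := by gcongr <;> omega
    _ = 12 * y ^ 6 := by ring
    _ ≤ y * y ^ 6 := by gcongr
    _ = y ^ 7 := by ring

/-- The encodings of the configurations that are needed fit into a state of the automaton. -/
theorem pumpHeight_lt_stateLength (x : Instance) :
    2 + x.K.bits.length + x.pda.n * (2 + 2 * pumpHeight x.pda.explicit x.K) +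
      pumpHeight x.pda.explicit x.K + 1 ≤ stateLength x.size := by
  have hs := length_code_le_size x
  have hn := numStack_lt_size x
  have hH := pumpHeight_le x
  have hy : x.size ≤ 2 ^ x.size ^ 2 := Nat.lt_two_pow_self.le.trans
    (Nat.pow_le_pow_right two_pos (Nat.le_self_pow two_ne_zero _))
  have e : stateLength x.size = (2 ^ x.size ^ 2) ^ 10 := by
    rw [stateLength, ← pow_mul, mul_comm]
  rw [e]
  generalize 2 ^ x.size ^ 2 = y at *
  generalize pumpHeight x.pda.explicit x.K = H at *
  have hy1 : 8 ≤ y := by omega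
  calc _ ≤ 2 + y + y * (2 + 2 * y ^ 7) + y ^ 7 + 1 := by gcongr <;> omega
    _ = 2 * y ^ 8 + y ^ 7 + 3 * y ^ 1 + 3 * y ^ 0 := by ring
    _ ≤ 2 * y ^ 8 + y ^ 8 + 3 * y ^ 8 + 3 * y ^ 8 := by gcongr <;> omega
    _ ≤ 8 * (8 * y ^ 8) := by omega
    _ ≤ y * (y * y ^ 8) := by gcongr
    _ = y ^ 10 := by ring

theorem language_dsnfaOf (x : Instance) :
    (dsnfaOf x).language = preservingDownClosure x.Θ x.K x.pda.language := by
  refine le_antisymm language_dsnfaOf_le fun u hu => ?_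
  obtain ⟨κ, f, rfl, c, h⟩ := exists_pumpPath_of_mem hu
  set H := pumpHeight x.pda.explicit x.K with hH
  have hM := pumpHeight_lt_stateLength x
  rw [← hH] at hM
  have hstart : (startConf x).ctrl.length ≤ H := by
    have : (startConf x).ctrl.length = x.pda.explicit.startStack.length := by
      simp [startConf, SuccinctPDA.explicit]
    rw [this, hH, pumpHeight]
    omega
  -- The part of the state for the stack takes all space that is not needed for the tracks.
  obtain ⟨J, hJ⟩ : ∃ J, stateLength x.size = 2 + x.K.bits.length + x.pda.n * (2 + 2 * H) + J :=
    Nat.exists_eq_add_of_le (by omega)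
  obtain ⟨k, l, -, hl, hp⟩ := wordPath_of_pumpPath (J := J) (by omega)
    (C := startConf x) h hstart balanced_startConf (k := x.K.bits) (bitsVal_bits _)
  have h₁ := start_complete (x := x) (J := J) (J' := 2 * H) (by omega)
  have h₂ := finish_complete (x := x) (J := J) (J' := 2 * H) (k := k) (κ := κ) (c := c) (b := [])
    rfl
  have hw : startWord x = startLtr :: .blank :: (x.K.bits.map bitLtr ++
      List.replicate (J + x.pda.n * (2 + 2 * H)) .hash) := by
    simp only [startWord, initWord, List.cons_append, List.append_assoc, List.length_cons,
      List.length_append, List.length_map, List.length_nil, List.cons.injEq, true_and,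
      List.append_cancel_left_eq]
    rw [List.nil_append, ← List.replicate_succ]
    congr 1
    omega
  have hlen := (WordPath.cons (a := none) ⟨_, .start, h₁⟩ hp).length_eq
  refine mem_dsnfaOf_language.2
    ⟨none :: (l ++ [none]), by simpa [List.reduceOption_append] using hl, ?_⟩
  rw [hw]
  refine .cons ⟨_, .start, h₁⟩ (hp.append (.cons ⟨_, .finish, ?_⟩ (.nil _)))
  convert h₂ using 2
  rw [hlen]
  simp only [List.length_cons, List.length_append, List.length_map, List.length_replicate]
  omega

/-! ### Generators for codes -/

/-- The variables of the generator. -/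
inductive Reg
  | len | s | g | d | n | t₁ | t₂ | t₃ | l | p | q | i | v | a | γ | k | q₀ | f | j | e₁ | e₂ | e₃
  | e₄
  deriving DecidableEq

instance : Fintype Reg :=
  ⟨{.len, .s, .g, .d, .n, .t₁, .t₂, .t₃, .l, .p, .q, .i, .v, .a, .γ, .k, .q₀, .f, .j, .e₁, .e₂,
    .e₃, .e₄}, fun r => by cases r <;> simp⟩

namespace Gen

section
variable {R O : Type} [DecidableEq R]

/-- With variables `ρ`, the generator `g` reads `c` and writes `w`. -/
def Emits (g : Gen R O) (ρ : R → ℕ) (c : List CSym) (w : List (O × CSym)) : Prop :=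
  ∀ rest, g.eval ρ (c ++ rest) = (rest, w)

/-- Runs the generators in the list one after the other. -/
def seqs (gs : List (Gen R O)) : Gen R O := gs.foldr seq nop

variable {ρ : R → ℕ} {g h : Gen R O} {c c' : List CSym} {w w' : List (O × CSym)}

theorem Emits.nop : Emits (nop : Gen R O) ρ [] [] := fun _ => rfl

theorem Emits.emit (o : O) (x : CSym) : Emits (emit o x : Gen R O) ρ [] [(o, x)] := fun _ => rfl

theorem Emits.seq (hg : Emits g ρ c w) (hh : Emits h ρ c' w') :
    Emits (.seq g h) ρ (c ++ c') (w ++ w') := by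
  intro rest
  simp only [eval, List.append_assoc, hg _, hh _]

theorem Emits.seqs_nil : Emits (seqs [] : Gen R O) ρ [] [] := .nop

theorem Emits.seqs_cons {gs : List (Gen R O)} (hg : Emits g ρ c w) (hh : Emits (seqs gs) ρ c' w') :
    Emits (seqs (g :: gs)) ρ (c ++ c') (w ++ w') := hg.seq hh

theorem readUnary_unary (n : ℕ) (rest : List CSym) :
    readUnary (Code.unary n ++ rest) = (n, rest) := by
  induction n with
  | zero => rfl
  | succ n ih =>
    have : Code.unary (n + 1) ++ rest = some true :: (Code.unary n ++ rest) := rfl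
    rw [this, readUnary, ih]

theorem Emits.rd {r : R} {n : ℕ} (hg : Emits g (Function.update ρ r n) c w) :
    Emits (.rd r g) ρ (Code.unary n ++ c) w := by
  intro rest
  rw [eval, List.append_assoc, readUnary_unary]
  exact hg rest

theorem Emits.ifz_zero {r : R} (hr : ρ r = 0) (hg : Emits g ρ c w) : Emits (.ifz r g h) ρ c w := by
  intro rest
  rw [eval, if_pos hr]
  exact hg rest

theorem Emits.ifz_pos {r : R} (hr : ρ r ≠ 0) (hh : Emits h ρ c w) : Emits (.ifz r g h) ρ c w := by
  intro rest
  rw [eval, if_neg hr]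
  exact hh rest

theorem Emits.ifb {b : Bool} (hg : b = true → Emits g ρ c w) (hh : b = false → Emits h ρ c w) :
    Emits (.ifb g h) ρ (some b :: c) w := by
  intro rest
  cases b
  · simpa [eval] using hh rfl rest
  · simpa [eval] using hg rfl rest

theorem repeatFrom_eq {f : ℕ → List CSym → List CSym × List (O × CSym)} {c : ℕ → List CSym}
    {w : ℕ → List (O × CSym)} (t n : ℕ)
    (h : ∀ t' < t + n, ∀ rest, f t' (c t' ++ rest) = (rest, w t'))
    (rest : List CSym) : repeatFrom f t n ((List.range' t n).flatMap c ++ rest) =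
      (rest, (List.range' t n).flatMap w) := by
  induction n generalizing t with
  | zero => rfl
  | succ n ih =>
    simp only [List.range'_succ, List.flatMap_cons, repeatFrom, List.append_assoc]
    rw [h t (by omega)]
    simp only
    rw [ih (t + 1) fun t' ht' => h t' (by omega)]

theorem Emits.rep {i r : R} {c : ℕ → List CSym} {w : ℕ → List (O × CSym)}
    (hg : ∀ t < ρ r, Emits g (Function.update ρ i t) (c t) (w t)) :
    Emits (.rep i r g) ρ ((List.range (ρ r)).flatMap c) ((List.range (ρ r)).flatMap w) := by
  intro rest
  rw [eval, List.range_eq_range']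
  exact repeatFrom_eq 0 _ (fun t ht rest => hg t (by omega) rest) rest

/-- A repetition reads and writes the concatenation of what its iterations read and write. -/
theorem Emits.rep_finRange {i r : R} {m : ℕ} (hm : ρ r = m) {c : Fin m → List CSym}
    {w : Fin m → List (O × CSym)} (hg : ∀ t : Fin m, Emits g (Function.update ρ i t) (c t) (w t)) :
    Emits (.rep i r g) ρ ((List.finRange m).flatMap c) ((List.finRange m).flatMap w) := by
  subst hm
  have key : ∀ {β : Type} (v : Fin (ρ r) → List β), (List.finRange (ρ r)).flatMap v =
      (List.range (ρ r)).flatMap fun t => if h : t < ρ r then v ⟨t, h⟩ else [] := by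
    intro β v
    rw [← List.map_coe_finRange_eq_range, List.flatMap_map]
    simp
  rw [key, key]
  refine .rep fun t ht => ?_
  simpa [ht] using hg ⟨t, ht⟩

theorem flatMap_get {α β : Type} (l : List α) (f : α → List β) :
    (List.finRange l.length).flatMap (fun i => f (l.get i)) = l.flatMap f := by
  conv_rhs => rw [← List.ofFn_get l, List.ofFn_eq_map]
  rw [List.flatMap_map]

theorem Emits.list {α : Type} {c : α → List CSym} {w : α → List (O × CSym)} {r j : R} {l : List α}
    (hg : ∀ a ∈ l, ∀ t, Emits g (Function.update (Function.update ρ r l.length) j t) (c a) (w a)) :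
    Emits (.rd r (.rep j r g)) ρ (Code.list c l) (l.flatMap w) := by
  rw [Code.list, ← flatMap_get l w, ← flatMap_get l c]
  exact .rd (.rep_finRange (by simp) fun t => hg _ (List.get_mem _ _) _)

/-- With variables `ρ`, the generator `g` writes `w` without reading. -/
abbrev Writes (g : Gen R O) (ρ : R → ℕ) (w : List (O × CSym)) : Prop := Emits g ρ [] w

theorem Writes.seq (hg : Writes g ρ w) (hh : Writes h ρ w') : Writes (.seq g h) ρ (w ++ w') :=
  Emits.seq hg hh

theorem Writes.rep {i r : R} {m : ℕ} (hm : ρ r = m) {w : ℕ → List (O × CSym)}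
    (hg : ∀ t < m, Writes g (Function.update ρ i t) (w t)) :
    Writes (.rep i r g) ρ ((List.range m).flatMap w) := by
  subst hm
  have := Emits.rep (c := fun _ => []) hg
  rwa [show (List.range (ρ r)).flatMap (fun _ => ([] : List CSym)) = [] by simp] at this

theorem Writes.rep_finRange {i r : R} {m : ℕ} (hm : ρ r = m)
    {w : Fin m → List (O × CSym)} (hg : ∀ t : Fin m, Writes g (Function.update ρ i t) (w t)) :
    Writes (.rep i r g) ρ ((List.finRange m).flatMap w) := by
  have := Emits.rep_finRange (c := fun _ => []) hm hg
  rwa [show (List.finRange m).flatMap (fun _ => ([] : List CSym)) = [] by simp] at this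

/-- A sum of a constant and of variables. -/
abbrev Lin (R : Type) := ℕ × List R

/-- The value of a sum. -/
def Lin.val (ρ : R → ℕ) (e : Lin R) : ℕ := e.1 + (e.2.map ρ).sum

/-- Runs `g` as often as the value of `e` says; `i` is used as loop variable. -/
def times (e : Lin R) (i : R) (g : Gen R O) : Gen R O :=
  seqs (List.replicate e.1 g ++ e.2.map fun r => .rep i r g)

theorem flatMap_const_replicate {α : Type} (k n : ℕ) (a : α) :
    (List.range k).flatMap (fun _ => List.replicate n a) = List.replicate (k * n) a := by
  rw [List.eq_replicate_iff]
  refine ⟨by simp, fun b hb => ?_⟩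
  obtain ⟨_, -, hb⟩ := List.mem_flatMap.1 hb
  exact List.eq_of_mem_replicate hb

/-- Repeating what `g` writes `e` times. -/
theorem Writes.times {m : R} {ℓ : ℕ} (hm : ρ m = ℓ) {e : Lin R} {i : R} (hi : m ≠ i) {n : ℕ}
    {a : O × CSym} (hg : ∀ ρ' : R → ℕ, ρ' m = ℓ → Writes g ρ' (List.replicate n a)) :
    Writes (times e i g) ρ (List.replicate (n * e.val ρ) a) := by
  obtain ⟨k, rs⟩ := e
  have h₁ : Writes (seqs (rs.map fun r => .rep i r g)) ρ
      (List.replicate (n * (rs.map ρ).sum) a) := by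
    induction rs with
    | nil => exact .nop
    | cons r rs ih =>
      have := Writes.rep (i := i) (r := r) rfl
        fun t _ => hg (Function.update ρ i t) (by rwa [Function.update_of_ne hi])
      have e : List.replicate (n * ((r :: rs).map ρ).sum) a =
          (List.range (ρ r)).flatMap (fun _ => List.replicate n a) ++
            List.replicate (n * (rs.map ρ).sum) a := by
        rw [flatMap_const_replicate, ← List.replicate_add, List.map_cons, List.sum_cons,
          Nat.mul_add, mul_comm n (ρ r)]
      rw [e]
      exact this.seq ih
  induction k with
  | zero => simpa [Gen.times, Lin.val] using h₁
  | succ k ih =>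
    have e : List.replicate (n * Lin.val ρ (k + 1, rs)) a =
        List.replicate n a ++ List.replicate (n * Lin.val ρ (k, rs)) a := by
      rw [← List.replicate_add]
      congr 1
      simp only [Lin.val]
      ring
    rw [e]
    exact (hg ρ hm).seq ih

end

/-- The word `c` on the stream `o`. -/
def onStream {O : Type} (o : O) (c : List CSym) : List (O × CSym) := c.map (Prod.mk o)

/-- Writes the value of `e` in unary. -/
def unaryGen {O : Type} (o : O) (e : Lin Reg) : Gen Reg O :=
  .seq (times e .t₁ (.emit o (some true))) (.emit o none)

theorem writes_unaryGen {O : Type} (o : O) (ρ : Reg → ℕ) (e : Lin Reg) :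
    Writes (unaryGen o e) ρ (onStream o (Code.unary (e.val ρ))) := by
  have := (Writes.times (g := .emit o (some true)) (ρ := ρ) (m := Reg.len) rfl (i := .t₁) (by simp)
    (n := 1) (e := e) (fun ρ' _ => Emits.emit o (some true))).seq (Emits.emit o none)
  rw [one_mul] at this
  simp only [onStream, Code.unary, List.map_append, List.map_replicate]
  exact this

/-- The codes of states, with parameters that are sums of variables. -/
structure StateExpr where
  tag : ℕ
  fst : Lin Reg := (0, [])
  snd : Lin Reg := (0, [])
  thd : Lin Reg := (0, [])

/-- The value of a code of a state. -/
def StateExpr.val (ρ : Reg → ℕ) (e : StateExpr) : ℕ × ℕ × ℕ × ℕ :=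
  (e.tag, e.fst.val ρ, e.snd.val ρ, e.thd.val ρ)

/-- The variable `len` as a sum. -/
def lenLin : Lin Reg := (0, [.len])

/-- Writes `c * len ^ 3` symbols. -/
def cubeGen {O : Type} (o : O) (x : CSym) (c : ℕ) : Gen Reg O :=
  times lenLin .t₁ (times lenLin .t₂ (times lenLin .t₃ (seqs (List.replicate c (.emit o x)))))

theorem writes_replicate {O : Type} (o : O) (x : CSym) (c : ℕ) (ρ : Reg → ℕ) :
    Writes (seqs (List.replicate c (.emit o x))) ρ (List.replicate c (o, x)) := by
  induction c with
  | zero => exact .nop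
  | succ c ih => exact (Emits.emit o x).seq ih

theorem writes_times_len {O : Type} {g : Gen Reg O} {ρ : Reg → ℕ} {ℓ : ℕ} (hρ : ρ .len = ℓ)
    {r : Reg}
    (hr : .len ≠ r) {n : ℕ} {a : O × CSym}
    (hg : ∀ ρ' : Reg → ℕ, ρ' .len = ℓ → Writes g ρ' (List.replicate n a)) :
    Writes (times lenLin r g) ρ (List.replicate (n * ℓ) a) := by
  have := Writes.times hρ (e := lenLin) hr hg
  simpa [lenLin, Lin.val, hρ] using this

theorem writes_cubeGen {O : Type} (o : O) (x : CSym) (c : ℕ) {ρ : Reg → ℕ} {ℓ : ℕ}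
    (hρ : ρ .len = ℓ) :
    Writes (cubeGen o x c) ρ (List.replicate (c * ℓ * ℓ * ℓ) (o, x)) :=
  writes_times_len hρ (by simp) fun _ h₁ => writes_times_len h₁ (by simp) fun _ h₂ =>
    writes_times_len h₂ (by simp) fun _ _ => writes_replicate o x c _

/-- Writes the number of a state in unary. -/
def stateGen {O : Type} (o : O) (e : StateExpr) : Gen Reg O :=
  seqs [times e.fst .t₁ (.emit o (some true)),
    times e.snd .t₁ (times lenLin .t₂ (.emit o (some true))),
    times e.thd .t₁ (times lenLin .t₂ (times lenLin .t₃ (.emit o (some true)))),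
    cubeGen o (some true) e.tag, .emit o none]

theorem writes_stateGen {O : Type} (o : O) {ρ : Reg → ℕ} {ℓ : ℕ} (hρ : ρ .len = ℓ) (e : StateExpr) :
    Writes (stateGen o e) ρ (onStream o (Code.unary (fourDigits ℓ (e.val ρ)))) := by
  have h : ∀ ρ' : Reg → ℕ, Writes (.emit o (some true)) ρ' (List.replicate 1 (o, some true)) :=
    fun _ => Emits.emit o _
  have := (Writes.times hρ (e := e.fst) (i := .t₁) (by simp) fun ρ' _ => h ρ').seqs_cons
    ((Writes.times hρ (e := e.snd) (i := .t₁) (by simp) fun ρ' h₁ =>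
      writes_times_len h₁ (r := .t₂) (by simp) fun ρ' _ => h ρ').seqs_cons
    ((Writes.times hρ (e := e.thd) (i := .t₁) (by simp) fun ρ' h₁ =>
      writes_times_len h₁ (r := .t₂) (by simp) fun ρ' h₂ =>
        writes_times_len h₂ (r := .t₃) (by simp) fun ρ' _ => h ρ').seqs_cons
    ((writes_cubeGen o (some true) e.tag hρ).seqs_cons
    ((Emits.emit o none).seqs_cons .seqs_nil))))
  rw [onStream, Code.unary]
  refine Eq.mp (congrArg (Writes _ ρ) ?_) this
  simp only [List.append_nil, ← List.append_assoc, ← List.replicate_add, List.map_append,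
    List.map_replicate, List.map_cons, List.map_nil, fourDigits, StateExpr.val]
  congr 2
  ring

theorem proj_append {O : Type} [DecidableEq O] (o : O) (w w' : List (O × CSym)) :
    proj o (w ++ w') = proj o w ++ proj o w' := by
  simp [proj]

theorem proj_onStream {O : Type} [DecidableEq O] (o o' : O) (c : List CSym) :
    proj o (onStream o' c) = if o' = o then c else [] := by
  simp only [proj, onStream, List.filter_map]
  split <;> rename_i h <;> simp [h, Function.comp_def]

/-! ### Generators for lists of edges -/

/-- The code of an edge with the given numbers of states and letters. -/
def edgeCode (q : ℕ) (l : Option (ℕ × ℕ)) (r : ℕ) : List CSym :=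
  Code.unary q ++ ((l.elim (Code.unary 0) fun l => Code.unary (l.1 + 1) ++ Code.unary l.2) ++
    Code.unary r)

/-- Writes the code of an edge; `gq` and `gr` write the states. -/
def edgeGen {O : Type} (o : O) (gq : Gen Reg O) (l : Option (Lin Reg × Lin Reg)) (gr : Gen Reg O) :
    Gen Reg O :=
  .seq gq (.seq (l.elim (unaryGen o (0, [])) fun l =>
    .seq (unaryGen o (l.1.1 + 1, l.1.2)) (unaryGen o l.2)) gr)

theorem writes_edgeGen {O : Type} {o : O} {gq gr : Gen Reg O} {l : Option (Lin Reg × Lin Reg)}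
    {ρ : Reg → ℕ} {q r : ℕ} (hq : Writes gq ρ (onStream o (Code.unary q)))
    (hr : Writes gr ρ (onStream o (Code.unary r))) :
    Writes (edgeGen o gq l gr) ρ
      (onStream o (edgeCode q (l.map fun l => (l.1.val ρ, l.2.val ρ)) r)) := by
  rcases l with _ | ⟨⟨c, rs⟩, l⟩
  · have := hq.seq ((writes_unaryGen o ρ (0, [])).seq hr)
    simp [edgeCode, onStream, Lin.val] at this ⊢
    exact this
  · have := hq.seq (((writes_unaryGen o ρ (c + 1, rs)).seq (writes_unaryGen o ρ l)).seq hr)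
    simp [edgeCode, onStream, Lin.val, add_right_comm] at this ⊢
    exact this

/-- The streams: the numbers at the beginning; the length of the word at the beginning of the
initial state, and this word; the number of states of the transducer for `ε`, and its initial state;
the number of its final states, and these; the number of its edges, and these; the codes of the
other transducers. -/
abbrev Stream := Fin 9

/-- An edge or a final state with parameters that are sums of variables. -/
abbrev ItemExpr := (StateExpr × Option (Lin Reg × Lin Reg) × StateExpr) ⊕ StateExpr

/-- The edges and final states of the transducer for `ε`, as symbols on the streams. The number of
edges and the number of final states are written in unary, on streams of their own. -/
def itemTrace {x : Instance} : Item (EpsState x) → List (Stream × CSym)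
  | .edge q l r => onStream 6 [some true] ++
      onStream 7 (edgeCode q.num (l.map fun l => (l.1.num, l.2.num)) r.num)
  | .final q => onStream 4 [some true] ++ onStream 5 (Code.unary q.num)

/-- Writes an edge or a final state. -/
def itemGen : ItemExpr → Gen Reg Stream
  | .inl (q, l, r) => .seq (.emit 6 (some true)) (edgeGen 7 (stateGen 7 q) l (stateGen 7 r))
  | .inr q => .seq (.emit 4 (some true)) (stateGen 5 q)

/-- With variables `ρ`, the expression describes the item. -/
def Matches {x : Instance} (ρ : Reg → ℕ) : ItemExpr → Item (EpsState x) → Prop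
  | .inl (q, l, r), .edge q' l' r' => q.val ρ = q'.code ∧
      l.map (fun l => (l.1.val ρ, l.2.val ρ)) = l'.map (fun l => (l.1.num, l.2.num)) ∧
      r.val ρ = r'.code
  | .inr q, .final q' => q.val ρ = q'.code
  | _, _ => False

/-- The values of the variables that hold the sizes in the input. -/
structure Sizes (x : Instance) (ρ : Reg → ℕ) : Prop where
  len : ρ .len = x.size
  s : ρ .s = x.numInput
  g : ρ .g = x.pda.numStack
  d : ρ .d = x.pda.numLetters
  n : ρ .n = x.pda.n

variable {x : Instance} {ρ : Reg → ℕ}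

theorem Sizes.update (h : Sizes x ρ) {r : Reg} (v : ℕ)
    (hr : r ≠ .len ∧ r ≠ .s ∧ r ≠ .g ∧ r ≠ .d ∧ r ≠ .n) : Sizes x (Function.update ρ r v) :=
  ⟨by rw [Function.update_of_ne hr.1.symm, h.len], by rw [Function.update_of_ne hr.2.1.symm, h.s],
    by rw [Function.update_of_ne hr.2.2.1.symm, h.g],
    by rw [Function.update_of_ne hr.2.2.2.1.symm, h.d],
    by rw [Function.update_of_ne hr.2.2.2.2.symm, h.n]⟩

theorem writes_itemGen (hρ : Sizes x ρ) {e : ItemExpr} {i : Item (EpsState x)} (h : Matches ρ e i) :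
    Writes (itemGen e) ρ (itemTrace i) := by
  rcases e with ⟨q, l, r⟩ | q <;> rcases i with ⟨q', l', r'⟩ | q'
  · obtain ⟨hq, hl, hr⟩ := h
    rw [itemTrace, ← hl, EpsState.num, EpsState.num, ← hq, ← hr]
    exact (Emits.emit _ _).seq
      (writes_edgeGen (writes_stateGen 7 hρ.len q) (writes_stateGen 7 hρ.len r))
  · exact h.elim
  · exact h.elim
  · have h : q.val ρ = q'.code := h
    rw [itemTrace, EpsState.num, ← h]
    exact (Emits.emit _ _).seq (writes_stateGen 5 hρ.len q)

/-- Writes a list of items. -/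
def itemsGen (l : List ItemExpr) : Gen Reg Stream := seqs (l.map itemGen)

theorem writes_itemsGen (hρ : Sizes x ρ) {es : List ItemExpr} {is : List (Item (EpsState x))}
    (h : List.Forall₂ (Matches ρ) es is) : Writes (itemsGen es) ρ (is.flatMap itemTrace) := by
  induction h with
  | nil => exact .nop
  | cons h _ ih => exact (writes_itemGen hρ h).seq ih

theorem emits_seqs {α : Type} {tr : α → List (Stream × CSym)} {gs : List (Gen Reg Stream)}
    {cs : List (List CSym)} {ls : List (List α)}
    (h : List.Forall₂ (fun g (p : List CSym × List α) => Emits g ρ p.1 (p.2.flatMap tr)) gs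
      (cs.zip ls)) (hl : cs.length = ls.length) :
    Emits (seqs gs) ρ cs.flatten (ls.flatten.flatMap tr) := by
  induction gs generalizing cs ls with
  | nil =>
    cases cs <;> cases ls <;> simp at h hl
    exact .nop
  | cons g gs ih =>
    cases cs <;> cases ls <;> simp at h hl
    rw [List.flatten_cons, List.flatten_cons, List.flatMap_append]
    exact h.1.seqs_cons (ih h.2 hl)

theorem writes_seqs {α : Type} {tr : α → List (Stream × CSym)} {gs : List (Gen Reg Stream)}
    {ls : List (List α)} (h : List.Forall₂ (fun g l => Writes g ρ (l.flatMap tr)) gs ls) :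
    Writes (seqs gs) ρ (ls.flatten.flatMap tr) := by
  induction h with
  | nil => exact .nop
  | cons h _ ih =>
    rw [List.flatten_cons, List.flatMap_append]
    exact Emits.seqs_cons h ih

/-- The number of a letter as a sum. -/
def cst (a : Ltr) : Lin Reg := (a.num, [])

/-- The number of the letter `data r`. -/
def dat (r : Reg) : Lin Reg := (5, [r])

/-- Writes an item for each letter other than `hash`. -/
def plainGen (f : Lin Reg → Gen Reg Stream) : Gen Reg Stream :=
  .seq (seqs ([Ltr.zero, .bracket, .one, .blank].map fun a => f (cst a)))
    (.rep .l .len (f (dat .l)))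

theorem writes_plainGen {f : Lin Reg → Gen Reg Stream} {w : Ltr → List (Stream × CSym)}
    (hρ : Sizes x ρ) (h : ∀ ρ', (∀ r ≠ .l, ρ' r = ρ r) → ∀ (e : Lin Reg) (a : Ltr),
      e.val ρ' = a.num → Writes (f e) ρ' (w a)) :
    Writes (plainGen f) ρ ((plainLtrs x).flatMap w) := by
  have hc : ∀ a, Writes (f (cst a)) ρ (w a) :=
    fun a => h ρ (fun _ _ => rfl) _ a (by simp [cst, Lin.val])
  have h₁ := (hc .zero).seqs_cons ((hc .bracket).seqs_cons ((hc .one).seqs_cons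
    ((hc .blank).seqs_cons .seqs_nil)))
  have h₂ : Writes (.rep .l .len (f (dat .l))) ρ
      ((List.range x.size).flatMap fun i => w (.data i)) :=
    Writes.rep hρ.len fun t _ => h _ (fun r hr => Function.update_of_ne hr _ _) _ _
      (by simp [dat, Lin.val, Ltr.num])
  have := h₁.seq h₂
  simp [plainLtrs, List.flatMap_map] at this ⊢
  exact this

end Gen

/-! ### The generator for the gadgets that do not depend on transducers of the PDA -/

namespace Gen

open Item

variable {x : Instance} {ρ : Reg → ℕ}

/-- Writes loops that copy the letters in `l`. -/
def loopsGen (q : StateExpr) (l : List Ltr) : Gen Reg Stream :=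
  itemsGen (l.map fun a => .inl (q, some (cst a, cst a), q))

theorem writes_loopsGen (hρ : Sizes x ρ) {q : StateExpr} {q' : EpsState x} (hq : q.val ρ = q'.code)
    (l : List Ltr) : Writes (loopsGen q l) ρ ((loops q' l).flatMap itemTrace) := by
  refine writes_itemsGen hρ ?_
  rw [loops, List.forall₂_map_left_iff, List.forall₂_map_right_iff, List.forall₂_same]
  exact fun a _ => ⟨hq, by simp [cst, Lin.val], hq⟩

/-- Writes loops that copy all letters other than `hash`. -/
def copyGen (q : StateExpr) : Gen Reg Stream := plainGen fun e => itemGen (.inl (q, some (e, e), q))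

theorem Sizes.of_eq (hρ : Sizes x ρ) {ρ' : Reg → ℕ} (h : ∀ r ≠ .l, ρ' r = ρ r) : Sizes x ρ' :=
  ⟨by rw [h _ (by simp), hρ.len], by rw [h _ (by simp), hρ.s], by rw [h _ (by simp), hρ.g],
    by rw [h _ (by simp), hρ.d], by rw [h _ (by simp), hρ.n]⟩

theorem writes_copyGen (hρ : Sizes x ρ) {q : StateExpr} {q' : EpsState x}
    (hq : ∀ ρ', (∀ r ≠ .l, ρ' r = ρ r) → q.val ρ' = q'.code) :
    Writes (copyGen q) ρ ((loops q' (plainLtrs x)).flatMap itemTrace) := by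
  rw [loops, List.flatMap_map]
  exact writes_plainGen hρ fun ρ' h e a ha => writes_itemGen (hρ.of_eq h)
    ⟨hq ρ' h, by simp [ha], hq ρ' h⟩

/-- The states of the gadget for the bracket operation `r`. -/
def rowExpr (tag : ℕ) (r : Fin 8) (p q : Lin Reg := (0, [])) : StateExpr := ⟨tag, (r, []), p, q⟩

/-- Writes the items of the gadget for a bracket operation. -/
def rowGen (r : Fin 8) : Gen Reg Stream := seqs [
  itemsGen [.inl (⟨0, (0, []), (0, []), (0, [])⟩,
    some (cst (bracketOp r).src.ltr, cst (bracketOp r).dst.ltr), rowExpr 1 r)],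
  if (bracketOp r).atTop then seqs [
      itemsGen [.inl (rowExpr 1 r, some (cst .blank, cst .blank), rowExpr 2 r)],
      loopsGen (rowExpr 2 r) baseLtrs,
      itemsGen [.inl (rowExpr 2 r, some (cst (if (bracketOp r).before then .bracket else .blank),
        cst (if (bracketOp r).after then .bracket else .blank)), rowExpr 3 r)]]
    else itemsGen [.inl (rowExpr 1 r, some (cst .blank, cst .blank), rowExpr 3 r)],
  copyGen (rowExpr 3 r),
  itemsGen [.inl (rowExpr 3 r, some (cst .hash, cst .hash), rowExpr 4 r), .inr (rowExpr 3 r)],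
  .rep .p .d (.rep .q .d (itemsGen [
    .inl (rowExpr 4 r, some (dat (pick (bracketOp r).s .p .q), dat (pick (bracketOp r).t .p .q)),
      rowExpr 5 r (0, [.p]) (0, [.q])),
    .inl (rowExpr 5 r (0, [.p]) (0, [.q]), some (cst .blank, cst .blank),
      rowExpr 5 r (0, [.p]) (0, [.q])),
    .inl (rowExpr 5 r (0, [.p]) (0, [.q]),
      some (if (bracketOp r).before then dat .p else cst .blank,
      if (bracketOp r).after then dat .p else cst .blank), rowExpr 6 r (0, [.q]))])),
  .rep .q .d (itemsGen [
    .inl (rowExpr 6 r (0, [.q]), some (cst .blank, cst .blank), rowExpr 6 r (0, [.q])),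
    .inl (rowExpr 6 r (0, [.q]), some (if (bracketOp r).before then dat .q else cst .blank,
      if (bracketOp r).after then dat .q else cst .blank), rowExpr 3 r)])]

theorem writes_rowGen (hρ : Sizes x ρ) (r : Fin 8) :
    Writes (rowGen r) ρ ((rowItems x r).flatMap itemTrace) := by
  rw [rowItems]
  refine writes_seqs (.cons ?_ (.cons ?_ (.cons ?_ (.cons ?_ (.cons ?_ (.cons ?_ .nil))))))
  · refine writes_itemsGen hρ ?_
    simp [Matches, StateExpr.val, EpsState.code, rowExpr, Lin.val, cst]
  · split
    · refine writes_seqs (.cons ?_ (.cons ?_ (.cons ?_ .nil)))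
      · refine writes_itemsGen hρ ?_
        simp [Matches, StateExpr.val, EpsState.code, rowExpr, Lin.val, cst]
      · exact writes_loopsGen hρ (by simp [StateExpr.val, EpsState.code, rowExpr, Lin.val]) _
      · refine writes_itemsGen hρ ?_
        simp [Matches, StateExpr.val, EpsState.code, rowExpr, Lin.val, cst]
    · refine writes_itemsGen hρ ?_
      simp [Matches, StateExpr.val, EpsState.code, rowExpr, Lin.val, cst]
  · exact writes_copyGen hρ fun _ _ => by simp [StateExpr.val, EpsState.code, rowExpr, Lin.val]
  · refine writes_itemsGen hρ ?_
    simp [Matches, StateExpr.val, EpsState.code, rowExpr, Lin.val, cst]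
  · rw [List.flatMap_assoc]
    refine Writes.rep_finRange hρ.d fun p => ?_
    rw [List.flatMap_assoc]
    refine Writes.rep_finRange (by simpa using hρ.d) fun q => ?_
    refine writes_itemsGen ((hρ.update _ (by simp)).update _ (by simp)) ?_
    cases (bracketOp r).before <;> cases (bracketOp r).after <;> cases (bracketOp r).s <;>
      cases (bracketOp r).t <;> simp [Matches, StateExpr.val, EpsState.code, rowExpr, Lin.val, cst,
        dat, pick, Ltr.num]
  · rw [List.flatMap_assoc]
    refine Writes.rep_finRange hρ.d fun q => ?_
    refine writes_itemsGen (hρ.update _ (by simp)) ?_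
    cases (bracketOp r).before <;> cases (bracketOp r).after <;>
      simp [Matches, StateExpr.val, EpsState.code, rowExpr, Lin.val, cst, dat, Ltr.num]

/-- A state without parameters. -/
def plainExpr (tag : ℕ) : StateExpr := ⟨tag, (0, []), (0, []), (0, [])⟩

/-- A state with one parameter. -/
def chainExpr (tag : ℕ) (i : Lin Reg) : StateExpr := ⟨tag, i, (0, []), (0, [])⟩

/-- Writes the items that depend only on the sizes in the input. -/
def baseGen : Gen Reg Stream := seqs [
  seqs ((List.finRange 8).map rowGen),
  itemsGen (modes.map fun m => .inl (plainExpr 0, some (cst m.ltr, cst m.ltr), plainExpr 11)),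
  copyGen (plainExpr 12),
  itemsGen [.inl (plainExpr 12, some (cst .hash, cst .hash), plainExpr 12), .inr (plainExpr 12),
    .inl (plainExpr 0, some (cst Mode.N.ltr, cst Mode.N.ltr), plainExpr 13),
    .inl (plainExpr 13, some (cst .blank, cst .blank), plainExpr 14)],
  loopsGen (plainExpr 14) baseLtrs,
  itemsGen [.inl (plainExpr 14, some (cst .bracket, cst .blank), plainExpr 14),
    .inl (plainExpr 14, some (cst .hash, cst .hash), plainExpr 15), .inr (plainExpr 14)],
  .rep .l .len (itemsGen [.inl (plainExpr 14, some (dat .l, cst .blank), plainExpr 14),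
    .inl (plainExpr 15, some (dat .l, dat .l), plainExpr 14)]),
  itemsGen [.inl (plainExpr 0, some (cst startLtr, cst Mode.N.ltr), plainExpr 16),
    .inl (plainExpr 16, some (cst .blank, cst .blank), plainExpr 17)],
  loopsGen (plainExpr 17) baseLtrs,
  itemsGen [.inl (plainExpr 17, some (cst .hash, cst .blank), plainExpr 17),
    .inr (chainExpr 18 (0, [.n])),
    .inl (chainExpr 18 (0, [.n]), some (cst .hash, cst .blank), chainExpr 18 (0, [.n])),
    .inl (plainExpr 0, some (cst Mode.N.ltr, cst .zero), plainExpr 20),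
    .inl (plainExpr 20, some (cst .blank, cst .zero), plainExpr 21),
    .inr (chainExpr 21 (0, [.n]))],
  plainGen fun e => itemGen (.inl (chainExpr 21 (0, [.n]), some (e, cst .zero),
    chainExpr 21 (0, [.n])))]

theorem writes_baseGen (hρ : Sizes x ρ) : Writes baseGen ρ ((baseItems x).flatMap itemTrace) := by
  rw [baseItems]
  refine writes_seqs (.cons ?_ (.cons ?_ (.cons ?_ (.cons ?_ (.cons ?_ (.cons ?_ (.cons ?_
    (.cons ?_ (.cons ?_ (.cons ?_ (.cons ?_ .nil)))))))))))
  · rw [List.flatMap_def]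
    refine writes_seqs ?_
    rw [List.forall₂_map_left_iff, List.forall₂_map_right_iff, List.forall₂_same]
    exact fun r _ => writes_rowGen hρ r
  · refine writes_itemsGen hρ ?_
    rw [List.forall₂_map_left_iff, List.forall₂_map_right_iff, List.forall₂_same]
    intro m _
    simp [Matches, StateExpr.val, EpsState.code, plainExpr, Lin.val, cst]
  · exact writes_copyGen hρ fun _ _ => by simp [StateExpr.val, EpsState.code, plainExpr, Lin.val]
  · refine writes_itemsGen hρ ?_
    simp [Matches, StateExpr.val, EpsState.code, plainExpr, Lin.val, cst]
  · exact writes_loopsGen hρ (by simp [StateExpr.val, EpsState.code, plainExpr, Lin.val]) _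
  · refine writes_itemsGen hρ ?_
    simp [Matches, StateExpr.val, EpsState.code, plainExpr, Lin.val, cst]
  · rw [List.flatMap_assoc]
    refine Writes.rep hρ.len fun i _ => ?_
    refine writes_itemsGen (hρ.update _ (by simp)) ?_
    simp [Matches, StateExpr.val, EpsState.code, plainExpr, Lin.val, cst, dat, Ltr.num]
  · refine writes_itemsGen hρ ?_
    simp [Matches, StateExpr.val, EpsState.code, plainExpr, Lin.val, cst]
  · exact writes_loopsGen hρ (by simp [StateExpr.val, EpsState.code, plainExpr, Lin.val]) _
  · refine writes_itemsGen hρ ?_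
    simp [Matches, StateExpr.val, EpsState.code, plainExpr, chainExpr, Lin.val, cst, hρ.n]
  · rw [List.flatMap_map]
    refine writes_plainGen hρ fun ρ' h e a ha => writes_itemGen (hρ.of_eq h) ?_
    simp [Matches, StateExpr.val, EpsState.code, chainExpr, Lin.val, cst, (hρ.of_eq h).n, ← ha]

/-- Reads the initial state of the PDA, and writes the edges for its letters. -/
def startGen : Gen Reg Stream := .rep .i .n (.rd .v (itemsGen [
  .inl (chainExpr 18 (0, [.i]), some (cst .hash, cst .blank), chainExpr 18 (0, [.i])),
  .inl (chainExpr 18 (0, [.i]), some (cst .hash, cst .hash), chainExpr 19 (0, [.i])),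
  .inl (chainExpr 19 (0, [.i]), some (cst .hash, dat .v), chainExpr 18 (1, [.i]))]))

theorem flatMap_toList {α β : Type} {n : ℕ} (v : List.Vector α n) (f : α → List β) :
    v.toList.flatMap f = (List.finRange n).flatMap fun i => f (v.get i) := by
  conv_lhs => rw [← List.Vector.ofFn_get v, List.Vector.toList_ofFn, List.ofFn_eq_map]
  rw [List.flatMap_map]

theorem emits_startGen (hρ : Sizes x ρ) : Emits startGen ρ (x.pda.start.toList.flatMap Code.letter)
    ((startItems x).flatMap itemTrace) := by
  rw [startItems, List.flatMap_assoc, flatMap_toList]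
  refine Emits.rep_finRange hρ.n fun i => ?_
  rw [Code.letter, ← List.append_nil (Code.unary _)]
  refine .rd (writes_itemsGen ((hρ.update _ (by simp)).update _ (by simp)) ?_)
  simp [Matches, StateExpr.val, EpsState.code, chainExpr, Lin.val, cst, dat, Ltr.num, add_comm]

/-- Reads the final state of the PDA, and writes the edges for its letters. -/
def finishGen : Gen Reg Stream := .rep .i .n (.rd .v (.seq
  (plainGen fun e => itemGen (.inl (chainExpr 21 (0, [.i]), some (e, cst .zero),
    chainExpr 21 (0, [.i]))))
  (itemsGen [.inl (chainExpr 21 (0, [.i]), some (cst .hash, cst .zero), chainExpr 22 (0, [.i])),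
    .inl (chainExpr 22 (0, [.i]), some (dat .v, cst .zero), chainExpr 21 (1, [.i]))])))

theorem emits_finishGen (hρ : Sizes x ρ) : Emits finishGen ρ
    (x.pda.final.toList.flatMap Code.letter)
    ((finishItems x).flatMap itemTrace) := by
  rw [finishItems, List.flatMap_assoc, flatMap_toList]
  refine Emits.rep_finRange hρ.n fun i => ?_
  rw [Code.letter, ← List.append_nil (Code.unary _), List.flatMap_append, List.flatMap_map]
  have hρ' := (hρ.update (r := .i) i.1 (by simp)).update (r := .v) (x.pda.final.get i).1 (by simp)
  refine .rd (Writes.seq ?_ ?_)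
  · refine writes_plainGen hρ' fun ρ' h e a ha => writes_itemGen (hρ'.of_eq h) ?_
    have hi := h .i (by simp)
    simp [Matches, StateExpr.val, EpsState.code, chainExpr, Lin.val, cst, ← ha, hi]
  · refine writes_itemsGen hρ' ?_
    simp [Matches, StateExpr.val, EpsState.code, chainExpr, Lin.val, cst, dat, Ltr.num, add_comm]

/-- Reads the initial stack symbol, and writes the edge for it. -/
def bottomGen : Gen Reg Stream :=
  .rd .v (itemsGen [.inl (plainExpr 17, some (cst .hash, (4, [.v])), plainExpr 18)])

theorem emits_bottomGen (hρ : Sizes x ρ) :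
    Emits bottomGen ρ (Code.optLetter x.pda.bottom) ((bottomItems x).flatMap itemTrace) := by
  have h : Code.optLetter x.pda.bottom = Code.unary (labCode x.pda.bottom) ++ [] := by
    cases x.pda.bottom <;> simp [Code.optLetter, labCode]
  rw [h]
  refine .rd (writes_itemsGen (hρ.update _ (by simp)) ?_)
  simp [bottomItems, Matches, StateExpr.val, EpsState.code, plainExpr, Lin.val, cst, num_optLtr]

/-! ### The generator for the gadgets for the transducers of the PDA -/

/-- The kinds of stack operations. -/
inductive OpKind
  | skip | push | pop

/-- The numbers of the stack operations of a kind, where `γ` holds the stack symbol. -/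
def OpKind.lin : OpKind → Lin Reg
  | skip => (0, [])
  | push => (1, [.γ])
  | pop => (1, [.g, .γ])

/-- With variables `ρ`, the kind describes the operation. -/
def OpKind.Is (ρ : Reg → ℕ) : OpKind → StackOp (Fin x.pda.numStack) → Prop
  | skip, op => op = .skip
  | push, op => ∃ γ : Fin _, op = .push γ ∧ ρ .γ = γ
  | pop, op => ∃ γ : Fin _, op = .pop γ ∧ ρ .γ = γ

/-- Writes the edges that handle the stack. -/
def stackGen (lab : Lin Reg) (op : OpKind) : Gen Reg Stream :=
  match op with
  | .skip => itemsGen [.inl (⟨7, (0, []), lab, op.lin⟩, some ((4 + lab.1, lab.2), cst .blank),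
      ⟨9, (0, [.q₀]), lab, op.lin⟩)]
  | .push => seqs [itemsGen [.inl (⟨7, (0, []), lab, op.lin⟩, some ((4 + lab.1, lab.2), cst .blank),
      ⟨8, (0, []), lab, op.lin⟩)], loopsGen ⟨8, (0, []), lab, op.lin⟩ baseLtrs,
      itemsGen [.inl (⟨8, (0, []), lab, op.lin⟩, some (cst .blank, dat .γ),
        ⟨9, (0, [.q₀]), lab, op.lin⟩)]]
  | .pop => seqs [itemsGen [.inl (⟨7, (0, []), lab, op.lin⟩, some ((4 + lab.1, lab.2), cst .blank),
      ⟨8, (0, []), lab, op.lin⟩)], loopsGen ⟨8, (0, []), lab, op.lin⟩ baseLtrs,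
      itemsGen [.inl (⟨8, (0, []), lab, op.lin⟩, some (dat .γ, cst .blank),
        ⟨9, (0, [.q₀]), lab, op.lin⟩)]]

/-- Reads the edges of a transducer, and writes the corresponding edges. -/
def edgesGen (lab : Lin Reg) (op : OpKind) : Gen Reg Stream :=
  .rd .f (.rep .j .f (.rd .e₁ (.rd .e₂ (.ifz .e₂
    (.rd .e₄ (itemGen (.inl (⟨9, (0, [.e₁]), lab, op.lin⟩, none, ⟨9, (0, [.e₄]), lab, op.lin⟩))))
    (.rd .e₃ (.rd .e₄ (itemGen (.inl (⟨10, (0, [.e₁]), lab, op.lin⟩, some ((4, [.e₂]), dat .e₃),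
      ⟨9, (0, [.e₄]), lab, op.lin⟩)))))))))

/-- Reads the final states of a transducer, and writes the corresponding final states. -/
def finalsGen (lab : Lin Reg) (op : OpKind) : Gen Reg Stream :=
  .rd .f (.rep .j .f (.rd .e₁ (itemGen (.inr ⟨9, (0, [.e₁]), lab, op.lin⟩))))

/-- Reads a transducer, and writes the items of the gadget for it. -/
def pdaGen (lab : Lin Reg) (op : OpKind) : Gen Reg Stream := .rd .k (.rd .q₀ (seqs [
  itemsGen (modes.map fun m => .inl (plainExpr 0, some (cst m.ltr, cst m.ltr),
    ⟨7, (0, []), lab, op.lin⟩)),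
  .rep .q .k (.seq (itemsGen [.inl (⟨9, (0, [.q]), lab, op.lin⟩, some (cst .hash, cst .hash),
    ⟨10, (0, [.q]), lab, op.lin⟩)]) (copyGen ⟨9, (0, [.q]), lab, op.lin⟩)),
  stackGen lab op, finalsGen lab op, edgesGen lab op]))

/-- The variables that are free for use in the gadgets for transducers. -/
def IsLocal (r : Reg) : Prop := r ∈ ([.l, .q, .k, .q₀, .f, .j, .e₁, .e₂, .e₃, .e₄] : List Reg)

/-- The variables describe the input label `a` and the operation `op`, for the expression `lab` and
the kind `o`. -/
structure Describes (ρ : Reg → ℕ) (lab : Lin Reg) (o : OpKind) (a : Option (Fin x.numInput))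
    (op : StackOp (Fin x.pda.numStack)) : Prop where
  sizes : Sizes x ρ
  lab : ∀ ρ' : Reg → ℕ, (∀ r, ¬ IsLocal r → ρ' r = ρ r) → lab.val ρ' = labCode a
  op : ∀ ρ' : Reg → ℕ, (∀ r, ¬ IsLocal r → ρ' r = ρ r) → o.Is (x := x) ρ' op

variable {lab : Lin Reg} {o : OpKind} {a : Option (Fin x.numInput)}
  {op : StackOp (Fin x.pda.numStack)}

theorem OpKind.Is.val (hρ : Sizes x ρ) (h : o.Is ρ op) : o.lin.val ρ = opCode op := by
  cases o
  · obtain rfl := h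
    rfl
  · obtain ⟨γ, rfl, h⟩ := h
    simp [lin, Lin.val, opCode, h]
  · obtain ⟨γ, rfl, h⟩ := h
    simp [lin, Lin.val, opCode, h, hρ.g, add_assoc]

theorem Describes.update (h : Describes ρ lab o a op) {r : Reg} (hr : IsLocal r) (v : ℕ) :
    Describes (Function.update ρ r v) lab o a op := by
  have key : ∀ ρ' : Reg → ℕ, (∀ r', ¬ IsLocal r' → ρ' r' = Function.update ρ r v r') →
      ∀ r', ¬ IsLocal r' → ρ' r' = ρ r' := fun ρ' h r' hr' =>
    (h r' hr').trans (Function.update_of_ne (by rintro rfl; exact hr' hr) _ _)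
  refine ⟨h.sizes.update v ?_, fun ρ' h' => h.lab ρ' (key ρ' h'), fun ρ' h' => h.op ρ' (key ρ' h')⟩
  simp only [IsLocal, List.mem_cons, List.not_mem_nil, or_false] at hr
  rcases hr with rfl | rfl | rfl | rfl | rfl | rfl | rfl | rfl | rfl | rfl <;> simp

theorem Describes.lab_val (h : Describes ρ lab o a op) : lab.val ρ = labCode a :=
  h.lab ρ fun _ _ => rfl

theorem Describes.op_val (h : Describes ρ lab o a op) : o.lin.val ρ = opCode op :=
  (h.op ρ fun _ _ => rfl).val h.sizes

theorem writes_stackGen (h : Describes ρ lab o a op) (hq : ρ .q₀ = (x.pda.transducer a op).init) :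
    Writes (stackGen lab o) ρ ((stackItems x a op).flatMap itemTrace) := by
  have hl := h.lab_val
  have ho := h.op_val
  have hl' : 4 + lab.1 + (lab.2.map ρ).sum = 4 + labCode a := by
    rw [← hl, Lin.val, add_assoc]
  have hop := h.op ρ fun _ _ => rfl
  cases o
  · obtain rfl : op = .skip := hop
    refine writes_itemsGen h.sizes ?_
    simp only [stackItems, List.forall₂_cons, Matches, StateExpr.val, EpsState.code, hl, ho]
    simp [Lin.val, cst, num_optLtr, hq, hl']
  · obtain ⟨γ, rfl, hγ⟩ := hop
    have : stackItems x a (.push γ) = List.flatten [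
        [edge (.pdaHead a (.push γ)) (some (optLtr a, .blank)) (.pdaStack a (.push γ))],
        loops (.pdaStack a (.push γ)) baseLtrs,
          [edge (.pdaStack a (.push γ)) (some (.blank, .data γ))
        (.pda a (.push γ) (x.pda.transducer a _).init)]] := by simp [stackItems]
    rw [this]
    refine writes_seqs (.cons ?_ (.cons ?_ (.cons ?_ .nil)))
    · refine writes_itemsGen h.sizes ?_
      simp only [List.forall₂_cons, Matches, StateExpr.val, EpsState.code, hl, ho]
      simp [Lin.val, cst, num_optLtr, hl']
    · exact writes_loopsGen h.sizes (by simp only [StateExpr.val, EpsState.code, hl, ho]; rfl) _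
    · refine writes_itemsGen h.sizes ?_
      simp only [List.forall₂_cons, Matches, StateExpr.val, EpsState.code, hl, ho]
      simp [Lin.val, cst, hq, dat, Ltr.num, hγ]
  · obtain ⟨γ, rfl, hγ⟩ := hop
    have : stackItems x a (.pop γ) = List.flatten [
        [edge (.pdaHead a (.pop γ)) (some (optLtr a, .blank)) (.pdaStack a (.pop γ))],
        loops (.pdaStack a (.pop γ)) baseLtrs, [edge (.pdaStack a (.pop γ)) (some (.data γ, .blank))
        (.pda a (.pop γ) (x.pda.transducer a _).init)]] := by simp [stackItems]
    rw [this]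
    refine writes_seqs (.cons ?_ (.cons ?_ (.cons ?_ .nil)))
    · refine writes_itemsGen h.sizes ?_
      simp only [List.forall₂_cons, Matches, StateExpr.val, EpsState.code, hl, ho]
      simp [Lin.val, cst, num_optLtr, hl']
    · exact writes_loopsGen h.sizes (by simp only [StateExpr.val, EpsState.code, hl, ho]; rfl) _
    · refine writes_itemsGen h.sizes ?_
      simp only [List.forall₂_cons, Matches, StateExpr.val, EpsState.code, hl, ho]
      simp [Lin.val, cst, hq, dat, Ltr.num, hγ]

theorem emits_finalsGen (h : Describes ρ lab o a op) :
    Emits (finalsGen lab o) ρ (Code.list Code.letter (x.pda.transducer a op).final)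
      (((x.pda.transducer a op).final.map fun q => final (.pda a op q)).flatMap itemTrace) := by
  rw [List.flatMap_map]
  refine .list fun q _ t => ?_
  rw [Code.letter, ← List.append_nil (Code.unary _)]
  have h' := ((h.update (r := .f) (by simp [IsLocal]) (x.pda.transducer a op).final.length).update
    (r := .j) (by simp [IsLocal]) t).update (r := .e₁) (by simp [IsLocal]) q.1
  refine .rd (writes_itemGen h'.sizes ?_)
  simp only [Matches, StateExpr.val, EpsState.code, h'.lab_val, h'.op_val]
  simp [Lin.val]

theorem emits_edgesGen (h : Describes ρ lab o a op) :
    Emits (edgesGen lab o) ρ (Code.list Code.edge (x.pda.transducer a op).edges)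
      (((x.pda.transducer a op).edges.map (pdaItem x a op)).flatMap itemTrace) := by
  rw [List.flatMap_map]
  refine .list fun e _ t => ?_
  have h' := (h.update (r := .f) (by simp [IsLocal]) (x.pda.transducer a op).edges.length).update
    (r := .j) (by simp [IsLocal]) t
  rcases e with ⟨q, _ | ⟨y, z⟩, r⟩
  · have h'' := ((h'.update (r := .e₁) (by simp [IsLocal]) q.1).update (r := .e₂)
      (by simp [IsLocal]) 0).update (r := .e₄) (by simp [IsLocal]) r.1
    rw [Code.edge, Code.letter, Code.letter, ← List.append_nil (Code.unary r)]
    refine .rd (.rd (.ifz_zero (by simp) (.rd (writes_itemGen h''.sizes ?_))))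
    simp only [pdaItem, Matches, StateExpr.val, EpsState.code, h''.lab_val, h''.op_val]
    simp [Lin.val]
  · have h'' := (((h'.update (r := .e₁) (by simp [IsLocal]) q.1).update (r := .e₂)
      (by simp [IsLocal]) (y.1 + 1)).update (r := .e₃) (by simp [IsLocal]) z.1).update (r := .e₄)
      (by simp [IsLocal]) r.1
    rw [Code.edge, Code.letter, Code.letter, Code.letter, ← List.append_nil (Code.unary r)]
    refine .rd (.rd (.ifz_pos (by simp) (.rd (.rd (writes_itemGen h''.sizes ?_)))))
    simp only [pdaItem, Matches, StateExpr.val, EpsState.code, h''.lab_val, h''.op_val]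
    simp [Lin.val, dat, Ltr.num]
    omega

theorem emits_pdaGen (h : Describes ρ lab o a op) : Emits (pdaGen lab o) ρ
    (Code.transducer (x.pda.transducer a op)) ((pdaItems x a op).flatMap itemTrace) := by
  rw [Code.transducer, Code.letter]
  have h' := (h.update (r := .k) (by simp [IsLocal]) (x.pda.transducer a op).numStates).update
    (r := .q₀) (by simp [IsLocal]) (x.pda.transducer a op).init.1
  refine .rd (.rd ?_)
  rw [pdaItems]
  refine Eq.mp (congrArg (fun c => Emits _ _ c _) ?_)
    (emits_seqs (tr := itemTrace) (cs := [[], [], [], Code.list Code.letter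
    (x.pda.transducer a op).final, Code.list Code.edge (x.pda.transducer a op).edges])
    (.cons ?_ (.cons ?_ (.cons ?_ (.cons ?_ (.cons ?_ .nil))))) rfl)
  · simp
  · refine writes_itemsGen h'.sizes ?_
    rw [List.forall₂_map_left_iff, List.forall₂_map_right_iff, List.forall₂_same]
    intro m _
    simp only [Matches, StateExpr.val, EpsState.code, h'.lab_val, h'.op_val]
    simp [Lin.val, cst, plainExpr]
  · show Writes _ _ _
    rw [List.flatMap_assoc]
    refine Writes.rep_finRange (by simp) fun q => ?_
    have h'' := h'.update (r := .q) (by simp [IsLocal]) q.1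
    rw [List.flatMap_append]
    refine (writes_itemsGen h''.sizes ?_).seq (writes_copyGen h''.sizes fun ρ' hρ' => ?_)
    · simp only [List.forall₂_cons, Matches, StateExpr.val, EpsState.code, h''.lab_val, h''.op_val]
      simp [Lin.val, cst]
    · have hloc : ∀ r, ¬ IsLocal r → ρ' r = Function.update (Function.update (Function.update ρ .k
          (x.pda.transducer a op).numStates) .q₀ (x.pda.transducer a op).init.1) .q q.1 r :=
        fun r hr => hρ' r fun e => hr (by simp [e, IsLocal])
      have h₁ := (h''.op ρ' hloc).val (h''.sizes.of_eq hρ')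
      have h₂ := hρ' .q (by simp)
      simp only [StateExpr.val, EpsState.code, h''.lab ρ' hloc, h₁]
      simp [Lin.val, h₂]
  · exact writes_stackGen h' (by simp)
  · exact emits_finalsGen h'
  · exact emits_edgesGen h'

end Gen

namespace Gen

open Item

variable {x : Instance} {ρ : Reg → ℕ}

/-- Reads the transducers for an input label, and writes the items of their gadgets. -/
def opsGen (lab : Lin Reg) : Gen Reg Stream :=
  .seq (pdaGen lab .skip) (.seq (.rep .γ .g (pdaGen lab .push)) (.rep .γ .g (pdaGen lab .pop)))

theorem emits_opsGen (hρ : Sizes x ρ) {lab : Lin Reg} {a : Option (Fin x.numInput)}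
    (hlab : ∀ ρ' : Reg → ℕ, (∀ r, ¬ IsLocal r → r ≠ .γ → ρ' r = ρ r) → lab.val ρ' = labCode a) :
    Emits (opsGen lab) ρ
      ((Code.stackOps x.pda.numStack).flatMap fun op => Code.transducer (x.pda.transducer a op))
      (((Code.stackOps x.pda.numStack).flatMap fun op => pdaItems x a op).flatMap itemTrace) := by
  have hγ : ∀ v, ∀ ρ' : Reg → ℕ, (∀ r, ¬ IsLocal r → ρ' r = Function.update ρ .γ v r) →
      lab.val ρ' = labCode a ∧ ρ' .γ = v := fun v ρ' h =>
    ⟨hlab ρ' fun r hr hr' => by rw [h r hr, Function.update_of_ne hr'],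
      by rw [h .γ (by simp [IsLocal]), Function.update_self]⟩
  rw [List.flatMap_assoc]
  simp only [Code.stackOps, List.flatMap_cons, List.flatMap_append, List.flatMap_map]
  refine Emits.seq (emits_pdaGen ⟨hρ, fun ρ' h => hlab ρ' fun r hr _ => h r hr, fun _ _ => rfl⟩)
    (.seq ?_ ?_)
  · exact .rep_finRange hρ.g fun γ => emits_pdaGen ⟨hρ.update _ (by simp),
      fun ρ' h => (hγ γ ρ' h).1, fun ρ' h => ⟨γ, rfl, (hγ γ ρ' h).2⟩⟩
  · exact .rep_finRange hρ.g fun γ => emits_pdaGen ⟨hρ.update _ (by simp),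
      fun ρ' h => (hγ γ ρ' h).1, fun ρ' h => ⟨γ, rfl, (hγ γ ρ' h).2⟩⟩

/-- Reads the transducers of the PDA, and writes the items of the gadgets for them. -/
def blocksGen : Gen Reg Stream := .seq (opsGen (0, [])) (.rep .a .s (opsGen (1, [.a])))

theorem emits_blocksGen (hρ : Sizes x ρ) : Emits blocksGen ρ
    ((Code.labels x.numInput).flatMap fun a => (Code.stackOps x.pda.numStack).flatMap fun op =>
      Code.transducer (x.pda.transducer a op))
    (((Code.labels x.numInput).flatMap fun a => (Code.stackOps x.pda.numStack).flatMap fun op =>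
      pdaItems x a op).flatMap itemTrace) := by
  rw [List.flatMap_assoc]
  simp only [Code.labels, List.flatMap_cons, List.flatMap_map]
  refine .seq (emits_opsGen hρ fun _ _ => rfl) (.rep_finRange hρ.s fun a => ?_)
  refine emits_opsGen (hρ.update _ (by simp)) fun ρ' h => ?_
  have := h .a (by simp [IsLocal]) (by simp)
  rw [Function.update_self] at this
  simp [Lin.val, labCode, this, add_comm]

/-! ### The generator for the transducers for letters -/

theorem code_mkTransducer {X : Type} {num : X → ℕ} {N k : ℕ} {i : X} {F : List X}
    {E : List (LEdge X)} {G : Set X} (hk : ∀ q ∈ G, num q ≤ k) (hi : i ∈ G) (hF : ∀ q ∈ F, q ∈ G)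
    (hE : ∀ e ∈ E, GoodEdge G N e) :
    Code.transducer (mkTransducer num N k i F E) = Code.unary (k + 1) ++ (Code.unary (num i) ++
      ((Code.unary F.length ++ F.flatMap fun q => Code.unary (num q)) ++
        (Code.unary E.length ++ E.flatMap fun e =>
          edgeCode (num e.1) (e.2.1.map fun l => (l.1.num, l.2.num)) (num e.2.2)))) := by
  have hnum : ∀ q ∈ G, Code.letter (Fin.ofNat (k + 1) (num q)) = Code.unary (num q) :=
    fun q hq => congrArg Code.unary (Nat.mod_eq_of_lt (Nat.lt_succ_of_le (hk q hq)))
  have h₁ : F.flatMap (fun q => Code.letter (Fin.ofNat (k + 1) (num q))) =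
      F.flatMap fun q => Code.unary (num q) :=
    List.flatMap_congr fun q hq => hnum q (hF q hq)
  have h₂ : E.flatMap (fun e => Code.edge (Fin.ofNat (k + 1) (num e.1),
      e.2.1.map fun l => (Fin.ofNat (N + 1) l.1.num, Fin.ofNat (N + 1) l.2.num),
      Fin.ofNat (k + 1) (num e.2.2))) = E.flatMap fun e =>
        edgeCode (num e.1) (e.2.1.map fun l => (l.1.num, l.2.num)) (num e.2.2) := by
    refine List.flatMap_congr ?_
    rintro ⟨q, _ | ⟨y, z⟩, r⟩ he
    · obtain ⟨hq, hr, -⟩ := hE _ he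
      simp only [Option.map_none, Code.edge, edgeCode, Option.elim_none, hnum _ hq, hnum _ hr]
    · obtain ⟨hq, hr, hl⟩ := hE _ he
      obtain ⟨hy, hz⟩ := hl _ rfl
      have hy' : (Fin.ofNat (N + 1) y.num).1 = y.num := Nat.mod_eq_of_lt (Nat.lt_succ_of_le hy)
      have hz' : (Fin.ofNat (N + 1) z.num).1 = z.num := Nat.mod_eq_of_lt (Nat.lt_succ_of_le hz)
      have hq' : (Fin.ofNat (k + 1) (num q)).1 = num q := Nat.mod_eq_of_lt
        (Nat.lt_succ_of_le (hk _ hq))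
      have hr' : (Fin.ofNat (k + 1) (num r)).1 = num r := Nat.mod_eq_of_lt
        (Nat.lt_succ_of_le (hk _ hr))
      simp only [Option.map_some, Code.edge, edgeCode, Option.elim_some, Code.letter, hq', hr', hy',
        hz', List.append_assoc]
  rw [Code.transducer]
  simp only [mkTransducer, Code.list, List.length_map, List.flatMap_map, h₁, h₂, hnum i hi]

/-- The edges of the transducers for letters, as symbols on their stream. -/
def letterTrace (e : LEdge LetterState) : List (Stream × CSym) :=
  onStream 8 (edgeCode e.1.num (e.2.1.map fun l => (l.1.num, l.2.num)) e.2.2.num)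

/-- Writes an edge of a transducer for a letter. -/
def letterEdgeGen (q : LetterState) (l : Lin Reg × Lin Reg) (r : LetterState) : Gen Reg Stream :=
  edgeGen 8 (unaryGen 8 (q.num, [])) (some l) (unaryGen 8 (r.num, []))

theorem writes_letterEdgeGen {q r : LetterState} {l : Lin Reg × Lin Reg} {y z : Ltr}
    (hy : l.1.val ρ = y.num) (hz : l.2.val ρ = z.num) :
    Writes (letterEdgeGen q l r) ρ (letterTrace (q, some (y, z), r)) := by
  have h : ∀ s : LetterState, Writes (unaryGen (8 : Stream) (s.num, [])) ρ
      (onStream 8 (Code.unary s.num)) := by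
    intro s
    simpa [Lin.val] using writes_unaryGen (8 : Stream) ρ (s.num, [])
  have := writes_edgeGen (l := some l) (h q) (h r)
  simp only [Option.map_some, hy, hz] at this
  exact this

/-- The number of edges of the transducer for a letter that do not depend on the size of the input:
those before the copying of the rest of the word, and five loops. -/
def letterCount (b : Bool) : ℕ := (if b then 4 else (modes.filter Mode.reads).length + 1) + 5

/-- Writes the transducer for a letter, which is in `Θ` if `b = true`. -/
def letterGen (b : Bool) : Gen Reg Stream := seqs [
  unaryGen 8 (4, []), unaryGen 8 (0, []), unaryGen 8 (1, []), unaryGen 8 (3, []),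
  unaryGen 8 (letterCount b, [.len]),
  if b then seqs [letterEdgeGen .init (cst Mode.N.ltr, cst Mode.N.ltr) .head,
    letterEdgeGen .head (cst .blank, dat .a) .count,
    letterEdgeGen .count (cst .zero, cst .one) .count,
    letterEdgeGen .count (cst .one, cst .zero) .copy]
  else .seq (seqs ((modes.filter Mode.reads).map fun m =>
      letterEdgeGen .init (cst m.ltr, cst m.ltr) .head))
    (letterEdgeGen .head (cst .blank, dat .a) .copy),
  letterEdgeGen .copy (cst .hash, cst .hash) .copy,
  plainGen fun e => letterEdgeGen .copy (e, e) .copy]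

theorem writes_letterGen (hρ : Sizes x ρ) (a : Fin x.numInput) (ha : ρ .a = a) :
    Writes (letterGen (a ∈ x.Θ)) ρ
      (onStream 8 (Code.transducer ((dsnfaOf x).transducer (some a)))) := by
  have hlen : (letterItems x a).length = letterCount (a ∈ x.Θ) + x.size := by
    by_cases h : a ∈ x.Θ
    · simp [letterItems, letterCount, h, plainLtrs]
      omega
    · simp [letterItems, letterCount, h, plainLtrs]
      omega
  have hdat : (dat .a).val ρ = (Ltr.data a).num := by simp [dat, Lin.val, ha, Ltr.num]
  have hcst : ∀ b, (cst b).val ρ = b.num := by simp [cst, Lin.val]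
  have hcode : Code.transducer ((dsnfaOf x).transducer (some a)) = Code.unary 4 ++ (Code.unary 0 ++
      (Code.unary 1 ++ (Code.unary 3 ++ (Code.unary (letterItems x a).length ++
        (letterItems x a).flatMap fun e => edgeCode e.1.num
          (e.2.1.map fun l => (l.1.num, l.2.num)) e.2.2.num)))) := by
    have := code_mkTransducer (N := x.size + 4) (k := 3) (i := LetterState.init) (F := [.copy])
      (E := letterItems x a) (G := Set.univ) (num := LetterState.num)
      (fun q _ => by cases q <;> simp [LetterState.num]) trivial (fun _ _ => trivial)
      fun e he => LetterEdge.good (mem_letterItems.1 he)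
    refine this.trans ?_
    simp [LetterState.num]
  have htrace : onStream (8 : Stream) ((letterItems x a).flatMap fun e => edgeCode e.1.num
      (e.2.1.map fun l => (l.1.num, l.2.num)) e.2.2.num) =
        (letterItems x a).flatMap letterTrace := by
    rw [onStream, List.map_flatMap]
    rfl
  have h : ∀ e : Lin Reg, ∀ k, e.val ρ = k → Writes (unaryGen 8 e) ρ
      (onStream (8 : Stream) (Code.unary k)) := fun e k hk => hk ▸ writes_unaryGen 8 ρ e
  have h₁ : Writes (if decide (a ∈ x.Θ) then seqs [
      letterEdgeGen .init (cst Mode.N.ltr, cst Mode.N.ltr) .head,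
      letterEdgeGen .head (cst .blank, dat .a) .count,
      letterEdgeGen .count (cst .zero, cst .one) .count,
      letterEdgeGen .count (cst .one, cst .zero) .copy]
    else .seq (seqs ((modes.filter Mode.reads).map fun m =>
      letterEdgeGen .init (cst m.ltr, cst m.ltr) .head))
      (letterEdgeGen .head (cst .blank, dat .a) .copy)) ρ
      ((if a ∈ x.Θ then
        [((.init, some (Mode.N.ltr, Mode.N.ltr), .head) : LEdge LetterState),
          (.head, some (.blank, .data a), .count),
          (.count, some (.zero, .one), .count), (.count, some (.one, .zero), .copy)]
      else
        (modes.filter Mode.reads).map (fun m => (.init, some (m.ltr, m.ltr), .head)) ++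
          [(.head, some (.blank, .data a), .copy)]).flatMap letterTrace) := by
    by_cases hΘ : a ∈ x.Θ
    · rw [if_pos (by simpa using hΘ), if_pos hΘ]
      exact Emits.seqs_cons (c := []) (c' := []) (writes_letterEdgeGen (hcst _) (hcst _))
        (Emits.seqs_cons (c := []) (c' := []) (writes_letterEdgeGen (hcst _) hdat)
        (Emits.seqs_cons (c := []) (c' := []) (writes_letterEdgeGen (hcst _) (hcst _))
        (Emits.seqs_cons (c := []) (c' := []) (writes_letterEdgeGen (hcst _) (hcst _)) .seqs_nil)))
    · rw [if_neg (by simpa using hΘ), if_neg hΘ, List.flatMap_append]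
      refine Writes.seq ?_ ?_
      · generalize modes.filter Mode.reads = l
        induction l with
        | nil => exact .nop
        | cons m l ih =>
          exact Emits.seqs_cons (c := []) (c' := []) (writes_letterEdgeGen (hcst _) (hcst _)) ih
      · simpa using writes_letterEdgeGen (q := .head) (r := .copy) (hcst .blank) hdat
  have h₂ : Writes (plainGen fun e => letterEdgeGen .copy (e, e) .copy) ρ
      ((plainLtrs x).flatMap fun l => letterTrace (.copy, some (l, l), .copy)) :=
    writes_plainGen hρ fun ρ' _ e a ha => writes_letterEdgeGen ha ha
  have key := (h (4, []) 4 rfl).seqs_cons ((h (0, []) 0 rfl).seqs_cons ((h (1, []) 1 rfl).seqs_cons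
    ((h (3, []) 3 rfl).seqs_cons ((h (letterCount (a ∈ x.Θ), [.len]) _ rfl).seqs_cons
    (h₁.seqs_cons ((writes_letterEdgeGen (q := .copy) (r := .copy) (l := (cst .hash, cst .hash))
      (hcst .hash) (hcst .hash)).seqs_cons (h₂.seqs_cons .seqs_nil)))))))
  refine Eq.mp (congrArg (Writes _ ρ) ?_) key
  rw [hcode, hlen, ← hρ.len]
  have hon : ∀ c c' : List CSym, onStream (8 : Stream) (c ++ c') = onStream 8 c ++ onStream 8 c' :=
    fun c c' => List.map_append
  simp only [hon, htrace]
  simp only [letterItems, List.flatMap_append, List.flatMap_cons, List.flatMap_map,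
    List.append_nil]
  simp [Lin.val]

end Gen

/-! ### The generator for the doubly succinct automaton -/

namespace Gen

open Item

variable {x : Instance} {ρ : Reg → ℕ}

/-- Reads the bits of `Θ`, and writes the edges that delete letters and the transducers for letters.
-/
def thetaGen : Gen Reg Stream := .rep .a .s (.ifb (letterGen true)
  (.seq (itemsGen [.inl (plainExpr 11, some (cst .blank, dat .a), plainExpr 12)])
    (letterGen false)))

/-- The edges that delete the letter `a`. -/
def dropItem (x : Instance) (a : Fin x.numInput) : List (Item (EpsState x)) :=
  if a ∈ x.Θ then [] else [edge .dropHead (some (.blank, .data a)) .drop]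

theorem emits_thetaGen (hρ : Sizes x ρ) : Emits thetaGen ρ
    ((List.finRange x.numInput).map fun a => some (decide (a ∈ x.Θ)))
    ((List.finRange x.numInput).flatMap fun a => (dropItem x a).flatMap itemTrace ++
      onStream 8 (Code.transducer ((dsnfaOf x).transducer (some a)))) := by
  rw [List.map_eq_flatMap]
  refine .rep_finRange hρ.s fun a => ?_
  have hρ' := hρ.update (r := .a) a.1 (by simp)
  have h := writes_letterGen hρ' a (by simp)
  refine .ifb (fun ha => ?_) fun ha => ?_
  · rw [ha] at h
    rw [decide_eq_true_eq] at ha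
    simpa [dropItem, ha] using h
  · rw [ha] at h
    rw [decide_eq_false_iff_not] at ha
    refine Writes.seq ?_ h
    refine writes_itemsGen hρ' ?_
    simp [dropItem, ha, Matches, StateExpr.val, EpsState.code, plainExpr, Lin.val, cst, dat,
      Ltr.num]

/-- Writes what precedes the items on the streams. -/
def preGen : Gen Reg Stream := seqs [
  unaryGen 0 (0, [.s]), unaryGen 0 (3, [.len]),
  times lenLin .t₁ (times lenLin .t₂ (seqs (List.replicate 10 (.emit 0 (some false))))),
  .emit 0 (some true), .emit 0 none, .emit 1 (some true), .emit 1 (some true),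
  unaryGen 2 (cst startLtr), unaryGen 2 (cst .blank),
  cubeGen 3 (some true) 23, .emit 3 (some true), .emit 3 none, unaryGen 3 (0, [])]

theorem bits_two_pow (k : ℕ) : (2 ^ k).bits = List.replicate k false ++ [true] := by
  induction k with
  | zero => simp
  | succ k ih =>
    rw [pow_succ, mul_comm, Nat.bit0_bits _ (pow_ne_zero _ two_ne_zero), ih]
    rfl

/-- What `preGen` writes. -/
def preTrace (x : Instance) : List (Stream × CSym) :=
  onStream 0 (Code.unary x.numInput ++ (Code.unary (x.size + 3) ++
    Code.binary (stateLength x.size))) ++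
  (onStream 1 [some true, some true] ++
  (onStream 2 (Code.unary startLtr.num ++ Code.unary Ltr.blank.num) ++
  onStream 3 (Code.unary (23 * x.size ^ 3 + 1) ++ Code.unary 0)))

theorem writes_preGen (hρ : Sizes x ρ) : Writes preGen ρ (preTrace x) := by
  have key := (writes_unaryGen 0 ρ (0, [.s])).seqs_cons ((writes_unaryGen 0 ρ (3, [.len])).seqs_cons
    ((writes_times_len hρ.len (r := .t₁) (by simp) fun ρ₁ h₁ => writes_times_len h₁ (r := .t₂)
      (by simp) fun ρ₂ h₂ => writes_replicate (0 : Stream) (some false) 10 ρ₂).seqs_cons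
    ((Emits.emit 0 (some true)).seqs_cons ((Emits.emit 0 none).seqs_cons
    ((Emits.emit 1 (some true)).seqs_cons ((Emits.emit 1 (some true)).seqs_cons
    ((writes_unaryGen 2 ρ (cst startLtr)).seqs_cons ((writes_unaryGen 2 ρ (cst .blank)).seqs_cons
    ((writes_cubeGen 3 (some true) 23 hρ.len).seqs_cons ((Emits.emit 3 (some true)).seqs_cons
    ((Emits.emit 3 none).seqs_cons ((writes_unaryGen 3 ρ (0, [])).seqs_cons .seqs_nil))))))))))))
  refine Eq.mp (congrArg (Writes _ ρ) ?_) key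
  have e₁ : 10 * x.size * x.size = 10 * x.size ^ 2 := by ring
  have e₂ : 23 * x.size * x.size * x.size = 23 * x.size ^ 3 := by ring
  have e₃ : Code.unary (23 * x.size ^ 3 + 1) =
      List.replicate (23 * x.size ^ 3) (some true) ++ ([some true] ++ [none]) := by
    rw [Code.unary, List.replicate_succ', List.append_assoc]
  rw [preTrace, Code.binary, stateLength, bits_two_pow, e₁, e₂, e₃]
  simp [onStream, Lin.val, cst, hρ.s, hρ.len, add_comm]

/-- Ends the numbers of final states and of edges. -/
def postGen : Gen Reg Stream := .seq (.emit 4 none) (.emit 6 none)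

/-- Reads the input up to the number `K`, and writes the streams, but for a part of the initial
state that depends on `K`. -/
def fullGen : Gen Reg Stream := .rd .s (.rd .g (.rd .d (.rd .n (.seq preGen (.seq baseGen
  (.seq startGen (.seq finishGen (.seq bottomGen (.seq blocksGen (.seq thetaGen postGen))))))))))

/-- What `fullGen` writes. -/
def fullTrace (x : Instance) : List (Stream × CSym) :=
  preTrace x ++ ((baseItems x).flatMap itemTrace ++ ((startItems x).flatMap itemTrace ++
    ((finishItems x).flatMap itemTrace ++ ((bottomItems x).flatMap itemTrace ++
    ((((Code.labels x.numInput).flatMap fun a => (Code.stackOps x.pda.numStack).flatMap fun op =>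
      pdaItems x a op).flatMap itemTrace) ++
    (((List.finRange x.numInput).flatMap fun a => (dropItem x a).flatMap itemTrace ++
      onStream 8 (Code.transducer ((dsnfaOf x).transducer (some a)))) ++
    (onStream 4 [none] ++ onStream 6 [none])))))))

theorem eval_fullGen (x : Instance) :
    fullGen.eval (Function.update (fun _ => 0) .len (Code.input x).length) (Code.input x) =
      (Code.binary x.K, fullTrace x) := by
  have hρ : Sizes x (Function.update (Function.update (Function.update (Function.update
      (Function.update (fun _ => 0) .len (Code.input x).length) .s x.numInput) .g x.pda.numStack) .d
      x.pda.numLetters) .n x.pda.n) := by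
    constructor <;> simp [Instance.size]
  have body := Emits.seq (writes_preGen hρ) <| Emits.seq (writes_baseGen hρ) <|
    Emits.seq (emits_startGen hρ) <| Emits.seq (emits_finishGen hρ) <|
    Emits.seq (emits_bottomGen hρ) <| Emits.seq (emits_blocksGen hρ) <|
    Emits.seq (emits_thetaGen hρ) <| Emits.seq (Emits.emit 4 none) (Emits.emit 6 none)
  have := (Emits.rd (Emits.rd (Emits.rd (Emits.rd body)))) (Code.binary x.K)
  refine Eq.trans (congrArg (fullGen.eval _) ?_) this
  simp [Code.input, Code.succinctPDA]

/-- What is written for the digits of `K`: the rest of the word at the beginning of the initial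
state. -/
def digitTrace : CSym → List (Stream × CSym)
  | some b => onStream 1 [some true] ++ onStream 2 (Code.unary (bitLtr b).num)
  | none => onStream 1 [some true, none] ++ onStream 2 (Code.unary Ltr.hash.num)

theorem proj_flatMap {O α : Type} [DecidableEq O] (o : O) (l : List α) (f : α → List (O × CSym)) :
    proj o (l.flatMap f) = l.flatMap fun a => proj o (f a) := by
  induction l with
  | nil => rfl
  | cons a l ih => rw [List.flatMap_cons, List.flatMap_cons, proj_append, ih]

/-- What is written on the streams for a list of items. -/
theorem proj_items (l : List (Item (EpsState x))) (o : Stream) : proj o (l.flatMap itemTrace) =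
    if o = 4 then List.replicate (finals l).length (some true)
    else if o = 5 then (finals l).flatMap fun q => Code.unary q.num
    else if o = 6 then List.replicate (edges l).length (some true)
    else if o = 7 then (edges l).flatMap fun e =>
      edgeCode e.1.num (e.2.1.map fun l => (l.1.num, l.2.num)) e.2.2.num
    else [] := by
  induction l with
  | nil => fin_cases o <;> rfl
  | cons e l ih =>
    rw [List.flatMap_cons, proj_append, ih]
    cases e <;> simp only [itemTrace, proj_append, proj_onStream] <;> fin_cases o <;>
      simp [finals, edges, List.replicate_succ]

theorem proj_thetaTrace (o : Stream) :
    proj o ((List.finRange x.numInput).flatMap fun a => (dropItem x a).flatMap itemTrace ++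
      onStream 8 (Code.transducer ((dsnfaOf x).transducer (some a)))) =
    proj o ((dropItems x).flatMap itemTrace) ++ if 8 = o then (List.finRange x.numInput).flatMap
      fun a => Code.transducer ((dsnfaOf x).transducer (some a)) else [] := by
  rw [proj_flatMap]
  simp only [proj_append, proj_onStream]
  split
  · subst o
    simp [proj_items]
  · rw [List.append_nil, dropItems, List.flatMap_assoc, proj_flatMap]
    simp only [List.append_nil]
    rfl

theorem proj_fullTrace (o : Stream) : proj o (fullTrace x) =
    proj o (preTrace x) ++ (proj o ((epsItems x).flatMap itemTrace) ++
      ((if 8 = o then (List.finRange x.numInput).flatMap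
        fun a => Code.transducer ((dsnfaOf x).transducer (some a)) else []) ++
      if 4 = o ∨ 6 = o then [none] else [])) := by
  have h : (epsItems x).flatMap itemTrace = (baseItems x).flatMap itemTrace ++
      ((startItems x).flatMap itemTrace ++ ((finishItems x).flatMap itemTrace ++
      ((bottomItems x).flatMap itemTrace ++ ((((Code.labels x.numInput).flatMap fun a =>
        (Code.stackOps x.pda.numStack).flatMap fun op => pdaItems x a op).flatMap itemTrace) ++
      (dropItems x).flatMap itemTrace)))) := by
    simp only [epsItems, List.flatten_cons, List.flatten_nil, List.append_nil, List.flatMap_append]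
  rw [h, fullTrace]
  simp only [proj_append, proj_thetaTrace, List.append_assoc, proj_onStream]
  congr 8
  fin_cases o <;> rfl

theorem proj_digits (bs : List Bool) (o : Stream) :
    proj o ((bs.map some ++ [none]).flatMap digitTrace) =
      if o = 1 then List.replicate (bs.length + 1) (some true) ++ [none]
      else if o = 2 then bs.flatMap (fun b => Code.unary (bitLtr b).num) ++ Code.unary Ltr.hash.num
      else [] := by
  induction bs with
  | nil =>
    simp only [List.map_nil, List.nil_append, List.flatMap_cons, List.flatMap_nil, digitTrace,
      proj_append, proj_onStream, List.append_nil]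
    fin_cases o <;> rfl
  | cons b bs ih =>
    rw [List.map_cons, List.cons_append, List.flatMap_cons, proj_append, ih]
    simp only [digitTrace, proj_append, proj_onStream]
    fin_cases o <;> simp [List.replicate_succ]

theorem code_initPrefix : Code.list Code.letter (dsnfaOf x).initPrefix =
    Code.unary (x.K.bits.length + 3) ++ (Code.unary startLtr.num ++ (Code.unary Ltr.blank.num ++
      (x.K.bits.flatMap (fun b => Code.unary (bitLtr b).num) ++ Code.unary Ltr.hash.num))) := by
  have h : ((initWord x).map (toFin (x.size + 4))).flatMap Code.letter =
      (initWord x).flatMap fun a => Code.unary a.num := by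
    rw [List.flatMap_map]
    refine List.flatMap_congr fun a ha => congrArg Code.unary (Nat.mod_eq_of_lt ?_)
    exact Nat.lt_succ_of_le (isWord_startWord a (List.mem_append_left _ ha))
  rw [Code.list]
  have h' : (dsnfaOf x).initPrefix.length = x.K.bits.length + 3 := by
    refine (List.length_map _).trans ?_
    simp [initWord]
  rw [h']
  refine (congrArg (Code.unary _ ++ ·) h).trans ?_
  simp [initWord, List.flatMap_map]

theorem code_epsTransducer : Code.transducer ((dsnfaOf x).transducer none) =
    Code.unary (23 * x.size ^ 3 + 1) ++ (Code.unary 0 ++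
      ((Code.unary (finals (epsItems x)).length ++ (finals (epsItems x)).flatMap fun q =>
        Code.unary q.num) ++ (Code.unary (edges (epsItems x)).length ++
        (edges (epsItems x)).flatMap fun e =>
          edgeCode e.1.num (e.2.1.map fun l => (l.1.num, l.2.num)) e.2.2.num))) := by
  have hi : (EpsState.init : EpsState x).num = 0 := by
    simp [EpsState.num, EpsState.code, fourDigits]
  rw [← hi]
  refine code_mkTransducer (G := EpsState.Good) (fun _ => EpsState.num_le) ?_
    (fun q hq => (mem_finals_epsItems.1 hq).good)
    fun e he => EpsEdge.good (mem_edges_epsItems.1 he)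
  have := numStack_lt_size x
  refine ⟨?_, ?_, ?_, ?_⟩ <;> simp only [EpsState.code] <;> omega

/-- The order of the streams in the output. -/
def streams : List Stream := [0, 1, 2, 3, 4, 5, 6, 7, 8]

/-- The streams, one after the other, form the code of the automaton. -/
theorem flatMap_proj_trace (x : Instance) :
    streams.flatMap (fun o => proj o (fullTrace x ++ (Code.binary x.K).flatMap digitTrace)) =
      Code.dsnfa ⟨x.numInput, dsnfaOf x⟩ := by
  have hcode : Code.dsnfa ⟨x.numInput, dsnfaOf x⟩ = Code.unary x.numInput ++
    (Code.unary (x.size + 3) ++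
      (Code.binary (stateLength x.size) ++ (Code.list Code.letter (dsnfaOf x).initPrefix ++
      (Code.transducer ((dsnfaOf x).transducer none) ++ (List.finRange x.numInput).flatMap
        fun a => Code.transducer ((dsnfaOf x).transducer (some a)))))) := by
    rw [Code.dsnfa, Code.labels, List.flatMap_cons, List.flatMap_map]
    rfl
  rw [hcode, code_initPrefix, code_epsTransducer]
  have h₁ : Code.unary (x.K.bits.length + 3) = [some true, some true] ++
      (List.replicate (x.K.bits.length + 1) (some true) ++ [none]) := rfl
  rw [h₁]
  simp only [streams, List.flatMap_cons, List.flatMap_nil, proj_append, proj_fullTrace, proj_items,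
    Code.binary, proj_digits, preTrace, proj_onStream]
  simp [Code.unary]

theorem fullGen_wf : fullGen.Wf = true := by
  decide +kernel

theorem len_notMem_bound : Reg.len ∉ fullGen.bound := by
  decide +kernel

end Gen

theorem mainTheorem4 :
    ∃ B : (x : Instance) → DSNFA (Fin x.numInput),
      Nonempty (Turing.TM2ComputableInPolyTime Code.input Code.dsnfa
        (fun x => (⟨x.numInput, B x⟩ : Σ s : ℕ, DSNFA (Fin s)))) ∧
      ∀ x : Instance, (B x).language = preservingDownClosure x.Θ x.K x.pda.language := by
  refine ⟨dsnfaOf, ?_, language_dsnfaOf⟩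
  obtain ⟨time, h⟩ := Gen.exec_run Gen.fullGen Gen.fullGen_wf .len Gen.len_notMem_bound
    Gen.digitTrace Gen.streams (by decide) (by decide)
  refine Prog.computableInPolyTime (Gen.run Gen.fullGen .len Gen.digitTrace Gen.streams) .inp .out
    time fun x => ?_
  obtain ⟨t, ht, he⟩ := h (Code.input x)
  rw [Gen.runTrace, Gen.eval_fullGen, Gen.flatMap_proj_trace] at he
  exact ⟨t, ht, he⟩
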